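/- Let $\mathbb K$ be a field, $n\ge 0$, and let $Q$ be the bipartite type $A$ quiver $y_n\xrightarrow{\beta_n}x_n\xleftarrow{\alpha_n}y_{n-1}\xrightarrow{\beta_{n-1}}\cdots\xrightarrow{\beta_1}x_1\xleftarrow{\alpha_1}y_0$ with dimension vector $\mathbf d$; put $d_x=\sum_k\mathbf d(x_k)$, $d_y=\sum_k\mathbf d(y_k)$, $d=d_x+d_y$. Let $\Omega^\circ$ be an orbit of $\mathbf{GL}(\mathbf d)=\prod_z \mathrm{GL}_{\mathbf d(z)}(\mathbb K)$ in $\mathrm{rep}_Q(\mathbf d)=\prod_a \mathrm{Mat}(\mathbf d(ta),\mathbf d(ha))$ under $(V_a)\bullet g=(g_{ta}^{-1}V_ag_{ha})$, and let $\Omega$ be its closure. A permutation $v$ is identified with the matrix having a $1$ in entry $(i,j)$ iff $v(i)=j$; $\ell(v)$ is its number of inversions, and $\mathrm{rot}$ denotes rotation of a matrix or grid by $180^\circ$. **Lacing diagrams.** $\mathrm{Laces}(\mathbf d)$ is the set of tuples $\mathbf w=(w_n,w^n,\dots,w_1,w^1)\in\mathrm{rep}_Q(\mathbf d)$ of partial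 permutation matrices, $w_k$ at $\beta_k$ and $w^k$ at $\alpha_k$, drawn as columns of $\mathbf d(z)$ dots, $z\in Q_0$, with an arrow from the $i$-th dot of column $ta$ to the $j$-th dot of column $ha$ for each $1$ in position $(i,j)$ of the matrix at $a$; the laces of $\mathbf w$ are the connected components. The completion $c(w)\in S_{k+\ell}$ of a $k\times\ell$ partial permutation matrix $w$ is the unique permutation of minimal length whose matrix has northwest corner $w$. The extended diagram of $\mathbf w$ consists of the permutations $c(w_k)$ (columns aligned at the top) and $\mathrm{rot}(c(\mathrm{rot}(w^k)))$ (columns aligned at the bottom); its dots that are not dots of $\mathbf w$ are called virtual. The length $|\mathbf w|$ is the number of crossings in the extended diagram, and $W(\Omega)$ is the set of lacing diagrams in $\Omega^\circ$ of minimal length among those in $\Omega^\circ$. A K-theoretic move acts on an extended diagram at two vertically adjacent non-virtual dots of a column having a neighbouring column on both sides, such that on each side at least one of the two dots joined to them is non-virtual. It passes between any two of the three configurations that have the same outer dots on both sides and in which the two strands through the middle dots cross (i) only to the left of the middle column, (ii) on both sides, (iii) only to the right. $KW(\Omega)$ is the set of lacing diagrams whose extended diagram is obtained from that of an element of $W(\Omega)$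 by finitely many (possibly zero) K-theoretic moves. **Zelevinsky permutation.** Divide the rows of a $d\times d$ matrix into blocks labelled $y_0,\dots,y_n,x_n,\dots,x_1$ from top to bottom and its columns into blocks labelled $x_n,\dots,x_1,y_0,\dots,y_n$ from left to right, the block labelled $z$ having size $\mathbf d(z)$. Block $\alpha_k$ is the intersection of block row $y_{k-1}$ and block column $x_k$; block $\beta_k$ is that of block row $y_k$ and block column $x_k$. Let $\mathbf w$ be a lacing diagram in $\Omega^\circ$. Then $v(\Omega)\in S_d$ is the permutation such that: the number of $1$s in block $(z,z')$ is the number of laces of $\mathbf w$ with left endpoint in column $z$ and right endpoint in column $z'$ if $z=z'$ or $z$ is to the left of $z'$, and the number of arrows of $\mathbf w$ between columns $z$ and $z'$ if $z$ is exactly one vertex to the right of $z'$; and the $1$s run from northwest to southeast in each block row and each block column. **Pipe dreams.** A pipe dream on the $k\times\ell$ grid is a set $P$ of cells (crosses). Its Demazure product $\delta(P)\in S_{k+\ell}$ is the product, in the monoid with relations $\tau_i^2=\tau_i$ and the braid and commutation relations (whose elements are identified with permutations), of the $\tau_{i+j-1}$ over all $(i,j)\in P$, read along rows from right to left, from the top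 row downwards. $\mathrm{Pipes}(v_0,v(\Omega))$ is the set of pipe dreams $P$ on the $d_y\times d_x$ grid (the northwest part of the $d\times d$ grid) with $\delta(P)=v(\Omega)$. For such $P$ let $P_k$ and $P^k$ be its restrictions to the blocks $\beta_k$ and $\alpha_k$, and put $\pi(P)=(v_n,v^n,\dots,v_1,v^1)\in S_{\mathbf d}=\prod_{k}\bigl(S_{\mathbf d(y_k)+\mathbf d(x_k)}\times S_{\mathbf d(y_{k-1})+\mathbf d(x_k)}\bigr)$ with $v_k=\delta(P_k)$, $v^k=\delta(\mathrm{rot}(P^k))$. Let $X_\Omega=\{\pi(P): P\in\mathrm{Pipes}(v_0,v(\Omega))\}$. **Truncation.** $LD:S_{\mathbf d}\to\mathrm{Laces}(\mathbf d)$ sends $(v_n,v^n,\dots,v_1,v^1)$ to $(t_n(v_n),\mathrm{rot}(t^n(v^n)),\dots,t_1(v_1),\mathrm{rot}(t^1(v^1)))$, where $t_k$ (resp. $t^k$) takes the northwest $\mathbf d(y_k)\times\mathbf d(x_k)$ (resp. $\mathbf d(y_{k-1})\times\mathbf d(x_k)$) submatrix. **Proposition.** The permutation $v(\Omega)$ exists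 and is unique, and $LD$ restricts to a bijection $X_\Omega\overset{\sim}{\to}KW(\Omega)$. -/

import Mathlib

open scoped BigOperators

namespace BipartiteLaces

/-! ### Permutations, partial permutations, completions -/

/-- The length of a permutation: its number of inversions. -/
def permLength {m : ℕ} (v : Equiv.Perm (Fin m)) : ℕ :=
  (Finset.univ.filter fun p : Fin m × Fin m => p.1 < p.2 ∧ v p.2 < v p.1).card

/-- The `180` degree rotation of the permutation matrix of `v`, that is `w₀ v w₀`. -/
def rotPerm {m : ℕ} (v : Equiv.Perm (Fin m)) : Equiv.Perm (Fin m) :=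
  Fin.revPerm * v * Fin.revPerm

/-- The `180` degree rotation of an `a × b` partial permutation matrix. (A partial permutation
`w : Fin a ≃. Fin b` stands for the matrix with a `1` in entry `(i, j)` iff `j ∈ w i`.) -/
def rotPartial {a b : ℕ} (w : Fin a ≃. Fin b) : Fin a ≃. Fin b :=
  (Fin.revPerm.toPEquiv.trans w).trans Fin.revPerm.toPEquiv

/-- In a diagram of a permutation of `a + b` dots, the `i`-th of the `a` dots of the tail column,
when the columns are aligned at the top. -/
def topTail {a : ℕ} (b : ℕ) (i : Fin a) : Fin (a + b) := ⟨i.val, by omega⟩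

/-- The `j`-th of the `b` dots of the head column, columns aligned at the top. -/
def topHead (a : ℕ) {b : ℕ} (j : Fin b) : Fin (a + b) := ⟨j.val, by omega⟩

/-- The `i`-th of the `a` dots of the tail column, columns aligned at the bottom. -/
def botTail {a : ℕ} (b : ℕ) (i : Fin a) : Fin (a + b) := ⟨b + i.val, by omega⟩

/-- The `j`-th of the `b` dots of the head column, columns aligned at the bottom. -/
def botHead (a : ℕ) {b : ℕ} (j : Fin b) : Fin (a + b) := ⟨a + j.val, by omega⟩

/-- The northwest `a × b` submatrix of the permutation matrix of `v` (the matrix with a `1` in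
entry `(i, j)` iff `v i = j`). -/
def trunc {a b : ℕ} (v : Equiv.Perm (Fin (a + b))) : Fin a ≃. Fin b where
  toFun i := if h : (v (topTail b i)).val < b then some ⟨(v (topTail b i)).val, h⟩ else none
  invFun j :=
    if h : (v.symm (topHead a j)).val < a then some ⟨(v.symm (topHead a j)).val, h⟩ else none
  inv i j := by
    constructor
    · intro h
      simp only [Option.dite_none_right_eq_some, Option.some.injEq] at h ⊢
      obtain ⟨h1, h2⟩ := h
      have h3 : v.symm (topHead a j) = topTail b i := Fin.ext (by rw [← h2]; rfl)
      have h4 : v (topTail b i) = topHead a j := by rw [← h3]; simp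
      exact ⟨by rw [h4]; exact j.isLt, Fin.ext (by simp [h4, topHead])⟩
    · intro h
      simp only [Option.dite_none_right_eq_some, Option.some.injEq] at h ⊢
      obtain ⟨h1, h2⟩ := h
      have h3 : v (topTail b i) = topHead a j := Fin.ext (by rw [← h2]; rfl)
      have h4 : v.symm (topHead a j) = topTail b i := by rw [← h3]; simp
      exact ⟨by rw [h4]; exact i.isLt, Fin.ext (by simp [h4, topTail])⟩

theorem exists_trunc_eq {a b : ℕ} (w : Fin a ≃. Fin b) :
    ∃ v : Equiv.Perm (Fin (a + b)), trunc v = w := by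
  let f : Fin a → Fin (a + b) := fun i =>
    match w i with
    | some j => topHead a j
    | none => botTail b i
  have hsome : ∀ i j, w i = some j → f i = topHead a j := by
    intro i j h; simp only [f, h]
  have hnone : ∀ i, w i = none → f i = botTail b i := by
    intro i h; simp only [f, h]
  have hf : Function.Injective f := by
    intro i i' h
    rcases h1 : w i with _ | j <;> rcases h2 : w i' with _ | j'
    · rw [hnone i h1, hnone i' h2] at h
      have h' := congrArg Fin.val h
      simp only [botTail] at h'
      exact Fin.ext (by omega)
    · rw [hnone i h1, hsome i' j' h2] at h
      have h' := congrArg Fin.val h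
      simp only [botTail, topHead] at h'
      omega
    · rw [hsome i j h1, hnone i' h2] at h
      have h' := congrArg Fin.val h
      simp only [botTail, topHead] at h'
      omega
    · rw [hsome i j h1, hsome i' j' h2] at h
      have h' := congrArg Fin.val h
      simp only [topHead] at h'
      have hj : j = j' := Fin.ext h'
      subst hj
      exact w.inj h1 h2
  have ht : Function.Injective (topTail b : Fin a → Fin (a + b)) := by
    intro i i' h
    have h' := congrArg Fin.val h
    exact Fin.ext h'
  obtain ⟨v, hv⟩ : ∃ v : Equiv.Perm (Fin (a + b)), ∀ i, v (topTail b i) = f i := by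
    classical
    let e := (Equiv.ofInjective _ ht).symm.trans (Equiv.ofInjective _ hf)
    refine ⟨e.extendSubtype, fun i => ?_⟩
    rw [Equiv.extendSubtype_apply_of_mem e (topTail b i) ⟨i, rfl⟩]
    simp only [e, Equiv.trans_apply]
    rw [show (⟨topTail b i, ⟨i, rfl⟩⟩ : Set.range (topTail b : Fin a → Fin (a + b))) =
      Equiv.ofInjective _ ht i from rfl, Equiv.symm_apply_apply]
    rfl
  refine ⟨v, PEquiv.ext fun i => ?_⟩
  change (if h : (v (topTail b i)).val < b then some (⟨(v (topTail b i)).val, h⟩ : Fin b)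
    else none) = w i
  rcases h1 : w i with _ | j
  · have h3 : (v (topTail b i)).val = b + i.val := by rw [hv i, hnone i h1]; rfl
    exact dif_neg (by omega)
  · have h3 : (v (topTail b i)).val = j.val := by rw [hv i, hsome i j h1]; rfl
    rw [dif_pos (by rw [h3]; exact j.isLt)]
    exact congrArg some (Fin.ext h3)

/-- The completion `c(w)` of an `a × b` partial permutation matrix, as an element of `S_{a+b}`:
the (unique) permutation of minimal length whose matrix has `w` as its northwest corner. (The
completion of smallest size `m`, extended by `i ↦ i` for `m < i ≤ a + b`, is this permutation.) -/
noncomputable def completion {a b : ℕ} (w : Fin a ≃. Fin b) : Equiv.Perm (Fin (a + b)) :=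
  (Set.exists_min_image {v : Equiv.Perm (Fin (a + b)) | trunc v = w} permLength
    (Set.toFinite _) (exists_trunc_eq w)).choose

/-! ### The quiver, its representations and its lacing diagrams -/

/- The bipartite quiver is `y_n → x_n ← y_{n-1} → ⋯ → x_1 ← y_0`. A dimension vector is a pair
`dy : Fin (n + 1) → ℕ`, `dx : Fin n → ℕ`, where `dy i` is the dimension at `y_i` and `dx k` is the
dimension at `x_{k+1}`. The index `k : Fin n` of an arrow stands for `k + 1`:
`β_{k+1} : y_{k+1} → x_{k+1}` points right and `α_{k+1} : y_k → x_{k+1}` points left. -/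

/-- The representation space. -/
@[ext]
structure Rep (K : Type*) {n : ℕ} (dy : Fin (n + 1) → ℕ) (dx : Fin n → ℕ) where
  β : (k : Fin n) → Matrix (Fin (dy k.succ)) (Fin (dx k)) K
  α : (k : Fin n) → Matrix (Fin (dy k.castSucc)) (Fin (dx k)) K

/-- The right action of `GL(d)`: `(V • g)_a = g_{ta}⁻¹ V_a g_{ha}`. -/
def Rep.act {K : Type*} [Field K] {n : ℕ} {dy : Fin (n + 1) → ℕ} {dx : Fin n → ℕ}
    (V : Rep K dy dx) (gy : (i : Fin (n + 1)) → GL (Fin (dy i)) K)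
    (gx : (k : Fin n) → GL (Fin (dx k)) K) : Rep K dy dx where
  β k := ((gy k.succ)⁻¹).val * V.β k * (gx k).val
  α k := ((gy k.castSucc)⁻¹).val * V.α k * (gx k).val

/-- The `GL(d)`-orbit of `V`. -/
def Rep.orbit {K : Type*} [Field K] {n : ℕ} {dy : Fin (n + 1) → ℕ} {dx : Fin n → ℕ}
    (V : Rep K dy dx) : Set (Rep K dy dx) :=
  {U | ∃ gy gx, U = V.act gy gx}

/-- Lacing diagrams: tuples of partial permutations, one for each arrow. -/
@[ext]
structure Laces {n : ℕ} (dy : Fin (n + 1) → ℕ) (dx : Fin n → ℕ) where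
  β : (k : Fin n) → Fin (dy k.succ) ≃. Fin (dx k)
  α : (k : Fin n) → Fin (dy k.castSucc) ≃. Fin (dx k)

/-- The group `S_d = ∏ₖ S_{β_k} × S_{α_k}`. -/
@[ext]
structure PermTuple {n : ℕ} (dy : Fin (n + 1) → ℕ) (dx : Fin n → ℕ) where
  β : (k : Fin n) → Equiv.Perm (Fin (dy k.succ + dx k))
  α : (k : Fin n) → Equiv.Perm (Fin (dy k.castSucc + dx k))

section

variable {n : ℕ} {dy : Fin (n + 1) → ℕ} {dx : Fin n → ℕ}

/-- A lacing diagram as a tuple of partial permutation matrices. -/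
def Laces.toRep (K : Type*) [Field K] (w : Laces dy dx) : Rep K dy dx where
  β k := (w.β k).toMatrix
  α k := (w.α k).toMatrix

/-- The extended lacing diagram: `c(w_a)` for right-pointing arrows, where columns are aligned at
the top (the virtual dots are the lowest ones), and `rot(c(rot(w_a)))` for left-pointing arrows,
where columns are aligned at the bottom (the virtual dots are the highest ones). -/
noncomputable def Laces.extended (w : Laces dy dx) : PermTuple dy dx where
  β k := completion (w.β k)
  α k := rotPerm (completion (rotPartial (w.α k)))

/-- The length `|w|`: the number of crossings in the extended lacing diagram. -/
noncomputable def Laces.length (w : Laces dy dx) : ℕ :=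
  ∑ k, (permLength (w.extended.β k) + permLength (w.extended.α k))

/-- Minimal lacing diagrams of the orbit `O`. -/
def minimalLaces {K : Type*} [Field K] (O : Set (Rep K dy dx)) : Set (Laces dy dx) :=
  {w | w.toRep K ∈ O ∧ ∀ w' : Laces dy dx, w'.toRep K ∈ O → w.length ≤ w'.length}

/-! ### K-theoretic lacing diagrams -/

/-- The effect of a K-theoretic move at two adjacent dots of a middle column. Here `L` and `R` send
the dots of the middle column to the dots of the left and right neighbouring columns to which they
are joined; the two middle dots are `s`, `t` in the numbering used by `L`, and `s'`, `t'` in the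
numbering used by `R`. The laces through the two dots cross on at least one side before the move
and on at least one side after it, and a move can only exchange the two left partners and/or
the two right partners. -/
def LocalMove {N M : ℕ} (L L' : Equiv.Perm (Fin N)) (s t : Fin N)
    (R R' : Equiv.Perm (Fin M)) (s' t' : Fin M) : Prop :=
  (L' = L ∨ L' = L * Equiv.swap s t) ∧ (R' = R ∨ R' = R * Equiv.swap s' t') ∧
  (L t < L s ∨ R t' < R s') ∧ (L' t < L' s ∨ R' t' < R' s')

/-- A single K-theoretic move from `w` to `w'`, performed on the extended lacing diagrams. -/
inductive KMove (w w' : Laces dy dx) : Prop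
  /-- The middle column is the sink `x_{k+1}`, between `y_{k+1}` and `y_k`; its dots `s`, `t` are
  non-virtual and adjacent. -/
  | sink (k : Fin n) (s t : Fin (dx k)) (hst : t.val = s.val + 1)
      (hβ : ∀ j, j ≠ k → w'.extended.β j = w.extended.β j)
      (hα : ∀ j, j ≠ k → w'.extended.α j = w.extended.α j)
      (hleft : ((w.extended.β k)⁻¹ (topHead _ s)).val < dy k.succ ∨
        ((w.extended.β k)⁻¹ (topHead _ t)).val < dy k.succ)
      (hright : dx k ≤ ((w.extended.α k)⁻¹ (botHead _ s)).val ∨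
        dx k ≤ ((w.extended.α k)⁻¹ (botHead _ t)).val)
      (hmove : LocalMove
        (w.extended.β k)⁻¹ (w'.extended.β k)⁻¹ (topHead _ s) (topHead _ t)
        (w.extended.α k)⁻¹ (w'.extended.α k)⁻¹ (botHead _ s) (botHead _ t))
  /-- The middle column is the source `y_{r+1} = y_l`, between `x_{l+1}` (reached by `α_{l+1}`) and
  `x_{r+1}` (reached by `β_{r+1}`); its dots `s`, `t` are non-virtual and adjacent. -/
  | source (l r : Fin n) (hlr : r.succ = l.castSucc) (s t : Fin (dy r.succ))
      (hst : t.val = s.val + 1)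
      (hβ : ∀ j, j ≠ r → w'.extended.β j = w.extended.β j)
      (hα : ∀ j, j ≠ l → w'.extended.α j = w.extended.α j)
      (hleft : dy l.castSucc ≤
          (w.extended.α l (botTail _ (Fin.cast (congrArg dy hlr) s))).val ∨
        dy l.castSucc ≤ (w.extended.α l (botTail _ (Fin.cast (congrArg dy hlr) t))).val)
      (hright : (w.extended.β r (topTail _ s)).val < dx r ∨
        (w.extended.β r (topTail _ t)).val < dx r)
      (hmove : LocalMove
        (w.extended.α l) (w'.extended.α l)
        (botTail _ (Fin.cast (congrArg dy hlr) s)) (botTail _ (Fin.cast (congrArg dy hlr) t))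
        (w.extended.β r) (w'.extended.β r) (topTail _ s) (topTail _ t))

/-- The set `KW(Ω)` of K-theoretic lacing diagrams, `Ω` the closure of the orbit `O`. -/
def KW {K : Type*} [Field K] (O : Set (Rep K dy dx)) : Set (Laces dy dx) :=
  {w | ∃ w₀ ∈ minimalLaces O, Relation.ReflTransGen KMove w₀ w}

/-! ### Laces and the bipartite Zelevinsky permutation -/

/-- The vertices of the quiver: `Sum.inl i` is `y_i` and `Sum.inr k` is `x_{k+1}`. -/
abbrev Vertex (n : ℕ) : Type := Fin (n + 1) ⊕ Fin n

/-- The position of a vertex in the quiver, from left to right: `y_n, x_n, …, x_1, y_0`. -/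
def Vertex.pos : Vertex n → ℕ
  | Sum.inl i => 2 * i.rev.val
  | Sum.inr k => 2 * k.rev.val + 1

/-- The dots of a lacing diagram: those of the columns `y_i` and those of the columns `x_{k+1}`. -/
abbrev Dot (dy : Fin (n + 1) → ℕ) (dx : Fin n → ℕ) : Type :=
  (Σ i : Fin (n + 1), Fin (dy i)) ⊕ (Σ k : Fin n, Fin (dx k))

/-- The column of a dot. -/
def Dot.column : Dot dy dx → Vertex n
  | Sum.inl p => Sum.inl p.1
  | Sum.inr p => Sum.inr p.1

/-- The arrows between dots in a lacing diagram. -/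
inductive Laces.Arrow (w : Laces dy dx) : Dot dy dx → Dot dy dx → Prop
  | beta (k : Fin n) (i : Fin (dy k.succ)) (j : Fin (dx k)) (h : j ∈ w.β k i) :
      Laces.Arrow w (Sum.inl ⟨k.succ, i⟩) (Sum.inr ⟨k, j⟩)
  | alpha (k : Fin n) (i : Fin (dy k.castSucc)) (j : Fin (dx k)) (h : j ∈ w.α k i) :
      Laces.Arrow w (Sum.inl ⟨k.castSucc, i⟩) (Sum.inr ⟨k, j⟩)

/-- The lacing diagram as a graph; the laces are its connected components. -/
def Laces.graph (w : Laces dy dx) : SimpleGraph (Dot dy dx) := SimpleGraph.fromRel w.Arrow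

/-- The number of laces with left endpoint in column `z` and right endpoint in column `z'`. -/
noncomputable def Laces.laceCount (w : Laces dy dx) (z z' : Vertex n) : ℕ :=
  Nat.card {C : w.graph.ConnectedComponent //
    ((∃ p ∈ C.supp, Dot.column p = z) ∧ ∀ p ∈ C.supp, z.pos ≤ (Dot.column p).pos) ∧
    ((∃ p ∈ C.supp, Dot.column p = z') ∧ ∀ p ∈ C.supp, (Dot.column p).pos ≤ z'.pos)}

/-- The number of arrows between the columns `z` and `z'`. -/
noncomputable def Laces.arrowCount (w : Laces dy dx) (z z' : Vertex n) : ℕ :=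
  Nat.card {p : Dot dy dx × Dot dy dx //
    Dot.column p.1 = z ∧ Dot.column p.2 = z' ∧ w.graph.Adj p.1 p.2}

/-- The number of dots in a column. -/
def dim (dy : Fin (n + 1) → ℕ) (dx : Fin n → ℕ) : Vertex n → ℕ
  | Sum.inl i => dy i
  | Sum.inr k => dx k

/-- The number of rows above block row `z`; block rows are `y_0, …, y_n, x_n, …, x_1`. -/
def rowOffset (dy : Fin (n + 1) → ℕ) (dx : Fin n → ℕ) : Vertex n → ℕ
  | Sum.inl i => ∑ j ∈ Finset.Iio i, dy j
  | Sum.inr k => (∑ j, dy j) + ∑ j ∈ Finset.Ioi k, dx j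

/-- The number of columns left of block column `z`; block columns are
`x_n, …, x_1, y_0, …, y_n`. -/
def colOffset (dy : Fin (n + 1) → ℕ) (dx : Fin n → ℕ) : Vertex n → ℕ
  | Sum.inl i => (∑ j, dx j) + ∑ j ∈ Finset.Iio i, dy j
  | Sum.inr k => ∑ j ∈ Finset.Ioi k, dx j

/-- Row `r` lies in block row `z`. -/
def InRow (dy : Fin (n + 1) → ℕ) (dx : Fin n → ℕ) (z : Vertex n) (r : ℕ) : Prop :=
  rowOffset dy dx z ≤ r ∧ r < rowOffset dy dx z + dim dy dx z

/-- Column `c` lies in block column `z`. -/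
def InCol (dy : Fin (n + 1) → ℕ) (dx : Fin n → ℕ) (z : Vertex n) (c : ℕ) : Prop :=
  colOffset dy dx z ≤ c ∧ c < colOffset dy dx z + dim dy dx z

/-- The symmetric group `S_d`, where `d = d_y + d_x` is the total dimension. -/
abbrev TotalPerm (dy : Fin (n + 1) → ℕ) (dx : Fin n → ℕ) : Type :=
  Equiv.Perm (Fin ((∑ i, dy i) + ∑ k, dx k))

/-- The number of `1`s of the matrix of `v` in block `(z, z')`. -/
noncomputable def onesInBlock (v : TotalPerm dy dx) (z z' : Vertex n) : ℕ :=
  Nat.card {r // InRow dy dx z (Fin.val r) ∧ InCol dy dx z' (v r).val}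

/-- The three defining conditions of the bipartite Zelevinsky permutation of the closure of the
orbit `O`. -/
def IsZelevinsky {K : Type*} [Field K] (O : Set (Rep K dy dx)) (v : TotalPerm dy dx) : Prop :=
  (∃ w : Laces dy dx, w.toRep K ∈ O ∧
    (∀ z z' : Vertex n, z.pos ≤ z'.pos → onesInBlock v z z' = w.laceCount z z') ∧
    (∀ z z' : Vertex n, z.pos = z'.pos + 1 → onesInBlock v z z' = w.arrowCount z z')) ∧
  (∀ (z : Vertex n) (r r'), InRow dy dx z (Fin.val r) → InRow dy dx z (Fin.val r') →
    r < r' → v r < v r') ∧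
  (∀ (z : Vertex n) (r r'), InCol dy dx z (v r).val → InCol dy dx z (v r').val →
    r < r' → v r < v r')

/-- The bipartite Zelevinsky permutation `v(Ω)`, `Ω` the closure of the orbit `O`. -/
noncomputable def zelevinsky {K : Type*} [Field K] (O : Set (Rep K dy dx)) : TotalPerm dy dx :=
  Classical.epsilon (IsZelevinsky O)

end

/-! ### Pipe dreams -/

/- A pipe dream on the `k × l` grid is a set of cells `(i, j)` with `i < k`, `j < l` (rows and
columns are numbered from `0`). -/

/-- Right Demazure multiplication `v ∗ τ`, where `τ` exchanges `a` and `a + 1` (from `0`). -/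
def demazureStep {m : ℕ} (v : Equiv.Perm (Fin m)) (a : ℕ) : Equiv.Perm (Fin m) :=
  if h : a + 1 < m then
    if v ⟨a, by omega⟩ < v ⟨a + 1, h⟩ then v * Equiv.swap ⟨a, by omega⟩ ⟨a + 1, h⟩ else v
  else v

/-- The word of a pipe dream: along rows from right to left, from the top row downwards. -/
def pipeWord (k l : ℕ) (P : Finset (ℕ × ℕ)) : List ℕ :=
  (List.range k).flatMap fun i =>
    ((List.range l).reverse.filter fun j => (i, j) ∈ P).map fun j => i + j

/-- The Demazure product `δ(P) ∈ S_{k+l}` of a pipe dream on the `k × l` grid. -/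
def demazure (k l : ℕ) (P : Finset (ℕ × ℕ)) : Equiv.Perm (Fin (k + l)) :=
  (pipeWord k l P).foldl demazureStep 1

/-- The `k × l` mini pipe dream of `P` whose northwest corner is the cell `(r, c)`. -/
def miniPipe (P : Finset (ℕ × ℕ)) (r c k l : ℕ) : Finset (ℕ × ℕ) :=
  (Finset.range k ×ˢ Finset.range l).filter fun p => (r + p.1, c + p.2) ∈ P

/-- The `180` degree rotation of a pipe dream on the `k × l` grid. -/
def rotPipe (k l : ℕ) (P : Finset (ℕ × ℕ)) : Finset (ℕ × ℕ) :=
  (Finset.range k ×ˢ Finset.range l).filter fun p => (k - 1 - p.1, l - 1 - p.2) ∈ P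

section

variable {n : ℕ} {dy : Fin (n + 1) → ℕ} {dx : Fin n → ℕ}

/-- The set `Pipes(v₀, v)`: pipe dreams for `v ∈ S_d` with all crosses in the northwest
`d_y × d_x` subgrid. -/
def pipes (v : TotalPerm dy dx) : Set (Finset (ℕ × ℕ)) :=
  {P | P ⊆ Finset.range (∑ i, dy i) ×ˢ Finset.range (∑ k, dx k) ∧
    demazure (∑ i, dy i) (∑ k, dx k) P = v}

/-- The tuple `π(P)`, with entries `δ(P_k)` and `δ(rot(P^k))` for the restrictions `P_k` and `P^k`
of `P` to the blocks `β_k` and `α_k` of the snake region. -/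
def pipeTuple (dy : Fin (n + 1) → ℕ) (dx : Fin n → ℕ) (P : Finset (ℕ × ℕ)) : PermTuple dy dx where
  β k := demazure (dy k.succ) (dx k)
    (miniPipe P (rowOffset dy dx (Sum.inl k.succ)) (colOffset dy dx (Sum.inr k))
      (dy k.succ) (dx k))
  α k := demazure (dy k.castSucc) (dx k)
    (rotPipe (dy k.castSucc) (dx k)
      (miniPipe P (rowOffset dy dx (Sum.inl k.castSucc)) (colOffset dy dx (Sum.inr k))
        (dy k.castSucc) (dx k)))

/-- The set `X_Ω = {π(P) : P ∈ Pipes(v₀, v(Ω))}`, `Ω` the closure of the orbit `O`. -/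
def XSet {K : Type*} [Field K] (O : Set (Rep K dy dx)) : Set (PermTuple dy dx) :=
  pipeTuple dy dx '' pipes (zelevinsky O)

/-- The truncation map `LD : S_d → Laces(d)`. -/
def LD (v : PermTuple dy dx) : Laces dy dx where
  β k := trunc (v.β k)
  α k := rotPartial (trunc (v.α k))

end

end BipartiteLaces

namespace BipartiteLaces
open Equiv

/-! ### The 0-Hecke monoid of permutations of `ℕ` -/

/-! All objects are compared through one element of the 0-Hecke monoid. The blocks α_k and β_k form
a snake in the `d_y × d_x` grid. Fill everything northwest and southeast of the snake with crosses,
and put into α_k and β_k words for the permutations of the extended diagram of `w`. The Demazure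
product of this filling is `Laces.total w`. Both sides of the bijection are described as the set of
lacing diagrams with `w.total = v(Ω)`, and `LD` is shown to identify `X_Ω` with this set.

Pipe dreams. The permutation `v(Ω)` has no `1` in a block `(z, z')` with `z` at least two vertices
to the right of `z'`. By counting large values in initial segments, this forces every cell outside
the snake to be a cross (`exists_le_of_notMem`, `exists_ge_of_notMem`), so `δ(P)` depends only on
`π(P)`. A generator placed at virtual dots of a block slides through the full rectangles to the edge
of the grid, where it becomes a generator inside one block row or block column of `v(Ω)`. If the
block already had a descent there, the generator would be absorbed and `v(Ω)` would have a descent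
in that block row or column, which it has not. So the permutations in `π(P)` increase at virtual
dots. Such permutations are exactly completions, hence `π(P)` can be recovered from its truncation.
Conversely a completion has a pipe dream inside its own block, read off from its Lehmer code. This
gives `bijOn_LD_pipes`.

Moves. A generator inserted between two consecutive blocks, at dots of the column which they share,
may be absorbed into either block. So a crossing on the left, on the right or on both sides gives
the same product (`Middle.total_cross`), and K-theoretic moves preserve `Laces.total`. Conversely,
if the product ascends in the block rows, moves push all crossings at inner columns to the left. In
the resulting diagram no two wires cross twice, so the word of the grid is reduced
(`Frame.isRed_sufWord`): the Demazure product is then an ordinary product of permutations, and its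
number of inversions is the length of the diagram plus a constant. The wires of an ordinary product
follow the laces, so its blocks count laces and arrows (`Laces.onesInBlock_eq`). Hence `v(Ω)`
determines the left-pushed diagram up to permuting dots within columns, so determines its orbit, and
the number of inversions shows that this diagram is minimal (`KW_eq`).

The permutation `v(Ω)`. Every orbit contains a lacing diagram, by a choice of bases adapted to
chains of subspaces (`exists_laces_mem_orbit`), and the lace counts are orbit invariants, being
differences of dimensions of spaces of compatible families of vectors (`Laces.finrank_families`). A
diagram of minimal length can be pushed to the left, which shows that its product ascends in block
rows, or to the right, which gives block columns; the product is the same both times, and it is the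
required permutation (`exists_isZelevinsky`). A permutation that is monotone in block rows and block
columns is determined by its block counts (`blockMono_unique`). The blocks left open by the
definition are empty, because the row sums are already exhausted. -/

theorem perm_inv_apply {α : Type*} (u : Perm α) (i : α) : u⁻¹ (u i) = i := u.symm_apply_apply i

theorem perm_apply_inv {α : Type*} (u : Perm α) (i : α) : u (u⁻¹ i) = i := u.apply_symm_apply i

theorem swap_lt_swap {a x y : ℕ} (h : x < y) (h' : ¬(x = a ∧ y = a + 1)) :
    swap a (a + 1) x < swap a (a + 1) y := by
  simp only [swap_apply_def]; split_ifs <;> omega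

/-- Right Demazure multiplication by the transposition of `a` and `a + 1`. -/
def rstep (u : Perm ℕ) (a : ℕ) : Perm ℕ := if u a < u (a + 1) then u * swap a (a + 1) else u

/-- Left Demazure multiplication by the transposition of `a` and `a + 1`. -/
def lstep (a : ℕ) (u : Perm ℕ) : Perm ℕ := (rstep u⁻¹ a)⁻¹

theorem lstep_eq (a : ℕ) (u : Perm ℕ) :
    lstep a u = if u⁻¹ a < u⁻¹ (a + 1) then swap a (a + 1) * u else u := by
  unfold lstep rstep; split_ifs <;> simp

theorem perm_ne {u : Perm ℕ} {a b : ℕ} (h : a ≠ b) : u a ≠ u b := fun e => h (u.injective e)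

theorem rstep_desc (u : Perm ℕ) (a : ℕ) : (rstep u a) (a + 1) < (rstep u a) a := by
  have := perm_ne (u := u) (show a ≠ a + 1 by omega)
  unfold rstep
  split_ifs with h
  · simpa using h
  · omega

theorem lstep_desc (u : Perm ℕ) (a : ℕ) : (lstep a u)⁻¹ (a + 1) < (lstep a u)⁻¹ a := by
  simpa [lstep] using rstep_desc u⁻¹ a

theorem lstep_one (a : ℕ) : lstep a 1 = rstep 1 a := by simp [lstep, rstep]

/-- The two multiplications act on values and on positions, and interact only when `u` carries the
pair `b, b + 1` to `a, a + 1`. This commutation is the associativity of the monoid in the only form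
needed: it makes equality of Demazure products a two-sided congruence. -/
theorem lstep_rstep_comm (a b : ℕ) (u : Perm ℕ) :
    lstep a (rstep u b) = rstep (lstep a u) b := by
  have hne := perm_ne (u := u⁻¹) (show a ≠ a + 1 by omega)
  have hne' := perm_ne (u := u) (show b ≠ b + 1 by omega)
  rw [lstep_eq, lstep_eq]
  unfold rstep
  by_cases h1 : u b < u (b + 1) <;> by_cases h2 : u⁻¹ a < u⁻¹ (a + 1)
  · by_cases h : u b = a ∧ u (b + 1) = a + 1
    · obtain ⟨e1, e2⟩ := h
      have e1' : u⁻¹ a = b := by rw [← e1]; simp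
      have e2' : u⁻¹ (a + 1) = b + 1 := by rw [← e2]; simp
      have : u * swap b (b + 1) = swap a (a + 1) * u := by
        rw [← e2, ← e1, Equiv.mul_swap_eq_swap_mul]
      have k1 : ¬ (swap a (a + 1) * u) b < (swap a (a + 1) * u) (b + 1) := by
        simp [e1, e2]
      have k2 : ¬ (u * swap b (b + 1))⁻¹ a < (u * swap b (b + 1))⁻¹ (a + 1) := by
        simp only [mul_inv_rev, swap_inv, Perm.mul_apply, e1', e2']
        simp
      rw [if_pos h1, if_neg k2, if_pos h2, if_neg k1, this]
    · have h' : ¬(u⁻¹ a = b ∧ u⁻¹ (a + 1) = b + 1) := by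
        rintro ⟨e1, e2⟩
        exact h ⟨(Perm.inv_eq_iff_eq.1 e1).symm, (Perm.inv_eq_iff_eq.1 e2).symm⟩
      have k1 := swap_lt_swap h1 h
      have k2 := swap_lt_swap h2 h'
      have k2' : (u * swap b (b + 1))⁻¹ a < (u * swap b (b + 1))⁻¹ (a + 1) := by
        simpa only [mul_inv_rev, swap_inv, Perm.mul_apply] using k2
      have k1' : (swap a (a + 1) * u) b < (swap a (a + 1) * u) (b + 1) := k1
      rw [if_pos h1, if_pos h2, if_pos k1', if_pos k2', mul_assoc]
  · have h : ¬(u b = a ∧ u (b + 1) = a + 1) := by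
      rintro ⟨e1, e2⟩
      exact h2 (by rw [Perm.inv_eq_iff_eq.2 e1.symm, Perm.inv_eq_iff_eq.2 e2.symm]; omega)
    have k : ¬ ((u * swap b (b + 1))⁻¹ a < (u * swap b (b + 1))⁻¹ (a + 1)) := by
      simp only [mul_inv_rev, swap_inv, Perm.mul_apply]
      have := swap_lt_swap (a := b) (x := u⁻¹ (a + 1)) (y := u⁻¹ a) (by omega) (by
        rintro ⟨e1, e2⟩
        have e1 : a + 1 = u b := by rw [← e1]; simp
        have e2 : a = u (b + 1) := by rw [← e2]; simp
        omega)
      omega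
    rw [if_pos h1, if_neg h2, if_neg k, if_pos h1]
  · have k : ¬ ((swap a (a + 1) * u) b < (swap a (a + 1) * u) (b + 1)) := by
      simp only [Perm.mul_apply]
      have := swap_lt_swap (a := a) (x := u (b + 1)) (y := u b) (by omega) (by
        rintro ⟨e1, e2⟩
        have e1 : b + 1 = u⁻¹ a := by rw [← e1]; simp
        have e2 : b = u⁻¹ (a + 1) := by rw [← e2]; simp
        omega)
      omega
    rw [if_neg h1, if_pos h2, if_neg k]
  · rw [if_neg h1, if_neg h2, if_neg h1]

/-- The Demazure product of a word. -/
def dem (W : List ℕ) : Perm ℕ := W.foldl rstep 1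

@[simp] theorem dem_nil : dem [] = 1 := rfl

theorem dem_snoc (W : List ℕ) (a : ℕ) : dem (W ++ [a]) = rstep (dem W) a := by simp [dem]

theorem foldl_lstep (a : ℕ) (u : Perm ℕ) (W : List ℕ) :
    W.foldl rstep (lstep a u) = lstep a (W.foldl rstep u) := by
  induction W generalizing u with
  | nil => rfl
  | cons b W ih => rw [List.foldl_cons, List.foldl_cons, ← lstep_rstep_comm, ih]

theorem dem_cons (a : ℕ) (W : List ℕ) : dem (a :: W) = lstep a (dem W) := by
  rw [dem, List.foldl_cons, ← lstep_one, foldl_lstep, dem]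

/-- Words with the same Demazure product. -/
def Sim (W W' : List ℕ) : Prop := dem W = dem W'

theorem Sim.refl (W : List ℕ) : Sim W W := rfl
theorem Sim.symm {W W' : List ℕ} (h : Sim W W') : Sim W' W := Eq.symm h
theorem Sim.trans {U V W : List ℕ} (h : Sim U V) (h' : Sim V W) : Sim U W := Eq.trans h h'

/-- On the right this is immediate from the definition by a fold. On the left it rests on
`dem_cons`, that is, on the commutation of left and right steps. -/
theorem Sim.append {U U' V V' : List ℕ} (h : Sim U U') (h' : Sim V V') :
    Sim (U ++ V) (U' ++ V') := by
  have h1 : Sim (U ++ V) (U' ++ V) := by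
    have : dem U = dem U' := h
    unfold Sim dem at *
    rw [List.foldl_append, List.foldl_append, this]
  refine h1.trans ?_
  clear h1 h
  induction U' with
  | nil => exact h'
  | cons a U ih =>
    unfold Sim at *
    rw [List.cons_append, List.cons_append, dem_cons, dem_cons, ih]

theorem Sim.left {V V' : List ℕ} (U : List ℕ) (h : Sim V V') : Sim (U ++ V) (U ++ V') :=
  (Sim.refl U).append h

theorem Sim.right {U U' : List ℕ} (V : List ℕ) (h : Sim U U') : Sim (U ++ V) (U' ++ V) :=
  h.append (Sim.refl V)

theorem dem_reverse (W : List ℕ) : dem W.reverse = (dem W)⁻¹ := by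
  induction W with
  | nil => simp
  | cons a W ih => rw [List.reverse_cons, dem_snoc, ih, dem_cons, lstep, inv_inv]

/-- Letters of commuting generators. -/
def Far (a b : ℕ) : Prop := a + 2 ≤ b ∨ b + 2 ≤ a

theorem Far.symm {a b : ℕ} (h : Far a b) : Far b a := Or.symm h

theorem rstep_comm {a b : ℕ} (h : Far a b) (u : Perm ℕ) :
    rstep (rstep u a) b = rstep (rstep u b) a := by
  have key : ∀ a b, Far a b → swap a (a + 1) b = b ∧ swap a (a + 1) (b + 1) = b + 1 := by
    intro a b h
    unfold Far at h
    constructor <;> apply swap_apply_of_ne_of_ne <;> omega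
  have e : swap a (a + 1) * swap b (b + 1) = swap b (b + 1) * swap a (a + 1) := by
    rw [Equiv.mul_swap_eq_swap_mul, (key a b h).1, (key a b h).2]
  unfold rstep
  by_cases h1 : u a < u (a + 1) <;> by_cases h2 : u b < u (b + 1) <;>
    simp [h1, h2, key a b h, key b a h.symm, mul_assoc, e]

theorem sim_pair {a b : ℕ} (h : Far a b) : Sim [a, b] [b, a] := rstep_comm h 1

theorem sim_cons_far {a : ℕ} {W : List ℕ} (h : ∀ b ∈ W, Far a b) : Sim (a :: W) (W ++ [a]) := by
  induction W with
  | nil => rfl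
  | cons b W ih =>
    have h1 : Sim ([a, b] ++ W) ([b, a] ++ W) := (sim_pair (h b (by simp))).right W
    have h2 : Sim ([b] ++ (a :: W)) ([b] ++ (W ++ [a])) :=
      Sim.left [b] (ih fun c hc => h c (by simp [hc]))
    exact h1.trans h2

theorem sim_append_far {U W : List ℕ} (h : ∀ a ∈ U, ∀ b ∈ W, Far a b) :
    Sim (U ++ W) (W ++ U) := by
  induction U with
  | nil => simpa using Sim.refl W
  | cons a U ih =>
    have h1 : Sim ([a] ++ (U ++ W)) ([a] ++ (W ++ U)) :=
      Sim.left [a] (ih fun c hc => h c (by simp [hc]))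
    have h2 : Sim ((a :: W) ++ U) ((W ++ [a]) ++ U) :=
      (sim_cons_far (h a (by simp))).right U
    refine h1.trans ?_
    simpa using h2

/-- `W` is a reduced word of `u`. -/
inductive IsRed : List ℕ → Perm ℕ → Prop
  | nil : IsRed [] 1
  | snoc {W : List ℕ} {u : Perm ℕ} {a : ℕ} (h : IsRed W u) (ha : u a < u (a + 1)) :
      IsRed (W ++ [a]) (u * swap a (a + 1))

theorem IsRed.dem_eq {W : List ℕ} {u : Perm ℕ} (h : IsRed W u) : dem W = u := by
  induction h with
  | nil => rfl
  | snoc h ha ih => rw [dem_snoc, ih, rstep, if_pos ha]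

/-- The inversions of a permutation. -/
def inversions (u : Perm ℕ) : Set (ℕ × ℕ) := {p | p.1 < p.2 ∧ u p.2 < u p.1}

/-- The transposition carries the old inversions bijectively to inversions, since it preserves the
order of every pair except `a, a + 1`; that pair is the single new inversion. -/
theorem encard_inversions_mul_swap {u : Perm ℕ} {a : ℕ} (ha : u a < u (a + 1)) :
    (inversions (u * swap a (a + 1))).encard = (inversions u).encard + 1 := by
  have hinj : Function.Injective (Prod.map (swap a (a + 1)) (swap a (a + 1))) :=
    (Equiv.injective _).prodMap (Equiv.injective _)
  have e : inversions (u * swap a (a + 1)) =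
      insert (a, a + 1) (Prod.map (swap a (a + 1)) (swap a (a + 1)) '' inversions u) := by
    ext ⟨i, j⟩
    simp only [inversions, Set.mem_ofPred_eq, Perm.mul_apply, Set.mem_insert_iff, Set.mem_image,
      Prod.exists, Prod.map_apply, Prod.mk.injEq]
    constructor
    · rintro ⟨h1, h2⟩
      by_cases h : i = a ∧ j = a + 1
      · exact Or.inl h
      · exact Or.inr ⟨swap a (a + 1) i, swap a (a + 1) j, ⟨swap_lt_swap h1 h, h2⟩, by simp⟩
    · rintro (⟨rfl, rfl⟩ | ⟨i', j', ⟨h1, h2⟩, rfl, rfl⟩)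
      · simpa using ha
      · refine ⟨swap_lt_swap h1 ?_, by simpa using h2⟩
        rintro ⟨rfl, rfl⟩
        omega
  rw [e, Set.encard_insert_of_notMem, hinj.encard_image]
  rintro ⟨⟨i, j⟩, ⟨h1, h2⟩, h3⟩
  simp only [Prod.map_apply, Prod.mk.injEq] at h3
  have e1 : i = a + 1 := (swap a (a + 1)).injective (by rw [h3.1, swap_apply_right])
  have e2 : j = a := (swap a (a + 1)).injective (by rw [h3.2, swap_apply_left])
  simp only at h1
  omega

theorem IsRed.encard {W : List ℕ} {u : Perm ℕ} (h : IsRed W u) :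
    (inversions u).encard = W.length := by
  induction h with
  | nil =>
    simp only [List.length_nil, Nat.cast_zero, Set.encard_eq_zero]
    ext ⟨i, j⟩
    simp only [inversions, Set.mem_ofPred_eq, Perm.one_apply, Set.mem_empty_iff_false, iff_false]
    omega
  | snoc h ha ih => rw [encard_inversions_mul_swap ha, ih]; simp

theorem IsRed.length_eq {W W' : List ℕ} {u : Perm ℕ} (h : IsRed W u) (h' : IsRed W' u) :
    W.length = W'.length := by
  have := h.encard.symm.trans h'.encard
  exact_mod_cast this

/-- The condition says that no two wires cross twice: a pair of positions inverted by `x` is not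
inverted by `y⁻¹`. -/
theorem IsRed.append {V W : List ℕ} {x y : Perm ℕ} (hx : IsRed V x) (hy : IsRed W y)
    (hxy : ∀ p q, p < q → x q < x p → y⁻¹ p < y⁻¹ q) : IsRed (V ++ W) (x * y) := by
  -- Equivalently, every inversion of `y` is an inversion of `x * y`. In this form the hypothesis
  -- passes to a prefix of the word of `y`.
  replace hxy : ∀ i j, i < j → y j < y i → x (y j) < x (y i) := by
    intro i j hij h
    by_contra hc
    have h1 : x (y i) < x (y j) :=
      lt_of_le_of_ne (not_lt.1 hc) (perm_ne (u := x) (by omega))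
    have := hxy _ _ h h1
    simp at this
    omega
  induction hy with
  | nil => simpa using hx
  | @snoc W u a h ha ih =>
    rw [← List.append_assoc, ← mul_assoc]
    have hcond : ∀ i j, i < j → u j < u i → x (u j) < x (u i) := by
      intro i j hij hu
      have h1 := swap_lt_swap (a := a) hij (by rintro ⟨rfl, rfl⟩; omega)
      have := hxy _ _ h1 (by simpa using hu)
      simpa using this
    have h2 := ih hcond
    have h3 := hxy a (a + 1) (by omega) (by simpa using ha)
    exact h2.snoc (by simpa using h3)

theorem IsRed.cons_iff {W : List ℕ} {u : Perm ℕ} {a : ℕ} (h : IsRed W u)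
    (ha : u⁻¹ a < u⁻¹ (a + 1)) : IsRed (a :: W) (swap a (a + 1) * u) := by
  have h1 : IsRed [a] (swap a (a + 1)) := by
    simpa using IsRed.snoc (a := a) IsRed.nil (by simp)
  refine h1.append h ?_
  intro p q hpq hs
  have : p = a ∧ q = a + 1 := by
    by_contra hc
    have := swap_lt_swap hpq hc
    omega
  rw [this.1, this.2]; exact ha

/-! ### Embedding finite permutations, rectangles -/

/-- The permutation of `ℕ` acting as `u` on the window `[o, o + m)`. -/
def emb (o : ℕ) {m : ℕ} (u : Perm (Fin m)) : Perm ℕ where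
  toFun i := if h : o ≤ i ∧ i < o + m then o + (u ⟨i - o, by omega⟩).val else i
  invFun i := if h : o ≤ i ∧ i < o + m then o + (u⁻¹ ⟨i - o, by omega⟩).val else i
  left_inv i := by
    by_cases h : o ≤ i ∧ i < o + m
    · have := (u ⟨i - o, by omega⟩).isLt
      simp only [dif_pos h]
      rw [dif_pos (by omega)]
      simp only [Nat.add_sub_cancel_left, Fin.eta, perm_inv_apply]
      omega
    · simp only [dif_neg h]
  right_inv i := by
    by_cases h : o ≤ i ∧ i < o + m
    · have := (u⁻¹ ⟨i - o, by omega⟩).isLt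
      simp only [dif_pos h]
      rw [dif_pos (by omega)]
      simp only [Nat.add_sub_cancel_left, Fin.eta, perm_apply_inv]
      omega
    · simp only [dif_neg h]

variable {o m : ℕ}

theorem emb_add (o : ℕ) (u : Perm (Fin m)) (i : Fin m) : emb o u (o + i) = o + u i := by
  have : emb o u (o + i) = if h : o ≤ o + i.val ∧ o + i.val < o + m then
    o + (u ⟨o + i - o, by omega⟩).val else o + i := rfl
  rw [this, dif_pos (by omega)]
  simp

theorem emb_out (u : Perm (Fin m)) {i : ℕ} (h : i < o ∨ o + m ≤ i) : emb o u i = i := by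
  have : emb o u i = if h : o ≤ i ∧ i < o + m then
    o + (u ⟨i - o, by omega⟩).val else i := rfl
  rw [this, dif_neg (by omega)]

theorem window_cases (o m i : ℕ) : (∃ j : Fin m, i = o + j) ∨ (i < o ∨ o + m ≤ i) := by
  by_cases h : o ≤ i ∧ i < o + m
  · exact Or.inl ⟨⟨i - o, by omega⟩, by simp; omega⟩
  · right; omega

theorem emb_mul (o : ℕ) (u v : Perm (Fin m)) : emb o (u * v) = emb o u * emb o v := by
  ext i
  rcases window_cases o m i with ⟨j, rfl⟩ | h
  · simp [emb_add]
  · simp [emb_out _ h]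

@[simp] theorem emb_one (o : ℕ) : emb o (1 : Perm (Fin m)) = 1 := by
  ext i
  rcases window_cases o m i with ⟨j, rfl⟩ | h
  · simp [emb_add]
  · simp [emb_out _ h]

theorem emb_inv (o : ℕ) (u : Perm (Fin m)) : emb o u⁻¹ = (emb o u)⁻¹ := by
  rw [eq_inv_iff_mul_eq_one, ← emb_mul, inv_mul_cancel, emb_one]

theorem emb_injective (o : ℕ) : Function.Injective (emb o : Perm (Fin m) → Perm ℕ) := by
  intro u v h
  ext i
  have := congrArg (fun w : Perm ℕ => w (o + i)) h
  simp only [emb_add] at this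
  omega

theorem emb_swap (o : ℕ) {a : ℕ} (h : a + 1 < m) :
    emb o (swap (⟨a, by omega⟩ : Fin m) ⟨a + 1, h⟩) = swap (o + a) (o + a + 1) := by
  ext i
  rcases window_cases o m i with ⟨j, rfl⟩ | h'
  · rw [emb_add]
    simp only [swap_apply_def, Fin.ext_iff]
    split_ifs <;> simp_all <;> omega
  · rw [emb_out _ h', swap_apply_of_ne_of_ne] <;> omega

theorem emb_lt_iff (o : ℕ) (u : Perm (Fin m)) (i j : Fin m) :
    emb o u (o + i) < emb o u (o + j) ↔ u i < u j := by
  rw [emb_add, emb_add, Fin.lt_def]; omega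

theorem emb_demazureStep (o : ℕ) (u : Perm (Fin m)) {a : ℕ} (h : a + 1 < m) :
    emb o (demazureStep u a) = rstep (emb o u) (o + a) := by
  have := emb_lt_iff o u ⟨a, by omega⟩ ⟨a + 1, h⟩
  simp only at this
  unfold demazureStep rstep
  rw [dif_pos h]
  simp only [add_assoc, this]
  split_ifs
  · rw [emb_mul, emb_swap, add_assoc]
  · rfl

theorem dem_map_add (o : ℕ) {W : List ℕ} (h : ∀ a ∈ W, a + 1 < m) :
    dem (W.map (o + ·)) = emb o (W.foldl demazureStep (1 : Perm (Fin m))) := by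
  induction W using List.reverseRecOn with
  | nil => simp
  | append_singleton W a ih =>
    rw [List.map_append, List.map_singleton, dem_snoc, List.foldl_append, ih
      (fun b hb => h b (by simp [hb])), List.foldl_cons, List.foldl_nil,
      emb_demazureStep _ _ (h a (by simp))]

theorem encard_inversions_emb (o : ℕ) (u : Perm (Fin m)) :
    (inversions (emb o u)).encard = permLength u := by
  have e : inversions (emb o u) = (fun p : Fin m × Fin m => (o + p.1.val, o + p.2.val)) ''
      ((Finset.univ.filter fun p : Fin m × Fin m => p.1 < p.2 ∧ u p.2 < u p.1 : Finset _) :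
        Set (Fin m × Fin m)) := by
    ext ⟨i, j⟩
    simp only [inversions, Set.mem_ofPred_eq, Finset.coe_filter, Finset.mem_univ, true_and,
      Set.mem_image, Prod.exists, Prod.mk.injEq]
    constructor
    · rintro ⟨h1, h2⟩
      rcases window_cases o m i with ⟨i, rfl⟩ | hi <;> rcases window_cases o m j with ⟨j, rfl⟩ | hj
      · exact ⟨i, j, ⟨by rw [Fin.lt_def]; omega, (emb_lt_iff o u j i).1 h2⟩, rfl, rfl⟩
      · rw [emb_out _ hj, emb_add] at h2
        omega
      · rw [emb_out _ hi, emb_add] at h2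
        omega
      · rw [emb_out _ hj, emb_out _ hi] at h2
        omega
    · rintro ⟨i, j, ⟨h1, h2⟩, rfl, rfl⟩
      exact ⟨by rw [Fin.lt_def] at h1; omega, (emb_lt_iff o u j i).2 h2⟩
  rw [e, Function.Injective.encard_image, Set.encard_coe_eq_coe_finsetCard, permLength]
  rintro ⟨i, j⟩ ⟨i', j'⟩ h
  simp only [Prod.mk.injEq] at h
  ext <;> simp <;> omega

theorem IsRed.length_emb {W : List ℕ} {u : Perm (Fin m)} (h : IsRed W (emb o u)) :
    W.length = permLength u := by
  have := h.encard.symm.trans (encard_inversions_emb o u)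
  exact_mod_cast this

theorem permLength_mul_swap {u : Perm (Fin m)} {s t : Fin m} (hst : t.val = s.val + 1)
    (h : u s < u t) : permLength (u * swap s t) = permLength u + 1 := by
  have h1 : swap s t = swap ⟨s.val, by omega⟩ ⟨s.val + 1, by omega⟩ := by
    congr 1; exact Fin.ext hst
  have h2 := (emb_lt_iff 0 u s t).2 h
  rw [hst, zero_add, zero_add] at h2
  have h3 := encard_inversions_mul_swap h2
  have h4 : emb 0 (u * swap s t) = emb 0 u * swap s.val (s.val + 1) := by
    rw [emb_mul, h1, emb_swap, zero_add]
  rw [← h4, encard_inversions_emb, encard_inversions_emb] at h3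
  exact_mod_cast h3

theorem permLength_inv (u : Perm (Fin m)) : permLength u⁻¹ = permLength u := by
  unfold permLength
  refine Finset.card_bij (fun p _ => (u⁻¹ p.2, u⁻¹ p.1)) ?_ ?_ ?_
  · rintro ⟨i, j⟩ h
    simp only [Finset.mem_filter, Finset.mem_univ, true_and] at h ⊢
    simpa using h.symm
  · rintro ⟨i, j⟩ _ ⟨i', j'⟩ _ h
    simp only [Prod.mk.injEq] at h
    rw [(u⁻¹).injective h.1, (u⁻¹).injective h.2]
  · rintro ⟨i, j⟩ h
    refine ⟨(u j, u i), ?_, by simp⟩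
    simp only [Finset.mem_filter, Finset.mem_univ, true_and] at h ⊢
    simpa using h.symm

/-- Strip off descents at adjacent positions until none is left; a permutation without descents is
the identity. The bound keeps all letters in the window of `emb o`. -/
theorem exists_word (o : ℕ) (u : Perm (Fin m)) :
    ∃ W, IsRed W (emb o u) ∧ ∀ a ∈ W, o ≤ a ∧ a + 1 < o + m := by
  induction h : permLength u using Nat.strong_induction_on generalizing u with
  | _ l ih =>
    by_cases hd : ∃ s t : Fin m, t.val = s.val + 1 ∧ u t < u s
    · obtain ⟨s, t, hst, hlt⟩ := hd
      have h1 : (u * swap s t) s < (u * swap s t) t := by simpa using hlt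
      have h2 := permLength_mul_swap hst h1
      rw [mul_assoc, swap_mul_self, mul_one] at h2
      obtain ⟨W, hW, hb⟩ := ih _ (by omega) (u * swap s t) rfl
      refine ⟨W ++ [o + s], ?_, ?_⟩
      · have h3 := (emb_lt_iff o _ s t).2 h1
        rw [hst, ← add_assoc] at h3
        have h4 := hW.snoc h3
        have h1 : swap s t = swap ⟨s.val, by omega⟩ ⟨s.val + 1, by omega⟩ := by
          congr 1; exact Fin.ext hst
        rw [← emb_swap o (m := m) (by omega), ← emb_mul, ← h1, mul_assoc, swap_mul_self,
          mul_one] at h4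
        exact h4
      · intro a ha
        rcases List.mem_append.1 ha with ha | ha
        · exact hb a ha
        · simp only [List.mem_singleton] at ha
          omega
    · push Not at hd
      have : u = 1 := by
        have hm : StrictMono u := by
          intro i j hij
          obtain ⟨k, hk⟩ : ∃ k, j.val = i.val + 1 + k := ⟨j.val - i.val - 1, by
            rw [Fin.lt_def] at hij; omega⟩
          induction k generalizing j with
          | zero =>
            exact lt_of_le_of_ne (hd i j hk) fun e => by rw [u.injective e] at hk; omega
          | succ k ihk =>
            have h1 := ihk (j := ⟨i.val + 1 + k, by omega⟩) (by rw [Fin.lt_def]; simp; omega) rfl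
            have h2 := hd ⟨i.val + 1 + k, by omega⟩ j (by simp; omega)
            exact lt_of_lt_of_le h1 h2
        ext i
        have h1 := hm.id_le i
        have hm' : StrictMono (u⁻¹ : Perm (Fin m)) := by
          intro i j hij
          by_contra hc
          have := hm.monotone (not_lt.1 hc)
          rw [perm_apply_inv, perm_apply_inv] at this
          omega
        have h2 := hm'.id_le (u i)
        simp only [id, perm_inv_apply] at h1 h2
        rw [le_antisymm h2 h1, Perm.one_apply]
      exact ⟨[], by rw [this, emb_one]; exact IsRed.nil, by simp⟩

/-- A reduced word of `emb o u`. -/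
noncomputable def redWord (o : ℕ) (u : Perm (Fin m)) : List ℕ := (exists_word o u).choose

theorem redWord_isRed (o : ℕ) (u : Perm (Fin m)) : IsRed (redWord o u) (emb o u) :=
  (exists_word o u).choose_spec.1

theorem redWord_mem {u : Perm (Fin m)} {a : ℕ} (h : a ∈ redWord o u) : o ≤ a ∧ a + 1 < o + m :=
  (exists_word o u).choose_spec.2 a h

/-- The permutation exchanging the adjacent windows `[o, o + m)` and `[o + m, o + m + l)`. -/
def rect (o m l : ℕ) : Perm ℕ where
  toFun i := if o ≤ i ∧ i < o + m then i + l else if o + m ≤ i ∧ i < o + m + l then i - m else i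
  invFun i := if o ≤ i ∧ i < o + l then i + m else if o + l ≤ i ∧ i < o + m + l then i - l else i
  left_inv i := by dsimp only; split_ifs <;> omega
  right_inv i := by dsimp only; split_ifs <;> omega

theorem rect_apply (o m l i : ℕ) : rect o m l i =
    if o ≤ i ∧ i < o + m then i + l else if o + m ≤ i ∧ i < o + m + l then i - m else i := rfl

theorem rect_inv_apply (o m l i : ℕ) : (rect o m l)⁻¹ i =
    if o ≤ i ∧ i < o + l then i + m else if o + l ≤ i ∧ i < o + m + l then i - l else i := rfl

/-- The word of a full `m × l` rectangle of crosses. -/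
def fullWord (o m l : ℕ) : List ℕ :=
  (List.range m).flatMap fun i => (List.range l).reverse.map fun j => o + i + j

theorem fullWord_mem {l a : ℕ} (h : a ∈ fullWord o m l) : o ≤ a ∧ a + 1 < o + m + l := by
  simp only [fullWord, List.mem_flatMap, List.mem_range, List.mem_map, List.mem_reverse] at h
  obtain ⟨i, hi, j, hj, rfl⟩ := h
  omega

theorem isRed_row (o l : ℕ) :
    IsRed ((List.range l).reverse.map fun j => o + j) (rect o 1 l) := by
  induction l with
  | zero =>
    have : rect o 1 0 = 1 := by
      ext i; simp only [rect_apply, Perm.one_apply]; split_ifs <;> omega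
    rw [this]; exact IsRed.nil
  | succ l ih =>
    rw [List.range_succ, List.reverse_append, List.reverse_singleton, List.singleton_append,
      List.map_cons]
    have : rect o 1 (l + 1) = swap (o + l) (o + l + 1) * rect o 1 l := by
      ext i
      simp only [rect_apply, Perm.mul_apply, swap_apply_def]
      split_ifs <;> omega
    rw [this]
    refine ih.cons_iff ?_
    simp only [rect_inv_apply]
    split_ifs <;> omega

theorem isRed_fullWord (o m l : ℕ) : IsRed (fullWord o m l) (rect o m l) := by
  induction m with
  | zero =>
    have : rect o 0 l = 1 := by
      ext i; simp only [rect_apply, Perm.one_apply]; split_ifs <;> omega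
    rw [this]; exact IsRed.nil
  | succ m ih =>
    have h1 : fullWord o (m + 1) l =
        fullWord o m l ++ (List.range l).reverse.map fun j => o + m + j := by
      simp [fullWord, List.range_succ]
    have h2 : rect o (m + 1) l = rect o m l * rect (o + m) 1 l := by
      ext i
      simp only [rect_apply, Perm.mul_apply]
      split_ifs <;> omega
    rw [h1, h2]
    refine ih.append (isRed_row (o + m) l) ?_
    intro p q hpq h
    simp only [rect_apply, rect_inv_apply] at h ⊢
    split_ifs at h ⊢ <;> omega

theorem dem_fullWord (o m l : ℕ) : dem (fullWord o m l) = rect o m l := (isRed_fullWord o m l).dem_eq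

/-- The block exchange carries the adjacent pair `a, a + 1` to an adjacent pair in the same order,
so a left step at the image is a right step at the source. This is how a generator travels through a
rectangle of crosses, its index changing by the width. -/
theorem sim_fullWord_fst {l a : ℕ} (h1 : o ≤ a) (h2 : a + 1 < o + m) :
    Sim ((a + l) :: fullWord o m l) (fullWord o m l ++ [a]) := by
  unfold Sim
  have e1 : rect o m l a = a + l := by rw [rect_apply, if_pos (by omega)]
  have e2 : rect o m l (a + 1) = a + l + 1 := by rw [rect_apply, if_pos (by omega)]; omega
  have e3 : (rect o m l)⁻¹ (a + l) = a := by rw [← e1, perm_inv_apply]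
  have e4 : (rect o m l)⁻¹ (a + l + 1) = a + 1 := by rw [← e2, perm_inv_apply]
  rw [dem_cons, dem_snoc, dem_fullWord, lstep_eq, rstep, e1, e2, e3, e4, if_pos (by omega),
    if_pos (by omega), mul_swap_eq_swap_mul, e1, e2]

/-- The same passage for the other window of the rectangle; here the index changes by the height. -/
theorem sim_fullWord_snd {l a : ℕ} (h1 : o ≤ a) (h2 : a + 1 < o + l) :
    Sim (a :: fullWord o m l) (fullWord o m l ++ [a + m]) := by
  unfold Sim
  have e1 : rect o m l (a + m) = a := by
    rw [rect_apply, if_neg (by omega), if_pos (by omega)]; omega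
  have e2 : rect o m l (a + m + 1) = a + 1 := by
    rw [rect_apply, if_neg (by omega), if_pos (by omega)]; omega
  have e3 : (rect o m l)⁻¹ a = a + m := by rw [Perm.inv_eq_iff_eq, e1]
  have e4 : (rect o m l)⁻¹ (a + 1) = a + m + 1 := by rw [Perm.inv_eq_iff_eq, e2]
  rw [dem_cons, dem_snoc, dem_fullWord, lstep_eq, rstep, e1, e2, e3, e4, if_pos (by omega),
    if_pos (by omega), mul_swap_eq_swap_mul, e1, e2]

/-! ### Words of pipe dreams -/

/-- The reading word of row `r` of `P`, in the columns `[c, c + l)`. -/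
def rowWord (P : Finset (ℕ × ℕ)) (r c l : ℕ) : List ℕ :=
  ((List.range l).reverse.filter fun j => (r, c + j) ∈ P).map fun j => r + c + j

/-- The reading word of the block of `P` with northwest corner `(r, c)` and size `k × l`. -/
def blockWord (P : Finset (ℕ × ℕ)) (r c k l : ℕ) : List ℕ :=
  (List.range k).flatMap fun i => rowWord P (r + i) c l

variable {P : Finset (ℕ × ℕ)} {r c k l : ℕ}

theorem mem_rowWord {a : ℕ} : a ∈ rowWord P r c l ↔ ∃ j < l, (r, c + j) ∈ P ∧ a = r + c + j := by
  simp only [rowWord, List.mem_map, List.mem_filter, List.mem_reverse, List.mem_range,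
    decide_eq_true_eq]
  grind

theorem mem_blockWord {a : ℕ} : a ∈ blockWord P r c k l ↔
    ∃ i < k, ∃ j < l, (r + i, c + j) ∈ P ∧ a = r + i + c + j := by
  simp only [blockWord, List.mem_flatMap, List.mem_range, mem_rowWord]

theorem pipeWord_eq : pipeWord k l P = blockWord P 0 0 k l := by
  simp only [pipeWord, blockWord, rowWord, zero_add, add_zero]

theorem pipeWord_lt {a : ℕ} (h : a ∈ pipeWord k l P) : a + 1 < k + l := by
  rw [pipeWord_eq, mem_blockWord] at h
  obtain ⟨i, hi, j, hj, -, rfl⟩ := h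
  omega

theorem dem_pipeWord (o : ℕ) : dem ((pipeWord k l P).map (o + ·)) = emb o (demazure k l P) :=
  dem_map_add o fun _ => pipeWord_lt

/-- The letter of a cell is the sum of its coordinates, so moving a block to the corner `(r, c)`
shifts all letters by `c + r`. -/
theorem pipeWord_miniPipe :
    (pipeWord k l (miniPipe P r c k l)).map (c + r + ·) = blockWord P r c k l := by
  rw [pipeWord, blockWord, List.map_flatMap]
  refine List.flatMap_congr fun i hi => ?_
  rw [List.mem_range] at hi
  rw [rowWord, List.map_map]
  have : (List.range l).reverse.filter (fun j => decide ((i, j) ∈ miniPipe P r c k l)) =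
      (List.range l).reverse.filter (fun j => decide ((r + i, c + j) ∈ P)) := by
    refine List.filter_congr fun j hj => ?_
    rw [List.mem_reverse, List.mem_range] at hj
    simp [miniPipe, hi, hj]
  rw [this]
  refine List.map_congr_left fun j _ => ?_
  simp only [Function.comp_apply]
  omega

theorem blockWord_full (h : ∀ i < k, ∀ j < l, (r + i, c + j) ∈ P) :
    blockWord P r c k l = fullWord (c + r) k l := by
  unfold blockWord fullWord
  refine List.flatMap_congr fun i hi => ?_
  rw [List.mem_range] at hi
  rw [rowWord, List.filter_eq_self.2]
  · refine List.map_congr_left fun j _ => ?_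
    omega
  · intro j hj
    rw [List.mem_reverse, List.mem_range] at hj
    simpa using h i hi j hj

theorem blockWord_add_rows (k₁ k₂ : ℕ) :
    blockWord P r c (k₁ + k₂) l = blockWord P r c k₁ l ++ blockWord P (r + k₁) c k₂ l := by
  simp only [blockWord, List.range_add, List.flatMap_append, List.flatMap_map, add_assoc]

theorem blockWord_succ_rows :
    blockWord P r c (k + 1) l = blockWord P r c k l ++ rowWord P (r + k) c l := by
  simp only [blockWord, List.range_succ, List.flatMap_append, List.flatMap_singleton]

theorem rowWord_add (l₁ l₂ : ℕ) :
    rowWord P r c (l₁ + l₂) = rowWord P r (c + l₁) l₂ ++ rowWord P r c l₁ := by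
  simp only [rowWord, List.range_add, List.reverse_append, List.filter_append, List.map_append,
    ← List.map_reverse, List.filter_map, List.map_map, add_assoc, Function.comp_def]

/-- A cell of the right part in a new row has a letter at least two larger than that of any cell of
the left part in an earlier row. The reading by rows may therefore be replaced by a reading by block
columns, the rightmost one first. -/
theorem sim_blockWord_add (l₁ l₂ : ℕ) :
    Sim (blockWord P r c k (l₁ + l₂)) (blockWord P r (c + l₁) k l₂ ++ blockWord P r c k l₁) := by
  induction k with
  | zero => exact Sim.refl _
  | succ k ih =>
    rw [blockWord_succ_rows, blockWord_succ_rows, blockWord_succ_rows, rowWord_add]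
    refine (ih.right _).trans ?_
    have h : Sim (blockWord P r c k l₁ ++ rowWord P (r + k) (c + l₁) l₂)
        (rowWord P (r + k) (c + l₁) l₂ ++ blockWord P r c k l₁) := by
      refine sim_append_far fun a ha b hb => ?_
      rw [mem_blockWord] at ha
      rw [mem_rowWord] at hb
      obtain ⟨i, hi, j, hj, -, rfl⟩ := ha
      obtain ⟨j', hj', -, rfl⟩ := hb
      left; omega
    simpa only [List.append_assoc] using
      (h.right (rowWord P (r + k) c l₁)).left (blockWord P r (c + l₁) k l₂)

/-! ### Rotation -/

theorem reverse_range_eq (k : ℕ) : (List.range k).reverse = (List.range k).map (k - 1 - ·) := by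
  apply List.ext_getElem
  · simp
  · intro i h1 h2
    simp

theorem pipeWord_rotPipe : pipeWord k l (rotPipe k l P) =
    ((pipeWord k l P).map (k + l - 2 - ·)).reverse := by
  unfold pipeWord
  rw [List.map_flatMap, List.reverse_flatMap, reverse_range_eq k, List.flatMap_map]
  refine List.flatMap_congr fun i hi => ?_
  rw [List.mem_range] at hi
  simp only [Function.comp_apply, ← List.map_reverse, List.map_map, ← List.filter_reverse,
    List.reverse_reverse]
  rw [reverse_range_eq l, List.filter_map, List.map_map]
  have : (List.range l).filter ((fun j => decide ((i, j) ∈ rotPipe k l P)) ∘ (l - 1 - ·)) =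
      (List.range l).filter (fun j => decide ((k - 1 - i, j) ∈ P)) := by
    refine List.filter_congr fun j hj => ?_
    rw [List.mem_range] at hj
    have h2 : l - 1 - (l - 1 - j) = j := by omega
    have h3 : l - 1 - j < l := by omega
    simp [rotPipe, hi, h2, h3]
  rw [this]
  refine List.map_congr_left fun j hj => ?_
  have hj : j < l := by simpa using (List.mem_filter.1 hj).1
  simp only [Function.comp_apply]
  omega

theorem rotPerm_demazureStep {m : ℕ} (u : Perm (Fin m)) {a : ℕ} (h : a + 1 < m) :
    demazureStep (rotPerm u) (m - 2 - a) = rotPerm (demazureStep u a) := by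
  have e1 : Fin.rev (⟨m - 2 - a, by omega⟩ : Fin m) = ⟨a + 1, h⟩ := by
    ext; simp only [Fin.val_rev]; omega
  have e2 : Fin.rev (⟨m - 2 - a + 1, by omega⟩ : Fin m) = ⟨a, by omega⟩ := by
    ext; simp only [Fin.val_rev]; omega
  unfold demazureStep
  rw [dif_pos h, dif_pos (by omega)]
  simp only [rotPerm, Perm.mul_apply, Fin.revPerm_apply, e1, e2, Fin.rev_lt_rev]
  split_ifs
  · rw [← e1, ← e2, ← Fin.revPerm_apply, ← Fin.revPerm_apply, mul_assoc, mul_assoc, mul_assoc,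
      mul_assoc, ← mul_swap_eq_swap_mul, swap_comm]
  · rfl

theorem rotPerm_foldl {m : ℕ} {W : List ℕ} (h : ∀ a ∈ W, a + 1 < m) :
    (W.map (m - 2 - ·)).foldl demazureStep (1 : Perm (Fin m)) =
      rotPerm (W.foldl demazureStep 1) := by
  induction W using List.reverseRecOn with
  | nil => ext i; simp [rotPerm]
  | append_singleton W a ih =>
    rw [List.map_append, List.map_singleton, List.foldl_append, ih (fun b hb => h b (by simp [hb])),
      List.foldl_append, List.foldl_cons, List.foldl_nil, List.foldl_cons, List.foldl_nil,
      rotPerm_demazureStep _ (h a (by simp))]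

theorem foldl_reverse {m : ℕ} {W : List ℕ} (h : ∀ a ∈ W, a + 1 < m) :
    W.reverse.foldl demazureStep (1 : Perm (Fin m)) = (W.foldl demazureStep 1)⁻¹ := by
  apply emb_injective 0
  rw [← dem_map_add 0 (by simpa using h), emb_inv, ← dem_map_add 0 h, ← dem_reverse,
    List.map_reverse]

/-- Rotation of the grid reverses the reading word and complements its letters. Reversal inverts the
product, and complementing conjugates it by the longest element. -/
theorem demazure_rotPipe : demazure k l (rotPipe k l P) = rotPerm (demazure k l P)⁻¹ := by
  unfold demazure
  rw [pipeWord_rotPipe, foldl_reverse, rotPerm_foldl fun _ => pipeWord_lt]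
  · simp only [rotPerm, mul_inv_rev, mul_assoc]; rfl
  · intro a ha
    rw [List.mem_map] at ha
    obtain ⟨b, hb, rfl⟩ := ha
    have := pipeWord_lt hb
    omega

/-! ### Forced crosses -/

/-- The number of positions before `p` with value at least `q`. -/
def cnt (u : Perm ℕ) (q p : ℕ) : ℕ := ((Finset.range p).filter fun i => q ≤ u i).card

theorem cnt_succ (u : Perm ℕ) (q p : ℕ) : cnt u q (p + 1) = cnt u q p + if q ≤ u p then 1 else 0 := by
  unfold cnt
  rw [Finset.range_add_one, Finset.filter_insert]
  split_ifs
  · rw [Finset.card_insert_of_notMem (by simp)]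
  · rfl

theorem cnt_mono (u : Perm ℕ) (q : ℕ) {p p' : ℕ} (h : p ≤ p') : cnt u q p ≤ cnt u q p' := by
  apply Finset.card_le_card
  apply Finset.filter_subset_filter
  simpa using h

/-- A generator permutes the first `p` positions among themselves unless it exchanges `p - 1` and
`p`. -/
theorem cnt_rstep (u : Perm ℕ) (q : ℕ) {a p : ℕ} (h : a + 1 ≠ p) :
    cnt (rstep u a) q p = cnt u q p := by
  unfold rstep
  split_ifs
  · rcases Nat.lt_or_gt_of_ne h with h | h
    · obtain ⟨d, rfl⟩ : ∃ d, p = a + 2 + d := ⟨p - (a + 2), by omega⟩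
      clear h
      induction d with
      | zero =>
        have e : cnt (u * swap a (a + 1)) q a = cnt u q a := by
          unfold cnt
          congr 1
          refine Finset.filter_congr fun i hi => ?_
          rw [Finset.mem_range] at hi
          rw [Perm.mul_apply, swap_apply_of_ne_of_ne (by omega) (by omega)]
        rw [add_zero, cnt_succ, cnt_succ, cnt_succ, cnt_succ, e]
        simp only [Perm.mul_apply, swap_apply_left, swap_apply_right]
        ring
      | succ d ih =>
        rw [← add_assoc, cnt_succ, cnt_succ, ih (by omega), Perm.mul_apply,
          swap_apply_of_ne_of_ne (by omega) (by omega)]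
    · unfold cnt
      congr 1
      refine Finset.filter_congr fun i hi => ?_
      rw [Finset.mem_range] at hi
      rw [Perm.mul_apply, swap_apply_of_ne_of_ne (by omega) (by omega)]
  · rfl

theorem cnt_foldl (u : Perm ℕ) (q : ℕ) {W : List ℕ} {p : ℕ} (h : ∀ a ∈ W, a + 1 ≠ p) :
    cnt (W.foldl rstep u) q p = cnt u q p := by
  induction W generalizing u with
  | nil => rfl
  | cons a W ih =>
    rw [List.foldl_cons, ih _ fun b hb => h b (by simp [hb]), cnt_rstep _ _ (h a (by simp))]

/-- In a strictly decreasing word the letters above `p` come first and do not affect the count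
before `p`. Once they and a possible letter `p` are done, the remaining letters do not affect the
count before `p + 1`. So one row of a pipe dream raises the count by at most one while the threshold
moves by one. -/
theorem cnt_foldl_succ_le (u : Perm ℕ) (q p : ℕ) {W : List ℕ} (h : W.Pairwise (· > ·)) :
    cnt (W.foldl rstep u) q (p + 1) ≤ cnt u q p + 1 := by
  have triv : ∀ u : Perm ℕ, cnt u q (p + 1) ≤ cnt u q p + 1 := by
    intro u; rw [cnt_succ]; split_ifs <;> omega
  induction W generalizing u with
  | nil => exact triv u
  | cons a W ih =>
    rw [List.pairwise_cons] at h
    rw [List.foldl_cons]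
    by_cases ha : p < a
    · rw [← cnt_rstep u q (a := a) (p := p) (by omega)]
      exact ih _ h.2
    · rw [cnt_foldl]
      · by_cases hap : a = p
        · rw [← cnt_rstep u q (a := a) (p := p) (by omega)]
          exact triv _
        · rw [cnt_rstep _ _ (by omega)]
          exact triv _
      · intro b hb
        have := h.1 b hb
        omega

theorem rowWord_pairwise : (rowWord P r c l).Pairwise (· > ·) := by
  unfold rowWord
  refine List.Pairwise.map (R := (· > ·)) _ (fun a b h => by omega) (List.Pairwise.filter _ ?_)
  rw [List.pairwise_reverse]
  exact List.pairwise_lt_range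

/-- A missing cross keeps a small value near the top: the first `r + 1` positions cannot all carry
values beyond `c`. Read contrapositively, this forces the crosses northwest of the snake. -/
theorem exists_le_of_notMem {D E : ℕ} (hr : r < D) (h : (r, c) ∉ P) :
    ∃ i ≤ r, dem (pipeWord D E P) i ≤ c := by
  rw [pipeWord_eq]
  -- Along the antidiagonal through `(r, c)`, each row lets at most one more large value in.
  have h1 : ∀ i, cnt (dem (blockWord P 0 0 i E)) (c + 1) (i + c + 1) ≤ i := by
    intro i
    induction i with
    | zero =>
      simp only [blockWord, List.range_zero, List.flatMap_nil, dem_nil, cnt, Perm.one_apply]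
      rw [Finset.filter_false_of_mem]
      · simp
      · intro i hi
        rw [Finset.mem_range] at hi
        omega
    | succ i ih =>
      rw [blockWord_succ_rows, dem, List.foldl_append]
      have := cnt_foldl_succ_le (dem (blockWord P 0 0 i E)) (c + 1) (i + c + 1)
        (rowWord_pairwise (P := P) (r := 0 + i) (c := 0) (l := E))
      rw [show i + 1 + c + 1 = i + c + 1 + 1 by ring]
      exact this.trans (by omega)
  -- Row `r` could raise the count before position `r + c + 1` only through the letter `r + c`,
  -- whose cell is missing. Later rows have letters above `r`, so they leave the first `r + 1`
  -- positions together.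
  have h2 : cnt (dem (blockWord P 0 0 (r + 1) E)) (c + 1) (r + 1) ≤ r := by
    refine (cnt_mono _ _ (show r + 1 ≤ r + c + 1 by omega)).trans ?_
    rw [blockWord_succ_rows, dem, List.foldl_append, cnt_foldl]
    · exact h1 r
    · intro a ha hac
      obtain ⟨j, -, hj, rfl⟩ := mem_rowWord.1 ha
      apply h
      convert hj using 2 <;> omega
  have h3 : cnt (dem (blockWord P 0 0 D E)) (c + 1) (r + 1) ≤ r := by
    obtain ⟨D', rfl⟩ : ∃ D', D = r + 1 + D' := ⟨D - (r + 1), by omega⟩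
    rw [blockWord_add_rows, dem, List.foldl_append, cnt_foldl]
    · exact h2
    · intro a ha
      obtain ⟨i, -, j, -, -, rfl⟩ := mem_blockWord.1 ha
      omega
  by_contra hc
  push Not at hc
  unfold cnt at h3
  rw [Finset.filter_true_of_mem] at h3
  · simp at h3
  · intro i hi
    rw [Finset.mem_range] at hi
    exact hc i (by omega)

/-- The dual statement, for the crosses southeast of the snake: a missing cross leaves too few large
values in the first `D + c` positions, so one of them must sit further down. -/
theorem exists_ge_of_notMem {D E : ℕ} (hr : r < D) (hc : c < E) (h : (r, c) ∉ P) :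
    ∃ i, D + c ≤ i ∧ i < D + E ∧ E + r ≤ dem (pipeWord D E P) i := by
  rw [pipeWord_eq]
  have h0 : ∀ p ≤ E + r, cnt 1 (E + r) p = 0 := by
    intro p hp
    unfold cnt
    rw [Finset.filter_false_of_mem]
    · simp
    · intro i hi
      rw [Finset.mem_range] at hi
      simp only [Perm.one_apply]
      omega
  have h1 : ∀ i, cnt (dem (blockWord P 0 0 (r + 1 + i) E)) (E + r) (r + 1 + i + c) ≤ i := by
    intro i
    induction i with
    | zero =>
      rw [add_zero, blockWord_succ_rows, dem, List.foldl_append, cnt_foldl]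
      · refine (cnt_mono _ _ (show r + 1 + c ≤ E + r by omega)).trans ?_
        rw [cnt_foldl, h0 _ le_rfl]
        intro a ha
        obtain ⟨i, hi, j, hj, -, rfl⟩ := mem_blockWord.1 ha
        omega
      · intro a ha hac
        obtain ⟨j, -, hj, rfl⟩ := mem_rowWord.1 ha
        apply h
        convert hj using 2 <;> omega
    | succ i ih =>
      rw [← add_assoc, blockWord_succ_rows, dem, List.foldl_append]
      have := cnt_foldl_succ_le (dem (blockWord P 0 0 (r + 1 + i) E)) (E + r) (r + 1 + i + c)
        (rowWord_pairwise (P := P) (r := 0 + (r + 1 + i)) (c := 0) (l := E))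
      rw [show r + 1 + i + 1 + c = r + 1 + i + c + 1 by ring]
      exact this.trans (by omega)
  have h2 := h1 (D - (r + 1))
  rw [show r + 1 + (D - (r + 1)) = D by omega] at h2
  set v := dem (blockWord P 0 0 D E)
  -- All letters stay below `D + E`, so the number of values at least `E + r` in the whole window is
  -- that of the identity.
  have h3 : cnt v (E + r) (D + E) = D - r := by
    have : v = (blockWord P 0 0 D E).foldl rstep 1 := rfl
    rw [this, cnt_foldl]
    · unfold cnt
      have : (Finset.range (D + E)).filter (fun i => E + r ≤ (1 : Perm ℕ) i) =
          Finset.Ico (E + r) (D + E) := by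
        ext i
        rw [Finset.mem_filter, Finset.mem_range, Finset.mem_Ico, Perm.one_apply]
        omega
      rw [this, Nat.card_Ico]
      omega
    · intro a ha
      obtain ⟨i, hi, j, hj, -, rfl⟩ := mem_blockWord.1 ha
      omega
  by_contra hcon
  push Not at hcon
  have h4 : cnt v (E + r) (D + E) ≤ cnt v (E + r) (D + c) := by
    apply Finset.card_le_card
    intro i
    simp only [Finset.mem_filter, Finset.mem_range]
    rintro ⟨h5, h6⟩
    refine ⟨?_, h6⟩
    by_contra h7
    have := hcon i (by omega) h5
    omega
  omega

/-! ### Existence of pipe dreams -/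

theorem perm_eq_one_of_strictMonoOn {u : Perm ℕ} {a : ℕ} (h : ∀ i < a, u i = i)
    (hm : ∀ i j, a ≤ i → i < j → u i < u j) : u = 1 := by
  have hs : StrictMono u := by
    intro i j hij
    by_cases hi : a ≤ i
    · exact hm i j hi hij
    · rw [h i (by omega)]
      by_cases hj : a ≤ j
      · by_contra hc
        have h1 : u j ≤ i := not_lt.1 hc
        have h2 := h (u j) (by omega)
        have := u.injective h2
        omega
      · rw [h j (by omega)]; exact hij
  have hs' : StrictMono (u⁻¹ : Perm ℕ) := by
    intro i j hij
    by_contra hc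
    have := hs.monotone (not_lt.1 hc)
    rw [perm_apply_inv, perm_apply_inv] at this
    omega
  ext i
  have h1 := hs.id_le i
  have h2 := hs'.id_le (u i)
  simp only [id, perm_inv_apply] at h1 h2
  rw [le_antisymm h2 h1, Perm.one_apply]

/-- This is the Lehmer code. Once the positions before `r` are fixed, a descending row of `u r - r`
generators brings the value `u r` to its place and can be split off; the remaining factor fixes one
more position and inherits the bounds. -/
theorem exists_code {a b : ℕ} (n : ℕ) {r : ℕ} (hr : r + n = a) {u : Perm ℕ}
    (hfix : ∀ i < r, u i = i) (hm : ∀ i j, a ≤ i → i < j → u i < u j)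
    (hb : ∀ i < a, u i ≤ i + b) :
    ∃ code : ℕ → ℕ, (∀ i, code i ≤ b) ∧
      IsRed ((List.range' r n).flatMap fun i => (List.range (code i)).reverse.map (i + ·)) u := by
  induction n generalizing r u with
  | zero =>
    rw [perm_eq_one_of_strictMonoOn (a := a) (fun i hi => hfix i (by omega)) hm]
    exact ⟨0, by simp, IsRed.nil⟩
  | succ n ih =>
    have hur : r ≤ u r := by
      by_contra hc
      have := u.injective (hfix (u r) (by omega))
      omega
    have hinv := rect_inv_apply r 1 (u r - r)
    set x := rect r 1 (u r - r)
    -- Here `x` is the cycle moving the value `r` up to `u r`; dividing by it makes the next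
    -- permutation fix `r` as well.
    have hne : ∀ i, i ≠ r → u i ≠ u r := fun i hi => perm_ne hi
    have hge : ∀ i, r ≤ i → r ≤ u i := by
      intro i hi
      by_contra hc
      have := u.injective (hfix (u i) (by omega))
      omega
    have hfix' : ∀ i < r + 1, (x⁻¹ * u) i = i := by
      intro i hi
      rw [Perm.mul_apply, hinv]
      by_cases hir : i = r
      · subst hir; split_ifs <;> omega
      · rw [hfix i (by omega)]; split_ifs <;> omega
    obtain ⟨code, hc, hred⟩ := ih (r := r + 1) (by omega) (u := x⁻¹ * u) hfix'
      (by
        intro i j hi hij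
        have h1 := hm i j hi hij
        have h2 := hne i (by omega)
        have h3 := hne j (by omega)
        rw [Perm.mul_apply, Perm.mul_apply, hinv, hinv]
        split_ifs <;> omega)
      (by
        intro i hi
        have h1 := hb i hi
        have h2 := hb r (by omega)
        by_cases hir : i < r + 1
        · rw [hfix' i hir]; omega
        · have h3 := hne i (by omega)
          rw [Perm.mul_apply, hinv]
          split_ifs <;> omega)
    have h1 := hb r (by omega)
    refine ⟨fun i => if i = r then u r - r else code i, fun i => ?_, ?_⟩
    · dsimp only; split_ifs
      · omega
      · exact hc i
    · rw [List.range'_succ, List.flatMap_cons]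
      simp only [if_true]
      have e : ((List.range' (r + 1) n).flatMap fun i =>
          (List.range (if i = r then u r - r else code i)).reverse.map (i + ·)) =
          (List.range' (r + 1) n).flatMap fun i => (List.range (code i)).reverse.map (i + ·) := by
        refine List.flatMap_congr fun i hi => ?_
        rw [List.mem_range'_1] at hi
        rw [if_neg (by omega)]
      rw [e]
      have h2 := (isRed_row r (u r - r)).append hred (by
        intro p q hpq hx
        have hxx := rect_apply r 1 (u r - r)
        have hpr : p = r := by
          change x q < x p at hx
          rw [hxx, hxx] at hx
          split_ifs at hx <;> omega
        subst hpr
        have h3 : (x⁻¹ * u)⁻¹ p = p := by rw [Perm.inv_eq_iff_eq, hfix' p (by omega)]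
        rw [h3]
        by_contra hc
        have h4 := hfix' ((x⁻¹ * u)⁻¹ q) (by omega)
        rw [perm_apply_inv] at h4
        omega)
      have h3 : rect r 1 (u r - r) * (x⁻¹ * u) = u := by
        change x * (x⁻¹ * u) = u
        group
      rwa [h3] at h2

/-- Monotonicity beyond position `a` leaves only `a` nontrivial rows, and the bound on the values
makes the code fit into `b` columns. -/
theorem exists_pipe {a b : ℕ} (u : Perm (Fin (a + b)))
    (hm : ∀ i j : Fin (a + b), a ≤ i.val → i < j → u i < u j)
    (hb : ∀ i : Fin (a + b), i.val < a → (u i).val ≤ i.val + b) :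
    ∃ P ⊆ Finset.range a ×ˢ Finset.range b, demazure a b P = u := by
  obtain ⟨code, hc, hred⟩ := exists_code (a := a) (b := b) a (r := 0) (by omega) (u := emb 0 u)
    (by intro i hi; omega)
    (by
      intro i j hi hij
      rcases window_cases 0 (a + b) i with ⟨i, rfl⟩ | hi' <;>
        rcases window_cases 0 (a + b) j with ⟨j, rfl⟩ | hj'
      · rw [emb_lt_iff]; exact hm i j (by omega) (by rw [Fin.lt_def]; omega)
      · rw [emb_out _ hj', emb_add]; omega
      · omega
      · rw [emb_out _ hi', emb_out _ hj']; exact hij)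
    (by
      intro i hi
      have := hb ⟨i, by omega⟩ hi
      have h2 := emb_add 0 u ⟨i, by omega⟩
      simp only [zero_add] at h2
      rw [h2]
      exact this)
  -- The left-justified pipe dream: row `i` begins with `code i` crosses and has no others.
  refine ⟨(Finset.range a ×ˢ Finset.range b).filter fun p => p.2 < code p.1,
    Finset.filter_subset _ _, ?_⟩
  apply emb_injective 0
  rw [← dem_pipeWord, ← hred.dem_eq]
  congr 1
  rw [show (fun x => 0 + x) = id by ext; simp, List.map_id, pipeWord, ← List.range_eq_range']
  refine List.flatMap_congr fun i hi => ?_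
  rw [List.mem_range] at hi
  congr 1
  have h1 := hc i
  obtain ⟨d, rfl⟩ : ∃ d, b = code i + d := ⟨b - code i, by omega⟩
  rw [List.range_add, List.reverse_append, List.filter_append, List.filter_eq_nil_iff.2,
    List.filter_eq_self.2, List.nil_append]
  · intro j hj
    rw [List.mem_reverse, List.mem_range] at hj
    simp [hi]; omega
  · intro j hj
    simp only [List.mem_reverse, List.mem_map, List.mem_range] at hj
    obtain ⟨j, -, rfl⟩ := hj
    simp

/-! ### Words assembled from the blocks of the snake region -/

/-- The dimensions at the vertices of the quiver. -/
structure Frame where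
  n : ℕ
  ey : ℕ → ℕ
  ex : ℕ → ℕ

namespace Frame

variable (F : Frame)

/-- The offset of block row `y_i`. -/
def Y (i : ℕ) : ℕ := ∑ j ∈ Finset.range i, F.ey j

/-- The sum of the dimensions at the vertices `x`, from the `k`-th on. -/
def X (k : ℕ) : ℕ := ∑ j ∈ Finset.Ico k F.n, F.ex j

/-- The total dimension at the vertices `y`. -/
def D : ℕ := F.Y (F.n + 1)

/-- The first letter of block `α_k`. -/
def oA (k : ℕ) : ℕ := F.X (k + 1) + F.Y k

/-- The first letter of block `β_k`. -/
def oB (k : ℕ) : ℕ := F.X (k + 1) + F.Y (k + 1)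

theorem Y_succ (i : ℕ) : F.Y (i + 1) = F.Y i + F.ey i := Finset.sum_range_succ _ _

theorem Y_zero : F.Y 0 = 0 := rfl

theorem Y_mono {i j : ℕ} (h : i ≤ j) : F.Y i ≤ F.Y j :=
  Finset.sum_le_sum_of_subset (by simpa using h)

theorem X_succ {k : ℕ} (h : k < F.n) : F.X k = F.X (k + 1) + F.ex k := by
  unfold X
  rw [Finset.sum_eq_sum_Ico_succ_bot h, add_comm]

theorem X_last : F.X F.n = 0 := by simp [X]

theorem X_anti {i j : ℕ} (h : i ≤ j) : F.X j ≤ F.X i :=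
  Finset.sum_le_sum_of_subset (Finset.Ico_subset_Ico_left h)

theorem Y_le_D {i : ℕ} (h : i ≤ F.n + 1) : F.Y i ≤ F.D := F.Y_mono h

/-- The word of the blocks in block column `x_k`, for given words of `α_k` and `β_k`. -/
def colWord (wA wB : ℕ → List ℕ) (k : ℕ) : List ℕ :=
  fullWord (F.X (k + 1)) (F.Y k) (F.ex k) ++ (wA k ++ (wB k ++
    fullWord (F.X (k + 1) + F.Y (k + 2)) (F.D - F.Y (k + 2)) (F.ex k)))

/-- The word of the block columns before `k`. -/
def preWord (wA wB : ℕ → List ℕ) (k : ℕ) : List ℕ := (List.range k).flatMap (F.colWord wA wB)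

/-- The word of the block columns from `k` on. -/
def sufWord (wA wB : ℕ → List ℕ) (k : ℕ) : List ℕ :=
  (List.range' k (F.n - k)).flatMap (F.colWord wA wB)

/-- The word of the whole grid. -/
def totWord (wA wB : ℕ → List ℕ) : List ℕ := F.preWord wA wB F.n

/-- The letters of the words of the blocks lie in the range allowed. -/
def Bounded (wA wB : ℕ → List ℕ) : Prop := ∀ k < F.n,
  (∀ a ∈ wA k, F.oA k ≤ a ∧ a + 1 < F.oA k + F.ey k + F.ex k) ∧
  (∀ a ∈ wB k, F.oB k ≤ a ∧ a + 1 < F.oB k + F.ey (k + 1) + F.ex k)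

variable {F} {wA wB : ℕ → List ℕ}

theorem preWord_succ (k : ℕ) :
    F.preWord wA wB (k + 1) = F.preWord wA wB k ++ F.colWord wA wB k := by
  simp [preWord, List.range_succ]

theorem sufWord_eq {k : ℕ} (h : k < F.n) :
    F.sufWord wA wB k = F.colWord wA wB k ++ F.sufWord wA wB (k + 1) := by
  unfold sufWord
  rw [show F.n - k = F.n - (k + 1) + 1 by omega, List.range'_succ, List.flatMap_cons]

theorem totWord_eq_sufWord : F.totWord wA wB = F.sufWord wA wB 0 := by
  rw [totWord, preWord, sufWord, Nat.sub_zero, List.range_eq_range']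

theorem totWord_eq {k : ℕ} (h : k ≤ F.n) :
    F.totWord wA wB = F.preWord wA wB k ++ F.sufWord wA wB k := by
  rw [totWord, preWord, preWord, sufWord, ← List.flatMap_append, List.range_eq_range',
    List.range_eq_range']
  congr 1
  have := List.range'_append_1 (s := 0) (m := k) (n := F.n - k)
  rw [Nat.zero_add] at this
  rw [this]
  congr 1; omega

theorem colWord_congr {wA' wB' : ℕ → List ℕ} {k : ℕ} (h1 : wA k = wA' k) (h2 : wB k = wB' k) :
    F.colWord wA wB k = F.colWord wA' wB' k := by
  unfold colWord; rw [h1, h2]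

theorem preWord_congr {wA' wB' : ℕ → List ℕ} {k : ℕ}
    (h : ∀ j < k, wA j = wA' j ∧ wB j = wB' j) : F.preWord wA wB k = F.preWord wA' wB' k := by
  refine List.flatMap_congr fun j hj => ?_
  rw [List.mem_range] at hj
  exact colWord_congr (h j hj).1 (h j hj).2

theorem sufWord_congr {wA' wB' : ℕ → List ℕ} {k : ℕ}
    (h : ∀ j, k ≤ j → wA j = wA' j ∧ wB j = wB' j) :
    F.sufWord wA wB k = F.sufWord wA' wB' k := by
  refine List.flatMap_congr fun j hj => ?_
  rw [List.mem_range'_1] at hj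
  exact colWord_congr (h j hj.1).1 (h j hj.1).2

theorem sim_colWord {wA' wB' : ℕ → List ℕ} {k : ℕ} (h1 : Sim (wA k) (wA' k))
    (h2 : Sim (wB k) (wB' k)) : Sim (F.colWord wA wB k) (F.colWord wA' wB' k) :=
  Sim.left _ (h1.append (h2.right _))

theorem sim_preWord {wA' wB' : ℕ → List ℕ} {k : ℕ}
    (h : ∀ j < k, Sim (wA j) (wA' j) ∧ Sim (wB j) (wB' j)) :
    Sim (F.preWord wA wB k) (F.preWord wA' wB' k) := by
  induction k with
  | zero => exact Sim.refl _
  | succ k ih =>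
    rw [preWord_succ, preWord_succ]
    exact (ih fun j hj => h j (by omega)).append
      (sim_colWord (h k (by omega)).1 (h k (by omega)).2)

theorem totWord_update {k : ℕ} (h : k < F.n) (U V : List ℕ) :
    F.totWord (Function.update wA k U) (Function.update wB k V) =
      F.preWord wA wB k ++ (fullWord (F.X (k + 1)) (F.Y k) (F.ex k) ++ (U ++ (V ++
        (fullWord (F.X (k + 1) + F.Y (k + 2)) (F.D - F.Y (k + 2)) (F.ex k) ++
          F.sufWord wA wB (k + 1))))) := by
  rw [totWord_eq h.le, sufWord_eq h, colWord, Function.update_self, Function.update_self,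
    preWord_congr (wA' := wA) (wB' := wB), sufWord_congr (wA' := wA) (wB' := wB)]
  · simp only [List.append_assoc]
  · intro j hj
    rw [Function.update_of_ne (by omega), Function.update_of_ne (by omega)]
    exact ⟨rfl, rfl⟩
  · intro j hj
    rw [Function.update_of_ne (by omega), Function.update_of_ne (by omega)]
    exact ⟨rfl, rfl⟩

theorem totWord_update_left {k : ℕ} (h : k < F.n) (U : List ℕ) :
    F.totWord (Function.update wA k U) wB =
      F.preWord wA wB k ++ (fullWord (F.X (k + 1)) (F.Y k) (F.ex k) ++ (U ++ (wB k ++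
        (fullWord (F.X (k + 1) + F.Y (k + 2)) (F.D - F.Y (k + 2)) (F.ex k) ++
          F.sufWord wA wB (k + 1))))) := by
  rw [← totWord_update h, Function.update_eq_self]

theorem totWord_update_right {k : ℕ} (h : k < F.n) (V : List ℕ) :
    F.totWord wA (Function.update wB k V) =
      F.preWord wA wB k ++ (fullWord (F.X (k + 1)) (F.Y k) (F.ex k) ++ (wA k ++ (V ++
        (fullWord (F.X (k + 1) + F.Y (k + 2)) (F.D - F.Y (k + 2)) (F.ex k) ++
          F.sufWord wA wB (k + 1))))) := by
  rw [← totWord_update h, Function.update_eq_self]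

theorem totWord_split {k : ℕ} (h : k < F.n) :
    F.totWord wA wB =
      F.preWord wA wB k ++ (fullWord (F.X (k + 1)) (F.Y k) (F.ex k) ++ (wA k ++ (wB k ++
        (fullWord (F.X (k + 1) + F.Y (k + 2)) (F.D - F.Y (k + 2)) (F.ex k) ++
          F.sufWord wA wB (k + 1))))) := by
  rw [← totWord_update h, Function.update_eq_self, Function.update_eq_self]

/-! ### Sliding generators through the word -/

theorem colWord_mem (hb : F.Bounded wA wB) {k a : ℕ} (hk : k < F.n) (ha : a ∈ F.colWord wA wB k) :
    F.X (k + 1) ≤ a ∧ a + 1 < F.X k + F.D := by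
  have h1 := F.X_succ hk
  have h2 := F.Y_succ k
  have h3 := F.Y_succ (k + 1)
  have h4 := F.Y_le_D (show k + 2 ≤ F.n + 1 by omega)
  have hoA : F.oA k = F.X (k + 1) + F.Y k := rfl
  have hoB : F.oB k = F.X (k + 1) + F.Y (k + 1) := rfl
  rw [show k + 1 + 1 = k + 2 by rfl] at h3
  simp only [colWord, List.mem_append] at ha
  rcases ha with ha | ha | ha | ha
  · have := fullWord_mem ha; omega
  · have := (hb k hk).1 a ha; omega
  · have := (hb k hk).2 a ha; omega
  · have := fullWord_mem ha; omega

theorem preWord_mem (hb : F.Bounded wA wB) {k a : ℕ} (hk : k ≤ F.n) (ha : a ∈ F.preWord wA wB k) :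
    F.X k ≤ a ∧ a + 1 < F.X 0 + F.D := by
  simp only [preWord, List.mem_flatMap, List.mem_range] at ha
  obtain ⟨j, hj, ha⟩ := ha
  have h1 := colWord_mem hb (by omega) ha
  have h2 := F.X_anti (show j + 1 ≤ k by omega)
  have h3 := F.X_anti (show 0 ≤ j by omega)
  omega

theorem sufWord_mem (hb : F.Bounded wA wB) {k a : ℕ} (ha : a ∈ F.sufWord wA wB k) : a + 1 < F.X k + F.D := by
  simp only [sufWord, List.mem_flatMap, List.mem_range'_1] at ha
  obtain ⟨j, hj, ha⟩ := ha
  have h1 := colWord_mem hb (by omega) ha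
  have h3 := F.X_anti (show k ≤ j by omega)
  omega

/-- The letters `oB k + ey (k + 1) + i` sit at the virtual inputs of β_k, which are fed by block row
`x_k`. Such a letter passes the southeast rectangle of its block column and then exceeds all later
letters. -/
theorem slide_ins (hb : F.Bounded wA wB) {k i : ℕ} (hk : k < F.n) (hi : i + 1 < F.ex k) :
    Sim ((F.oB k + F.ey (k + 1) + i) ::
        (fullWord (F.X (k + 1) + F.Y (k + 2)) (F.D - F.Y (k + 2)) (F.ex k) ++
          F.sufWord wA wB (k + 1)))
      ((fullWord (F.X (k + 1) + F.Y (k + 2)) (F.D - F.Y (k + 2)) (F.ex k) ++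
          F.sufWord wA wB (k + 1)) ++ [F.D + F.X (k + 1) + i]) := by
  have h3 := F.Y_succ (k + 1)
  rw [show k + 1 + 1 = k + 2 by rfl] at h3
  have h4 := F.Y_le_D (show k + 2 ≤ F.n + 1 by omega)
  have hoB : F.oB k = F.X (k + 1) + F.Y (k + 1) := rfl
  have e1 := sim_fullWord_snd (o := F.X (k + 1) + F.Y (k + 2)) (m := F.D - F.Y (k + 2))
    (l := F.ex k) (a := F.oB k + F.ey (k + 1) + i) (by omega) (by omega)
  rw [show F.oB k + F.ey (k + 1) + i + (F.D - F.Y (k + 2)) = F.D + F.X (k + 1) + i by omega] at e1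
  have e2 : Sim ((F.D + F.X (k + 1) + i) :: F.sufWord wA wB (k + 1))
      (F.sufWord wA wB (k + 1) ++ [F.D + F.X (k + 1) + i]) := by
    refine sim_cons_far fun b h => ?_
    have := sufWord_mem hb h
    right; omega
  refine (e1.right _).trans ?_
  simpa using e2.left (fullWord (F.X (k + 1) + F.Y (k + 2)) (F.D - F.Y (k + 2)) (F.ex k))

/-- A letter at wires of block row `y_k` that have not yet reached α_k. In each later block column
it passes the northwest rectangle, losing the width, and commutes with the other blocks, whose
letters are larger. -/
theorem slide_pending (hb : F.Bounded wA wB) {k j i : ℕ} (hkj : k < j) (hj : j ≤ F.n) (hi : i + 1 < F.ey k) :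
    Sim ((F.X j + F.Y k + i) :: F.sufWord wA wB j) (F.sufWord wA wB j ++ [F.Y k + i]) := by
  obtain ⟨d, hd⟩ : ∃ d, F.n = j + d := ⟨F.n - j, by omega⟩
  induction d generalizing j with
  | zero =>
    obtain rfl : j = F.n := by omega
    have : F.sufWord wA wB F.n = [] := by simp [sufWord]
    rw [this, F.X_last, zero_add]
    exact Sim.refl _
  | succ d ih =>
    have ih := ih (j := j + 1) (by omega) (by omega) (by omega)
    have h1 := F.X_succ (show j < F.n by omega)
    have h2 := F.Y_mono (show k + 1 ≤ j by omega)
    have h3 := F.Y_succ k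
    have h4 := F.Y_mono (show j ≤ j + 1 by omega)
    have h5 := F.Y_mono (show j ≤ j + 2 by omega)
    have e1 := sim_fullWord_fst (o := F.X (j + 1)) (m := F.Y j) (l := F.ex j)
      (a := F.X (j + 1) + F.Y k + i) (by omega) (by omega)
    rw [show F.X (j + 1) + F.Y k + i + F.ex j = F.X j + F.Y k + i by omega] at e1
    have e2 : Sim ((F.X (j + 1) + F.Y k + i) :: (wA j ++ (wB j ++
        fullWord (F.X (j + 1) + F.Y (j + 2)) (F.D - F.Y (j + 2)) (F.ex j))))
        ((wA j ++ (wB j ++ fullWord (F.X (j + 1) + F.Y (j + 2)) (F.D - F.Y (j + 2)) (F.ex j))) ++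
          [F.X (j + 1) + F.Y k + i]) := by
      refine sim_cons_far fun b h => ?_
      left
      have hoA : F.oA j = F.X (j + 1) + F.Y j := rfl
      have hoB : F.oB j = F.X (j + 1) + F.Y (j + 1) := rfl
      simp only [List.mem_append] at h
      rcases h with h | h | h
      · have := (hb j (by omega)).1 b h; omega
      · have := (hb j (by omega)).2 b h; omega
      · have := fullWord_mem h; omega
    have e3 : Sim ((F.X j + F.Y k + i) :: F.colWord wA wB j)
        (F.colWord wA wB j ++ [F.X (j + 1) + F.Y k + i]) := by
      refine (e1.right _).trans ?_
      simpa [colWord] using e2.left (fullWord (F.X (j + 1)) (F.Y j) (F.ex j))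
    rw [sufWord_eq (show j < F.n by omega)]
    refine (e3.right _).trans ?_
    simpa using ih.left (F.colWord wA wB j)

/-- The letters `oA k + i` sit where wires leave α_k for block column `x_k`. They pass the northwest
rectangle above α_k and are then smaller than all letters of the earlier block columns. -/
theorem slide_outs (hb : F.Bounded wA wB) {k i : ℕ} (hk : k < F.n) (hi : i + 1 < F.ex k) :
    Sim (F.preWord wA wB k ++ (fullWord (F.X (k + 1)) (F.Y k) (F.ex k) ++ [F.oA k + i]))
      ((F.X (k + 1) + i) :: (F.preWord wA wB k ++ fullWord (F.X (k + 1)) (F.Y k) (F.ex k))) := by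
  have h1 := F.X_succ hk
  have e1 := sim_fullWord_snd (o := F.X (k + 1)) (m := F.Y k) (l := F.ex k)
    (a := F.X (k + 1) + i) (by omega) (by omega)
  rw [show F.X (k + 1) + i + F.Y k = F.oA k + i by unfold oA; omega] at e1
  have e2 : Sim ((F.X (k + 1) + i) :: F.preWord wA wB k)
      (F.preWord wA wB k ++ [F.X (k + 1) + i]) := by
    refine sim_cons_far fun b h => ?_
    have := preWord_mem hb hk.le h
    left; omega
  refine (e1.symm.left _).trans ?_
  simpa using e2.symm.right (fullWord (F.X (k + 1)) (F.Y k) (F.ex k))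

/-- A letter at wires which have left the snake for block column `y_k`. It passes the southeast
rectangles of the earlier block columns, gaining their widths. -/
theorem slide_done (hb : F.Bounded wA wB) {k j i : ℕ} (hkj : j < k) (hk : k ≤ F.n) (hi : i + 1 < F.ey k) :
    Sim (F.preWord wA wB j ++ [F.X j + F.Y k + i]) ((F.X 0 + F.Y k + i) :: F.preWord wA wB j) := by
  induction j with
  | zero => exact Sim.refl _
  | succ j ih =>
    have ih := ih (by omega)
    have h1 := F.X_succ (show j < F.n by omega)
    have h2 := F.Y_mono (show j + 2 ≤ k by omega)
    have h3 := F.Y_succ k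
    have h4 := F.Y_mono (show j ≤ j + 1 by omega)
    have h5 := F.Y_le_D (show k + 1 ≤ F.n + 1 by omega)
    have h6 := F.Y_succ j
    have h7 := F.Y_succ (j + 1)
    rw [show j + 1 + 1 = j + 2 by rfl] at h7
    have e1 := sim_fullWord_fst (o := F.X (j + 1) + F.Y (j + 2)) (m := F.D - F.Y (j + 2))
      (l := F.ex j) (a := F.X (j + 1) + F.Y k + i) (by omega) (by omega)
    rw [show F.X (j + 1) + F.Y k + i + F.ex j = F.X j + F.Y k + i by omega] at e1
    have e2 : Sim ((F.X j + F.Y k + i) ::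
        (fullWord (F.X (j + 1)) (F.Y j) (F.ex j) ++ (wA j ++ wB j)))
        ((fullWord (F.X (j + 1)) (F.Y j) (F.ex j) ++ (wA j ++ wB j)) ++
          [F.X j + F.Y k + i]) := by
      refine sim_cons_far fun b h => ?_
      right
      have hoA : F.oA j = F.X (j + 1) + F.Y j := rfl
      have hoB : F.oB j = F.X (j + 1) + F.Y (j + 1) := rfl
      simp only [List.mem_append] at h
      rcases h with h | h | h
      · have := fullWord_mem h; omega
      · have := (hb j (by omega)).1 b h; omega
      · have := (hb j (by omega)).2 b h; omega
    have e3 : Sim (F.colWord wA wB j ++ [F.X (j + 1) + F.Y k + i])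
        ((F.X j + F.Y k + i) :: F.colWord wA wB j) := by
      have e4 := e2.symm.right (fullWord (F.X (j + 1) + F.Y (j + 2)) (F.D - F.Y (j + 2)) (F.ex j))
      rw [List.append_assoc, List.singleton_append] at e4
      have e5 := (e1.symm.left (fullWord (F.X (j + 1)) (F.Y j) (F.ex j) ++ (wA j ++ wB j))).trans e4
      simpa [colWord] using e5
    rw [preWord_succ, List.append_assoc]
    refine (e3.left _).trans ?_
    simpa using ih.right (F.colWord wA wB j)

theorem dem_update_ins (hb : F.Bounded wA wB) {k i : ℕ} (hk : k < F.n) (hi : i + 1 < F.ex k) :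
    dem (F.totWord wA (Function.update wB k (wB k ++ [F.oB k + F.ey (k + 1) + i]))) =
      rstep (dem (F.totWord wA wB)) (F.D + F.X (k + 1) + i) := by
  rw [← dem_snoc, totWord_update_right hk, totWord_split hk]
  have := (slide_ins hb hk hi).left
    (F.preWord wA wB k ++ (fullWord (F.X (k + 1)) (F.Y k) (F.ex k) ++ (wA k ++ wB k)))
  simpa [Sim] using this

theorem dem_update_pending (hb : F.Bounded wA wB) {k i : ℕ} (hk : k < F.n) (hi : i + 1 < F.ey k) :
    dem (F.totWord (Function.update wA k (wA k ++ [F.oA k + i])) wB) =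
      rstep (dem (F.totWord wA wB)) (F.Y k + i) := by
  rw [← dem_snoc, totWord_update_left hk, totWord_split hk]
  have e1 := slide_pending hb (show k < k + 1 by omega) (by omega) hi
  have e2 : Sim ((F.oA k + i) :: (wB k ++
      fullWord (F.X (k + 1) + F.Y (k + 2)) (F.D - F.Y (k + 2)) (F.ex k)))
      ((wB k ++ fullWord (F.X (k + 1) + F.Y (k + 2)) (F.D - F.Y (k + 2)) (F.ex k)) ++
        [F.oA k + i]) := by
    refine sim_cons_far fun b h => ?_
    left
    have h6 := F.Y_succ k
    have h7 := F.Y_succ (k + 1)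
    rw [show k + 1 + 1 = k + 2 by rfl] at h7
    have hoA : F.oA k = F.X (k + 1) + F.Y k := rfl
    have hoB : F.oB k = F.X (k + 1) + F.Y (k + 1) := rfl
    simp only [List.mem_append] at h
    rcases h with h | h
    · have := (hb k hk).2 b h; omega
    · have := fullWord_mem h; omega
  have e3 := (e2.right (F.sufWord wA wB (k + 1))).trans (by
    simpa [oA] using e1.left
      (wB k ++ fullWord (F.X (k + 1) + F.Y (k + 2)) (F.D - F.Y (k + 2)) (F.ex k)))
  have := e3.left
    (F.preWord wA wB k ++ (fullWord (F.X (k + 1)) (F.Y k) (F.ex k) ++ wA k))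
  simpa [Sim] using this

/-- In the leftmost block column the southeast rectangle is empty and no block column follows, so a
letter behind β_k is already the last letter of the word. -/
theorem dem_update_first {k i : ℕ} (hk : F.n = k + 1) :
    dem (F.totWord wA (Function.update wB k (wB k ++ [F.oB k + i]))) =
      rstep (dem (F.totWord wA wB)) (F.Y F.n + i) := by
  rw [← dem_snoc, totWord_update_right (by omega), totWord_split (k := k) (by omega)]
  have e1 : F.sufWord wA wB (k + 1) = [] := by simp [sufWord, hk]
  have e2 : F.D - F.Y (k + 2) = 0 := by rw [D, hk, Nat.sub_self]
  have e3 : F.oB k + i = F.Y F.n + i := by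
    rw [oB, ← hk, F.X_last, zero_add]
  rw [e1, e2, e3]
  simp [fullWord]

theorem dem_update_outs (hb : F.Bounded wA wB) {k i : ℕ} (hk : k < F.n) (hi : i + 1 < F.ex k) :
    dem (F.totWord (Function.update wA k ((F.oA k + i) :: wA k)) wB) =
      lstep (F.X (k + 1) + i) (dem (F.totWord wA wB)) := by
  rw [← dem_cons, totWord_update_left hk, totWord_split hk]
  have := (slide_outs hb hk hi).right
    (wA k ++ (wB k ++ (fullWord (F.X (k + 1) + F.Y (k + 2)) (F.D - F.Y (k + 2)) (F.ex k) ++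
          F.sufWord wA wB (k + 1))))
  simpa [Sim] using this

theorem dem_update_done (hb : F.Bounded wA wB) {k i : ℕ} (hk : k < F.n) (hi : i + 1 < F.ey (k + 1)) :
    dem (F.totWord wA (Function.update wB k ((F.oB k + F.ex k + i) :: wB k))) =
      lstep (F.X 0 + F.Y (k + 1) + i) (dem (F.totWord wA wB)) := by
  rw [← dem_cons, totWord_update_right hk, totWord_split hk]
  have e1 := slide_done hb (show k < k + 1 by omega) (by omega) hi
  have hX := F.X_succ hk
  have hoA : F.oA k = F.X (k + 1) + F.Y k := rfl
  have hoB : F.oB k = F.X (k + 1) + F.Y (k + 1) := rfl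
  have e2 : Sim ((F.oB k + F.ex k + i) :: (fullWord (F.X (k + 1)) (F.Y k) (F.ex k) ++ wA k))
      ((fullWord (F.X (k + 1)) (F.Y k) (F.ex k) ++ wA k) ++ [F.oB k + F.ex k + i]) := by
    refine sim_cons_far fun b h => ?_
    right
    have h6 := F.Y_succ k
    simp only [List.mem_append] at h
    rcases h with h | h
    · have := fullWord_mem h; omega
    · have := (hb k hk).1 b h; omega
  rw [show F.X k + F.Y (k + 1) + i = F.oB k + F.ex k + i by omega] at e1
  have e3 := (e2.symm.left (F.preWord wA wB k)).trans (by
    simpa using e1.right (fullWord (F.X (k + 1)) (F.Y k) (F.ex k) ++ wA k))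
  have := e3.right (wB k ++ (fullWord (F.X (k + 1) + F.Y (k + 2)) (F.D - F.Y (k + 2)) (F.ex k) ++
          F.sufWord wA wB (k + 1)))
  simpa [Sim] using this

/-- Dually, the northwest rectangle of the rightmost block column is empty and its α is read first.
-/
theorem dem_update_last {i : ℕ} (hn : 0 < F.n) :
    dem (F.totWord (Function.update wA 0 ((F.oA 0 + F.ex 0 + i) :: wA 0)) wB) =
      lstep (F.X 0 + i) (dem (F.totWord wA wB)) := by
  rw [← dem_cons, totWord_update_left hn, totWord_split hn]
  have e1 : F.oA 0 + F.ex 0 + i = F.X 0 + i := by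
    rw [F.X_succ hn, oA, F.Y_zero]; omega
  rw [e1, F.Y_zero]
  simp [fullWord, preWord]

/-- The blocks α_k and β_k are adjacent in the word, so a letter between them belongs to either one.
This is the algebraic form of a move at a sink. -/
theorem dem_update_sink {k i : ℕ} (hk : k < F.n) :
    dem (F.totWord (Function.update wA k (wA k ++ [F.oA k + F.ey k + i])) wB) =
      dem (F.totWord wA (Function.update wB k ((F.oB k + i) :: wB k))) := by
  have h6 := F.Y_succ k
  have hoA : F.oA k = F.X (k + 1) + F.Y k := rfl
  have hoB : F.oB k = F.X (k + 1) + F.Y (k + 1) := rfl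
  rw [totWord_update_left hk, totWord_update_right hk,
    show F.oA k + F.ey k + i = F.oB k + i by omega]
  simp

/-- Between β_k and α_{k+1} the word contains only a southeast and a northwest rectangle, whose
letters are far from those at the dots of `y_{k+1}`. So the letter may again be given to either
block. -/
theorem dem_update_source {k i : ℕ} (hk : k + 1 < F.n) (hi : i + 1 < F.ey (k + 1)) :
    dem (F.totWord (Function.update wA (k + 1)
        ((F.oA (k + 1) + F.ex (k + 1) + i) :: wA (k + 1))) wB) =
      dem (F.totWord wA (Function.update wB k (wB k ++ [F.oB k + i]))) := by
  have hX := F.X_succ hk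
  have hoA : F.oA (k + 1) = F.X (k + 2) + F.Y (k + 1) := rfl
  have hoB : F.oB k = F.X (k + 1) + F.Y (k + 1) := rfl
  rw [show k + 1 + 1 = k + 2 by rfl] at hX
  rw [totWord_update_left hk, totWord_update_right (by omega), preWord_succ, sufWord_eq hk,
    show F.oA (k + 1) + F.ex (k + 1) + i = F.oB k + i by omega]
  have h6 := F.Y_succ (k + 1)
  rw [show k + 1 + 1 = k + 2 by rfl] at h6
  have e2 : Sim ((F.oB k + i) ::
      (fullWord (F.X (k + 1) + F.Y (k + 2)) (F.D - F.Y (k + 2)) (F.ex k) ++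
        fullWord (F.X (k + 2)) (F.Y (k + 1)) (F.ex (k + 1))))
      ((fullWord (F.X (k + 1) + F.Y (k + 2)) (F.D - F.Y (k + 2)) (F.ex k) ++
        fullWord (F.X (k + 2)) (F.Y (k + 1)) (F.ex (k + 1))) ++ [F.oB k + i]) := by
    refine sim_cons_far fun b h => ?_
    simp only [List.mem_append] at h
    rcases h with h | h
    · have := fullWord_mem h
      left; omega
    · have := fullWord_mem h
      right; omega
  have := (e2.symm.left (F.preWord wA wB k ++ (fullWord (F.X (k + 1)) (F.Y k) (F.ex k) ++
    (wA k ++ wB k)))).right (wA (k + 1) ++ (wB (k + 1) ++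
      (fullWord (F.X (k + 2) + F.Y (k + 3)) (F.D - F.Y (k + 3)) (F.ex (k + 1)) ++
        F.sufWord wA wB (k + 2))))
  simpa [Sim, colWord] using this

end Frame

/-! ### Reducedness of the words assembled from blocks -/

theorem supp_inv {u : Perm ℕ} {o l : ℕ} (h : ∀ p, p < o ∨ o + l ≤ p → u p = p) :
    (∀ p, p < o ∨ o + l ≤ p → u⁻¹ p = p) ∧ (∀ p, o ≤ p → p < o + l → o ≤ u p ∧ u p < o + l) ∧
    (∀ p, o ≤ p → p < o + l → o ≤ u⁻¹ p ∧ u⁻¹ p < o + l) := by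
  refine ⟨fun p hp => by rw [Perm.inv_eq_iff_eq, h p hp], fun p h1 h2 => ?_, fun p h1 h2 => ?_⟩
  · by_contra hc
    have h3 := u.injective (h (u p) (by omega))
    omega
  · by_contra hc
    have h3 := h (u⁻¹ p) (by omega)
    rw [perm_apply_inv] at h3
    omega

namespace Frame

variable (F : Frame)

/-- The permutation of block column `x_k`. -/
def colPerm (A B : ℕ → Perm ℕ) (k : ℕ) : Perm ℕ :=
  rect (F.X (k + 1)) (F.Y k) (F.ex k) * (A k * (B k *
    rect (F.X (k + 1) + F.Y (k + 2)) (F.D - F.Y (k + 2)) (F.ex k)))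

/-- The product of the permutations of the block columns from `k` on. -/
def sufPerm (A B : ℕ → Perm ℕ) (k : ℕ) : Perm ℕ :=
  ((List.range' k (F.n - k)).map (F.colPerm A B)).prod

/-- The product of the permutations of the block columns before `k`. -/
def prePerm (A B : ℕ → Perm ℕ) (k : ℕ) : Perm ℕ := ((List.range k).map (F.colPerm A B)).prod

/-- The permutations of the blocks act on the windows of these blocks. -/
structure Supported (A B : ℕ → Perm ℕ) : Prop where
  left : ∀ k < F.n, ∀ p, p < F.oA k ∨ F.oA k + (F.ey k + F.ex k) ≤ p → A k p = p
  right : ∀ k < F.n, ∀ p, p < F.oB k ∨ F.oB k + (F.ey (k + 1) + F.ex k) ≤ p → B k p = p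

/-- No crossings in the blocks between dots of the left column, except possibly for the first
column. -/
structure LeftMono (A B : ℕ → Perm ℕ) : Prop where
  left : ∀ k < F.n, ∀ p q, F.oA k + F.ey k ≤ p → p < q → q < F.oA k + F.ey k + F.ex k →
    A k p < A k q
  right : ∀ k, k + 1 < F.n → ∀ p q, F.oB k ≤ p → p < q → q < F.oB k + F.ey (k + 1) →
    B k p < B k q

/-- No crossings in the blocks between dots of the right column, except possibly for the last
column. -/
structure RightMono (A B : ℕ → Perm ℕ) : Prop where
  left : ∀ k < F.n, 0 < k → ∀ p q, F.oA k + F.ex k ≤ p → p < q → q < F.oA k + F.ex k + F.ey k →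
    (A k)⁻¹ p < (A k)⁻¹ q
  right : ∀ k < F.n, ∀ p q, F.oB k ≤ p → p < q → q < F.oB k + F.ex k →
    (B k)⁻¹ p < (B k)⁻¹ q

variable {F} {A B : ℕ → Perm ℕ} {wA wB : ℕ → List ℕ}

theorem sufPerm_eq {k : ℕ} (h : k < F.n) :
    F.sufPerm A B k = F.colPerm A B k * F.sufPerm A B (k + 1) := by
  unfold sufPerm
  rw [show F.n - k = F.n - (k + 1) + 1 by omega, List.range'_succ, List.map_cons, List.prod_cons]

theorem sufPerm_last : F.sufPerm A B F.n = 1 := by simp [sufPerm]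

theorem prePerm_succ (k : ℕ) : F.prePerm A B (k + 1) = F.prePerm A B k * F.colPerm A B k := by
  simp [prePerm, List.range_succ]

theorem prePerm_last : F.prePerm A B F.n = F.sufPerm A B 0 := by
  rw [prePerm, sufPerm, Nat.sub_zero, List.range_eq_range']

theorem offsets {k : ℕ} (hk : k < F.n) : F.X k = F.X (k + 1) + F.ex k ∧
    F.Y (k + 1) = F.Y k + F.ey k ∧ F.Y (k + 2) = F.Y (k + 1) + F.ey (k + 1) ∧
    F.Y (k + 2) ≤ F.D ∧ F.oA k = F.X (k + 1) + F.Y k ∧ F.oB k = F.X (k + 1) + F.Y (k + 1) :=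
  ⟨F.X_succ hk, F.Y_succ k, F.Y_succ (k + 1), F.Y_le_D (by omega), rfl, rfl⟩

theorem colPerm_fix (hs : F.Supported A B) {k : ℕ} (hk : k < F.n) {p : ℕ}
    (hp : p < F.X (k + 1) ∨ F.X k + F.D ≤ p) : F.colPerm A B k p = p := by
  obtain ⟨h1, h2, h3, h4, h5, h6⟩ := offsets hk
  have e1 : rect (F.X (k + 1) + F.Y (k + 2)) (F.D - F.Y (k + 2)) (F.ex k) p = p := by
    rw [rect_apply, if_neg (by omega), if_neg (by omega)]
  simp only [colPerm, Perm.mul_apply]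
  rw [e1, hs.right k hk p (by omega), hs.left k hk p (by omega), rect_apply, if_neg (by omega),
    if_neg (by omega)]

theorem sufPerm_fix (hs : F.Supported A B) {k : ℕ} (hk : k ≤ F.n) {p : ℕ} (hp : F.X k + F.D ≤ p) :
    F.sufPerm A B k p = p := by
  obtain ⟨d, hd⟩ : ∃ d, F.n = k + d := ⟨F.n - k, by omega⟩
  induction d generalizing k with
  | zero =>
    obtain rfl : k = F.n := by omega
    rw [sufPerm_last, Perm.one_apply]
  | succ d ih =>
    have := F.X_succ (show k < F.n by omega)
    rw [sufPerm_eq (by omega), Perm.mul_apply, ih (by omega) (by omega) (by omega),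
      colPerm_fix hs (by omega) (Or.inr hp)]

theorem colPerm_shift (hs : F.Supported A B) {k : ℕ} (hk : k < F.n) {p : ℕ} (hp : p < F.Y k) :
    F.colPerm A B k (F.X (k + 1) + p) = F.X k + p := by
  obtain ⟨h1, h2, h3, h4, h5, h6⟩ := offsets hk
  have e1 : rect (F.X (k + 1) + F.Y (k + 2)) (F.D - F.Y (k + 2)) (F.ex k) (F.X (k + 1) + p) =
      F.X (k + 1) + p := by
    rw [rect_apply, if_neg (by omega), if_neg (by omega)]
  simp only [colPerm, Perm.mul_apply]
  rw [e1, hs.right k hk _ (by omega), hs.left k hk _ (by omega), rect_apply, if_pos (by omega)]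
  omega

/-- Wires of block rows above `y_k` have so far met only northwest rectangles, which move them in
parallel. -/
theorem sufPerm_shift (hs : F.Supported A B) {k : ℕ} (hk : k ≤ F.n) {p : ℕ} (hp : p < F.Y k) :
    F.sufPerm A B k p = F.X k + p := by
  obtain ⟨d, hd⟩ : ∃ d, F.n = k + d := ⟨F.n - k, by omega⟩
  induction d generalizing k with
  | zero =>
    obtain rfl : k = F.n := by omega
    rw [sufPerm_last, Perm.one_apply, F.X_last, zero_add]
  | succ d ih =>
    have := F.Y_succ k
    rw [sufPerm_eq (by omega), Perm.mul_apply, ih (by omega) (by omega) (by omega),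
      colPerm_shift hs (by omega) hp]

/-- Under `LeftMono`, two wires that cross in a block are not both carried in by non-virtual dots of
its left column, with β in the leftmost block column as the only exception. So one of them comes
straight from its block row and the two have not met before. Block columns are added from left to
right, each factor being checked against the product of everything that its wires traversed earlier.
-/
theorem isRed_sufWord (hA : ∀ k < F.n, IsRed (wA k) (A k)) (hB : ∀ k < F.n, IsRed (wB k) (B k))
    (hs : F.Supported A B) (hm : F.LeftMono A B) {k : ℕ} (hk : k ≤ F.n) :
    IsRed (F.sufWord wA wB k) (F.sufPerm A B k) := by
  obtain ⟨d, hd⟩ : ∃ d, F.n = k + d := ⟨F.n - k, by omega⟩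
  induction d generalizing k with
  | zero =>
    obtain rfl : k = F.n := by omega
    have : F.sufWord wA wB F.n = [] := by simp [sufWord]
    rw [this, sufPerm_last]
    exact IsRed.nil
  | succ d ih =>
    have hk' : k < F.n := by omega
    have ih := ih (k := k + 1) (by omega) (by omega)
    rw [sufWord_eq hk', sufPerm_eq hk', colWord, colPerm]
    simp only [List.append_assoc, mul_assoc]
    obtain ⟨h1, h2, h3, h4, h5, h6⟩ := offsets hk'
    have hfix : ∀ p, F.X (k + 1) + F.D ≤ p → F.sufPerm A B (k + 1) p = p :=
      fun p => sufPerm_fix hs (by omega)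
    have hshift : ∀ p, p < F.Y (k + 1) → F.sufPerm A B (k + 1) p = F.X (k + 1) + p :=
      fun p => sufPerm_shift hs (by omega)
    -- In the leftmost block column nothing precedes β, so its crossings need no restriction.
    have hlast : k + 1 < F.n ∨ F.sufPerm A B (k + 1) = 1 := by
      rcases Nat.lt_or_ge (k + 1) F.n with h | h
      · exact Or.inl h
      · right
        rw [show k + 1 = F.n by omega, sufPerm_last]
    set g := F.sufPerm A B (k + 1)
    set o := F.X (k + 1)
    have g1 : ∀ p, o + F.D ≤ p → g⁻¹ p = p := fun p hp => by
      rw [Perm.inv_eq_iff_eq, hfix p hp]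
    have g2 : ∀ p, p < o + F.D → g⁻¹ p < o + F.D := by
      intro p hp
      by_contra hc
      have := hfix (g⁻¹ p) (by omega)
      rw [perm_apply_inv] at this
      omega
    have g3 : ∀ p, o ≤ p → p < o + F.Y (k + 1) → g⁻¹ p = p - o := fun p hp hp' => by
      rw [Perm.inv_eq_iff_eq, hshift _ (by omega)]; omega
    have g4 : ∀ p, o + F.Y (k + 1) ≤ p → F.Y (k + 1) ≤ g⁻¹ p := by
      intro p hp
      by_contra hc
      have := hshift (g⁻¹ p) (by omega)
      rw [perm_apply_inv] at this
      omega
    have hSi := rect_inv_apply (o + F.Y (k + 2)) (F.D - F.Y (k + 2)) (F.ex k)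
    have hS := rect_apply (o + F.Y (k + 2)) (F.D - F.Y (k + 2)) (F.ex k)
    have rS := isRed_fullWord (o + F.Y (k + 2)) (F.D - F.Y (k + 2)) (F.ex k)
    set S := rect (o + F.Y (k + 2)) (F.D - F.Y (k + 2)) (F.ex k)
    -- A pair crossing in the southeast rectangle contains a wire from a block row `x`, which
    -- earlier factors fix and which lies beyond the reach of the other wire.
    have r1 := rS.append ih (by
      intro p q hpq h
      rw [hS, hS] at h
      have hq := g1 q
      have hp := g2 p
      split_ifs at h <;> omega)
    have r2 := (hB k hk').append r1 (by
      intro p q hpq h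
      rw [mul_inv_rev, Perm.mul_apply, Perm.mul_apply]
      obtain ⟨b1, b2, b3⟩ := supp_inv (hs.right k hk')
      have hw : F.oB k ≤ p ∧ q < F.oB k + (F.ey (k + 1) + F.ex k) := by
        by_contra hc
        have hp1 := hs.right k hk' p
        have hq1 := hs.right k hk' q
        have hp2 := b2 p
        have hq2 := b2 q
        omega
      have hp := hSi p
      have hq := hSi q
      by_cases hq' : F.oB k + F.ey (k + 1) ≤ q
      · rw [if_pos (by omega)] at hq
        rw [hq, g1 (q + (F.D - F.Y (k + 2))) (by omega)]
        by_cases hp' : F.oB k + F.ey (k + 1) ≤ p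
        · rw [if_pos (by omega)] at hp
          rw [hp, g1 (p + (F.D - F.Y (k + 2))) (by omega)]
          omega
        · rw [if_neg (by omega), if_neg (by omega)] at hp
          rw [hp]
          have := g2 p (by omega)
          omega
      · rw [if_neg (by omega), if_neg (by omega)] at hp hq
        rw [hp, hq]
        rcases hlast with hl | hl
        · have := hm.right k hl p q hw.1 hpq (by omega)
          omega
        · rw [hl, inv_one, Perm.one_apply, Perm.one_apply]
          exact hpq)
    have r3 := (hA k hk').append r2 (by
      intro p q hpq h
      simp only [mul_inv_rev, Perm.mul_apply]
      obtain ⟨a1, a2, a3⟩ := supp_inv (hs.left k hk')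
      obtain ⟨b1, b2, b3⟩ := supp_inv (hs.right k hk')
      have hw : F.oA k ≤ p ∧ q < F.oA k + (F.ey k + F.ex k) := by
        by_contra hc
        have hp1 := hs.left k hk' p
        have hq1 := hs.left k hk' q
        have hp2 := a2 p
        have hq2 := a2 q
        omega
      have hp' : p < F.oA k + F.ey k := by
        by_contra hc
        have := hm.left k hk' p q (by omega) hpq (by omega)
        omega
      have hS1 : ∀ r, r < F.oB k → S⁻¹ ((B k)⁻¹ r) = r := by
        intro r hr
        rw [b1 r (Or.inl hr), hSi, if_neg (by omega), if_neg (by omega)]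
      rw [hS1 p (by omega), g3 p (by omega) (by omega)]
      by_cases hq' : q < F.oA k + F.ey k
      · rw [hS1 q (by omega), g3 q (by omega) (by omega)]
        omega
      · have hq1 : F.oB k ≤ S⁻¹ ((B k)⁻¹ q) := by
          have e1 : F.oB k ≤ (B k)⁻¹ q := (b3 q (by omega) (by omega)).1
          have e2 := hSi ((B k)⁻¹ q)
          split_ifs at e2 <;> omega
        have := g4 _ (show o + F.Y (k + 1) ≤ S⁻¹ ((B k)⁻¹ q) by omega)
        omega)
    refine (isRed_fullWord o (F.Y k) (F.ex k)).append r3 ?_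
    intro p q hpq h
    simp only [mul_inv_rev, Perm.mul_apply]
    obtain ⟨a1, a2, a3⟩ := supp_inv (hs.left k hk')
    obtain ⟨b1, b2, b3⟩ := supp_inv (hs.right k hk')
    have hw : o ≤ p ∧ p < o + F.Y k ∧ o + F.Y k ≤ q ∧ q < o + F.Y k + F.ex k := by
      rw [rect_apply, rect_apply] at h
      split_ifs at h <;> omega
    have hS1 : ∀ r, r < F.oA k → S⁻¹ ((B k)⁻¹ ((A k)⁻¹ r)) = r := by
      intro r hr
      rw [a1 r (Or.inl hr), b1 r (by omega), hSi, if_neg (by omega), if_neg (by omega)]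
    rw [hS1 p (by omega), g3 p (by omega) (by omega)]
    by_contra hc
    -- If the order failed, the wire at `q` would also come from a block row above `y_k`; these are
    -- moved in parallel and cannot reach the position `q`.
    set r := g⁻¹ (S⁻¹ ((B k)⁻¹ ((A k)⁻¹ q)))
    have e1 := hshift r (by omega)
    have e2 : S⁻¹ ((B k)⁻¹ ((A k)⁻¹ q)) = o + r := by
      rw [← e1, perm_apply_inv]
    have e3 : (A k)⁻¹ q = o + r := by
      have e4 : (B k)⁻¹ ((A k)⁻¹ q) = S (o + r) := by rw [← e2, perm_apply_inv]
      rw [hS, if_neg (by omega), if_neg (by omega), Perm.inv_eq_iff_eq, hs.right k hk' _ (by omega)]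
        at e4
      exact e4
    rw [Perm.inv_eq_iff_eq, hs.left k hk' _ (by omega)] at e3
    omega

theorem prePerm_facts (hs : F.Supported A B) {k : ℕ} (hk : k ≤ F.n) :
    (∀ p < F.X k, F.prePerm A B k p = p) ∧ (∀ p, F.X 0 + F.D ≤ p → F.prePerm A B k p = p) ∧
    (∀ p, F.Y (k + 1) ≤ p → p < F.D → F.prePerm A B k (F.X k + p) = F.X 0 + p) := by
  induction k with
  | zero => simp [prePerm]
  | succ k ih =>
    have hk' : k < F.n := by omega
    obtain ⟨h1, h2, h3, h4, h5, h6⟩ := offsets hk'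
    have h7 := F.X_anti (Nat.zero_le k)
    obtain ⟨i1, i2, i3⟩ := ih (by omega)
    rw [prePerm_succ]
    refine ⟨fun p hp => ?_, fun p hp => ?_, fun p hp hp' => ?_⟩
    · rw [Perm.mul_apply, colPerm_fix hs hk' (Or.inl hp), i1 p (by omega)]
    · rw [Perm.mul_apply, colPerm_fix hs hk' (by omega), i2 p (by omega)]
    · have e1 : rect (F.X (k + 1) + F.Y (k + 2)) (F.D - F.Y (k + 2)) (F.ex k) (F.X (k + 1) + p) =
          F.X k + p := by
        rw [show k + 1 + 1 = k + 2 by rfl] at hp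
        rw [rect_apply, if_pos (by omega)]
        omega
      rw [show k + 1 + 1 = k + 2 by rfl] at hp
      simp only [colPerm, Perm.mul_apply]
      rw [e1, hs.right k hk' _ (by omega), hs.left k hk' _ (by omega), rect_apply,
        if_neg (by omega), if_neg (by omega), i3 p (by omega) hp']

/-- The mirror image of `isRed_sufWord`: block columns are now added from right to left. Under
`RightMono` a pair crossing in a block contains a wire that leaves the snake there, apart from the α
of the rightmost block column, and so the pair cannot cross again afterwards. -/
theorem isRed_preWord (hA : ∀ k < F.n, IsRed (wA k) (A k)) (hB : ∀ k < F.n, IsRed (wB k) (B k))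
    (hs : F.Supported A B) (hm : F.RightMono A B) {k : ℕ} (hk : k ≤ F.n) :
    IsRed (F.preWord wA wB k) (F.prePerm A B k) := by
  induction k with
  | zero => exact IsRed.nil
  | succ k ih =>
    have hk' : k < F.n := by omega
    obtain ⟨h1, h2, h3, h4, h5, h6⟩ := offsets hk'
    have h7 := F.X_anti (Nat.zero_le k)
    obtain ⟨i1, i2, i3⟩ := prePerm_facts hs hk'.le
    have ih := ih (by omega)
    -- The rightmost α is followed by nothing, so its crossings need no restriction.
    have hfirst : 0 < k ∨ F.prePerm A B k = 1 ∧ F.Y k = 0 := by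
      rcases Nat.eq_zero_or_pos k with rfl | h
      · exact Or.inr ⟨by simp [prePerm], F.Y_zero⟩
      · exact Or.inl h
    rw [preWord_succ, prePerm_succ, colWord, colPerm]
    simp only [← List.append_assoc, ← mul_assoc]
    set h := F.prePerm A B k
    set o := F.X (k + 1)
    have j1 : ∀ p, F.X k ≤ p → F.X k ≤ h p := by
      intro p hp
      by_contra hc
      have := h.injective (i1 (h p) (by omega))
      omega
    have j2 : ∀ p, p < F.X 0 + F.D → h p < F.X 0 + F.D := by
      intro p hp
      by_contra hc
      have := h.injective (i2 (h p) (by omega))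
      omega
    have j3 : ∀ r q, r < q → F.X k + F.Y (k + 1) ≤ q → q < F.X k + F.D → h r < h q := by
      intro r q hrq hq hq'
      have e1 := i3 (q - F.X k) (by omega) (by omega)
      rw [show F.X k + (q - F.X k) = q by omega] at e1
      by_contra hc
      have hr := j2 r (by omega)
      have e2 := i3 (h r - F.X 0) (by omega) (by omega)
      rw [show F.X 0 + (h r - F.X 0) = h r by omega] at e2
      have := h.injective e2
      omega
    have hN := rect_apply o (F.Y k) (F.ex k)
    have rN := isRed_fullWord o (F.Y k) (F.ex k)
    have hNi := rect_inv_apply o (F.Y k) (F.ex k)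
    set N := rect o (F.Y k) (F.ex k)
    have r1 := ih.append rN (by
      intro p q hpq hx
      rw [hNi, hNi]
      have e1 := i1 p
      have e2 := j1 q
      split_ifs <;> omega)
    have r2 := r1.append (hA k hk') (by
      intro p q hpq hx
      simp only [Perm.mul_apply] at hx
      obtain ⟨a1, a2, a3⟩ := supp_inv (hs.left k hk')
      by_contra hc
      have hw : F.oA k ≤ p ∧ q < F.oA k + (F.ey k + F.ex k) := by
        by_contra hc'
        have hp1 := a1 p
        have hq1 := a1 q
        have hp2 := a3 p
        have hq2 := a3 q
        omega
      have hp := hN p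
      have hq := hN q
      by_cases hp' : p < F.oA k + F.ex k
      · rw [if_neg (by omega), if_pos (by omega)] at hp
        rw [hp, i1 (p - F.Y k) (by omega)] at hx
        by_cases hq' : q < F.oA k + F.ex k
        · rw [if_neg (by omega), if_pos (by omega)] at hq
          rw [hq, i1 (q - F.Y k) (by omega)] at hx
          omega
        · rw [if_neg (by omega), if_neg (by omega)] at hq
          rw [hq] at hx
          have := j1 q (by omega)
          omega
      · rcases hfirst with hf | ⟨hf, hf'⟩
        · have := hm.left k hk' hf p q (by omega) hpq (by omega)
          omega
        · rw [if_neg (by omega), if_neg (by omega)] at hp hq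
          rw [hp, hq, hf, Perm.one_apply, Perm.one_apply] at hx
          omega)
    have hAN : ∀ r, r < F.X k + F.Y (k + 1) → N (A k r) < F.X k + F.Y (k + 1) := by
      intro r hr
      obtain ⟨a1, a2, a3⟩ := supp_inv (hs.left k hk')
      have e1 : A k r < F.X k + F.Y (k + 1) := by
        have := hs.left k hk' r
        have := a2 r
        omega
      have e2 := hN (A k r)
      split_ifs at e2 <;> omega
    have hAN' : ∀ r, F.X k + F.Y (k + 1) ≤ r → N (A k r) = r := by
      intro r hr
      rw [hs.left k hk' r (by omega), hN, if_neg (by omega), if_neg (by omega)]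
    have r3 := r2.append (hB k hk') (by
      intro p q hpq hx
      simp only [Perm.mul_apply] at hx
      obtain ⟨b1, b2, b3⟩ := supp_inv (hs.right k hk')
      by_contra hc
      have hw : F.oB k ≤ p ∧ q < F.oB k + (F.ey (k + 1) + F.ex k) := by
        by_contra hc'
        have hp1 := b1 p
        have hq1 := b1 q
        have hp2 := b3 p
        have hq2 := b3 q
        omega
      by_cases hq' : q < F.oB k + F.ex k
      · have := hm.right k hk' p q hw.1 hpq hq'
        omega
      · rw [hAN' q (by omega)] at hx
        have e1 : N (A k p) < q := by
          rcases Nat.lt_or_ge p (F.X k + F.Y (k + 1)) with hp | hp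
          · have := hAN p hp
            omega
          · rw [hAN' p hp]
            exact hpq
        have := j3 _ q e1 (by omega) (by omega)
        omega)
    refine r3.append (isRed_fullWord (o + F.Y (k + 2)) (F.D - F.Y (k + 2)) (F.ex k)) ?_
    intro p q hpq hx
    simp only [Perm.mul_apply] at hx
    by_contra hc
    have hw : o + F.Y (k + 2) ≤ p ∧ F.X k + F.Y (k + 2) ≤ q ∧ q < F.X k + F.D := by
      rw [rect_inv_apply, rect_inv_apply] at hc
      split_ifs at hc <;> omega
    rw [hs.right k hk' q (by omega), hAN' q (by omega)] at hx
    have e1 : N (A k (B k p)) < q := by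
      have e2 : B k p < q := by
        have := hs.right k hk' p
        have := (supp_inv (hs.right k hk')).2.1 p
        omega
      rcases Nat.lt_or_ge (B k p) (F.X k + F.Y (k + 1)) with hp | hp
      · have := hAN _ hp
        omega
      · rw [hAN' _ hp]
        exact e2
    have := j3 _ q e1 (by omega) (by omega)
    omega

theorem isRed_totWord_of_leftMono (hA : ∀ k < F.n, IsRed (wA k) (A k))
    (hB : ∀ k < F.n, IsRed (wB k) (B k)) (hs : F.Supported A B) (hm : F.LeftMono A B) :
    IsRed (F.totWord wA wB) (F.sufPerm A B 0) := by
  rw [totWord_eq_sufWord]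
  exact isRed_sufWord hA hB hs hm (Nat.zero_le _)

theorem isRed_totWord_of_rightMono (hA : ∀ k < F.n, IsRed (wA k) (A k))
    (hB : ∀ k < F.n, IsRed (wB k) (B k)) (hs : F.Supported A B) (hm : F.RightMono A B) :
    IsRed (F.totWord wA wB) (F.sufPerm A B 0) := by
  rw [← prePerm_last]
  exact isRed_preWord hA hB hs hm le_rfl

end Frame

/-! ### Uniqueness of block monotone permutations -/

section

variable {m : ℕ}

theorem card_le_fiber_eq {ι κ : Type*} [DecidableEq ι] [LinearOrder κ] {ρ : Fin m → ι}
    {f f' : Fin m → κ}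
    (hc : ∀ z z', (Finset.univ.filter fun r => ρ r = z ∧ f r = z').card =
      (Finset.univ.filter fun r => ρ r = z ∧ f' r = z').card) (z : ι) (c : κ) :
    (Finset.univ.filter fun r => ρ r = z ∧ f r ≤ c).card =
      (Finset.univ.filter fun r => ρ r = z ∧ f' r ≤ c).card := by
  have key : ∀ g : Fin m → κ, (∀ r, g r ∈ Finset.univ.image f ∪ Finset.univ.image f') →
      (Finset.univ.filter fun r => ρ r = z ∧ g r ≤ c).card =
      ∑ z' ∈ (Finset.univ.image f ∪ Finset.univ.image f').filter (· ≤ c),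
        (Finset.univ.filter fun r => ρ r = z ∧ g r = z').card := by
    intro g hg
    rw [Finset.card_eq_sum_card_fiberwise (f := g)
      (t := (Finset.univ.image f ∪ Finset.univ.image f').filter (· ≤ c))]
    · refine Finset.sum_congr rfl fun z' hz' => ?_
      rw [Finset.mem_filter] at hz'
      congr 1
      ext r
      simp only [Finset.mem_filter, Finset.mem_univ, true_and]
      constructor
      · rintro ⟨⟨h1, -⟩, h3⟩; exact ⟨h1, h3⟩
      · rintro ⟨h1, rfl⟩; exact ⟨⟨h1, hz'.2⟩, rfl⟩
    · intro r hr
      simp only [Finset.coe_filter, Finset.mem_univ, true_and, Set.mem_ofPred_eq] at hr ⊢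
      exact ⟨hg r, hr.2⟩
  rw [key f (by simp), key f' (by simp)]
  exact Finset.sum_congr rfl fun z' _ => hc z z'

/-- Within a block row the block label is a monotone function, so it is determined by how often each
value is taken. If it were larger for `f'` at some `r`, the label set below `f r` would have fewer
elements for `f'` than for `f`. -/
theorem block_le_of_card_eq {ι κ : Type*} [DecidableEq ι] [LinearOrder κ] {ρ : Fin m → ι}
    {f f' : Fin m → κ}
    (hc : ∀ z z', (Finset.univ.filter fun r => ρ r = z ∧ f r = z').card =
      (Finset.univ.filter fun r => ρ r = z ∧ f' r = z').card)
    (h : ∀ r r', ρ r = ρ r' → r ≤ r' → f r ≤ f r')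
    (h' : ∀ r r', ρ r = ρ r' → r ≤ r' → f' r ≤ f' r') (r : Fin m) : f' r ≤ f r := by
  by_contra hlt
  push Not at hlt
  have h1 : (Finset.univ.filter fun r' => ρ r' = ρ r ∧ f' r' ≤ f r).card <
      (Finset.univ.filter fun r' => ρ r' = ρ r ∧ f r' ≤ f r).card := by
    apply Finset.card_lt_card
    rw [Finset.ssubset_iff_of_subset]
    · exact ⟨r, by simp, by simpa using hlt⟩
    · intro r' hr'
      simp only [Finset.mem_filter, Finset.mem_univ, true_and] at hr' ⊢
      refine ⟨hr'.1, h r' r hr'.1 ?_⟩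
      by_contra hc
      have := h' r r' hr'.1.symm (not_le.1 hc).le
      exact absurd (lt_of_lt_of_le hlt (this.trans hr'.2)) (lt_irrefl _)
  rw [card_le_fiber_eq hc] at h1
  exact lt_irrefl _ h1

/-- First the block column of each `1` is forced by the counts and the order within block rows. Then
within a block column the values appear in the order of the rows, so each value is forced by its
rank. -/
theorem blockMono_unique {ι κ : Type*} [DecidableEq ι] [LinearOrder κ] {ρ : Fin m → ι}
    {σ : Fin m → κ} (hσ : Monotone σ) {v v' : Perm (Fin m)}
    (hc : ∀ z z', (Finset.univ.filter fun r => ρ r = z ∧ σ (v r) = z').card =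
      (Finset.univ.filter fun r => ρ r = z ∧ σ (v' r) = z').card)
    (h1 : ∀ r r', ρ r = ρ r' → r < r' → v r < v r')
    (h1' : ∀ r r', ρ r = ρ r' → r < r' → v' r < v' r')
    (h2 : ∀ r r', σ (v r) = σ (v r') → r < r' → v r < v r')
    (h2' : ∀ r r', σ (v' r) = σ (v' r') → r < r' → v' r < v' r') : v = v' := by
  have mono : ∀ v : Perm (Fin m), (∀ r r', ρ r = ρ r' → r < r' → v r < v r') →
      ∀ r r', ρ r = ρ r' → r ≤ r' → σ (v r) ≤ σ (v r') := by
    intro v h r r' hr hle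
    rcases hle.eq_or_lt with rfl | hlt
    · exact le_rfl
    · exact hσ (h r r' hr hlt).le
  have e : ∀ r, σ (v r) = σ (v' r) := fun r => le_antisymm
    (block_le_of_card_eq (fun z z' => (hc z z').symm) (mono v' h1') (mono v h1) r)
    (block_le_of_card_eq hc (mono v h1) (mono v' h1') r)
  have count : ∀ v : Perm (Fin m), (∀ r r', σ (v r) = σ (v r') → r < r' → v r < v r') → ∀ r,
      (Finset.univ.filter fun j => σ j = σ (v r) ∧ j ≤ v r).card =
      (Finset.univ.filter fun r' => σ (v r') = σ (v r) ∧ r' ≤ r).card := by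
    intro v h r
    symm
    refine Finset.card_bij (fun r' _ => v r') ?_ (fun _ _ _ _ h => v.injective h) ?_
    · intro r' hr'
      simp only [Finset.mem_filter, Finset.mem_univ, true_and] at hr' ⊢
      refine ⟨hr'.1, ?_⟩
      rcases hr'.2.eq_or_lt with rfl | hlt
      · exact le_rfl
      · exact (h _ _ hr'.1 hlt).le
    · intro j hj
      simp only [Finset.mem_filter, Finset.mem_univ, true_and] at hj
      refine ⟨v⁻¹ j, ?_, perm_apply_inv v j⟩
      simp only [Finset.mem_filter, Finset.mem_univ, true_and, perm_apply_inv]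
      refine ⟨hj.1, ?_⟩
      by_contra hlt
      have := h r (v⁻¹ j) (by rw [perm_apply_inv, hj.1]) (not_le.1 hlt)
      rw [perm_apply_inv] at this
      exact absurd (lt_of_lt_of_le this hj.2) (lt_irrefl _)
  have key : ∀ v v' : Perm (Fin m), (∀ r r', σ (v r) = σ (v r') → r < r' → v r < v r') →
      (∀ r r', σ (v' r) = σ (v' r') → r < r' → v' r < v' r') → (∀ r, σ (v r) = σ (v' r)) →
      ∀ r, v' r ≤ v r := by
    intro v v' h h' e r
    by_contra hlt
    push Not at hlt
    have h3 : (Finset.univ.filter fun j => σ j = σ (v r) ∧ j ≤ v r).card <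
        (Finset.univ.filter fun j => σ j = σ (v' r) ∧ j ≤ v' r).card := by
      apply Finset.card_lt_card
      rw [Finset.ssubset_iff_of_subset]
      · exact ⟨v' r, by simp, by simpa using fun _ => hlt⟩
      · intro j hj
        simp only [Finset.mem_filter, Finset.mem_univ, true_and] at hj ⊢
        exact ⟨hj.1.trans (e r), hj.2.trans hlt.le⟩
    rw [count v h, count v' h'] at h3
    simp only [e] at h3
    exact lt_irrefl _ h3
  ext r
  rw [le_antisymm (key v' v h2' h2 (fun r => (e r).symm) r) (key v v' h2 h2' e r)]

/-! ### Completions -/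

theorem lt_of_adjacent {f : Fin m → Fin m} {a : ℕ}
    (h : ∀ i j : Fin m, a ≤ i.val → j.val = i.val + 1 → f i < f j) (i j : Fin m)
    (hi : a ≤ i.val) (hij : i < j) : f i < f j := by
  obtain ⟨k, hk⟩ : ∃ k, j.val = i.val + 1 + k := ⟨j.val - i.val - 1, by
    rw [Fin.lt_def] at hij; omega⟩
  induction k generalizing j with
  | zero => exact h i j hi hk
  | succ k ihk =>
    have h1 := ihk ⟨i.val + 1 + k, by omega⟩ (by rw [Fin.lt_def]; simp; omega) rfl
    have h2 := h ⟨i.val + 1 + k, by omega⟩ j (by simp; omega) (by simp; omega)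
    exact h1.trans h2

theorem permLength_swap_mul {u : Perm (Fin m)} {s t : Fin m} (hst : t.val = s.val + 1)
    (h : u⁻¹ s < u⁻¹ t) : permLength (swap s t * u) = permLength u + 1 := by
  rw [← permLength_inv, mul_inv_rev, swap_inv, permLength_mul_swap hst h, permLength_inv]

end

section

variable {a b : ℕ}

theorem pequiv_ext {f g : Fin a ≃. Fin b} (h : ∀ i j, j ∈ f i ↔ j ∈ g i) : f = g :=
  PEquiv.ext fun i => Option.ext fun j => h i j

theorem mem_trunc {v : Perm (Fin (a + b))} {i : Fin a} {j : Fin b} :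
    j ∈ trunc v i ↔ v (topTail b i) = topHead a j := by
  change (if h : (v (topTail b i)).val < b then some (⟨(v (topTail b i)).val, h⟩ : Fin b)
    else none) = some j ↔ _
  rw [Option.dite_none_right_eq_some]
  simp only [Option.some.injEq, Fin.ext_iff, topHead]
  have := j.isLt
  constructor
  · rintro ⟨-, h⟩; exact h
  · intro h; exact ⟨by omega, h⟩

/-- A permutation that is increasing on the virtual dots of both columns (aligned at the top). -/
def VirtMono (a b : ℕ) (c : Perm (Fin (a + b))) : Prop :=
  (∀ i j : Fin (a + b), a ≤ i.val → i < j → c i < c j) ∧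
  (∀ i j : Fin (a + b), b ≤ i.val → i < j → c⁻¹ i < c⁻¹ j)

theorem trunc_completion (w : Fin a ≃. Fin b) : trunc (completion w) = w :=
  (Set.exists_min_image {v : Perm (Fin (a + b)) | trunc v = w} permLength
    (Set.toFinite _) (exists_trunc_eq w)).choose_spec.1

theorem completion_min {w : Fin a ≃. Fin b} {v : Perm (Fin (a + b))} (h : trunc v = w) :
    permLength (completion w) ≤ permLength v :=
  (Set.exists_min_image {v : Perm (Fin (a + b)) | trunc v = w} permLength
    (Set.toFinite _) (exists_trunc_eq w)).choose_spec.2 v h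

theorem trunc_mul_swap {c : Perm (Fin (a + b))} {s t : Fin (a + b)} (hs : a ≤ s.val)
    (ht : a ≤ t.val) : trunc (c * swap s t) = trunc c := by
  refine pequiv_ext fun i j => ?_
  rw [mem_trunc, mem_trunc, Perm.mul_apply, swap_apply_of_ne_of_ne]
  · rintro rfl; simp only [topTail] at hs; omega
  · rintro rfl; simp only [topTail] at ht; omega

theorem trunc_swap_mul {c : Perm (Fin (a + b))} {s t : Fin (a + b)} (hs : b ≤ s.val)
    (ht : b ≤ t.val) : trunc (swap s t * c) = trunc c := by
  refine pequiv_ext fun i j => ?_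
  rw [mem_trunc, mem_trunc, Perm.mul_apply]
  have : swap s t (topHead a j) = topHead a j := by
    apply swap_apply_of_ne_of_ne
    · rintro rfl; simp only [topHead] at hs; omega
    · rintro rfl; simp only [topHead] at ht; omega
  constructor
  · intro h; rw [← this] at h; exact (swap s t).injective h
  · intro h; rw [h, this]

/-- Exchanging two virtual dots does not change the northwest corner, so a descent there would
contradict the minimal length. -/
theorem virtMono_completion (w : Fin a ≃. Fin b) : VirtMono a b (completion w) := by
  constructor
  · refine lt_of_adjacent fun s t hs hst => ?_
    by_contra hc
    have hlt : completion w t < completion w s :=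
      lt_of_le_of_ne (not_lt.1 hc) fun e => by
        have := (completion w).injective e; rw [this] at hst; omega
    have h1 : (completion w * swap s t) s < (completion w * swap s t) t := by simpa using hlt
    have h2 := permLength_mul_swap hst h1
    rw [mul_assoc, swap_mul_self, mul_one] at h2
    have h3 := completion_min (w := w) (v := completion w * swap s t)
      (by rw [trunc_mul_swap hs (by omega), trunc_completion])
    omega
  · refine lt_of_adjacent fun s t hs hst => ?_
    by_contra hc
    have hlt : (completion w)⁻¹ t < (completion w)⁻¹ s :=
      lt_of_le_of_ne (not_lt.1 hc) fun e => by
        have := ((completion w)⁻¹).injective e; rw [this] at hst; omega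
    have h1 : (swap s t * completion w)⁻¹ s < (swap s t * completion w)⁻¹ t := by simpa using hlt
    have h2 := permLength_swap_mul hst h1
    rw [← mul_assoc, swap_mul_self, one_mul] at h2
    have h3 := completion_min (w := w) (v := swap s t * completion w)
      (by rw [trunc_swap_mul hs (by omega), trunc_completion])
    omega

/-- Treat every non-virtual row and column as a block of its own and all virtual ones as a single
block. The corner fixes all block counts and monotonicity fixes the rest, so this is an instance of
`blockMono_unique`. -/
theorem virtMono_unique {c c' : Perm (Fin (a + b))} (h : trunc c = trunc c') (hc : VirtMono a b c)
    (hc' : VirtMono a b c') : c = c' := by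
  have e : ∀ r : Fin (a + b), r.val < a → min (c r).val b = min (c' r).val b := by
    intro r hr
    have key : ∀ j : Fin b, c r = topHead a j ↔ c' r = topHead a j := by
      intro j
      have := @mem_trunc a b c ⟨r, hr⟩ j
      rw [h, mem_trunc] at this
      exact this.symm
    by_cases h1 : (c r).val < b
    · have := (key ⟨_, h1⟩).1 (Fin.ext rfl)
      rw [this]; simp [topHead]
    · by_cases h2 : (c' r).val < b
      · have := (key ⟨_, h2⟩).2 (Fin.ext rfl)
        rw [this]; simp [topHead]
      · omega
  refine blockMono_unique (ρ := fun r => min r.val a) (σ := fun r => min r.val b)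
    (fun i j hij => by rw [Fin.le_def] at hij; dsimp only; omega) ?_ ?_ ?_ ?_ ?_
  · intro z z'
    by_cases hz : z < a
    · congr 1
      ext r
      simp only [Finset.mem_filter, Finset.mem_univ, true_and]
      constructor <;> rintro ⟨h1, h2⟩ <;> refine ⟨h1, ?_⟩ <;> have := e r (by omega) <;> omega
    -- For the virtual block row the counts are the column totals minus the contribution of the
    -- non-virtual rows, on which `c` and `c'` agree.
    · by_cases hz' : z = a
      · have key : ∀ c : Perm (Fin (a + b)),
            (Finset.univ.filter fun r : Fin (a + b) => min r.val b = z').card =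
            (Finset.univ.filter fun r : Fin (a + b) => r.val < a ∧ min (c r).val b = z').card +
            (Finset.univ.filter fun r : Fin (a + b) => min r.val a = z ∧ min (c r).val b = z').card
            := by
          intro c
          rw [← Finset.card_union_of_disjoint]
          · symm
            refine Finset.card_bij (fun r _ => c r) ?_ (fun _ _ _ _ h => c.injective h) ?_
            · intro r hr
              simp only [Finset.mem_union, Finset.mem_filter, Finset.mem_univ, true_and] at hr ⊢
              rcases hr with hr | hr <;> exact hr.2
            · intro j hj
              refine ⟨c⁻¹ j, ?_, perm_apply_inv c j⟩
              simp only [Finset.mem_union, Finset.mem_filter, Finset.mem_univ, true_and,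
                perm_apply_inv] at hj ⊢
              by_cases h1 : (c⁻¹ j).val < a
              · exact Or.inl ⟨h1, hj⟩
              · exact Or.inr ⟨by omega, hj⟩
          · rw [Finset.disjoint_filter]
            rintro r - h1 h2
            omega
        have e2 : (Finset.univ.filter fun r : Fin (a + b) => r.val < a ∧ min (c r).val b = z') =
            (Finset.univ.filter fun r : Fin (a + b) => r.val < a ∧ min (c' r).val b = z') := by
          ext r
          simp only [Finset.mem_filter, Finset.mem_univ, true_and]
          constructor <;> rintro ⟨h1, h2⟩ <;> refine ⟨h1, ?_⟩ <;> have := e r (by omega) <;> omega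
        have h1 := key c
        have h2 := key c'
        rw [e2] at h1
        omega
      · rw [Finset.filter_false_of_mem, Finset.filter_false_of_mem]
        · rintro r - ⟨h1, -⟩; omega
        · rintro r - ⟨h1, -⟩; omega
  all_goals
    intro r r' h1 h2
  · exact hc.1 r r' (by rw [Fin.lt_def] at h2; omega) h2
  · exact hc'.1 r r' (by rw [Fin.lt_def] at h2; omega) h2
  · by_contra h3
    have h4 : c r' < c r := lt_of_le_of_ne (not_lt.1 h3) fun e => by
      have := c.injective e; rw [this] at h2; exact lt_irrefl _ h2
    have h5 := hc.2 _ _ (by rw [Fin.lt_def] at h4; omega) h4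
    rw [perm_inv_apply, perm_inv_apply] at h5
    exact lt_asymm h2 h5
  · by_contra h3
    have h4 : c' r' < c' r := lt_of_le_of_ne (not_lt.1 h3) fun e => by
      have := c'.injective e; rw [this] at h2; exact lt_irrefl _ h2
    have h5 := hc'.2 _ _ (by rw [Fin.lt_def] at h4; omega) h4
    rw [perm_inv_apply, perm_inv_apply] at h5
    exact lt_asymm h2 h5

theorem completion_eq {w : Fin a ≃. Fin b} {c : Perm (Fin (a + b))} (h : trunc c = w)
    (hc : VirtMono a b c) : completion w = c :=
  virtMono_unique (by rw [trunc_completion, h]) (virtMono_completion w) hc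

/-- The virtual values are taken in increasing order, so the `t`-th of them occurs at position at
least `t`. This is the bound on values that makes the Lehmer code fit into the block. -/
theorem exists_pipe_completion (w : Fin a ≃. Fin b) :
    ∃ P ⊆ Finset.range a ×ˢ Finset.range b, demazure a b P = completion w := by
  have hv := virtMono_completion w
  refine exists_pipe (completion w) hv.1 fun i hi => ?_
  have key : ∀ t, ∀ h : b + t < a + b, t ≤ ((completion w)⁻¹ ⟨b + t, h⟩).val := by
    intro t
    induction t with
    | zero => intro _; omega
    | succ t ih =>
      intro h
      have h1 := ih (by omega)
      have h2 := hv.2 ⟨b + t, by omega⟩ ⟨b + (t + 1), h⟩ (by simp) (by rw [Fin.lt_def]; simp)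
      rw [Fin.lt_def] at h2
      omega
  by_contra hc
  have h1 := key ((completion w i).val - b) (by omega)
  have h2 : (⟨b + ((completion w i).val - b), by omega⟩ : Fin (a + b)) = completion w i :=
    Fin.ext (by simp; omega)
  rw [h2, perm_inv_apply] at h1
  omega

/-! ### Exchanging two adjacent dots in a completion -/

theorem swap_lt_swap_fin {m : ℕ} {s t x y : Fin m} (hst : t.val = s.val + 1) (h : x < y)
    (h' : ¬(x = s ∧ y = t)) : swap s t x < swap s t y := by
  simp only [swap_apply_def, Fin.lt_def, Fin.ext_iff] at *
  split_ifs <;> omega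

/-- The exchange keeps virtual dots in increasing order unless it reverses two strands that both
come from virtual dots. The hypothesis excludes this, and uniqueness of monotone extensions
identifies the result. -/
theorem completion_head_swap {w : Fin a ≃. Fin b} {s t : Fin b} (hst : t.val = s.val + 1)
    (h : ((completion w)⁻¹ (topHead a s)).val < a ∨ ((completion w)⁻¹ (topHead a t)).val < a) :
    completion (w.trans (swap s t).toPEquiv) =
      swap (topHead a s) (topHead a t) * completion w := by
  have hv := virtMono_completion w
  apply completion_eq
  · refine pequiv_ext fun i j => ?_
    rw [mem_trunc, PEquiv.mem_trans]
    simp only [Equiv.toPEquiv_apply, Option.mem_some_iff]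
    rw [Perm.mul_apply]
    have e : ∀ x : Fin b, swap (topHead a s) (topHead a t) (topHead a x) =
        topHead a (swap s t x) := by
      intro x
      simp only [swap_apply_def, topHead, Fin.ext_iff]
      split_ifs <;> rfl
    constructor
    · intro h1
      refine ⟨swap s t j, ?_, by simp⟩
      rw [← trunc_completion w, mem_trunc]
      apply (swap (topHead a s) (topHead a t)).injective
      rw [h1, e, swap_apply_self]
    · rintro ⟨k, hk, rfl⟩
      rw [← trunc_completion w, mem_trunc] at hk
      rw [hk, e]
  · refine ⟨fun i j hi hij => ?_, fun i j hi hij => ?_⟩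
    · refine swap_lt_swap_fin (by simp [topHead, hst]) (hv.1 i j hi hij) ?_
      rintro ⟨h1, h2⟩
      rw [← h1, ← h2, perm_inv_apply, perm_inv_apply] at h
      rw [Fin.lt_def] at hij
      omega
    · rw [mul_inv_rev, swap_inv, Perm.mul_apply, Perm.mul_apply, swap_apply_of_ne_of_ne,
        swap_apply_of_ne_of_ne]
      · exact hv.2 i j hi hij
      all_goals
        rintro rfl
        rw [Fin.lt_def] at hij
        simp only [topHead] at hi hij
        omega

/-- The complementary case: neither dot carries an arrow, so exchanging them changes nothing. -/
theorem head_swap_eq_self {w : Fin a ≃. Fin b} {s t : Fin b}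
    (h : ¬(((completion w)⁻¹ (topHead a s)).val < a ∨ ((completion w)⁻¹ (topHead a t)).val < a)) :
    w.trans (swap s t).toPEquiv = w := by
  push Not at h
  have key : ∀ i x, x ∈ w i → x ≠ s ∧ x ≠ t := by
    intro i x hx
    rw [← trunc_completion w, mem_trunc] at hx
    have hx : (completion w)⁻¹ (topHead a x) = topTail b i := by rw [← hx, perm_inv_apply]
    have h1 : (topTail b i).val < a := i.isLt
    constructor <;> rintro rfl <;> rw [hx] at h <;> omega
  refine pequiv_ext fun i j => ?_
  rw [PEquiv.mem_trans]
  simp only [Equiv.toPEquiv_apply, Option.mem_some_iff]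
  constructor
  · rintro ⟨k, hk, rfl⟩
    rwa [swap_apply_of_ne_of_ne (key i k hk).1 (key i k hk).2]
  · intro hj
    exact ⟨j, hj, swap_apply_of_ne_of_ne (key i j hj).1 (key i j hj).2⟩

theorem completion_tail_swap {w : Fin a ≃. Fin b} {s t : Fin a} (hst : t.val = s.val + 1)
    (h : (completion w (topTail b s)).val < b ∨ (completion w (topTail b t)).val < b) :
    completion ((swap s t).toPEquiv.trans w) =
      completion w * swap (topTail b s) (topTail b t) := by
  have hv := virtMono_completion w
  apply completion_eq
  · refine pequiv_ext fun i j => ?_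
    rw [mem_trunc, PEquiv.mem_trans]
    simp only [Equiv.toPEquiv_apply, Option.mem_some_iff]
    rw [Perm.mul_apply]
    have e : ∀ x : Fin a, swap (topTail b s) (topTail b t) (topTail b x) =
        topTail b (swap s t x) := by
      intro x
      simp only [swap_apply_def, topTail, Fin.ext_iff]
      split_ifs <;> rfl
    rw [e, ← mem_trunc, trunc_completion]
    simp
  · refine ⟨fun i j hi hij => ?_, fun i j hi hij => ?_⟩
    · rw [Perm.mul_apply, Perm.mul_apply, swap_apply_of_ne_of_ne,
        swap_apply_of_ne_of_ne]
      · exact hv.1 i j hi hij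
      all_goals
        rintro rfl
        rw [Fin.lt_def] at hij
        simp only [topTail] at hi hij
        omega
    · rw [mul_inv_rev, swap_inv]
      refine swap_lt_swap_fin (by simp [topTail, hst]) (hv.2 i j hi hij) ?_
      rintro ⟨h1, h2⟩
      rw [← h1, ← h2, perm_apply_inv, perm_apply_inv] at h
      rw [Fin.lt_def] at hij
      omega

theorem tail_swap_eq_self {w : Fin a ≃. Fin b} {s t : Fin a}
    (h : ¬((completion w (topTail b s)).val < b ∨ (completion w (topTail b t)).val < b)) :
    (swap s t).toPEquiv.trans w = w := by
  push Not at h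
  have key : ∀ i x, x ∈ w i → i ≠ s ∧ i ≠ t := by
    intro i x hx
    rw [← trunc_completion w, mem_trunc] at hx
    have h1 : (topHead a x).val < b := x.isLt
    constructor <;> rintro rfl <;> rw [hx] at h <;> omega
  refine pequiv_ext fun i j => ?_
  rw [PEquiv.mem_trans]
  simp only [Equiv.toPEquiv_apply, Option.mem_some_iff]
  constructor
  · rintro ⟨k, rfl, hk⟩
    have h2 := key _ _ hk
    have : swap s t i = i := by
      apply swap_apply_of_ne_of_ne <;> rintro rfl <;> simp at h2
    rwa [this] at hk
  · intro hj
    have := swap_apply_of_ne_of_ne (key i j hj).1 (key i j hj).2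
    exact ⟨_, rfl, by rwa [this]⟩

/-! ### Rotated completions -/

/-- The rotated completion of a partial permutation. -/
noncomputable def rotCompletion (w : Fin a ≃. Fin b) : Perm (Fin (a + b)) :=
  rotPerm (completion (rotPartial w))

theorem mem_rotPartial {w : Fin a ≃. Fin b} {i : Fin a} {j : Fin b} :
    j ∈ rotPartial w i ↔ j.rev ∈ w i.rev := by
  unfold rotPartial
  rw [PEquiv.mem_trans]
  simp only [PEquiv.mem_trans, Equiv.toPEquiv_apply, Option.mem_some_iff, Fin.revPerm_apply]
  constructor
  · rintro ⟨k, ⟨l, rfl, h⟩, rfl⟩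
    rwa [Fin.rev_rev]
  · intro h
    exact ⟨_, ⟨_, rfl, h⟩, Fin.rev_rev j⟩

theorem rotPartial_rotPartial (w : Fin a ≃. Fin b) : rotPartial (rotPartial w) = w := by
  refine pequiv_ext fun i j => ?_
  rw [mem_rotPartial, mem_rotPartial, Fin.rev_rev, Fin.rev_rev]

theorem rotPerm_rotPerm {m : ℕ} (v : Perm (Fin m)) : rotPerm (rotPerm v) = v := by
  ext i
  simp [rotPerm]

theorem rotPerm_apply {m : ℕ} (v : Perm (Fin m)) (i : Fin m) : rotPerm v i = (v i.rev).rev := by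
  simp [rotPerm]

theorem rotPerm_mul {m : ℕ} (v w : Perm (Fin m)) : rotPerm (v * w) = rotPerm v * rotPerm w := by
  ext i
  simp [rotPerm_apply]

theorem rotPerm_inv {m : ℕ} (v : Perm (Fin m)) : rotPerm v⁻¹ = (rotPerm v)⁻¹ := by
  rw [eq_inv_iff_mul_eq_one, ← rotPerm_mul, inv_mul_cancel]
  ext i; simp [rotPerm]

theorem rotPerm_swap {m : ℕ} (s t : Fin m) : rotPerm (swap s t) = swap s.rev t.rev := by
  ext i
  simp only [rotPerm_apply, swap_apply_def, Fin.rev_eq_iff]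
  split_ifs <;> simp

theorem rev_botHead (j : Fin b) : (botHead a j).rev = topHead a j.rev := by
  ext; simp only [botHead, topHead, Fin.val_rev]; omega

theorem rev_botTail (i : Fin a) : (botTail b i).rev = topTail b i.rev := by
  ext; simp only [botTail, topTail, Fin.val_rev]; omega

theorem mem_iff_rotCompletion {w : Fin a ≃. Fin b} {i : Fin a} {j : Fin b} :
    j ∈ w i ↔ rotCompletion w (botTail b i) = botHead a j := by
  rw [rotCompletion, rotPerm_apply, rev_botTail, Fin.rev_eq_iff, rev_botHead, ← mem_trunc,
    trunc_completion, mem_rotPartial, Fin.rev_rev, Fin.rev_rev]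

theorem mem_iff_completion {w : Fin a ≃. Fin b} {i : Fin a} {j : Fin b} :
    j ∈ w i ↔ completion w (topTail b i) = topHead a j := by
  rw [← mem_trunc, trunc_completion]

theorem rotPartial_head_swap (w : Fin a ≃. Fin b) (s t : Fin b) :
    rotPartial (w.trans (swap s t).toPEquiv) =
      (rotPartial w).trans (swap s.rev t.rev).toPEquiv := by
  refine pequiv_ext fun i j => ?_
  rw [mem_rotPartial, PEquiv.mem_trans, PEquiv.mem_trans]
  simp only [Equiv.toPEquiv_apply, Option.mem_some_iff, ← rotPerm_swap, rotPerm_apply]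
  constructor
  · rintro ⟨k, hk, h⟩
    exact ⟨k.rev, by rwa [mem_rotPartial, Fin.rev_rev], by rw [Fin.rev_rev, h, Fin.rev_rev]⟩
  · rintro ⟨k, hk, rfl⟩
    exact ⟨k.rev, mem_rotPartial.1 hk, by rw [Fin.rev_rev]⟩

theorem rotPartial_tail_swap (w : Fin a ≃. Fin b) (s t : Fin a) :
    rotPartial ((swap s t).toPEquiv.trans w) =
      (swap s.rev t.rev).toPEquiv.trans (rotPartial w) := by
  refine pequiv_ext fun i j => ?_
  rw [mem_rotPartial, PEquiv.mem_trans, PEquiv.mem_trans]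
  simp only [Equiv.toPEquiv_apply, Option.mem_some_iff, ← rotPerm_swap, rotPerm_apply,
    exists_eq_left', mem_rotPartial, Fin.rev_rev]

theorem val_rotCompletion_inv (w : Fin a ≃. Fin b) (i : Fin (a + b)) :
    ((rotCompletion w)⁻¹ i).val = a + b - 1 - ((completion (rotPartial w))⁻¹ i.rev).val := by
  rw [rotCompletion, ← rotPerm_inv, rotPerm_apply, Fin.val_rev]; omega

theorem val_rotCompletion (w : Fin a ≃. Fin b) (i : Fin (a + b)) :
    (rotCompletion w i).val = a + b - 1 - (completion (rotPartial w) i.rev).val := by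
  rw [rotCompletion, rotPerm_apply, Fin.val_rev]; omega

theorem rotCompletion_head_swap {w : Fin a ≃. Fin b} {s t : Fin b} (hst : t.val = s.val + 1)
    (h : b ≤ ((rotCompletion w)⁻¹ (botHead a s)).val ∨
      b ≤ ((rotCompletion w)⁻¹ (botHead a t)).val) :
    rotCompletion (w.trans (swap s t).toPEquiv) =
      swap (botHead a s) (botHead a t) * rotCompletion w := by
  rw [val_rotCompletion_inv, val_rotCompletion_inv, rev_botHead, rev_botHead] at h
  rw [rotCompletion, rotPartial_head_swap, swap_comm, completion_head_swap, rotPerm_mul,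
    rotPerm_swap, ← rev_botHead, ← rev_botHead, Fin.rev_rev, Fin.rev_rev, swap_comm]
  · rfl
  · simp only [Fin.val_rev]; omega
  · omega

theorem rot_head_swap_eq_self {w : Fin a ≃. Fin b} {s t : Fin b}
    (h : ¬(b ≤ ((rotCompletion w)⁻¹ (botHead a s)).val ∨
      b ≤ ((rotCompletion w)⁻¹ (botHead a t)).val)) :
    w.trans (swap s t).toPEquiv = w := by
  rw [val_rotCompletion_inv, val_rotCompletion_inv, rev_botHead, rev_botHead] at h
  rw [← rotPartial_rotPartial (w.trans _), rotPartial_head_swap, head_swap_eq_self,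
    rotPartial_rotPartial]
  omega

theorem rotCompletion_tail_swap {w : Fin a ≃. Fin b} {s t : Fin a} (hst : t.val = s.val + 1)
    (h : a ≤ (rotCompletion w (botTail b s)).val ∨ a ≤ (rotCompletion w (botTail b t)).val) :
    rotCompletion ((swap s t).toPEquiv.trans w) =
      rotCompletion w * swap (botTail b s) (botTail b t) := by
  rw [val_rotCompletion, val_rotCompletion, rev_botTail, rev_botTail] at h
  rw [rotCompletion, rotPartial_tail_swap, swap_comm, completion_tail_swap, rotPerm_mul,
    rotPerm_swap, ← rev_botTail, ← rev_botTail, Fin.rev_rev, Fin.rev_rev, swap_comm]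
  · rfl
  · simp only [Fin.val_rev]; omega
  · omega

theorem rot_tail_swap_eq_self {w : Fin a ≃. Fin b} {s t : Fin a}
    (h : ¬(a ≤ (rotCompletion w (botTail b s)).val ∨ a ≤ (rotCompletion w (botTail b t)).val)) :
    (swap s t).toPEquiv.trans w = w := by
  rw [val_rotCompletion, val_rotCompletion, rev_botTail, rev_botTail] at h
  rw [← rotPartial_rotPartial (PEquiv.trans _ w), rotPartial_tail_swap, tail_swap_eq_self,
    rotPartial_rotPartial]
  omega

theorem rotCompletion_virtMono (w : Fin a ≃. Fin b) :
    (∀ i j : Fin (a + b), j.val < b → i < j → rotCompletion w i < rotCompletion w j) ∧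
    (∀ i j : Fin (a + b), j.val < a → i < j → (rotCompletion w)⁻¹ i < (rotCompletion w)⁻¹ j) := by
  have hv := virtMono_completion (rotPartial w)
  rw [rotCompletion, ← rotPerm_inv]
  refine ⟨fun i j hj hij => ?_, fun i j hj hij => ?_⟩
  · rw [rotPerm_apply, rotPerm_apply, Fin.rev_lt_rev]
    exact hv.1 _ _ (by rw [Fin.val_rev]; omega) (Fin.rev_lt_rev.2 hij)
  · rw [rotPerm_apply, rotPerm_apply, Fin.rev_lt_rev]
    exact hv.2 _ _ (by rw [Fin.val_rev]; omega) (Fin.rev_lt_rev.2 hij)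

end

/-! ### Ascents of the Demazure product of a word of blocks -/

theorem sim_snoc_of_desc {W : List ℕ} {a : ℕ} (h : ¬dem W a < dem W (a + 1)) :
    Sim (W ++ [a]) W := by
  rw [Sim, dem_snoc, rstep, if_neg h]

theorem sim_cons_of_desc {W : List ℕ} {a : ℕ} (h : ¬(dem W)⁻¹ a < (dem W)⁻¹ (a + 1)) :
    Sim (a :: W) W := by
  rw [Sim, dem_cons, lstep_eq, if_neg h]

theorem not_asc_of_rstep {u : Perm ℕ} {r : ℕ} (h : u = rstep u r) : ¬u r < u (r + 1) := by
  rw [h]; exact (rstep_desc u r).not_gt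

theorem not_asc_of_lstep {u : Perm ℕ} {r : ℕ} (h : u = lstep r u) : ¬u⁻¹ r < u⁻¹ (r + 1) := by
  rw [h]; exact (lstep_desc u r).not_gt

namespace Frame

variable (F : Frame)

/-- Ascents inside the block rows. -/
structure RowAsc (u : Perm ℕ) : Prop where
  y : ∀ k ≤ F.n, ∀ i, i + 1 < F.ey k → u (F.Y k + i) < u (F.Y k + i + 1)
  x : ∀ k < F.n, ∀ i, i + 1 < F.ex k → u (F.D + F.X (k + 1) + i) < u (F.D + F.X (k + 1) + i + 1)

/-- Ascents inside the block columns. -/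
structure ColAsc (u : Perm ℕ) : Prop where
  y : ∀ k ≤ F.n, ∀ i, i + 1 < F.ey k → u⁻¹ (F.X 0 + F.Y k + i) < u⁻¹ (F.X 0 + F.Y k + i + 1)
  x : ∀ k < F.n, ∀ i, i + 1 < F.ex k → u⁻¹ (F.X (k + 1) + i) < u⁻¹ (F.X (k + 1) + i + 1)

/-- Ascents at the virtual dots of the blocks. -/
structure VirtAsc (A B : ℕ → Perm ℕ) : Prop where
  pending : ∀ k < F.n, ∀ i, i + 1 < F.ey k → A k (F.oA k + i) < A k (F.oA k + i + 1)
  outs : ∀ k < F.n, ∀ i, i + 1 < F.ex k → (A k)⁻¹ (F.oA k + i) < (A k)⁻¹ (F.oA k + i + 1)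
  ins : ∀ k < F.n, ∀ i, i + 1 < F.ex k →
    B k (F.oB k + F.ey (k + 1) + i) < B k (F.oB k + F.ey (k + 1) + i + 1)
  done : ∀ k < F.n, ∀ i, i + 1 < F.ey (k + 1) →
    (B k)⁻¹ (F.oB k + F.ex k + i) < (B k)⁻¹ (F.oB k + F.ex k + i + 1)

/-- Ascents at the dots of the first column. -/
def FirstAsc (B : ℕ → Perm ℕ) : Prop :=
  ∀ k, k + 1 = F.n → ∀ i, i + 1 < F.ey (k + 1) → B k (F.oB k + i) < B k (F.oB k + i + 1)

/-- Ascents at the dots of the last column. -/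
def LastAsc (A : ℕ → Perm ℕ) : Prop :=
  0 < F.n → ∀ i, i + 1 < F.ey 0 →
    (A 0)⁻¹ (F.oA 0 + F.ex 0 + i) < (A 0)⁻¹ (F.oA 0 + F.ex 0 + i + 1)

variable {F} {A B : ℕ → Perm ℕ} {wA wB : ℕ → List ℕ}

theorem dem_totWord_congr {wA' wB' : ℕ → List ℕ}
    (h : ∀ k < F.n, Sim (wA k) (wA' k) ∧ Sim (wB k) (wB' k)) :
    dem (F.totWord wA wB) = dem (F.totWord wA' wB') :=
  sim_preWord h

theorem dem_update_left_of_sim {k : ℕ} {U : List ℕ} (h : Sim U (wA k)) :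
    dem (F.totWord (Function.update wA k U) wB) = dem (F.totWord wA wB) := by
  refine dem_totWord_congr fun j _ => ⟨?_, Sim.refl _⟩
  by_cases hj : j = k
  · subst hj; rwa [Function.update_self]
  · rw [Function.update_of_ne hj]; exact Sim.refl _

theorem dem_update_right_of_sim {k : ℕ} {U : List ℕ} (h : Sim U (wB k)) :
    dem (F.totWord wA (Function.update wB k U)) = dem (F.totWord wA wB) := by
  refine dem_totWord_congr fun j _ => ⟨Sim.refl _, ?_⟩
  by_cases hj : j = k
  · subst hj; rwa [Function.update_self]
  · rw [Function.update_of_ne hj]; exact Sim.refl _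

/-- If the block had a descent at these virtual dots, one more generator there would be absorbed.
But this generator slides to the edge of the grid, where it would raise an ascent of the total
product. The three lemmas after this one repeat the argument at the other kinds of virtual dots. -/
theorem pending_of_rowAsc (hb : F.Bounded wA wB) (hA : ∀ k < F.n, dem (wA k) = A k)
    (hr : F.RowAsc (dem (F.totWord wA wB))) {k i : ℕ} (hk : k < F.n) (hi : i + 1 < F.ey k) :
    A k (F.oA k + i) < A k (F.oA k + i + 1) := by
  rw [← hA k hk]
  by_contra hc
  have h := dem_update_pending hb hk hi
  rw [dem_update_left_of_sim (sim_snoc_of_desc hc)] at h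
  exact not_asc_of_rstep h (hr.y k hk.le i hi)

theorem ins_of_rowAsc (hb : F.Bounded wA wB) (hB : ∀ k < F.n, dem (wB k) = B k)
    (hr : F.RowAsc (dem (F.totWord wA wB))) {k i : ℕ} (hk : k < F.n) (hi : i + 1 < F.ex k) :
    B k (F.oB k + F.ey (k + 1) + i) < B k (F.oB k + F.ey (k + 1) + i + 1) := by
  rw [← hB k hk]
  by_contra hc
  have h := dem_update_ins hb hk hi
  rw [dem_update_right_of_sim (sim_snoc_of_desc hc)] at h
  exact not_asc_of_rstep h (hr.x k hk i hi)

theorem outs_of_colAsc (hb : F.Bounded wA wB) (hA : ∀ k < F.n, dem (wA k) = A k)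
    (hr : F.ColAsc (dem (F.totWord wA wB))) {k i : ℕ} (hk : k < F.n) (hi : i + 1 < F.ex k) :
    (A k)⁻¹ (F.oA k + i) < (A k)⁻¹ (F.oA k + i + 1) := by
  rw [← hA k hk]
  by_contra hc
  have h := dem_update_outs hb hk hi
  rw [dem_update_left_of_sim (sim_cons_of_desc hc)] at h
  exact not_asc_of_lstep h (hr.x k hk i hi)

theorem done_of_colAsc (hb : F.Bounded wA wB) (hB : ∀ k < F.n, dem (wB k) = B k)
    (hr : F.ColAsc (dem (F.totWord wA wB))) {k i : ℕ} (hk : k < F.n) (hi : i + 1 < F.ey (k + 1)) :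
    (B k)⁻¹ (F.oB k + F.ex k + i) < (B k)⁻¹ (F.oB k + F.ex k + i + 1) := by
  rw [← hB k hk]
  by_contra hc
  have h := dem_update_done hb hk hi
  rw [dem_update_right_of_sim (sim_cons_of_desc hc)] at h
  exact not_asc_of_lstep h (hr.y (k + 1) hk i hi)

theorem virtAsc_of_asc (hb : F.Bounded wA wB) (hA : ∀ k < F.n, dem (wA k) = A k)
    (hB : ∀ k < F.n, dem (wB k) = B k) (hr : F.RowAsc (dem (F.totWord wA wB)))
    (hc : F.ColAsc (dem (F.totWord wA wB))) : F.VirtAsc A B where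
  pending _ hk _ hi := pending_of_rowAsc hb hA hr hk hi
  outs _ hk _ hi := outs_of_colAsc hb hA hc hk hi
  ins _ hk _ hi := ins_of_rowAsc hb hB hr hk hi
  done _ hk _ hi := done_of_colAsc hb hB hc hk hi

/-- When both words are reduced and one is longer by one letter, the extra generator must have
acted, so it met an ascent. -/
theorem isRed_update_lt {U V : List ℕ} {x y : Perm ℕ} {r : ℕ} (hU : IsRed U x) (hV : IsRed V y)
    (hl : V.length = U.length + 1) (h : dem V = rstep (dem U) r) : dem U r < dem U (r + 1) := by
  by_contra hc
  rw [rstep, if_neg hc, hU.dem_eq, hV.dem_eq] at h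
  subst h
  have := hU.length_eq hV
  omega

theorem isRed_update_lt' {U V : List ℕ} {x y : Perm ℕ} {r : ℕ} (hU : IsRed U x) (hV : IsRed V y)
    (hl : V.length = U.length + 1) (h : dem V = lstep r (dem U)) :
    (dem U)⁻¹ r < (dem U)⁻¹ (r + 1) := by
  by_contra hc
  rw [lstep_eq, if_neg hc, hU.dem_eq, hV.dem_eq] at h
  subst h
  have := hU.length_eq hV
  omega

theorem isRed_update {w : ℕ → List ℕ} {C : ℕ → Perm ℕ} (h : ∀ k < F.n, IsRed (w k) (C k))
    {k : ℕ} {V : List ℕ} {v : Perm ℕ} (hV : IsRed V v) :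
    ∀ j < F.n, IsRed (Function.update w k V j) (Function.update C k v j) := by
  intro j hj
  by_cases hjk : j = k
  · subst hjk; rwa [Function.update_self, Function.update_self]
  · rw [Function.update_of_ne hjk, Function.update_of_ne hjk]; exact h j hj

theorem length_totWord_update_left {k : ℕ} (hk : k < F.n) (V : List ℕ) :
    (F.totWord (Function.update wA k V) wB).length + (wA k).length =
      (F.totWord wA wB).length + V.length := by
  rw [totWord_update_left hk, totWord_split hk]
  simp only [List.length_append]; omega

theorem length_totWord_update_right {k : ℕ} (hk : k < F.n) (V : List ℕ) :
    (F.totWord wA (Function.update wB k V)).length + (wB k).length =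
      (F.totWord wA wB).length + V.length := by
  rw [totWord_update_right hk, totWord_split hk]
  simp only [List.length_append]; omega

theorem Supported.update_left (hs : F.Supported A B) {k : ℕ} {v : Perm ℕ}
    (h : ∀ p, p < F.oA k ∨ F.oA k + (F.ey k + F.ex k) ≤ p → v p = p) :
    F.Supported (Function.update A k v) B where
  left j hj p hp := by
    by_cases hjk : j = k
    · subst hjk; rw [Function.update_self]; exact h p hp
    · rw [Function.update_of_ne hjk]; exact hs.left j hj p hp
  right := hs.right

theorem Supported.update_right (hs : F.Supported A B) {k : ℕ} {v : Perm ℕ}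
    (h : ∀ p, p < F.oB k ∨ F.oB k + (F.ey (k + 1) + F.ex k) ≤ p → v p = p) :
    F.Supported A (Function.update B k v) where
  left := hs.left
  right j hj p hp := by
    by_cases hjk : j = k
    · subst hjk; rw [Function.update_self]; exact h p hp
    · rw [Function.update_of_ne hjk]; exact hs.right j hj p hp

theorem LeftMono.update_left (hm : F.LeftMono A B) {k : ℕ} {v : Perm ℕ}
    (h : ∀ p q, F.oA k + F.ey k ≤ p → p < q → q < F.oA k + F.ey k + F.ex k → v p < v q) :
    F.LeftMono (Function.update A k v) B where
  left j hj p q h1 h2 h3 := by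
    by_cases hjk : j = k
    · subst hjk; rw [Function.update_self]; exact h p q h1 h2 h3
    · rw [Function.update_of_ne hjk]; exact hm.left j hj p q h1 h2 h3
  right := hm.right

theorem LeftMono.update_right (hm : F.LeftMono A B) {k : ℕ} {v : Perm ℕ}
    (h : k + 1 < F.n → ∀ p q, F.oB k ≤ p → p < q → q < F.oB k + F.ey (k + 1) → v p < v q) :
    F.LeftMono A (Function.update B k v) where
  left := hm.left
  right j hj p q h1 h2 h3 := by
    by_cases hjk : j = k
    · subst hjk; rw [Function.update_self]; exact h hj p q h1 h2 h3
    · rw [Function.update_of_ne hjk]; exact hm.right j hj p q h1 h2 h3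

theorem RightMono.update_left (hm : F.RightMono A B) {k : ℕ} {v : Perm ℕ}
    (h : 0 < k → ∀ p q, F.oA k + F.ex k ≤ p → p < q → q < F.oA k + F.ex k + F.ey k →
      v⁻¹ p < v⁻¹ q) : F.RightMono (Function.update A k v) B where
  left j hj h0 p q h1 h2 h3 := by
    by_cases hjk : j = k
    · subst hjk; rw [Function.update_self]; exact h h0 p q h1 h2 h3
    · rw [Function.update_of_ne hjk]; exact hm.left j hj h0 p q h1 h2 h3
  right := hm.right

theorem RightMono.update_right (hm : F.RightMono A B) {k : ℕ} {v : Perm ℕ}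
    (h : ∀ p q, F.oB k ≤ p → p < q → q < F.oB k + F.ex k → v⁻¹ p < v⁻¹ q) :
    F.RightMono A (Function.update B k v) where
  left := hm.left
  right j hj p q h1 h2 h3 := by
    by_cases hjk : j = k
    · subst hjk; rw [Function.update_self]; exact h p q h1 h2 h3
    · rw [Function.update_of_ne hjk]; exact hm.right j hj p q h1 h2 h3

theorem mul_swap_fix {u : Perm ℕ} {o l a : ℕ} (h : ∀ p, p < o ∨ o + l ≤ p → u p = p) (ha : o ≤ a)
    (ha' : a + 1 < o + l) : ∀ p, p < o ∨ o + l ≤ p → (u * swap a (a + 1)) p = p := by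
  intro p hp
  rw [Perm.mul_apply, swap_apply_of_ne_of_ne (by omega) (by omega), h p hp]

theorem swap_mul_fix {u : Perm ℕ} {o l a : ℕ} (h : ∀ p, p < o ∨ o + l ≤ p → u p = p) (ha : o ≤ a)
    (ha' : a + 1 < o + l) : ∀ p, p < o ∨ o + l ≤ p → (swap a (a + 1) * u) p = p := by
  intro p hp
  rw [Perm.mul_apply, h p hp, swap_apply_of_ne_of_ne (by omega) (by omega)]

theorem mul_swap_apply {u : Perm ℕ} {a p : ℕ} (h : p < a ∨ a + 1 < p) :
    (u * swap a (a + 1)) p = u p := by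
  rw [Perm.mul_apply, swap_apply_of_ne_of_ne (by omega) (by omega)]

theorem swap_mul_inv_apply {u : Perm ℕ} {a p : ℕ} (h : p < a ∨ a + 1 < p) :
    (swap a (a + 1) * u)⁻¹ p = u⁻¹ p := by
  rw [mul_inv_rev, swap_inv, Perm.mul_apply, swap_apply_of_ne_of_ne (by omega) (by omega)]

/-- A generator in a block row of the product corresponds to a letter behind some block, at inputs
that are virtual or belong to the first column. Adding the letter preserves `LeftMono`, so the
longer word is still reduced and the product must ascend there. -/
theorem rowAsc_of_leftMono (hb : F.Bounded wA wB) (hA : ∀ k < F.n, IsRed (wA k) (A k))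
    (hB : ∀ k < F.n, IsRed (wB k) (B k)) (hs : F.Supported A B) (hm : F.LeftMono A B)
    (hv : F.VirtAsc A B) (hf : F.FirstAsc B) : F.RowAsc (dem (F.totWord wA wB)) := by
  have hU := isRed_totWord_of_leftMono hA hB hs hm
  refine ⟨fun k hk i hi => ?_, fun k hk i hi => ?_⟩
  · rcases hk.lt_or_eq with hk | rfl
    · have hV := IsRed.snoc (hA k hk) (hv.pending k hk i hi)
      refine isRed_update_lt hU (isRed_totWord_of_leftMono (isRed_update hA hV) hB
        (hs.update_left (mul_swap_fix (hs.left k hk) (by omega) (by omega))) (hm.update_left ?_))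
        ?_ (dem_update_pending hb hk hi)
      · intro p q h1 h2 h3
        rw [mul_swap_apply (by omega), mul_swap_apply (by omega)]
        exact hm.left k hk p q h1 h2 h3
      · have := length_totWord_update_left (wA := wA) (wB := wB) hk (wA k ++ [F.oA k + i])
        rw [List.length_append, List.length_singleton] at this
        omega
    · rcases Nat.eq_zero_or_pos F.n with h0 | h0
      · have : F.totWord wA wB = [] := by simp [totWord, preWord, h0]
        rw [this, dem_nil, Perm.one_apply, Perm.one_apply]; omega
      · obtain ⟨k, hk⟩ : ∃ k, F.n = k + 1 := ⟨F.n - 1, by omega⟩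
        have hk' : k < F.n := by omega
        have hi' : i + 1 < F.ey (k + 1) := hk ▸ hi
        have hV := IsRed.snoc (hB k hk') (hf k hk.symm i hi')
        refine isRed_update_lt hU (isRed_totWord_of_leftMono hA (isRed_update hB hV)
          (hs.update_right (mul_swap_fix (hs.right k hk') (by omega) (by omega)))
          (hm.update_right fun h => by omega)) ?_ (dem_update_first hk)
        have := length_totWord_update_right (wA := wA) (wB := wB) hk' (wB k ++ [F.oB k + i])
        rw [List.length_append, List.length_singleton] at this
        omega
  · have hV := IsRed.snoc (hB k hk) (hv.ins k hk i hi)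
    refine isRed_update_lt hU (isRed_totWord_of_leftMono hA (isRed_update hB hV)
      (hs.update_right (mul_swap_fix (hs.right k hk) (by omega) (by omega)))
      (hm.update_right fun h => ?_)) ?_ (dem_update_ins hb hk hi)
    · intro p q h1 h2 h3
      rw [mul_swap_apply (by omega), mul_swap_apply (by omega)]
      exact hm.right k h p q h1 h2 h3
    · have := length_totWord_update_right (wA := wA) (wB := wB) hk
        (wB k ++ [F.oB k + F.ey (k + 1) + i])
      rw [List.length_append, List.length_singleton] at this
      omega

/-- The mirror image: generators of block columns are letters in front of a block, at virtual
outputs or at the outputs in the last column. -/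
theorem colAsc_of_rightMono (hb : F.Bounded wA wB) (hA : ∀ k < F.n, IsRed (wA k) (A k))
    (hB : ∀ k < F.n, IsRed (wB k) (B k)) (hs : F.Supported A B) (hm : F.RightMono A B)
    (hv : F.VirtAsc A B) (hf : F.LastAsc A) : F.ColAsc (dem (F.totWord wA wB)) := by
  have hU := isRed_totWord_of_rightMono hA hB hs hm
  refine ⟨fun k hk i hi => ?_, fun k hk i hi => ?_⟩
  · rcases Nat.eq_zero_or_pos k with rfl | h0
    · rcases Nat.eq_zero_or_pos F.n with h0 | h0
      · have : F.totWord wA wB = [] := by simp [totWord, preWord, h0]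
        rw [this, dem_nil, inv_one, Perm.one_apply, Perm.one_apply]; omega
      · have hV := (hA 0 h0).cons_iff (hf h0 i hi)
        rw [F.Y_zero, add_zero]
        refine isRed_update_lt' hU (isRed_totWord_of_rightMono (isRed_update hA hV) hB
          (hs.update_left (swap_mul_fix (hs.left 0 h0) (by omega) (by omega)))
          (hm.update_left fun h => by omega)) ?_ (dem_update_last h0)
        have := length_totWord_update_left (wA := wA) (wB := wB) h0
          ((F.oA 0 + F.ex 0 + i) :: wA 0)
        rw [List.length_cons] at this
        omega
    · obtain ⟨k, rfl⟩ : ∃ j, k = j + 1 := ⟨k - 1, by omega⟩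
      have hV := (hB k hk).cons_iff (hv.done k hk i hi)
      refine isRed_update_lt' hU (isRed_totWord_of_rightMono hA (isRed_update hB hV)
        (hs.update_right (swap_mul_fix (hs.right k hk) (by omega) (by omega)))
        (hm.update_right ?_)) ?_ (dem_update_done hb hk hi)
      · intro p q h1 h2 h3
        rw [swap_mul_inv_apply (by omega), swap_mul_inv_apply (by omega)]
        exact hm.right k hk p q h1 h2 h3
      · have := length_totWord_update_right (wA := wA) (wB := wB) hk
          ((F.oB k + F.ex k + i) :: wB k)
        rw [List.length_cons] at this
        omega
  · have hV := (hA k hk).cons_iff (hv.outs k hk i hi)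
    refine isRed_update_lt' hU (isRed_totWord_of_rightMono (isRed_update hA hV) hB
      (hs.update_left (swap_mul_fix (hs.left k hk) (by omega) (by omega)))
      (hm.update_left fun h => ?_)) ?_ (dem_update_outs hb hk hi)
    · intro p q h1 h2 h3
      rw [swap_mul_inv_apply (by omega), swap_mul_inv_apply (by omega)]
      exact hm.left k hk h p q h1 h2 h3
    · have := length_totWord_update_left (wA := wA) (wB := wB) hk
        ((F.oA k + i) :: wA k)
      rw [List.length_cons] at this
      omega

end Frame

/-! ### The frame of a dimension vector -/

section

variable {n : ℕ} (dy : Fin (n + 1) → ℕ) (dx : Fin n → ℕ)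

/-- A dimension vector, extended by zero. -/
def frame : Frame where
  n := n
  ey i := if h : i < n + 1 then dy ⟨i, h⟩ else 0
  ex k := if h : k < n then dx ⟨k, h⟩ else 0

theorem frame_n : (frame dy dx).n = n := rfl

theorem frame_ey (i : Fin (n + 1)) : (frame dy dx).ey i = dy i := dif_pos i.isLt

theorem frame_ey_castSucc (k : Fin n) : (frame dy dx).ey k = dy k.castSucc :=
  frame_ey dy dx k.castSucc

theorem frame_ey_succ (k : Fin n) : (frame dy dx).ey (k + 1) = dy k.succ :=
  frame_ey dy dx k.succ

theorem frame_ex (k : Fin n) : (frame dy dx).ex k = dx k := dif_pos k.isLt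

theorem sum_Iio_dy (i : Fin (n + 1)) : ∑ j ∈ Finset.Iio i, dy j = (frame dy dx).Y i := by
  refine Finset.sum_bij (fun j _ => j.val) ?_ (fun _ _ _ _ h => Fin.ext h) ?_
    (fun j _ => (frame_ey dy dx j).symm)
  · intro j hj
    rw [Finset.mem_Iio, Fin.lt_def] at hj
    rwa [Finset.mem_range]
  · intro j hj
    rw [Finset.mem_range] at hj
    exact ⟨⟨j, by omega⟩, by rwa [Finset.mem_Iio, Fin.lt_def], rfl⟩

theorem sum_Ioi_dx (k : Fin n) : ∑ j ∈ Finset.Ioi k, dx j = (frame dy dx).X (k + 1) := by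
  refine Finset.sum_bij (fun j _ => j.val) ?_ (fun _ _ _ _ h => Fin.ext h) ?_
    (fun j _ => (frame_ex dy dx j).symm)
  · intro j hj
    rw [Finset.mem_Ioi, Fin.lt_def] at hj
    rw [Finset.mem_Ico]
    exact ⟨hj, j.isLt⟩
  · intro j hj
    rw [Finset.mem_Ico] at hj
    exact ⟨⟨j, hj.2⟩, by rw [Finset.mem_Ioi, Fin.lt_def]; exact hj.1, rfl⟩

theorem sum_dy : ∑ i, dy i = (frame dy dx).D := by
  rw [Frame.D, Frame.Y, frame_n, ← Fin.sum_univ_eq_sum_range]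
  exact Finset.sum_congr rfl fun i _ => (frame_ey dy dx i).symm

theorem sum_dx : ∑ k, dx k = (frame dy dx).X 0 := by
  rw [Frame.X, frame_n, ← Finset.range_eq_Ico, ← Fin.sum_univ_eq_sum_range]
  exact Finset.sum_congr rfl fun k _ => (frame_ex dy dx k).symm

theorem rowOffset_inl (i : Fin (n + 1)) : rowOffset dy dx (Sum.inl i) = (frame dy dx).Y i :=
  sum_Iio_dy dy dx i

theorem rowOffset_inr (k : Fin n) :
    rowOffset dy dx (Sum.inr k) = (frame dy dx).D + (frame dy dx).X (k + 1) := by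
  rw [rowOffset, sum_Ioi_dx dy, sum_dy dy dx]

theorem colOffset_inl (i : Fin (n + 1)) :
    colOffset dy dx (Sum.inl i) = (frame dy dx).X 0 + (frame dy dx).Y i := by
  rw [colOffset, sum_dx dy, sum_Iio_dy dy dx]

theorem colOffset_inr (k : Fin n) : colOffset dy dx (Sum.inr k) = (frame dy dx).X (k + 1) :=
  sum_Ioi_dx dy dx k

end

section

variable {n : ℕ} {dy : Fin (n + 1) → ℕ} {dx : Fin n → ℕ}

namespace PermTuple

variable (c : PermTuple dy dx)

/-- The reduced words of the blocks `α`. -/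
noncomputable def wordA (k : ℕ) : List ℕ :=
  if h : k < n then redWord ((frame dy dx).oA k) (c.α ⟨k, h⟩)⁻¹ else []

/-- The reduced words of the blocks `β`. -/
noncomputable def wordB (k : ℕ) : List ℕ :=
  if h : k < n then redWord ((frame dy dx).oB k) (c.β ⟨k, h⟩) else []

/-- The permutations of the blocks `α`. -/
def permA (k : ℕ) : Perm ℕ :=
  if h : k < n then emb ((frame dy dx).oA k) (c.α ⟨k, h⟩)⁻¹ else 1

/-- The permutations of the blocks `β`. -/
def permB (k : ℕ) : Perm ℕ :=
  if h : k < n then emb ((frame dy dx).oB k) (c.β ⟨k, h⟩) else 1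

/-- The Demazure product of the blocks. -/
noncomputable def total : Perm ℕ := dem ((frame dy dx).totWord c.wordA c.wordB)

theorem wordA_eq (k : Fin n) : c.wordA k = redWord ((frame dy dx).oA k) (c.α k)⁻¹ := dif_pos k.isLt

theorem wordB_eq (k : Fin n) : c.wordB k = redWord ((frame dy dx).oB k) (c.β k) := dif_pos k.isLt

theorem permA_eq (k : Fin n) : c.permA k = emb ((frame dy dx).oA k) (c.α k)⁻¹ := dif_pos k.isLt

theorem permB_eq (k : Fin n) : c.permB k = emb ((frame dy dx).oB k) (c.β k) := dif_pos k.isLt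

theorem isRed_wordA (k : ℕ) (hk : k < (frame dy dx).n) : IsRed (c.wordA k) (c.permA k) := by
  obtain ⟨k, rfl⟩ : ∃ j : Fin n, k = j := ⟨⟨k, hk⟩, rfl⟩
  rw [wordA_eq, permA_eq]; exact redWord_isRed _ _

theorem isRed_wordB (k : ℕ) (hk : k < (frame dy dx).n) : IsRed (c.wordB k) (c.permB k) := by
  obtain ⟨k, rfl⟩ : ∃ j : Fin n, k = j := ⟨⟨k, hk⟩, rfl⟩
  rw [wordB_eq, permB_eq]; exact redWord_isRed _ _

theorem dem_wordA (k : ℕ) (hk : k < (frame dy dx).n) : dem (c.wordA k) = c.permA k :=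
  (c.isRed_wordA k hk).dem_eq

theorem dem_wordB (k : ℕ) (hk : k < (frame dy dx).n) : dem (c.wordB k) = c.permB k :=
  (c.isRed_wordB k hk).dem_eq

theorem bounded : (frame dy dx).Bounded c.wordA c.wordB := by
  intro k hk
  obtain ⟨k, rfl⟩ : ∃ j : Fin n, k = j := ⟨⟨k, hk⟩, rfl⟩
  rw [wordA_eq, wordB_eq, frame_ey_castSucc, frame_ey_succ, frame_ex, add_assoc, add_assoc]
  exact ⟨fun a ha => redWord_mem ha, fun a ha => redWord_mem ha⟩

theorem supported : (frame dy dx).Supported c.permA c.permB := by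
  constructor <;> intro k hk p hp <;> obtain ⟨k, rfl⟩ : ∃ j : Fin n, k = j := ⟨⟨k, hk⟩, rfl⟩
  · rw [frame_ey_castSucc, frame_ex] at hp
    rw [permA_eq, emb_out _ hp]
  · rw [frame_ey_succ, frame_ex] at hp
    rw [permB_eq, emb_out _ hp]

theorem length_wordA (k : Fin n) : (c.wordA k).length = permLength (c.α k) := by
  rw [wordA_eq, (redWord_isRed _ _).length_emb, permLength_inv]

theorem length_wordB (k : Fin n) : (c.wordB k).length = permLength (c.β k) := by
  rw [wordB_eq, (redWord_isRed _ _).length_emb]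

theorem total_eq {wA wB : ℕ → List ℕ} (hA : ∀ k < (frame dy dx).n, dem (wA k) = c.permA k)
    (hB : ∀ k < (frame dy dx).n, dem (wB k) = c.permB k) :
    dem ((frame dy dx).totWord wA wB) = c.total :=
  Frame.dem_totWord_congr fun k hk =>
    ⟨(hA k hk).trans (c.dem_wordA k hk).symm, (hB k hk).trans (c.dem_wordB k hk).symm⟩

end PermTuple

/-! ### Extended lacing diagrams as tuples increasing at virtual dots -/

theorem emb_lt_succ {m o i : ℕ} {u : Perm (Fin m)} (h : i + 1 < m) :
    emb o u (o + i) < emb o u (o + i + 1) ↔ u ⟨i, by omega⟩ < u ⟨i + 1, h⟩ :=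
  emb_lt_iff o u ⟨i, by omega⟩ ⟨i + 1, h⟩

theorem emb_inv_lt_succ {m o i : ℕ} {u : Perm (Fin m)} (h : i + 1 < m) :
    (emb o u)⁻¹ (o + i) < (emb o u)⁻¹ (o + i + 1) ↔ u⁻¹ ⟨i, by omega⟩ < u⁻¹ ⟨i + 1, h⟩ := by
  rw [← emb_inv, emb_lt_succ h]

theorem Laces.virtAsc (w : Laces dy dx) :
    (frame dy dx).VirtAsc w.extended.permA w.extended.permB := by
  constructor <;> intro k hk i hi <;> obtain ⟨k, rfl⟩ : ∃ j : Fin n, k = j := ⟨⟨k, hk⟩, rfl⟩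
  · rw [frame_ey_castSucc] at hi
    rw [PermTuple.permA_eq, emb_lt_succ (by omega)]
    exact (rotCompletion_virtMono (w.α k)).2 _ _ hi (by simp)
  · rw [frame_ex] at hi
    rw [PermTuple.permA_eq, emb_inv_lt_succ (by omega), inv_inv]
    exact (rotCompletion_virtMono (w.α k)).1 _ _ hi (by simp)
  · rw [frame_ex] at hi
    rw [frame_ey_succ, PermTuple.permB_eq, add_assoc, emb_lt_succ (by omega)]
    exact (virtMono_completion (w.β k)).1 _ _ (by simp) (by rw [Fin.lt_def]; simp)
  · rw [frame_ey_succ] at hi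
    rw [frame_ex, PermTuple.permB_eq, add_assoc, emb_inv_lt_succ (by omega)]
    exact (virtMono_completion (w.β k)).2 _ _ (by simp) (by rw [Fin.lt_def]; simp)

/-- The truncation of a tuple of extended diagrams. -/
def PermTuple.truncate (c : PermTuple dy dx) : Laces dy dx where
  β k := trunc (c.β k)
  α k := rotPartial (trunc (rotPerm (c.α k)))

/-- Permutations increasing at virtual dots are completions of their corners. So truncation loses
nothing on such tuples, which is what makes `LD` injective on `X_Ω`. -/
theorem PermTuple.extended_truncate {c : PermTuple dy dx}
    (h : (frame dy dx).VirtAsc c.permA c.permB) : c.truncate.extended = c := by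
  ext1
  · funext k
    refine completion_eq rfl ⟨lt_of_adjacent fun s t hs hst => ?_,
      lt_of_adjacent fun s t hs hst => ?_⟩
    · have := h.ins k k.isLt (s.val - dy k.succ) (by rw [frame_ex]; omega)
      rw [frame_ey_succ, permB_eq, add_assoc, emb_lt_succ (by omega)] at this
      convert this using 2 <;> exact Fin.ext (by simp; omega)
    · have := h.done k k.isLt (s.val - dx k) (by rw [frame_ey_succ]; omega)
      rw [frame_ex, permB_eq, add_assoc, emb_inv_lt_succ (by omega)] at this
      convert this using 2 <;> exact Fin.ext (by simp; omega)
  · funext k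
    change rotPerm (completion (rotPartial (rotPartial (trunc (rotPerm (c.α k)))))) = c.α k
    rw [rotPartial_rotPartial, completion_eq rfl, rotPerm_rotPerm]
    refine ⟨lt_of_adjacent fun s t hs hst => ?_, lt_of_adjacent fun s t hs hst => ?_⟩
    · have := h.outs k k.isLt t.rev.val (by rw [frame_ex, Fin.val_rev]; omega)
      rw [permA_eq, emb_inv_lt_succ (by rw [Fin.val_rev]; omega), inv_inv] at this
      rw [rotPerm_apply, rotPerm_apply, Fin.rev_lt_rev]
      convert this using 2
      exact Fin.ext (by simp only [Fin.val_rev]; omega)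
    · have := h.pending k k.isLt t.rev.val (by rw [frame_ey_castSucc, Fin.val_rev]; omega)
      rw [permA_eq, emb_lt_succ (by rw [Fin.val_rev]; omega)] at this
      rw [← rotPerm_inv, rotPerm_apply, rotPerm_apply, Fin.rev_lt_rev]
      convert this using 2
      exact Fin.ext (by simp only [Fin.val_rev]; omega)

/-- The Demazure product of the extended lacing diagram. -/
noncomputable def Laces.total (w : Laces dy dx) : Perm ℕ := w.extended.total

/-! ### Pipe dreams and lacing diagrams -/

/-- No `1`s in the northwest and southeast corners. -/
structure Frame.CornerZero (F : Frame) (u : Perm ℕ) : Prop where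
  nw : ∀ k < F.n, ∀ i < F.Y k, F.X k ≤ u i
  se : ∀ k < F.n, ∀ i, F.D + F.X (k + 1) ≤ i → i < F.D + F.X 0 → u i < F.X 0 + F.Y (k + 2)

/-- All crosses in the northwest and southeast corners. -/
structure Frame.CornerFull (F : Frame) (P : Finset (ℕ × ℕ)) : Prop where
  nw : ∀ k < F.n, ∀ i < F.Y k, ∀ j < F.ex k, (i, F.X (k + 1) + j) ∈ P
  se : ∀ k < F.n, ∀ i, F.Y (k + 2) ≤ i → i < F.D → ∀ j < F.ex k, (i, F.X (k + 1) + j) ∈ P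

/-- A missing cross in a corner of the grid would put a value where the permutation has an empty
block. -/
theorem Frame.cornerFull_of_cornerZero {F : Frame} {P : Finset (ℕ × ℕ)}
    (h : F.CornerZero (dem (pipeWord F.D (F.X 0) P))) : F.CornerFull P := by
  constructor
  · intro k hk i hi j hj
    by_contra hc
    have h1 := F.Y_le_D (show k ≤ F.n + 1 by omega)
    obtain ⟨i', hi', h2⟩ := exists_le_of_notMem (D := F.D) (E := F.X 0) (by omega) hc
    have h3 := h.nw k hk i' (by omega)
    have h4 := F.X_succ hk
    omega
  · intro k hk i hi hi' j hj
    by_contra hc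
    have h4 := F.X_succ hk
    have h5 := F.X_anti (Nat.zero_le k)
    obtain ⟨i', h1, h2, h3⟩ := exists_ge_of_notMem (D := F.D) (E := F.X 0) hi' (by omega) hc
    have := h.se k hk i' (by omega) h2
    omega

theorem Frame.sim_blockWord_col {F : Frame} {P : Finset (ℕ × ℕ)} (h : F.CornerFull P) {k : ℕ}
    (hk : k < F.n) : blockWord P 0 (F.X (k + 1)) F.D (F.ex k) =
      F.colWord (fun k => blockWord P (F.Y k) (F.X (k + 1)) (F.ey k) (F.ex k))
        (fun k => blockWord P (F.Y (k + 1)) (F.X (k + 1)) (F.ey (k + 1)) (F.ex k)) k := by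
  have h2 := F.Y_succ k
  have h3 := F.Y_succ (k + 1)
  have h4 := F.Y_le_D (show k + 2 ≤ F.n + 1 by omega)
  have e : F.D = F.Y k + (F.ey k + (F.ey (k + 1) + (F.D - F.Y (k + 2)))) := by
    rw [show k + 1 + 1 = k + 2 by rfl] at h3
    omega
  rw [Frame.colWord]
  conv_lhs => rw [e]
  rw [blockWord_add_rows, blockWord_add_rows, blockWord_add_rows, zero_add, ← h2, ← h3,
    blockWord_full (r := 0), blockWord_full (r := F.Y (k + 1 + 1))]
  · rfl
  · intro i hi j hj
    exact h.se k hk _ (by omega) (by rw [show k + 1 + 1 = k + 2 by rfl]; omega) j hj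
  · intro i hi j hj
    rw [zero_add]
    exact h.nw k hk i hi j hj

/-- Block columns are split off from right to left by `sim_blockWord_add`; with all crosses outside
the snake, each one reads as a northwest rectangle, α_k, β_k and a southeast rectangle. -/
theorem Frame.dem_pipeWord_eq {F : Frame} {P : Finset (ℕ × ℕ)} (h : F.CornerFull P) :
    dem (pipeWord F.D (F.X 0) P) =
      dem (F.totWord (fun k => blockWord P (F.Y k) (F.X (k + 1)) (F.ey k) (F.ex k))
        (fun k => blockWord P (F.Y (k + 1)) (F.X (k + 1)) (F.ey (k + 1)) (F.ex k))) := by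
  rw [pipeWord_eq, Frame.totWord_eq_sufWord]
  have key : ∀ d k, F.n = k + d → Sim (blockWord P 0 0 F.D (F.X k))
      (F.sufWord (fun k => blockWord P (F.Y k) (F.X (k + 1)) (F.ey k) (F.ex k))
        (fun k => blockWord P (F.Y (k + 1)) (F.X (k + 1)) (F.ey (k + 1)) (F.ex k)) k) := by
    intro d
    induction d with
    | zero =>
      intro k hk
      rw [add_zero] at hk
      rw [← hk, F.X_last]
      have e : blockWord P 0 0 F.D 0 = [] := by
        simp only [blockWord, List.flatMap_eq_nil_iff]
        intro _ _; rfl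
      rw [e]
      simp [sufWord, Sim.refl]
    | succ d ih =>
      intro k hk
      have h1 := F.X_succ (show k < F.n by omega)
      rw [Frame.sufWord_eq (by omega), h1, ← F.sim_blockWord_col h (by omega)]
      refine (sim_blockWord_add _ _).trans ?_
      rw [zero_add]
      exact (ih (k + 1) (by omega)).left _
  exact key F.n 0 (by omega)

/-- Rotation of the components at the arrows `α`. -/
def PermTuple.rot (c : PermTuple dy dx) : PermTuple dy dx where
  β := c.β
  α k := rotPerm (c.α k)

theorem LD_eq_truncate (c : PermTuple dy dx) : LD c = c.rot.truncate := by
  ext1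
  · rfl
  · funext k
    change _ = rotPartial (trunc (rotPerm (rotPerm (c.α k))))
    rw [rotPerm_rotPerm]; rfl

/-- A wire traverses α_k from `x` to `y`, against the arrow, so the block carries an inverse. The
rotation in `pipeTuple` supplies that inverse together with a conjugation, which `PermTuple.rot`
undoes. -/
theorem permA_pipeTuple (P : Finset (ℕ × ℕ)) (k : ℕ) (hk : k < (frame dy dx).n) :
    dem (blockWord P ((frame dy dx).Y k) ((frame dy dx).X (k + 1)) ((frame dy dx).ey k)
      ((frame dy dx).ex k)) = (pipeTuple dy dx P).rot.permA k := by
  obtain ⟨k, rfl⟩ : ∃ j : Fin n, k = j := ⟨⟨k, hk⟩, rfl⟩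
  have e : (pipeTuple dy dx P).rot.α k = rotPerm (demazure (dy k.castSucc) (dx k)
    (rotPipe (dy k.castSucc) (dx k)
      (miniPipe P (rowOffset dy dx (Sum.inl k.castSucc)) (colOffset dy dx (Sum.inr k))
        (dy k.castSucc) (dx k)))) := rfl
  rw [PermTuple.permA_eq, ← pipeWord_miniPipe, dem_pipeWord, frame_ey_castSucc, frame_ex, e,
    rowOffset_inl, colOffset_inr, demazure_rotPipe, rotPerm_rotPerm, inv_inv]
  rfl

theorem permB_pipeTuple (P : Finset (ℕ × ℕ)) (k : ℕ) (hk : k < (frame dy dx).n) :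
    dem (blockWord P ((frame dy dx).Y (k + 1)) ((frame dy dx).X (k + 1)) ((frame dy dx).ey (k + 1))
      ((frame dy dx).ex k)) = (pipeTuple dy dx P).rot.permB k := by
  obtain ⟨k, rfl⟩ : ∃ j : Fin n, k = j := ⟨⟨k, hk⟩, rfl⟩
  have e : (pipeTuple dy dx P).rot.β k = demazure (dy k.succ) (dx k)
      (miniPipe P (rowOffset dy dx (Sum.inl k.succ)) (colOffset dy dx (Sum.inr k))
        (dy k.succ) (dx k)) := rfl
  rw [PermTuple.permB_eq, ← pipeWord_miniPipe, dem_pipeWord, frame_ey_succ, frame_ex, e,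
    rowOffset_inl, colOffset_inr]
  rfl

theorem dem_pipeWord_eq_total {P : Finset (ℕ × ℕ)} (h : (frame dy dx).CornerFull P) :
    dem (pipeWord (∑ i, dy i) (∑ k, dx k) P) = (pipeTuple dy dx P).rot.total := by
  rw [sum_dy dy dx, sum_dx dy dx, Frame.dem_pipeWord_eq h]
  exact PermTuple.total_eq _ (permA_pipeTuple P) (permB_pipeTuple P)

theorem emb_demazure (k l : ℕ) (P : Finset (ℕ × ℕ)) :
    emb 0 (demazure k l P) = dem (pipeWord k l P) := by
  rw [← dem_pipeWord]; simp

/-- The empty corners of `v` reduce `P` to its blocks in the snake, and the ascents of `v` make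
these blocks increasing at virtual dots, hence completions. -/
theorem extended_LD_pipeTuple {v : TotalPerm dy dx} (hr : (frame dy dx).RowAsc (emb 0 v))
    (hc : (frame dy dx).ColAsc (emb 0 v)) (hz : (frame dy dx).CornerZero (emb 0 v))
    {P : Finset (ℕ × ℕ)} (hP : P ∈ pipes v) :
    (LD (pipeTuple dy dx P)).extended = (pipeTuple dy dx P).rot ∧
      (pipeTuple dy dx P).rot.total = emb 0 v := by
  have h1 : dem (pipeWord (∑ i, dy i) (∑ k, dx k) P) = emb 0 v := by
    rw [← emb_demazure, hP.2]
  have hf : (frame dy dx).CornerFull P := by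
    apply Frame.cornerFull_of_cornerZero
    rwa [← sum_dy dy dx, ← sum_dx dy dx, h1]
  rw [dem_pipeWord_eq_total hf] at h1
  refine ⟨?_, h1⟩
  rw [LD_eq_truncate, PermTuple.extended_truncate]
  rw [← h1] at hr hc
  exact Frame.virtAsc_of_asc (PermTuple.bounded _) (PermTuple.dem_wordA _)
    (PermTuple.dem_wordB _) hr hc

theorem LD_rot_extended (w : Laces dy dx) : LD w.extended.rot = w := by
  rw [LD]
  ext1
  · funext k; exact trunc_completion _
  · funext k
    change rotPartial (trunc (rotPerm (rotPerm (completion (rotPartial (w.α k)))))) = w.α k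
    rw [rotPerm_rotPerm, trunc_completion, rotPartial_rotPartial]

theorem rot_rot (c : PermTuple dy dx) : c.rot.rot = c := by
  ext1
  · rfl
  · funext k; exact rotPerm_rotPerm _

theorem miniPipe_eq {P Q : Finset (ℕ × ℕ)} {r c k l : ℕ}
    (hQ : Q ⊆ Finset.range k ×ˢ Finset.range l)
    (h : ∀ i < k, ∀ j < l, (r + i, c + j) ∈ P ↔ (i, j) ∈ Q) : miniPipe P r c k l = Q := by
  ext ⟨i, j⟩
  simp only [miniPipe, Finset.mem_filter, Finset.mem_product, Finset.mem_range]
  constructor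
  · rintro ⟨⟨h1, h2⟩, h3⟩
    exact (h i h1 j h2).1 h3
  · intro h3
    have h4 := hQ h3
    simp only [Finset.mem_product, Finset.mem_range] at h4
    exact ⟨h4, (h i h4.1 j h4.2).2 h3⟩

theorem rotPipe_subset {k l : ℕ} (P : Finset (ℕ × ℕ)) :
    rotPipe k l P ⊆ Finset.range k ×ˢ Finset.range l := Finset.filter_subset _ _

/-- Each block of the snake receives a pipe dream of its own completion, rotated for the α blocks;
all cells outside the snake become crosses. -/
theorem exists_pipe_of_laces (w : Laces dy dx) :
    ∃ P ⊆ Finset.range (∑ i, dy i) ×ˢ Finset.range (∑ k, dx k), (frame dy dx).CornerFull P ∧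
      pipeTuple dy dx P = w.extended.rot := by
  choose PB hPB hPB' using fun k => exists_pipe_completion (w.β k)
  choose PA hPA hPA' using fun k => exists_pipe_completion (rotPartial (w.α k))
  let F := frame dy dx
  have hF : F.n = n := rfl
  classical
  -- A cell outside the α and β block of its block column satisfies both implications vacuously, so
  -- it is a cross.
  let good : ℕ × ℕ → Prop := fun p => ∀ k : Fin n, F.X (k + 1) ≤ p.2 → p.2 < F.X k →
    (F.Y k ≤ p.1 → p.1 < F.Y (k + 1) →
      (p.1 - F.Y k, p.2 - F.X (k + 1)) ∈ rotPipe (dy k.castSucc) (dx k) (PA k)) ∧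
    (F.Y (k + 1) ≤ p.1 → p.1 < F.Y (k + 2) → (p.1 - F.Y (k + 1), p.2 - F.X (k + 1)) ∈ PB k)
  have hgood : ∀ k : Fin n, ∀ i j, j < dx k → (good (i, F.X (k + 1) + j) ↔
      (F.Y k ≤ i → i < F.Y (k + 1) → (i - F.Y k, j) ∈ rotPipe (dy k.castSucc) (dx k) (PA k)) ∧
      (F.Y (k + 1) ≤ i → i < F.Y (k + 2) → (i - F.Y (k + 1), j) ∈ PB k)) := by
    intro k i j hj
    have e := F.X_succ k.isLt
    rw [frame_ex] at e
    constructor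
    · intro h
      have := h k (by simp) (by simp only; omega)
      simpa only [Nat.add_sub_cancel_left] using this
    · intro h k' h1 h2
      simp only at h1 h2
      have : k' = k := by
        rcases lt_trichotomy k'.val k.val with hlt | he | hlt
        · have := F.X_anti (show k'.val + 1 ≤ k.val by omega); omega
        · exact Fin.ext he
        · have := F.X_anti (show k.val + 1 ≤ k'.val by omega); omega
      subst this
      simpa only [Nat.add_sub_cancel_left] using h
  let P := (Finset.range F.D ×ˢ Finset.range (F.X 0)).filter good
  have hmem : ∀ k : Fin n, ∀ i < F.D, ∀ j < dx k, ((i, F.X (k + 1) + j) ∈ P ↔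
      (F.Y k ≤ i → i < F.Y (k + 1) → (i - F.Y k, j) ∈ rotPipe (dy k.castSucc) (dx k) (PA k)) ∧
      (F.Y (k + 1) ≤ i → i < F.Y (k + 2) → (i - F.Y (k + 1), j) ∈ PB k)) := by
    intro k i hi j hj
    have e := F.X_succ k.isLt
    rw [frame_ex] at e
    have e' := F.X_anti (Nat.zero_le k.val)
    rw [← hgood k i j hj, Finset.mem_filter, Finset.mem_product, Finset.mem_range,
      Finset.mem_range]
    exact ⟨fun h => h.2, fun h => ⟨⟨hi, by simp only; omega⟩, h⟩⟩
  refine ⟨P, ?_, ⟨?_, ?_⟩, ?_⟩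
  · rw [sum_dy dy dx, sum_dx dy dx]; exact Finset.filter_subset _ _
  · intro k hk i hi j hj
    obtain ⟨k, rfl⟩ : ∃ j : Fin n, k = j := ⟨⟨k, hk⟩, rfl⟩
    have h1 := F.Y_le_D (show k.val ≤ F.n + 1 by omega)
    have h2 := F.Y_mono (show k.val ≤ k + 1 by omega)
    have hi : i < F.Y k := hi
    rw [frame_ex] at hj
    exact (hmem k i (by omega) j hj).2 ⟨fun h => by omega, fun h => by omega⟩
  · intro k hk i hi hi' j hj
    obtain ⟨k, rfl⟩ : ∃ j : Fin n, k = j := ⟨⟨k, hk⟩, rfl⟩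
    have h2 := F.Y_mono (show k.val + 1 ≤ k + 2 by omega)
    have hi : F.Y (k + 2) ≤ i := hi
    rw [frame_ex] at hj
    exact (hmem k i hi' j hj).2 ⟨fun _ h => by omega, fun _ h => by omega⟩
  · have hsz : ∀ k : Fin n, F.Y (k + 1) = F.Y k + dy k.castSucc ∧
        F.Y (k + 2) = F.Y (k + 1) + dy k.succ ∧ F.Y (k + 2) ≤ F.D := by
      intro k
      refine ⟨?_, ?_, F.Y_le_D (by omega)⟩
      · rw [F.Y_succ, frame_ey_castSucc]
      · rw [F.Y_succ (k + 1), frame_ey_succ]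
    ext1
    · funext k
      obtain ⟨h1, h2, h3⟩ := hsz k
      change demazure _ _ (miniPipe _ _ _ _ _) = completion (w.β k)
      rw [rowOffset_inl, colOffset_inr, ← hPB' k]
      congr 1
      refine miniPipe_eq (hPB k) fun i hi j hj => ?_
      rw [Fin.val_succ]
      change (F.Y (k + 1) + i, F.X (k + 1) + j) ∈ P ↔ _
      rw [hmem k _ (by omega) j hj, Nat.add_sub_cancel_left]
      exact ⟨fun h => h.2 (by omega) (by omega), fun h => ⟨fun _ _ => by omega, fun _ _ => h⟩⟩
    · funext k
      obtain ⟨h1, h2, h3⟩ := hsz k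
      change demazure _ _ (rotPipe _ _ (miniPipe _ _ _ _ _)) =
        rotPerm (rotPerm (completion (rotPartial (w.α k))))
      rw [rowOffset_inl, colOffset_inr, rotPerm_rotPerm, ← hPA' k,
        miniPipe_eq (rotPipe_subset (PA k)), demazure_rotPipe, demazure_rotPipe, ← rotPerm_inv,
        inv_inv, rotPerm_rotPerm]
      intro i hi j hj
      rw [Fin.val_castSucc]
      change (F.Y k + i, F.X (k + 1) + j) ∈ P ↔ _
      rw [hmem k _ (by omega) j hj, Nat.add_sub_cancel_left]
      exact ⟨fun h => h.1 (by omega) (by omega), fun h => ⟨fun _ _ => h, fun _ _ => by omega⟩⟩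

/-- Truncation is a bijection from the tuples of pipe dreams for `v` to the lacing diagrams with
Demazure product `v`. -/
theorem bijOn_LD_pipes {v : TotalPerm dy dx} (hr : (frame dy dx).RowAsc (emb 0 v))
    (hc : (frame dy dx).ColAsc (emb 0 v)) (hz : (frame dy dx).CornerZero (emb 0 v)) :
    Set.BijOn LD (pipeTuple dy dx '' pipes v) {w | w.total = emb 0 v} := by
  refine ⟨?_, ?_, ?_⟩
  · rintro _ ⟨P, hP, rfl⟩
    obtain ⟨h1, h2⟩ := extended_LD_pipeTuple hr hc hz hP
    rw [Set.mem_ofPred_eq, Laces.total, h1, h2]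
  -- Both tuples are recovered from the extended diagram of their common truncation.
  · rintro _ ⟨P, hP, rfl⟩ _ ⟨P', hP', rfl⟩ h
    obtain ⟨h1, -⟩ := extended_LD_pipeTuple hr hc hz hP
    obtain ⟨h1', -⟩ := extended_LD_pipeTuple hr hc hz hP'
    rw [← rot_rot (pipeTuple dy dx P), ← h1, h, h1', rot_rot]
  · intro w hw
    obtain ⟨P, hP, hf, hP'⟩ := exists_pipe_of_laces w
    refine ⟨w.extended.rot, ⟨P, ⟨hP, ?_⟩, hP'⟩, LD_rot_extended w⟩
    apply emb_injective 0
    rw [emb_demazure, dem_pipeWord_eq_total hf, hP', rot_rot]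
    exact hw

end

/-! ### Exchanging two adjacent dots on one side of a column -/

theorem emb_swap_of_succ {m : ℕ} (o : ℕ) {s t : Fin m} (hst : t.val = s.val + 1) :
    emb o (swap s t) = swap (o + s) (o + s + 1) := by
  have h1 : swap s t = swap ⟨s.val, by omega⟩ ⟨s.val + 1, by omega⟩ := by
    congr 1; exact Fin.ext hst
  rw [h1, emb_swap]

/-- In diagrams, a generator behind a block makes the two strands cross if they do not cross
already, and is otherwise absorbed. -/
theorem dem_snoc_emb {m o : ℕ} {W : List ℕ} {u : Perm (Fin m)} (hW : dem W = emb o u)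
    {s t : Fin m} (hst : t.val = s.val + 1) :
    dem (W ++ [o + s]) = emb o (if u t < u s then u else u * swap s t) := by
  have h := emb_lt_iff o u s t
  have hne : u s ≠ u t := fun e => by have := u.injective e; omega
  rw [hst, ← add_assoc] at h
  rw [dem_snoc, hW, rstep]
  by_cases h' : u s < u t
  · rw [if_pos (h.2 h'), if_neg h'.not_gt, emb_mul, emb_swap_of_succ o hst]
  · rw [if_neg (mt h.1 h'), if_pos (lt_of_le_of_ne (not_lt.1 h') hne.symm)]

theorem dem_cons_emb {m o : ℕ} {W : List ℕ} {u : Perm (Fin m)} (hW : dem W = emb o u)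
    {s t : Fin m} (hst : t.val = s.val + 1) :
    dem ((o + s) :: W) = emb o (if u⁻¹ t < u⁻¹ s then u else swap s t * u) := by
  have h := dem_snoc_emb (W := W.reverse) (u := u⁻¹) (o := o)
    (by rw [dem_reverse, hW, emb_inv]) hst
  rw [← List.reverse_cons, dem_reverse, inv_eq_iff_eq_inv, ← emb_inv] at h
  rw [h]
  congr 1
  split_ifs
  · rw [inv_inv]
  · rw [mul_inv_rev, inv_inv, swap_inv]

section

variable {n : ℕ} {dy : Fin (n + 1) → ℕ} {dx : Fin n → ℕ}

/-- The size of the extended diagram at an arrow; `inl k` stands for `β` and `inr k` for `α`. -/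
def slotSize (dy : Fin (n + 1) → ℕ) (dx : Fin n → ℕ) : Fin n ⊕ Fin n → ℕ
  | Sum.inl k => dy k.succ + dx k
  | Sum.inr k => dy k.castSucc + dx k

namespace PermTuple

/-- The component of a tuple at an arrow. -/
def get (c : PermTuple dy dx) : (σ : Fin n ⊕ Fin n) → Perm (Fin (slotSize dy dx σ))
  | Sum.inl k => c.β k
  | Sum.inr k => c.α k

/-- The tuple with given components. -/
def mk' (f : (σ : Fin n ⊕ Fin n) → Perm (Fin (slotSize dy dx σ))) : PermTuple dy dx where
  β k := f (Sum.inl k)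
  α k := f (Sum.inr k)

theorem get_mk' (f : (σ : Fin n ⊕ Fin n) → Perm (Fin (slotSize dy dx σ))) : (mk' f).get = f := by
  funext σ; cases σ <;> rfl

theorem get_injective : Function.Injective (get : PermTuple dy dx → _) := by
  intro c c' h
  ext1
  · funext k; exact congrFun h (Sum.inl k)
  · funext k; exact congrFun h (Sum.inr k)

end PermTuple

/-- Two adjacent dots `s`, `t` of the left or right column of the extended diagram at an arrow `σ`;
they are sources of the permutation, unless `inv` is set. The dots of the other column that are not
virtual are described by `real`. -/
structure Corner (dy : Fin (n + 1) → ℕ) (dx : Fin n → ℕ) where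
  σ : Fin n ⊕ Fin n
  inv : Bool
  s : Fin (slotSize dy dx σ)
  t : Fin (slotSize dy dx σ)
  hst : t.val = s.val + 1
  real : Fin (slotSize dy dx σ) → Prop

namespace Corner

variable (g g' : Corner dy dx) (c : PermTuple dy dx)

/-- The map from the column of the two dots to the other column. -/
def map : Perm (Fin (slotSize dy dx g.σ)) := if g.inv then (c.get g.σ)⁻¹ else c.get g.σ

/-- The strands through the two dots cross. -/
def Cross : Prop := g.map c g.t < g.map c g.s

/-- One of the strands through the two dots leads to a dot that is not virtual. -/
def Real : Prop := g.real (g.map c g.s) ∨ g.real (g.map c g.t)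

/-- Exchange of the strands through the two dots. -/
def flip : PermTuple dy dx :=
  .mk' (Function.update c.get g.σ
    (if g.inv then swap g.s g.t * c.get g.σ else c.get g.σ * swap g.s g.t))

variable {g g' c}

theorem get_flip_self : (g.flip c).get g.σ =
    if g.inv then swap g.s g.t * c.get g.σ else c.get g.σ * swap g.s g.t := by
  rw [flip, PermTuple.get_mk', Function.update_self]

theorem get_flip_of_ne {σ : Fin n ⊕ Fin n} (h : σ ≠ g.σ) : (g.flip c).get σ = c.get σ := by
  rw [flip, PermTuple.get_mk', Function.update_of_ne h]

theorem map_flip : g.map (g.flip c) = g.map c * swap g.s g.t := by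
  unfold map
  rw [get_flip_self]
  split_ifs
  · rw [mul_inv_rev, swap_inv]
  · rfl

theorem map_flip_of_ne (h : g'.σ ≠ g.σ) : g'.map (g.flip c) = g'.map c := by
  unfold map
  rw [get_flip_of_ne h]

theorem cross_flip : g.Cross (g.flip c) ↔ ¬g.Cross c := by
  have hne : g.map c g.s ≠ g.map c g.t := fun e => by
    have := (g.map c).injective e
    have := g.hst
    omega
  unfold Cross
  rw [map_flip, Perm.mul_apply, Perm.mul_apply, swap_apply_left, swap_apply_right, not_lt]
  exact ⟨le_of_lt, fun h => lt_of_le_of_ne h hne⟩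

theorem real_flip : g.Real (g.flip c) ↔ g.Real c := by
  unfold Real
  rw [map_flip, Perm.mul_apply, Perm.mul_apply, swap_apply_left, swap_apply_right, or_comm]

theorem cross_flip_of_ne (h : g'.σ ≠ g.σ) : g'.Cross (g.flip c) ↔ g'.Cross c := by
  unfold Cross
  rw [map_flip_of_ne h]

theorem real_flip_of_ne (h : g'.σ ≠ g.σ) : g'.Real (g.flip c) ↔ g'.Real c := by
  unfold Real
  rw [map_flip_of_ne h]

theorem flip_flip : g.flip (g.flip c) = c := by
  apply PermTuple.get_injective
  funext σ
  by_cases h : σ = g.σ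
  · subst h
    rw [get_flip_self, get_flip_self]
    split_ifs
    · rw [← mul_assoc, swap_mul_self, one_mul]
    · rw [mul_assoc, swap_mul_self, mul_one]
  · rw [get_flip_of_ne h, get_flip_of_ne h]

theorem flip_comm (h : g'.σ ≠ g.σ) : g'.flip (g.flip c) = g.flip (g'.flip c) := by
  apply PermTuple.get_injective
  funext σ
  by_cases h1 : σ = g.σ
  · subst h1
    rw [get_flip_of_ne h.symm, get_flip_self, get_flip_self, get_flip_of_ne h.symm]
  · by_cases h2 : σ = g'.σ
    · subst h2
      rw [get_flip_of_ne h, get_flip_self, get_flip_self, get_flip_of_ne h]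
    · rw [get_flip_of_ne h1, get_flip_of_ne h2, get_flip_of_ne h2, get_flip_of_ne h1]

theorem eq_flip_of_map {c' : PermTuple dy dx} (h : g.map c' = g.map c * swap g.s g.t)
    (h' : ∀ σ, σ ≠ g.σ → c'.get σ = c.get σ) : c' = g.flip c := by
  apply PermTuple.get_injective
  funext σ
  by_cases h1 : σ = g.σ
  · subst h1
    rw [← map_flip] at h
    unfold map at h
    split_ifs at h
    · exact inv_injective h
    · exact h
  · rw [h' σ h1, get_flip_of_ne h1]

theorem permLength_map : permLength (g.map c) = permLength (c.get g.σ) := by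
  unfold map
  split_ifs
  · exact permLength_inv _
  · rfl

theorem permLength_flip (h : g.Cross c) :
    permLength (c.get g.σ) = permLength ((g.flip c).get g.σ) + 1 := by
  have h1 : ¬g.Cross (g.flip c) := by rw [cross_flip]; exact not_not.2 h
  have hne : g.map (g.flip c) g.s ≠ g.map (g.flip c) g.t := fun e => by
    have := (g.map (g.flip c)).injective e
    have := g.hst
    omega
  have h2 := permLength_mul_swap g.hst (lt_of_le_of_ne (not_lt.1 h1) hne)
  rw [← map_flip, flip_flip, permLength_map, permLength_map] at h2
  exact h2

end Corner

/-- The weighted number of crossings. -/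
def PermTuple.weight (wt : Fin n ⊕ Fin n → ℕ) (c : PermTuple dy dx) : ℕ :=
  ∑ σ, wt σ * permLength (c.get σ)

theorem Corner.weight_flip {g : Corner dy dx} {c : PermTuple dy dx} (h : g.Cross c)
    (wt : Fin n ⊕ Fin n → ℕ) : c.weight wt = (g.flip c).weight wt + wt g.σ := by
  unfold PermTuple.weight
  rw [← Finset.add_sum_erase _ _ (Finset.mem_univ g.σ),
    ← Finset.add_sum_erase (a := g.σ) Finset.univ (fun σ => wt σ * permLength ((g.flip c).get σ))
      (Finset.mem_univ g.σ), Corner.permLength_flip h, mul_add, mul_one]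
  rw [Finset.sum_congr rfl fun σ hσ => by rw [← get_flip_of_ne (Finset.ne_of_mem_erase hσ)]]
  omega

theorem Laces.length_eq_weight (w : Laces dy dx) : w.length = w.extended.weight fun _ => 1 := by
  unfold Laces.length PermTuple.weight
  rw [Fintype.sum_sum_type, ← Finset.sum_add_distrib]
  exact Finset.sum_congr rfl fun k _ => by rw [one_mul, one_mul]; rfl

/-- Two adjacent dots in the column of a vertex with a neighbouring vertex on both sides. -/
inductive Middle (dy : Fin (n + 1) → ℕ) (dx : Fin n → ℕ)
  | sink (k : Fin n) (s t : Fin (dx k)) (hst : t.val = s.val + 1)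
  | source (l r : Fin n) (hlr : r.succ = l.castSucc) (s t : Fin (dy r.succ))
      (hst : t.val = s.val + 1)

namespace Middle

/-- The two dots, in the extended diagram on the left. -/
def L : Middle dy dx → Corner dy dx
  | sink k s t hst => ⟨Sum.inl k, true, topHead _ s, topHead _ t, hst, fun i => i.val < dy k.succ⟩
  | source l r hlr s t hst => ⟨Sum.inr l, false, botTail _ (Fin.cast (congrArg dy hlr) s),
      botTail _ (Fin.cast (congrArg dy hlr) t), by simp [botTail]; omega,
      fun i => dy l.castSucc ≤ i.val⟩

/-- The two dots, in the extended diagram on the right. -/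
def R : Middle dy dx → Corner dy dx
  | sink k s t hst => ⟨Sum.inr k, true, botHead _ s, botHead _ t, by simp [botHead]; omega,
      fun i => dx k ≤ i.val⟩
  | source l r hlr s t hst => ⟨Sum.inl r, false, topTail _ s, topTail _ t, hst,
      fun i => i.val < dx r⟩

theorem ne (m : Middle dy dx) : m.L.σ ≠ m.R.σ := by
  cases m <;> simp [L, R]

/-- Words with given Demazure products. -/
def Words (c : PermTuple dy dx) (wA wB : ℕ → List ℕ) : Prop :=
  ∀ k : Fin n, dem (wA k) = emb ((frame dy dx).oA k) (c.α k)⁻¹ ∧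
    dem (wB k) = emb ((frame dy dx).oB k) (c.β k)

theorem words (c : PermTuple dy dx) : Words c c.wordA c.wordB := fun k => by
  rw [c.dem_wordA k k.isLt, c.dem_wordB k k.isLt, c.permA_eq, c.permB_eq]
  exact ⟨rfl, rfl⟩

theorem Words.total_eq {c : PermTuple dy dx} {wA wB : ℕ → List ℕ} (h : Words c wA wB) :
    dem ((frame dy dx).totWord wA wB) = c.total := by
  refine c.total_eq (fun k hk => ?_) fun k hk => ?_
  · rw [c.permA_eq ⟨k, hk⟩]; exact (h ⟨k, hk⟩).1
  · rw [c.permB_eq ⟨k, hk⟩]; exact (h ⟨k, hk⟩).2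

theorem Words.update_left {c c' : PermTuple dy dx} {wA wB : ℕ → List ℕ} (h : Words c wA wB)
    {k : Fin n} {W : List ℕ} (hW : dem W = emb ((frame dy dx).oA k) (c'.α k)⁻¹)
    (h' : ∀ σ, σ ≠ Sum.inr k → c'.get σ = c.get σ) : Words c' (Function.update wA k W) wB := by
  intro j
  refine ⟨?_, ?_⟩
  · by_cases hj : j = k
    · subst hj; rw [Function.update_self, hW]
    · rw [Function.update_of_ne (fun e => hj (Fin.ext e)), (h j).1]
      congr 2
      exact (h' (Sum.inr j) (by simpa using hj)).symm
  · rw [(h j).2]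
    congr 1
    exact (h' (Sum.inl j) (by simp)).symm

theorem Words.update_right {c c' : PermTuple dy dx} {wA wB : ℕ → List ℕ} (h : Words c wA wB)
    {k : Fin n} {W : List ℕ} (hW : dem W = emb ((frame dy dx).oB k) (c'.β k))
    (h' : ∀ σ, σ ≠ Sum.inl k → c'.get σ = c.get σ) : Words c' wA (Function.update wB k W) := by
  intro j
  refine ⟨?_, ?_⟩
  · rw [(h j).1]
    congr 2
    exact (h' (Sum.inr j) (by simp)).symm
  · by_cases hj : j = k
    · subst hj; rw [Function.update_self, hW]
    · rw [Function.update_of_ne (fun e => hj (Fin.ext e)), (h j).2]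
      congr 1
      exact (h' (Sum.inl j) (by simpa using hj)).symm

/-- The tuple with the strands through the two dots crossing. -/
noncomputable def _root_.BipartiteLaces.Corner.cross (g : Corner dy dx) (c : PermTuple dy dx) :
    PermTuple dy dx := by
  classical exact if g.Cross c then c else g.flip c

theorem _root_.BipartiteLaces.Corner.cross_of {g : Corner dy dx} {c : PermTuple dy dx}
    (h : g.Cross c) : g.cross c = c := if_pos h

theorem _root_.BipartiteLaces.Corner.cross_of_not {g : Corner dy dx} {c : PermTuple dy dx}
    (h : ¬g.Cross c) : g.cross c = g.flip c := if_neg h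

theorem _root_.BipartiteLaces.Corner.get_cross_of_ne {g : Corner dy dx} {c : PermTuple dy dx}
    {σ : Fin n ⊕ Fin n} (h : σ ≠ g.σ) : (g.cross c).get σ = c.get σ := by
  by_cases h' : g.Cross c
  · rw [Corner.cross_of h']
  · rw [Corner.cross_of_not h', Corner.get_flip_of_ne h]

/-- Forcing the strands to cross on the left, or on the right, amounts to inserting one generator
between the two blocks; which block absorbs it does not matter. At a sink the blocks are adjacent,
at a source the generator commutes with what lies between. -/
theorem total_cross (m : Middle dy dx) (c : PermTuple dy dx) :
    (m.L.cross c).total = (m.R.cross c).total := by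
  have hw := words c
  cases m with
  | sink k s t hst =>
    have hL : Words ((sink k s t hst).L.cross c) c.wordA (Function.update c.wordB k
        (((frame dy dx).oB k + s) :: c.wordB k)) := by
      refine hw.update_right ?_ fun σ hσ => Corner.get_cross_of_ne hσ
      have := dem_cons_emb (hw k).2 (s := topHead (dy k.succ) s) (t := topHead (dy k.succ) t) hst
      refine this.trans ?_
      congr 1
      split_ifs with h
      · rw [Corner.cross_of (c := c) (g := (sink k s t hst).L) h]
      · rw [Corner.cross_of_not (c := c) (g := (sink k s t hst).L) h]
        exact (Corner.get_flip_self (c := c) (g := (sink k s t hst).L)).symm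
    have hR : Words ((sink k s t hst).R.cross c) (Function.update c.wordA k
        (c.wordA k ++ [(frame dy dx).oA k + (frame dy dx).ey k + s])) c.wordB := by
      refine hw.update_left ?_ fun σ hσ => Corner.get_cross_of_ne hσ
      have := dem_snoc_emb (hw k).1 (s := botHead (dy k.castSucc) s)
        (t := botHead (dy k.castSucc) t) (by simp [botHead]; omega)
      rw [frame_ey_castSucc, add_assoc]
      refine this.trans ?_
      congr 1
      split_ifs with h
      · rw [Corner.cross_of (c := c) (g := (sink k s t hst).R) h]
      · rw [Corner.cross_of_not (c := c) (g := (sink k s t hst).R) h]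
        have := Corner.get_flip_self (c := c) (g := (sink k s t hst).R)
        rw [show ((sink k s t hst).R.flip c).α k = swap (botHead _ s) (botHead _ t) * c.α k from
          this, mul_inv_rev, swap_inv]
    rw [← hL.total_eq, ← hR.total_eq]
    exact (Frame.dem_update_sink k.isLt).symm
  | source l r hlr s t hst =>
    have hl : l.val = r.val + 1 := by
      have := congrArg Fin.val hlr
      simpa using this.symm
    have hL : Words ((source l r hlr s t hst).L.cross c) (Function.update c.wordA l
        (((frame dy dx).oA l + (frame dy dx).ex l + s) :: c.wordA l)) c.wordB := by
      refine hw.update_left ?_ fun σ hσ => Corner.get_cross_of_ne hσ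
      have := dem_cons_emb (hw l).1 (s := botTail (dx l) (Fin.cast (congrArg dy hlr) s))
        (t := botTail (dx l) (Fin.cast (congrArg dy hlr) t)) (by simp [botTail]; omega)
      rw [frame_ex, add_assoc]
      refine this.trans ?_
      congr 1
      rw [inv_inv]
      split_ifs with h
      · rw [Corner.cross_of (c := c) (g := (source l r hlr s t hst).L) h]
      · rw [Corner.cross_of_not (c := c) (g := (source l r hlr s t hst).L) h]
        have := Corner.get_flip_self (c := c) (g := (source l r hlr s t hst).L)
        rw [show ((source l r hlr s t hst).L.flip c).α l =
          c.α l * swap (botTail _ (Fin.cast _ s)) (botTail _ (Fin.cast _ t)) from this,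
          mul_inv_rev, swap_inv]
    have hR : Words ((source l r hlr s t hst).R.cross c) c.wordA (Function.update c.wordB r
        (c.wordB r ++ [(frame dy dx).oB r + s])) := by
      refine hw.update_right ?_ fun σ hσ => Corner.get_cross_of_ne hσ
      have := dem_snoc_emb (hw r).2 (s := topTail (dx r) s) (t := topTail (dx r) t) hst
      refine this.trans ?_
      congr 1
      split_ifs with h
      · rw [Corner.cross_of (c := c) (g := (source l r hlr s t hst).R) h]
      · rw [Corner.cross_of_not (c := c) (g := (source l r hlr s t hst).R) h]
        exact (Corner.get_flip_self (c := c) (g := (source l r hlr s t hst).R)).symm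
    rw [← hL.total_eq, ← hR.total_eq]
    have := Frame.dem_update_source (F := frame dy dx) (wA := c.wordA) (wB := c.wordB)
      (k := r.val) (i := s.val) (by rw [← hl]; exact l.isLt)
      (by rw [frame_ey_succ]; omega)
    rw [← hl] at this
    exact this

/-- While the strands cross on one side, the product does not see whether they also cross on the
other. -/
theorem total_flip_left {m : Middle dy dx} {c : PermTuple dy dx} (h : m.R.Cross c) :
    (m.L.flip c).total = c.total := by
  have key : ∀ c : PermTuple dy dx, m.R.Cross c → ¬m.L.Cross c →
      (m.L.flip c).total = c.total := by
    intro c h h'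
    have := total_cross m c
    rwa [Corner.cross_of h, Corner.cross_of_not h'] at this
  by_cases h' : m.L.Cross c
  · have := key (m.L.flip c) ((Corner.cross_flip_of_ne m.ne.symm).2 h)
      (by rw [Corner.cross_flip]; exact not_not.2 h')
    rw [Corner.flip_flip] at this
    exact this.symm
  · exact key c h h'

theorem total_flip_right {m : Middle dy dx} {c : PermTuple dy dx} (h : m.L.Cross c) :
    (m.R.flip c).total = c.total := by
  have key : ∀ c : PermTuple dy dx, m.L.Cross c → ¬m.R.Cross c →
      (m.R.flip c).total = c.total := by
    intro c h h'
    have := total_cross m c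
    rw [Corner.cross_of h, Corner.cross_of_not h'] at this
    exact this.symm
  by_cases h' : m.R.Cross c
  · have := key (m.R.flip c) ((Corner.cross_flip_of_ne m.ne).2 h)
      (by rw [Corner.cross_flip]; exact not_not.2 h')
    rw [Corner.flip_flip] at this
    exact this.symm
  · exact key c h h'

/-- A move at the two dots. -/
structure Move (m : Middle dy dx) (c c' : PermTuple dy dx) : Prop where
  left : m.L.Real c
  right : m.R.Real c
  eq : c' = c ∨ c' = m.L.flip c ∨ c' = m.R.flip c ∨ c' = m.L.flip (m.R.flip c)
  cross : m.L.Cross c ∨ m.R.Cross c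
  cross' : m.L.Cross c' ∨ m.R.Cross c'

/-- A move is at most two flips. When both sides change, exactly one side crosses before; flipping
the uncrossed side first passes through the configuration with crossings on both sides. -/
theorem Move.total_eq {m : Middle dy dx} {c c' : PermTuple dy dx} (h : m.Move c c') :
    c'.total = c.total := by
  have h1 := h.cross
  have h2 := h.cross'
  rcases h.eq with rfl | rfl | rfl | rfl
  · rfl
  · rw [Corner.cross_flip, Corner.cross_flip_of_ne m.ne.symm] at h2
    exact total_flip_left (by tauto)
  · rw [Corner.cross_flip, Corner.cross_flip_of_ne m.ne] at h2
    exact total_flip_right (by tauto)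
  · rw [Corner.cross_flip, Corner.cross_flip_of_ne m.ne, Corner.cross_flip_of_ne m.ne.symm,
      Corner.cross_flip] at h2
    by_cases h3 : m.L.Cross c
    · have h4 : ¬m.R.Cross c := by tauto
      rw [total_flip_left (by rwa [Corner.cross_flip]), total_flip_right h3]
    · have h4 : m.R.Cross c := by tauto
      rw [Corner.flip_comm m.ne, total_flip_right (by rwa [Corner.cross_flip]),
        total_flip_left h4]

theorem eq_of_maps {m : Middle dy dx} {c c' : PermTuple dy dx}
    (hL : m.L.map c' = m.L.map c ∨ m.L.map c' = m.L.map c * swap m.L.s m.L.t)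
    (hR : m.R.map c' = m.R.map c ∨ m.R.map c' = m.R.map c * swap m.R.s m.R.t)
    (h : ∀ σ, σ ≠ m.L.σ → σ ≠ m.R.σ → c'.get σ = c.get σ) :
    c' = c ∨ c' = m.L.flip c ∨ c' = m.R.flip c ∨ c' = m.L.flip (m.R.flip c) := by
  have same : ∀ g : Corner dy dx, ∀ c c' : PermTuple dy dx, g.map c' = g.map c →
      c'.get g.σ = c.get g.σ := by
    intro g c c' h
    unfold Corner.map at h
    split_ifs at h
    · exact inv_injective h
    · exact h
  rcases hL with hL | hL <;> rcases hR with hR | hR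
  · left
    apply PermTuple.get_injective
    funext σ
    by_cases h1 : σ = m.L.σ
    · subst h1; exact same _ _ _ hL
    · by_cases h2 : σ = m.R.σ
      · subst h2; exact same _ _ _ hR
      · exact h σ h1 h2
  · right; right; left
    refine Corner.eq_flip_of_map hR fun σ h2 => ?_
    by_cases h1 : σ = m.L.σ
    · subst h1; exact same _ _ _ hL
    · exact h σ h1 h2
  · right; left
    refine Corner.eq_flip_of_map hL fun σ h1 => ?_
    by_cases h2 : σ = m.R.σ
    · subst h2; exact same _ _ _ hR
    · exact h σ h1 h2
  · right; right; right
    refine Corner.eq_flip_of_map (by rw [hL, Corner.map_flip_of_ne m.ne]) fun σ h1 => ?_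
    by_cases h2 : σ = m.R.σ
    · subst h2
      refine same _ _ _ ?_
      rw [hR, Corner.map_flip]
    · rw [Corner.get_flip_of_ne h2]; exact h σ h1 h2

end Middle

/-! ### K-theoretic moves as flips at the two corners of a column -/

theorem KMove.exists_move {w w' : Laces dy dx} (h : KMove w w') :
    ∃ m : Middle dy dx, m.Move w.extended w'.extended := by
  cases h with
  | sink k s t hst hβ hα hleft hright hmove =>
    obtain ⟨h1, h2, h3, h4⟩ := hmove
    refine ⟨.sink k s t hst, hleft, hright, Middle.eq_of_maps h1 h2 ?_, h3, h4⟩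
    rintro (σ | σ) h1 h2
    · exact hβ σ fun e => h1 (by rw [e]; rfl)
    · exact hα σ fun e => h2 (by rw [e]; rfl)
  | source l r hlr s t hst hβ hα hleft hright hmove =>
    obtain ⟨h1, h2, h3, h4⟩ := hmove
    refine ⟨.source l r hlr s t hst, hleft, hright, Middle.eq_of_maps h1 h2 ?_, h3, h4⟩
    rintro (σ | σ) h1 h2
    · exact hβ σ fun e => h2 (by rw [e]; rfl)
    · exact hα σ fun e => h1 (by rw [e]; rfl)

theorem KMove.total_eq {w w' : Laces dy dx} (h : KMove w w') : w'.total = w.total :=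
  h.exists_move.choose_spec.total_eq

theorem Middle.Move.kMove {m : Middle dy dx} {w w' : Laces dy dx}
    (h : m.Move w.extended w'.extended) : KMove w w' := by
  have hne := m.ne
  have hL : m.L.map w'.extended = m.L.map w.extended ∨
      m.L.map w'.extended = m.L.map w.extended * swap m.L.s m.L.t := by
    rcases h.eq with e | e | e | e <;> rw [e]
    · exact Or.inl rfl
    · exact Or.inr Corner.map_flip
    · exact Or.inl (Corner.map_flip_of_ne hne)
    · rw [Corner.map_flip, Corner.map_flip_of_ne hne]; exact Or.inr rfl
  have hR : m.R.map w'.extended = m.R.map w.extended ∨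
      m.R.map w'.extended = m.R.map w.extended * swap m.R.s m.R.t := by
    rcases h.eq with e | e | e | e <;> rw [e]
    · exact Or.inl rfl
    · exact Or.inl (Corner.map_flip_of_ne hne.symm)
    · exact Or.inr Corner.map_flip
    · rw [Corner.map_flip_of_ne hne.symm, Corner.map_flip]; exact Or.inr rfl
  have hO : ∀ σ, σ ≠ m.L.σ → σ ≠ m.R.σ → w'.extended.get σ = w.extended.get σ := by
    intro σ h1 h2
    rcases h.eq with e | e | e | e <;> rw [e]
    · rw [Corner.get_flip_of_ne h1]
    · rw [Corner.get_flip_of_ne h2]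
    · rw [Corner.get_flip_of_ne h1, Corner.get_flip_of_ne h2]
  have hm : LocalMove (m.L.map w.extended) (m.L.map w'.extended) m.L.s m.L.t
      (m.R.map w.extended) (m.R.map w'.extended) m.R.s m.R.t := ⟨hL, hR, h.cross, h.cross'⟩
  have h1 := h.left
  have h2 := h.right
  cases m with
  | sink k s t hst =>
    exact .sink k s t hst (fun j hj => hO (Sum.inl j) (by simpa [Middle.L] using hj)
      (by simp [Middle.R])) (fun j hj => hO (Sum.inr j) (by simp [Middle.L])
      (by simpa [Middle.R] using hj)) h1 h2 hm
  | source l r hlr s t hst =>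
    exact .source l r hlr s t hst (fun j hj => hO (Sum.inl j) (by simp [Middle.L])
      (by simpa [Middle.R] using hj)) (fun j hj => hO (Sum.inr j)
      (by simpa [Middle.L] using hj) (by simp [Middle.R])) h1 h2 hm

end

section

variable {n : ℕ} {dy : Fin (n + 1) → ℕ} {dx : Fin n → ℕ}

/-! ### Exchanging dots of a lacing diagram -/

namespace Laces

variable (w : Laces dy dx)

/-- Exchange of two dots of column `x`, for the arrow `β` only. -/
def headβ (k : Fin n) (s t : Fin (dx k)) : Laces dy dx where
  β := Function.update w.β k ((w.β k).trans (swap s t).toPEquiv)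
  α := w.α

/-- Exchange of two dots of column `x`, for the arrow `α` only. -/
def headα (k : Fin n) (s t : Fin (dx k)) : Laces dy dx where
  β := w.β
  α := Function.update w.α k ((w.α k).trans (swap s t).toPEquiv)

/-- Exchange of two dots of column `y`, for the arrow `β` only. -/
def tailβ (k : Fin n) (s t : Fin (dy k.succ)) : Laces dy dx where
  β := Function.update w.β k ((swap s t).toPEquiv.trans (w.β k))
  α := w.α

/-- Exchange of two dots of column `y`, for the arrow `α` only. -/
def tailα (k : Fin n) (s t : Fin (dy k.castSucc)) : Laces dy dx where
  β := w.β
  α := Function.update w.α k ((swap s t).toPEquiv.trans (w.α k))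

/-- The permutations of the dots of each column. -/
def conj (ρ : ∀ i, Perm (Fin (dy i))) (τ : ∀ k, Perm (Fin (dx k))) : Laces dy dx where
  β k := (ρ k.succ).toPEquiv.trans ((w.β k).trans (τ k).toPEquiv)
  α k := (ρ k.castSucc).toPEquiv.trans ((w.α k).trans (τ k).toPEquiv)

end Laces

/-- The exchange `f` of two dots of a lacing diagram has the effect of `g` on the extended diagram,
unless all dots concerned are virtual. -/
structure Corner.Lift (g : Corner dy dx) (f : Laces dy dx → Laces dy dx) : Prop where
  extended : ∀ w, g.Real w.extended → (f w).extended = g.flip w.extended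
  eq_self : ∀ w, ¬g.Real w.extended → f w = w
  real : ∀ w : Laces dy dx, g.Cross w.extended → g.Real w.extended

theorem extended_update_β {w w' : Laces dy dx} {g : Corner dy dx} {k : Fin n}
    (hg : g.σ = Sum.inl k) (h : w'.extended.get g.σ = (g.flip w.extended).get g.σ)
    (hβ : ∀ j, j ≠ k → w'.β j = w.β j) (hα : w'.α = w.α) : w'.extended = g.flip w.extended := by
  apply PermTuple.get_injective
  funext σ
  by_cases hσ : σ = g.σ
  · subst hσ; exact h
  · rw [Corner.get_flip_of_ne hσ]
    rcases σ with j | j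
    · have := hβ j (fun e => hσ (by rw [hg, e]))
      change completion _ = completion _
      rw [this]
    · change rotCompletion _ = rotCompletion _
      rw [hα]

theorem extended_update_α {w w' : Laces dy dx} {g : Corner dy dx} {k : Fin n}
    (hg : g.σ = Sum.inr k) (h : w'.extended.get g.σ = (g.flip w.extended).get g.σ)
    (hα : ∀ j, j ≠ k → w'.α j = w.α j) (hβ : w'.β = w.β) : w'.extended = g.flip w.extended := by
  apply PermTuple.get_injective
  funext σ
  by_cases hσ : σ = g.σ
  · subst hσ; exact h
  · rw [Corner.get_flip_of_ne hσ]
    rcases σ with j | j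
    · change completion _ = completion _
      rw [hβ]
    · have := hα j (fun e => hσ (by rw [hg, e]))
      change rotCompletion _ = rotCompletion _
      rw [this]

/-- The corner at two dots of column `x`, for the arrow `β`. -/
def Corner.headβ (dy : Fin (n + 1) → ℕ) {dx : Fin n → ℕ} (k : Fin n) (s t : Fin (dx k))
    (hst : t.val = s.val + 1) : Corner dy dx :=
  ⟨Sum.inl k, true, topHead _ s, topHead _ t, hst, fun i => i.val < dy k.succ⟩

/-- The corner at two dots of column `x`, for the arrow `α`. -/
def Corner.headα (dy : Fin (n + 1) → ℕ) {dx : Fin n → ℕ} (k : Fin n) (s t : Fin (dx k))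
    (hst : t.val = s.val + 1) : Corner dy dx :=
  ⟨Sum.inr k, true, botHead _ s, botHead _ t, by simp [botHead]; omega, fun i => dx k ≤ i.val⟩

/-- The corner at two dots of column `y`, for the arrow `β`. -/
def Corner.tailβ {dy : Fin (n + 1) → ℕ} (dx : Fin n → ℕ) (k : Fin n) (s t : Fin (dy k.succ))
    (hst : t.val = s.val + 1) : Corner dy dx :=
  ⟨Sum.inl k, false, topTail _ s, topTail _ t, hst, fun i => i.val < dx k⟩

/-- The corner at two dots of column `y`, for the arrow `α`. -/
def Corner.tailα {dy : Fin (n + 1) → ℕ} (dx : Fin n → ℕ) (k : Fin n) (s t : Fin (dy k.castSucc))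
    (hst : t.val = s.val + 1) : Corner dy dx :=
  ⟨Sum.inr k, false, botTail _ s, botTail _ t, by simp [botTail]; omega,
    fun i => dy k.castSucc ≤ i.val⟩

/-- If the two dots carry no arrow, the diagram itself is unchanged. Crossing strands cannot both
lead to virtual dots, because a completion is increasing there. The other three corners follow the
same pattern. -/
theorem lift_headβ (k : Fin n) (s t : Fin (dx k)) (hst : t.val = s.val + 1) :
    (Corner.headβ dy k s t hst).Lift fun w => w.headβ k s t where
  extended w h := by
    refine extended_update_β (k := k) rfl ?_ (fun j hj => Function.update_of_ne hj _ _) rfl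
    rw [Corner.get_flip_self]
    change completion (Function.update w.β k _ k) = _
    rw [Function.update_self]
    exact completion_head_swap hst h
  eq_self w h := by
    have : (w.β k).trans (swap s t).toPEquiv = w.β k := head_swap_eq_self h
    change Laces.mk (Function.update w.β k _) w.α = w
    rw [this, Function.update_eq_self]
  real w h := by
    by_contra hc
    have hv := virtMono_completion (w.β k)
    have h1 : ¬(((completion (w.β k))⁻¹ (topHead _ s)).val < dy k.succ ∨
      ((completion (w.β k))⁻¹ (topHead _ t)).val < dy k.succ) := hc
    have h2 := hv.1 _ _ (by omega) (show (completion (w.β k))⁻¹ (topHead _ t) <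
      (completion (w.β k))⁻¹ (topHead _ s) from h)
    rw [perm_apply_inv, perm_apply_inv, Fin.lt_def] at h2
    simp only [topHead] at h2
    omega

theorem lift_headα (k : Fin n) (s t : Fin (dx k)) (hst : t.val = s.val + 1) :
    (Corner.headα dy k s t hst).Lift fun w => w.headα k s t where
  extended w h := by
    refine extended_update_α (k := k) rfl ?_ (fun j hj => Function.update_of_ne hj _ _) rfl
    rw [Corner.get_flip_self]
    change rotCompletion (Function.update w.α k _ k) = _
    rw [Function.update_self]
    exact rotCompletion_head_swap hst h
  eq_self w h := by
    have : (w.α k).trans (swap s t).toPEquiv = w.α k := rot_head_swap_eq_self h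
    change Laces.mk w.β (Function.update w.α k _) = w
    rw [this, Function.update_eq_self]
  real w h := by
    by_contra hc
    have hv := rotCompletion_virtMono (w.α k)
    have h1 : ¬(dx k ≤ ((rotCompletion (w.α k))⁻¹ (botHead _ s)).val ∨
      dx k ≤ ((rotCompletion (w.α k))⁻¹ (botHead _ t)).val) := hc
    have h2 := hv.1 _ _ (by omega) (show (rotCompletion (w.α k))⁻¹ (botHead _ t) <
      (rotCompletion (w.α k))⁻¹ (botHead _ s) from h)
    rw [perm_apply_inv, perm_apply_inv, Fin.lt_def] at h2
    simp only [botHead] at h2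
    omega

theorem lift_tailβ (k : Fin n) (s t : Fin (dy k.succ)) (hst : t.val = s.val + 1) :
    (Corner.tailβ dx k s t hst).Lift fun w => w.tailβ k s t where
  extended w h := by
    refine extended_update_β (k := k) rfl ?_ (fun j hj => Function.update_of_ne hj _ _) rfl
    rw [Corner.get_flip_self]
    change completion (Function.update w.β k _ k) = _
    rw [Function.update_self]
    exact completion_tail_swap hst h
  eq_self w h := by
    have : (swap s t).toPEquiv.trans (w.β k) = w.β k := tail_swap_eq_self h
    change Laces.mk (Function.update w.β k _) w.α = w
    rw [this, Function.update_eq_self]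
  real w h := by
    by_contra hc
    have hv := virtMono_completion (w.β k)
    have h1 : ¬((completion (w.β k) (topTail _ s)).val < dx k ∨
      (completion (w.β k) (topTail _ t)).val < dx k) := hc
    have h2 := hv.2 _ _ (by omega) (show completion (w.β k) (topTail _ t) <
      completion (w.β k) (topTail _ s) from h)
    rw [perm_inv_apply, perm_inv_apply, Fin.lt_def] at h2
    simp only [topTail] at h2
    omega

theorem lift_tailα (k : Fin n) (s t : Fin (dy k.castSucc)) (hst : t.val = s.val + 1) :
    (Corner.tailα dx k s t hst).Lift fun w => w.tailα k s t where
  extended w h := by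
    refine extended_update_α (k := k) rfl ?_ (fun j hj => Function.update_of_ne hj _ _) rfl
    rw [Corner.get_flip_self]
    change rotCompletion (Function.update w.α k _ k) = _
    rw [Function.update_self]
    exact rotCompletion_tail_swap hst h
  eq_self w h := by
    have : (swap s t).toPEquiv.trans (w.α k) = w.α k := rot_tail_swap_eq_self h
    change Laces.mk w.β (Function.update w.α k _) = w
    rw [this, Function.update_eq_self]
  real w h := by
    by_contra hc
    have hv := rotCompletion_virtMono (w.α k)
    have h1 : ¬(dy k.castSucc ≤ (rotCompletion (w.α k) (botTail _ s)).val ∨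
      dy k.castSucc ≤ (rotCompletion (w.α k) (botTail _ t)).val) := hc
    have h2 := hv.2 _ _ (by omega) (show rotCompletion (w.α k) (botTail _ t) <
      rotCompletion (w.α k) (botTail _ s) from h)
    rw [perm_inv_apply, perm_inv_apply, Fin.lt_def] at h2
    simp only [botTail] at h2
    omega

namespace Middle

/-- Exchange of the two dots, on the left only. -/
def flipL : Middle dy dx → Laces dy dx → Laces dy dx
  | sink k s t _, w => w.headβ k s t
  | source l _ hlr s t _, w =>
    w.tailα l (Fin.cast (congrArg dy hlr) s) (Fin.cast (congrArg dy hlr) t)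

/-- Exchange of the two dots, on the right only. -/
def flipR : Middle dy dx → Laces dy dx → Laces dy dx
  | sink k s t _, w => w.headα k s t
  | source _ r _ s t _, w => w.tailβ r s t

theorem lift_flipL (m : Middle dy dx) : m.L.Lift m.flipL := by
  cases m with
  | sink k s t hst => exact lift_headβ k s t hst
  | source l r hlr s t hst =>
    exact lift_tailα l (Fin.cast (congrArg dy hlr) s) (Fin.cast (congrArg dy hlr) t) hst

theorem lift_flipR (m : Middle dy dx) : m.R.Lift m.flipR := by
  cases m with
  | sink k s t hst => exact lift_headα k s t hst
  | source l r hlr s t hst => exact lift_tailβ r s t hst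

theorem update_swap_apply {i j : Fin (n + 1)} (h : i = j) (s t : Fin (dy i)) :
    Function.update (fun i => (1 : Perm (Fin (dy i)))) i (swap s t) j =
      swap (Fin.cast (congrArg dy h) s) (Fin.cast (congrArg dy h) t) := by
  subst h; rw [Function.update_self]; rfl

theorem one_toPEquiv {m : ℕ} : (1 : Perm (Fin m)).toPEquiv = PEquiv.refl _ := rfl

/-- Exchanging the partners of two dots on both sides of their column is the same as exchanging the
dots, so the orbit does not change. Neither one-sided exchange is such a relabelling in general. -/
theorem flip_eq_conj (m : Middle dy dx) : ∃ ρ τ, ∀ w, m.flipL (m.flipR w) = w.conj ρ τ := by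
  cases m with
  | sink k s t hst =>
    refine ⟨fun _ => 1, Function.update (fun _ => 1) k (swap s t), fun w => ?_⟩
    ext1 <;> funext j <;> by_cases hj : j = k
    · subst hj
      simp only [flipL, flipR, Laces.headβ, Laces.headα, Laces.conj, Function.update_self,
        one_toPEquiv, PEquiv.refl_trans]
    · simp only [flipL, flipR, Laces.headβ, Laces.headα, Laces.conj, Function.update_of_ne hj,
        one_toPEquiv, PEquiv.refl_trans, PEquiv.trans_refl]
    · subst hj
      simp only [flipL, flipR, Laces.headβ, Laces.headα, Laces.conj, Function.update_self,
        one_toPEquiv, PEquiv.refl_trans]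
    · simp only [flipL, flipR, Laces.headβ, Laces.headα, Laces.conj, Function.update_of_ne hj,
        one_toPEquiv, PEquiv.refl_trans, PEquiv.trans_refl]
  | source l r hlr s t hst =>
    refine ⟨Function.update (fun _ => 1) r.succ (swap s t), fun _ => 1, fun w => ?_⟩
    ext1 <;> funext j
    · by_cases hj : j = r
      · subst hj
        simp only [flipL, flipR, Laces.tailβ, Laces.tailα, Laces.conj, Function.update_self,
          one_toPEquiv, PEquiv.trans_refl]
      · have hj' : j.succ ≠ r.succ := fun e => hj (Fin.succ_injective _ e)
        simp only [flipL, flipR, Laces.tailβ, Laces.tailα, Laces.conj, Function.update_of_ne hj,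
          Function.update_of_ne hj', one_toPEquiv, PEquiv.refl_trans, PEquiv.trans_refl]
    · by_cases hj : j = l
      · subst hj
        simp only [flipL, flipR, Laces.tailβ, Laces.tailα, Laces.conj, Function.update_self,
          update_swap_apply hlr, one_toPEquiv, PEquiv.trans_refl]
      · have hj' : j.castSucc ≠ r.succ := fun e => hj (Fin.castSucc_injective _ (e.trans hlr))
        simp only [flipL, flipR, Laces.tailβ, Laces.tailα, Laces.conj, Function.update_of_ne hj,
          Function.update_of_ne hj', one_toPEquiv, PEquiv.refl_trans, PEquiv.trans_refl]

end Middle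

/-- The column `y_n` has no left neighbour, so here the exchange on one side is already a
relabelling of dots. -/
theorem tailβ_eq_conj (k : Fin n) (hk : k.val + 1 = n) (s t : Fin (dy k.succ)) :
    ∃ ρ τ, ∀ w : Laces dy dx, w.tailβ k s t = w.conj ρ τ := by
  refine ⟨Function.update (fun _ => 1) k.succ (swap s t), fun _ => 1, fun w => ?_⟩
  ext1 <;> funext j
  · by_cases hj : j = k
    · subst hj
      simp only [Laces.tailβ, Laces.conj, Function.update_self, Middle.one_toPEquiv,
        PEquiv.trans_refl]
    · have hj' : j.succ ≠ k.succ := fun e => hj (Fin.succ_injective _ e)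
      simp only [Laces.tailβ, Laces.conj, Function.update_of_ne hj,
        Function.update_of_ne hj', Middle.one_toPEquiv, PEquiv.refl_trans, PEquiv.trans_refl]
  · have hj' : j.castSucc ≠ k.succ := fun e => by
      have := congrArg Fin.val e
      simp at this
      omega
    simp only [Laces.tailβ, Laces.conj, Function.update_of_ne hj', Middle.one_toPEquiv,
      PEquiv.refl_trans, PEquiv.trans_refl]

theorem tailα_eq_conj (k : Fin n) (hk : k.val = 0) (s t : Fin (dy k.castSucc)) :
    ∃ ρ τ, ∀ w : Laces dy dx, w.tailα k s t = w.conj ρ τ := by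
  refine ⟨Function.update (fun _ => 1) k.castSucc (swap s t), fun _ => 1, fun w => ?_⟩
  ext1 <;> funext j
  · have hj' : j.succ ≠ k.castSucc := fun e => by
      have := congrArg Fin.val e
      simp at this
      omega
    simp only [Laces.tailα, Laces.conj, Function.update_of_ne hj', Middle.one_toPEquiv,
      PEquiv.refl_trans, PEquiv.trans_refl]
  · by_cases hj : j = k
    · subst hj
      simp only [Laces.tailα, Laces.conj, Function.update_self, Middle.one_toPEquiv,
        PEquiv.trans_refl]
    · have hj' : j.castSucc ≠ k.castSucc := fun e => hj (Fin.castSucc_injective _ e)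
      simp only [Laces.tailα, Laces.conj, Function.update_of_ne hj,
        Function.update_of_ne hj', Middle.one_toPEquiv, PEquiv.refl_trans, PEquiv.trans_refl]

/-! ### Lacing diagrams in an orbit -/

/-- A permutation matrix. -/
def permGL (K : Type*) [Field K] {m : ℕ} (ρ : Perm (Fin m)) : GL (Fin m) K where
  val := ρ.toPEquiv.toMatrix
  inv := ρ.symm.toPEquiv.toMatrix
  val_inv := by
    rw [← PEquiv.toMatrix_trans, ← Equiv.toPEquiv_trans, Equiv.self_trans_symm,
      Equiv.toPEquiv_refl, PEquiv.toMatrix_refl]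
  inv_val := by
    rw [← PEquiv.toMatrix_trans, ← Equiv.toPEquiv_trans, Equiv.symm_trans_self,
      Equiv.toPEquiv_refl, PEquiv.toMatrix_refl]

theorem Rep.act_act {K : Type*} [Field K] (V : Rep K dy dx) (gy gy' : ∀ i, GL (Fin (dy i)) K)
    (gx gx' : ∀ k, GL (Fin (dx k)) K) :
    (V.act gy gx).act gy' gx' = V.act (fun i => gy i * gy' i) (fun k => gx k * gx' k) := by
  ext1 <;> funext k <;>
    simp only [Rep.act, mul_inv_rev, Units.val_mul, Matrix.mul_assoc]

theorem Rep.act_mem_orbit {K : Type*} [Field K] {V U : Rep K dy dx} (h : U ∈ V.orbit)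
    (gy : ∀ i, GL (Fin (dy i)) K) (gx : ∀ k, GL (Fin (dx k)) K) : U.act gy gx ∈ V.orbit := by
  obtain ⟨hy, hx, rfl⟩ := h
  exact ⟨_, _, Rep.act_act _ _ _ _ _⟩

theorem Laces.toRep_conj (K : Type*) [Field K] (w : Laces dy dx) (ρ : ∀ i, Perm (Fin (dy i)))
    (τ : ∀ k, Perm (Fin (dx k))) : (w.conj ρ τ).toRep K =
      (w.toRep K).act (fun i => (permGL K (ρ i))⁻¹) (fun k => permGL K (τ k)) := by
  ext1 <;> funext k <;>
    simp only [Laces.toRep, Laces.conj, Rep.act, PEquiv.toMatrix_trans, inv_inv, permGL,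
      Matrix.mul_assoc]

theorem Laces.conj_mem_orbit {K : Type*} [Field K] {V : Rep K dy dx} {w : Laces dy dx}
    (h : w.toRep K ∈ V.orbit) (ρ : ∀ i, Perm (Fin (dy i))) (τ : ∀ k, Perm (Fin (dx k))) :
    (w.conj ρ τ).toRep K ∈ V.orbit := by
  rw [Laces.toRep_conj]
  exact Rep.act_mem_orbit h _ _

end

theorem lt_of_succ_lt {f : ℕ → ℕ} {o l : ℕ} (h : ∀ i, i + 1 < l → f (o + i) < f (o + i + 1)) :
    ∀ p q, o ≤ p → p < q → q < o + l → f p < f q := by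
  intro p q h1 h2 h3
  obtain ⟨d, rfl⟩ : ∃ d, q = p + 1 + d := ⟨q - p - 1, by omega⟩
  induction d with
  | zero =>
    have := h (p - o) (by omega)
    rwa [show o + (p - o) = p by omega] at this
  | succ d ih =>
    have h4 := h (p + 1 + d - o) (by omega)
    rw [show o + (p + 1 + d - o) = p + 1 + d by omega] at h4
    exact (ih (by omega) (by omega)).trans h4

/-- The rectangles outside the snake contribute a constant. This is what turns a count of inversions
into a statement about the length of a lacing diagram. -/
theorem Frame.length_totWord {F : Frame} (wA wB : ℕ → List ℕ) :
    (F.totWord wA wB).length = (F.totWord (fun _ => []) fun _ => []).length +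
      ∑ k ∈ Finset.range F.n, ((wA k).length + (wB k).length) := by
  unfold totWord
  generalize F.n = m
  induction m with
  | zero => rfl
  | succ m ih =>
    rw [preWord_succ, preWord_succ, List.length_append, List.length_append, ih,
      Finset.sum_range_succ]
    simp only [colWord, List.length_append, List.length_nil]
    omega

section

variable {n : ℕ} {dy : Fin (n + 1) → ℕ} {dx : Fin n → ℕ}

/-- The number of crosses outside of the snake region. -/
noncomputable def cornerLength (dy : Fin (n + 1) → ℕ) (dx : Fin n → ℕ) : ℕ :=
  ((frame dy dx).totWord (fun _ => []) fun _ => []).length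

theorem Laces.length_totWord (w : Laces dy dx) :
    ((frame dy dx).totWord w.extended.wordA w.extended.wordB).length =
      cornerLength dy dx + w.length := by
  rw [Frame.length_totWord, cornerLength, Laces.length, frame_n, ← Fin.sum_univ_eq_sum_range
    (fun k => (w.extended.wordA k).length + (w.extended.wordB k).length)]
  congr 1
  refine Finset.sum_congr rfl fun k _ => ?_
  rw [PermTuple.length_wordA, PermTuple.length_wordB, add_comm]

/-- The product of the permutations of the blocks. -/
def PermTuple.product (c : PermTuple dy dx) : Perm ℕ := (frame dy dx).sufPerm c.permA c.permB 0

theorem Laces.encard_inversions {w : Laces dy dx}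
    (h : IsRed ((frame dy dx).totWord w.extended.wordA w.extended.wordB) w.extended.product) :
    w.total = w.extended.product ∧
      (inversions w.total).encard = (cornerLength dy dx + w.length : ℕ) := by
  have h1 : w.total = w.extended.product := h.dem_eq
  exact ⟨h1, by rw [h1, h.encard, w.length_totWord]⟩

/-! ### Pushing crossings to the left and to the right -/

theorem PermTuple.leftMono {c : PermTuple dy dx} (h : ∀ m : Middle dy dx, ¬m.R.Cross c) :
    (frame dy dx).LeftMono c.permA c.permB := by
  constructor
  · intro k hk
    obtain ⟨k, rfl⟩ : ∃ j : Fin n, k = j := ⟨⟨k, hk⟩, rfl⟩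
    refine lt_of_succ_lt fun i hi => ?_
    rw [frame_ex] at hi
    rw [frame_ey_castSucc, permA_eq, add_assoc, emb_lt_succ (by omega)]
    have := h (.sink k ⟨i, by omega⟩ ⟨i + 1, hi⟩ rfl)
    refine lt_of_le_of_ne (not_lt.1 this) fun e => ?_
    have := congrArg Fin.val ((c.α k)⁻¹.injective e)
    simp at this
  · intro k hk
    obtain ⟨r, rfl⟩ : ∃ j : Fin n, k = j := ⟨⟨k, by rw [frame_n] at hk; omega⟩, rfl⟩
    obtain ⟨l, hl⟩ : ∃ l : Fin n, l.val = r.val + 1 := ⟨⟨r + 1, hk⟩, rfl⟩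
    refine lt_of_succ_lt fun i hi => ?_
    rw [frame_ey_succ] at hi
    rw [permB_eq, emb_lt_succ (by omega)]
    have := h (.source l r (Fin.ext (by simp [hl])) ⟨i, by omega⟩ ⟨i + 1, hi⟩ rfl)
    refine lt_of_le_of_ne (not_lt.1 this) fun e => ?_
    have := congrArg Fin.val ((c.β r).injective e)
    simp at this

theorem PermTuple.rightMono {c : PermTuple dy dx} (h : ∀ m : Middle dy dx, ¬m.L.Cross c) :
    (frame dy dx).RightMono c.permA c.permB := by
  constructor
  · intro k hk h0
    obtain ⟨l, rfl⟩ : ∃ j : Fin n, k = j := ⟨⟨k, hk⟩, rfl⟩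
    obtain ⟨r, hr⟩ : ∃ r : Fin n, l.val = r.val + 1 := ⟨⟨l - 1, by omega⟩, by simp; omega⟩
    have hlr : r.succ = l.castSucc := Fin.ext (by simp [hr])
    refine lt_of_succ_lt fun i hi => ?_
    rw [frame_ey_castSucc] at hi
    have hi' : i + 1 < dy r.succ := hlr ▸ hi
    rw [frame_ex, permA_eq, add_assoc, emb_inv_lt_succ (by omega), inv_inv]
    have := h (.source l r hlr ⟨i, by omega⟩ ⟨i + 1, hi'⟩ rfl)
    refine lt_of_le_of_ne (not_lt.1 this) fun e => ?_
    have := congrArg Fin.val ((c.α l).injective e)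
    simp at this
  · intro k hk
    obtain ⟨k, rfl⟩ : ∃ j : Fin n, k = j := ⟨⟨k, hk⟩, rfl⟩
    refine lt_of_succ_lt fun i hi => ?_
    rw [frame_ex] at hi
    rw [permB_eq, emb_inv_lt_succ (by omega)]
    have := h (.sink k ⟨i, by omega⟩ ⟨i + 1, hi⟩ rfl)
    refine lt_of_le_of_ne (not_lt.1 this) fun e => ?_
    have := congrArg Fin.val ((c.β k)⁻¹.injective e)
    simp at this

/-- Weights increasing from left to right. -/
def weightR (n : ℕ) : Fin n ⊕ Fin n → ℕ
  | Sum.inl k => 2 * (n - k)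
  | Sum.inr k => 2 * (n - k) + 1

/-- Weights increasing from right to left. -/
def weightL (n : ℕ) : Fin n ⊕ Fin n → ℕ
  | Sum.inl k => 2 * k + 1
  | Sum.inr k => 2 * k

namespace Middle

theorem val_eq {l r : Fin n} (hlr : r.succ = l.castSucc) : l.val = r.val + 1 := by
  have := congrArg Fin.val hlr
  simpa using this.symm

theorem weightR_lt (m : Middle dy dx) : weightR n m.L.σ < weightR n m.R.σ := by
  cases m with
  | sink k s t hst => simp [L, R, weightR]
  | source l r hlr s t hst =>
    have := val_eq hlr
    simp only [L, R, weightR]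
    omega

theorem weightL_lt (m : Middle dy dx) : weightL n m.R.σ < weightL n m.L.σ := by
  cases m with
  | sink k s t hst => simp [L, R, weightL]
  | source l r hlr s t hst =>
    have := val_eq hlr
    simp only [L, R, weightL]
    omega

variable {m : Middle dy dx} {c : PermTuple dy dx} {w : Laces dy dx}

theorem extended_flip (hL : m.L.Real w.extended) (hR : m.R.Real w.extended) :
    (m.flipL (m.flipR w)).extended = m.L.flip (m.R.flip w.extended) := by
  have h1 := m.lift_flipR.extended w hR
  rw [m.lift_flipL.extended _ (by rwa [h1, Corner.real_flip_of_ne m.ne]), h1]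

theorem extended_flip_of_not_left (hL : ¬m.L.Real w.extended) (hR : m.R.Real w.extended) :
    (m.flipL (m.flipR w)).extended = m.R.flip w.extended := by
  have h1 := m.lift_flipR.extended w hR
  rw [m.lift_flipL.eq_self _ (by rwa [h1, Corner.real_flip_of_ne m.ne]), h1]

theorem extended_flip_of_not_right (hL : m.L.Real w.extended) (hR : ¬m.R.Real w.extended) :
    (m.flipL (m.flipR w)).extended = m.L.flip w.extended := by
  rw [m.lift_flipR.eq_self _ hR, m.lift_flipL.extended _ hL]

theorem weight_flip_flip (h : m.R.Cross c) (h' : ¬m.L.Cross c) (wt : Fin n ⊕ Fin n → ℕ) :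
    (m.L.flip (m.R.flip c)).weight wt + wt m.R.σ = c.weight wt + wt m.L.σ := by
  have h1 := Corner.weight_flip h wt
  have h2 := Corner.weight_flip (g := m.L) (c := m.L.flip (m.R.flip c))
    (by rwa [Corner.cross_flip, Corner.cross_flip_of_ne m.ne]) wt
  rw [Corner.flip_flip] at h2
  omega

theorem weight_flip_flip' (h : m.L.Cross c) (h' : ¬m.R.Cross c) (wt : Fin n ⊕ Fin n → ℕ) :
    (m.L.flip (m.R.flip c)).weight wt + wt m.L.σ = c.weight wt + wt m.R.σ := by
  rw [Corner.flip_comm m.ne]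
  have h1 := Corner.weight_flip h wt
  have h2 := Corner.weight_flip (g := m.R) (c := m.R.flip (m.L.flip c))
    (by rwa [Corner.cross_flip, Corner.cross_flip_of_ne m.ne.symm]) wt
  rw [Corner.flip_flip] at h2
  omega

end Middle

/-- A set of lacing diagrams that is stable under permutations of the dots of a column. -/
def ConjStable (S : Set (Laces dy dx)) : Prop := ∀ w ∈ S, ∀ ρ τ, w.conj ρ τ ∈ S

/-- The lacing diagrams of minimal length in a set. -/
def minLength (S : Set (Laces dy dx)) : Set (Laces dy dx) :=
  {w | w ∈ S ∧ ∀ w' ∈ S, w.length ≤ w'.length}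

section

variable {S : Set (Laces dy dx)}

theorem flip_mem (hS : ConjStable S) {w : Laces dy dx} (hw : w ∈ S) (m : Middle dy dx) :
    m.flipL (m.flipR w) ∈ S := by
  obtain ⟨ρ, τ, h⟩ := m.flip_eq_conj
  rw [h]; exact hS w hw ρ τ

/-- Exchanging the two dots removes the crossing on the right. To keep a shorter diagram from
arising, the exchange must create a crossing on the left; so the left strands are not both virtual
there and do not cross yet. -/
theorem right_cross_of_minLength (hS : ConjStable S) {w : Laces dy dx} (hw : w ∈ minLength S)
    {m : Middle dy dx} (h : m.R.Cross w.extended) :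
    m.L.Real w.extended ∧ ¬m.L.Cross w.extended := by
  have hR := m.lift_flipR.real w h
  have hmin := hw.2 _ (flip_mem hS hw.1 m)
  rw [Laces.length_eq_weight, Laces.length_eq_weight] at hmin
  have h1 := Corner.weight_flip h fun _ => 1
  by_cases hL : m.L.Real w.extended
  · refine ⟨hL, fun h2 => ?_⟩
    rw [Middle.extended_flip hL hR] at hmin
    have h3 := Corner.weight_flip (g := m.L) (c := m.R.flip w.extended)
      ((Corner.cross_flip_of_ne m.ne).2 h2) fun _ => 1
    omega
  · rw [Middle.extended_flip_of_not_left hL hR] at hmin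
    omega

theorem left_cross_of_minLength (hS : ConjStable S) {w : Laces dy dx} (hw : w ∈ minLength S)
    {m : Middle dy dx} (h : m.L.Cross w.extended) :
    m.R.Real w.extended ∧ ¬m.R.Cross w.extended := by
  have hL := m.lift_flipL.real w h
  have hmin := hw.2 _ (flip_mem hS hw.1 m)
  rw [Laces.length_eq_weight, Laces.length_eq_weight] at hmin
  have h1 := Corner.weight_flip h fun _ => 1
  by_cases hR : m.R.Real w.extended
  · refine ⟨hR, fun h2 => ?_⟩
    rw [Middle.extended_flip hL hR, Corner.flip_comm m.ne] at hmin
    have h3 := Corner.weight_flip (g := m.R) (c := m.L.flip w.extended)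
      ((Corner.cross_flip_of_ne m.ne.symm).2 h2) fun _ => 1
    omega
  · rw [Middle.extended_flip_of_not_right hL hR] at hmin
    omega

/-- Among minimal diagrams with the given product, choose one of least weight, where crossings
further right weigh more. A crossing to the right of an inner column could still be moved to its
left side, within the minimal diagrams and lowering the weight. -/
theorem exists_leftNormal (hS : ConjStable S) {w : Laces dy dx} (hw : w ∈ minLength S) :
    ∃ w' ∈ minLength S, w'.total = w.total ∧ ∀ m : Middle dy dx, ¬m.R.Cross w'.extended := by
  obtain ⟨w', ⟨h1, h2⟩, h3⟩ := (measure fun w : Laces dy dx =>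
    w.extended.weight (weightR n)).wf.has_min {w' | w' ∈ minLength S ∧ w'.total = w.total}
    ⟨w, hw, rfl⟩
  refine ⟨w', h1, h2, fun m hm => ?_⟩
  obtain ⟨hL, hc⟩ := right_cross_of_minLength hS h1 hm
  have e := Middle.extended_flip hL (m.lift_flipR.real w' hm)
  have hmove : m.Move w'.extended (m.flipL (m.flipR w')).extended := by
    rw [e]
    refine ⟨hL, m.lift_flipR.real w' hm, by tauto, Or.inr hm, Or.inl ?_⟩
    rwa [Corner.cross_flip, Corner.cross_flip_of_ne m.ne]
  refine h3 (m.flipL (m.flipR w')) ⟨⟨flip_mem hS h1.1 m, fun w'' hw'' => ?_⟩,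
    hmove.total_eq.trans h2⟩ ?_
  · refine le_trans (le_of_eq ?_) (h1.2 w'' hw'')
    have := Middle.weight_flip_flip hm hc fun _ => 1
    rw [Laces.length_eq_weight, Laces.length_eq_weight, e]
    omega
  · have := Middle.weight_flip_flip hm hc (weightR n)
    have h4 := m.weightR_lt
    change (m.flipL (m.flipR w')).extended.weight _ < w'.extended.weight _
    rw [e]
    omega

theorem exists_rightNormal (hS : ConjStable S) {w : Laces dy dx} (hw : w ∈ minLength S) :
    ∃ w' ∈ minLength S, w'.total = w.total ∧ ∀ m : Middle dy dx, ¬m.L.Cross w'.extended := by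
  obtain ⟨w', ⟨h1, h2⟩, h3⟩ := (measure fun w : Laces dy dx =>
    w.extended.weight (weightL n)).wf.has_min {w' | w' ∈ minLength S ∧ w'.total = w.total}
    ⟨w, hw, rfl⟩
  refine ⟨w', h1, h2, fun m hm => ?_⟩
  obtain ⟨hR, hc⟩ := left_cross_of_minLength hS h1 hm
  have e := Middle.extended_flip (m.lift_flipL.real w' hm) hR
  have hmove : m.Move w'.extended (m.flipL (m.flipR w')).extended := by
    rw [e]
    refine ⟨m.lift_flipL.real w' hm, hR, by tauto, Or.inl hm, Or.inr ?_⟩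
    rwa [Corner.cross_flip_of_ne m.ne.symm, Corner.cross_flip]
  refine h3 (m.flipL (m.flipR w')) ⟨⟨flip_mem hS h1.1 m, fun w'' hw'' => ?_⟩,
    hmove.total_eq.trans h2⟩ ?_
  · refine le_trans (le_of_eq ?_) (h1.2 w'' hw'')
    have := Middle.weight_flip_flip' hm hc fun _ => 1
    rw [Laces.length_eq_weight, Laces.length_eq_weight, e]
    omega
  · have := Middle.weight_flip_flip' hm hc (weightL n)
    have h4 := m.weightL_lt
    change (m.flipL (m.flipR w')).extended.weight _ < w'.extended.weight _
    rw [e]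
    omega

/-- Used at the two end columns, where undoing a crossing is a mere relabelling of dots and would
shorten the diagram. -/
theorem not_cross_of_lift (hS : ConjStable S) {w : Laces dy dx} (hw : w ∈ minLength S)
    {g : Corner dy dx} {f : Laces dy dx → Laces dy dx} (hg : g.Lift f)
    (hf : ∃ ρ τ, ∀ w : Laces dy dx, f w = w.conj ρ τ) : ¬g.Cross w.extended := by
  intro h
  obtain ⟨ρ, τ, hf⟩ := hf
  have hmin := hw.2 _ (hS w hw.1 ρ τ)
  have h1 := Corner.weight_flip h fun _ => 1
  rw [← hf, Laces.length_eq_weight, Laces.length_eq_weight, hg.extended w (hg.real w h)] at hmin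
  omega

theorem firstAsc_of_minLength (hS : ConjStable S) {w : Laces dy dx} (hw : w ∈ minLength S) :
    (frame dy dx).FirstAsc w.extended.permB := by
  intro k hk i hi
  rw [frame_n] at hk
  obtain ⟨k, rfl⟩ : ∃ j : Fin n, k = j := ⟨⟨k, by omega⟩, rfl⟩
  rw [frame_ey_succ] at hi
  rw [PermTuple.permB_eq, emb_lt_succ (by omega)]
  have := not_cross_of_lift hS hw (lift_tailβ k ⟨i, by omega⟩ ⟨i + 1, hi⟩ rfl)
    (tailβ_eq_conj k hk _ _)
  refine lt_of_le_of_ne (not_lt.1 this) fun e => ?_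
  have := congrArg Fin.val ((w.extended.β k).injective e)
  simp at this

theorem lastAsc_of_minLength (hS : ConjStable S) {w : Laces dy dx} (hw : w ∈ minLength S) :
    (frame dy dx).LastAsc w.extended.permA := by
  intro h0 i hi
  obtain ⟨k, hk⟩ : ∃ k : Fin n, k.val = 0 := ⟨⟨0, h0⟩, rfl⟩
  rw [← hk] at hi ⊢
  rw [frame_ey_castSucc] at hi
  rw [frame_ex, PermTuple.permA_eq, add_assoc, emb_inv_lt_succ (by omega), inv_inv]
  have := not_cross_of_lift hS hw (lift_tailα k ⟨i, by omega⟩ ⟨i + 1, hi⟩ rfl)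
    (tailα_eq_conj k hk _ _)
  refine lt_of_le_of_ne (not_lt.1 this) fun e => ?_
  have := congrArg Fin.val ((w.extended.α k).injective e)
  simp at this

theorem Laces.isRed_of_leftNormal {w : Laces dy dx} (h : ∀ m : Middle dy dx, ¬m.R.Cross w.extended) :
    IsRed ((frame dy dx).totWord w.extended.wordA w.extended.wordB) w.extended.product :=
  Frame.isRed_totWord_of_leftMono (PermTuple.isRed_wordA _) (PermTuple.isRed_wordB _)
    (PermTuple.supported _) (PermTuple.leftMono h)

/-- The product is unchanged by pushing crossings to the left, and the left-pushed diagram satisfies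
the hypotheses of `Frame.rowAsc_of_leftMono`. For block columns one pushes to the right instead. -/
theorem rowAsc_of_minLength (hS : ConjStable S) {w : Laces dy dx} (hw : w ∈ minLength S) :
    (frame dy dx).RowAsc w.total := by
  obtain ⟨w', h1, h2, h3⟩ := exists_leftNormal hS hw
  rw [← h2]
  exact Frame.rowAsc_of_leftMono (PermTuple.bounded _) (PermTuple.isRed_wordA _)
    (PermTuple.isRed_wordB _) (PermTuple.supported _) (PermTuple.leftMono h3) w'.virtAsc
    (firstAsc_of_minLength hS h1)

theorem colAsc_of_minLength (hS : ConjStable S) {w : Laces dy dx} (hw : w ∈ minLength S) :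
    (frame dy dx).ColAsc w.total := by
  obtain ⟨w', h1, h2, h3⟩ := exists_rightNormal hS hw
  rw [← h2]
  exact Frame.colAsc_of_rightMono (PermTuple.bounded _) (PermTuple.isRed_wordA _)
    (PermTuple.isRed_wordB _) (PermTuple.supported _) (PermTuple.rightMono h3) w'.virtAsc
    (lastAsc_of_minLength hS h1)

theorem exists_product_of_minLength (hS : ConjStable S) {w : Laces dy dx} (hw : w ∈ minLength S) :
    (∃ w' ∈ S, w.total = w'.extended.product) ∧
      (inversions w.total).encard = (cornerLength dy dx + w.length : ℕ) := by
  obtain ⟨w', h1, h2, h3⟩ := exists_leftNormal hS hw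
  obtain ⟨h4, h5⟩ := Laces.encard_inversions (Laces.isRed_of_leftNormal h3)
  refine ⟨⟨w', h1.1, h2.symm.trans h4⟩, ?_⟩
  rw [← h2, h5, le_antisymm (h1.2 w hw.1) (hw.2 w' h1.1)]

end

/-! ### Moves towards a normal form -/

/-- A tuple need not be an extended diagram, so increase at virtual dots has to be extracted from
the total product: its ascents in block rows forbid two strands from virtual inputs of the left
block to cross. -/
theorem Middle.left_real {m : Middle dy dx} {c : PermTuple dy dx}
    (hr : (frame dy dx).RowAsc c.total) (h : m.L.Cross c) : m.L.Real c := by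
  by_contra hc
  cases m with
  | sink k s t hst =>
    have h1 : ¬(((c.β k)⁻¹ (topHead _ s)).val < dy k.succ ∨
      ((c.β k)⁻¹ (topHead _ t)).val < dy k.succ) := hc
    have h2 : (c.β k)⁻¹ (topHead _ t) < (c.β k)⁻¹ (topHead _ s) := h
    have h3 := lt_of_succ_lt (f := c.permB k) (o := (frame dy dx).oB k + (frame dy dx).ey (k + 1))
      (l := (frame dy dx).ex k) (fun i hi => Frame.ins_of_rowAsc c.bounded c.dem_wordB hr k.isLt hi)
      ((frame dy dx).oB k + ((c.β k)⁻¹ (topHead _ t)).val)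
      ((frame dy dx).oB k + ((c.β k)⁻¹ (topHead _ s)).val)
      (by rw [frame_ey_succ]; omega) (by rw [Fin.lt_def] at h2; omega)
      (by rw [frame_ey_succ, frame_ex]; omega)
    rw [c.permB_eq, emb_lt_iff, perm_apply_inv, perm_apply_inv, Fin.lt_def] at h3
    simp only [topHead] at h3
    omega
  | source l r hlr s t hst =>
    set s' := Fin.cast (congrArg dy hlr) s with hs'
    set t' := Fin.cast (congrArg dy hlr) t with ht'
    have h1 : ¬(dy l.castSucc ≤ (c.α l (botTail _ s')).val ∨
      dy l.castSucc ≤ (c.α l (botTail _ t')).val) := hc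
    have h2 : c.α l (botTail _ t') < c.α l (botTail _ s') := h
    have h3 := lt_of_succ_lt (f := c.permA l) (o := (frame dy dx).oA l)
      (l := (frame dy dx).ey l)
      (fun i hi => Frame.pending_of_rowAsc c.bounded c.dem_wordA hr l.isLt hi)
      ((frame dy dx).oA l + (c.α l (botTail _ t')).val)
      ((frame dy dx).oA l + (c.α l (botTail _ s')).val)
      (by omega) (by rw [Fin.lt_def] at h2; omega)
      (by rw [frame_ey_castSucc]; omega)
    rw [c.permA_eq, emb_lt_iff, perm_inv_apply, perm_inv_apply, Fin.lt_def] at h3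
    simp only [botTail, hs', ht', Fin.val_cast] at h3
    omega

/-- If the strands do not yet cross on the left, make them cross there. The crossing on the right
keeps the product unchanged, so `left_real` applies to the new tuple. -/
theorem Middle.left_real_of_right_cross {m : Middle dy dx} {c : PermTuple dy dx}
    (hr : (frame dy dx).RowAsc c.total) (h : m.R.Cross c) : m.L.Real c := by
  by_cases hc : m.L.Cross c
  · exact left_real hr hc
  · rw [← Corner.real_flip]
    refine left_real ?_ (Corner.cross_flip.2 hc)
    rwa [total_flip_left h]

theorem Middle.Move.symm {m : Middle dy dx} {c c' : PermTuple dy dx} (h : m.Move c c') :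
    m.Move c' c := by
  have hne := m.ne
  refine ⟨?_, ?_, ?_, h.cross', h.cross⟩
  · have := h.left
    rcases h.eq with e | e | e | e <;>
      simpa [e, Corner.real_flip, Corner.real_flip_of_ne hne, Corner.real_flip_of_ne hne.symm]
  · have := h.right
    rcases h.eq with e | e | e | e <;>
      simpa [e, Corner.real_flip, Corner.real_flip_of_ne hne, Corner.real_flip_of_ne hne.symm]
  · rcases h.eq with e | e | e | e
    · exact Or.inl e.symm
    · exact Or.inr (Or.inl (by rw [e, Corner.flip_flip]))
    · exact Or.inr (Or.inr (Or.inl (by rw [e, Corner.flip_flip])))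
    · exact Or.inr (Or.inr (Or.inr (by
        rw [e, Corner.flip_comm hne, Corner.flip_flip, Corner.flip_flip])))

theorem KMove.symm {w w' : Laces dy dx} (h : KMove w w') : KMove w' w :=
  h.exists_move.choose_spec.symm.kMove

theorem total_eq_of_reflTransGen {w w' : Laces dy dx} (h : Relation.ReflTransGen KMove w w') :
    w'.total = w.total := by
  induction h with
  | refl => rfl
  | tail _ h ih => exact h.total_eq.trans ih

/-- No minimality is assumed here: a crossing on both sides is replaced by the one on the left, a
crossing on the right only is moved to the left. Both lower the weight, and the ascents in block
rows guarantee that the dots concerned are non-virtual, so that these are legitimate moves. The end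
of the process is a reduced word. -/
theorem exists_leftNormal_of_rowAsc {w : Laces dy dx} (hr : (frame dy dx).RowAsc w.total) :
    ∃ w', Relation.ReflTransGen KMove w' w ∧ w.total = w'.extended.product ∧
      (inversions w.total).encard = (cornerLength dy dx + w'.length : ℕ) := by
  obtain ⟨w', h1, h3⟩ := (measure fun w : Laces dy dx =>
    w.extended.weight (weightR n)).wf.has_min {w' | Relation.ReflTransGen KMove w' w}
    ⟨w, Relation.ReflTransGen.refl⟩
  have e := total_eq_of_reflTransGen h1
  have hN : ∀ m : Middle dy dx, ¬m.R.Cross w'.extended := by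
    intro m hm
    have hL := Middle.left_real_of_right_cross (m := m) (c := w'.extended)
      (by rw [e] at hr; exact hr) hm
    have hR := m.lift_flipR.real w' hm
    have hlt := m.weightR_lt
    have hw1 := Corner.weight_flip hm (weightR n)
    -- Crossing on both sides: drop the right one, which shortens the diagram. Otherwise exchange
    -- both partners, which keeps the length but moves the crossing to the left.
    by_cases hc : m.L.Cross w'.extended
    · have e1 := m.lift_flipR.extended w' hR
      have hmove : m.Move w'.extended (m.flipR w').extended := by
        rw [e1]
        exact ⟨hL, hR, by tauto, Or.inr hm, Or.inl ((Corner.cross_flip_of_ne m.ne).2 hc)⟩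
      refine h3 (m.flipR w') (Relation.ReflTransGen.head hmove.kMove.symm h1) ?_
      change (m.flipR w').extended.weight _ < w'.extended.weight _
      rw [e1]
      omega
    · have e1 := Middle.extended_flip hL hR
      have hmove : m.Move w'.extended (m.flipL (m.flipR w')).extended := by
        rw [e1]
        refine ⟨hL, hR, by tauto, Or.inr hm, Or.inl ?_⟩
        rwa [Corner.cross_flip, Corner.cross_flip_of_ne m.ne]
      refine h3 (m.flipL (m.flipR w')) (Relation.ReflTransGen.head hmove.kMove.symm h1) ?_
      have := Middle.weight_flip_flip hm hc (weightR n)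
      change (m.flipL (m.flipR w')).extended.weight _ < w'.extended.weight _
      rw [e1]
      omega
  obtain ⟨h4, h5⟩ := Laces.encard_inversions (Laces.isRed_of_leftNormal hN)
  exact ⟨w', h1, e.trans h4, by rw [e, h5]⟩

/-! ### The structure of laces -/

theorem Vertex.pos_injective : Function.Injective (Vertex.pos : Vertex n → ℕ) := by
  rintro (i | k) (i' | k') h <;> simp only [Vertex.pos, Fin.val_rev] at h
  · congr 1; apply Fin.ext; omega
  · omega
  · omega
  · congr 1; apply Fin.ext; omega

/-- The arrows of a lacing diagram, directed from left to right. -/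
inductive Laces.Next (w : Laces dy dx) : Dot dy dx → Dot dy dx → Prop
  | beta (k : Fin n) (i : Fin (dy k.succ)) (j : Fin (dx k)) (h : j ∈ w.β k i) :
      Laces.Next w (Sum.inl ⟨k.succ, i⟩) (Sum.inr ⟨k, j⟩)
  | alpha (k : Fin n) (i : Fin (dy k.castSucc)) (j : Fin (dx k)) (h : j ∈ w.α k i) :
      Laces.Next w (Sum.inr ⟨k, j⟩) (Sum.inl ⟨k.castSucc, i⟩)

/-- The position of the column of a dot. -/
def Dot.rank (p : Dot dy dx) : ℕ := (Dot.column p).pos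

namespace Laces

variable {w : Laces dy dx} {p q p' q' : Dot dy dx}

theorem next_iff : w.Next p q ↔
    (∃ k i j, j ∈ w.β k i ∧ p = Sum.inl ⟨k.succ, i⟩ ∧ q = Sum.inr ⟨k, j⟩) ∨
    (∃ k i j, j ∈ w.α k i ∧ p = Sum.inr ⟨k, j⟩ ∧ q = Sum.inl ⟨k.castSucc, i⟩) := by
  constructor
  · rintro (⟨k, i, j, h⟩ | ⟨k, i, j, h⟩)
    · exact Or.inl ⟨k, i, j, h, rfl, rfl⟩
    · exact Or.inr ⟨k, i, j, h, rfl, rfl⟩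
  · rintro (⟨k, i, j, h, rfl, rfl⟩ | ⟨k, i, j, h, rfl, rfl⟩)
    · exact .beta k i j h
    · exact .alpha k i j h

theorem next_inl_inr {k : Fin n} {i : Fin (dy k.succ)} {j : Fin (dx k)} :
    w.Next (Sum.inl ⟨k.succ, i⟩) (Sum.inr ⟨k, j⟩) ↔ j ∈ w.β k i := by
  refine ⟨fun h => ?_, .beta k i j⟩
  rw [next_iff] at h
  rcases h with ⟨k', i', j', h, h1, h2⟩ | ⟨k', i', j', h, h1, h2⟩
  · cases h2
    have := Sum.inl.inj h1
    rw [Sigma.mk.injEq] at this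
    obtain rfl := eq_of_heq this.2
    exact h
  · cases h1

theorem next_inr_inl {k : Fin n} {i : Fin (dy k.castSucc)} {j : Fin (dx k)} :
    w.Next (Sum.inr ⟨k, j⟩) (Sum.inl ⟨k.castSucc, i⟩) ↔ j ∈ w.α k i := by
  refine ⟨fun h => ?_, .alpha k i j⟩
  rw [next_iff] at h
  rcases h with ⟨k', i', j', h, h1, h2⟩ | ⟨k', i', j', h, h1, h2⟩
  · cases h1
  · cases h1
    have := Sum.inl.inj h2
    rw [Sigma.mk.injEq] at this
    obtain rfl := eq_of_heq this.2
    exact h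

theorem Next.rank_eq (h : w.Next p q) : q.rank = p.rank + 1 := by
  rcases h with ⟨k, i, j, h⟩ | ⟨k, i, j, h⟩
  · simp only [Dot.rank, Dot.column, Vertex.pos, Fin.val_rev, Fin.val_succ]; omega
  · simp only [Dot.rank, Dot.column, Vertex.pos, Fin.val_rev, Fin.val_castSucc]; omega

theorem Next.right_unique (h : w.Next p q) (h' : w.Next p q') : q = q' := by
  rw [next_iff] at h h'
  rcases h with ⟨k, i, j, h, rfl, rfl⟩ | ⟨k, i, j, h, rfl, rfl⟩ <;>
    rcases h' with ⟨k', i', j', h', e, rfl⟩ | ⟨k', i', j', h', e, rfl⟩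
  · have := Sum.inl.inj e
    rw [Sigma.mk.injEq] at this
    obtain rfl := Fin.succ_injective _ this.1
    obtain rfl := eq_of_heq this.2
    have : j = j' := Option.mem_unique h h'
    rw [this]
  · cases e
  · cases e
  · have := Sum.inr.inj e
    rw [Sigma.mk.injEq] at this
    obtain rfl := this.1
    obtain rfl := eq_of_heq this.2
    have : i = i' := (w.α k).inj h h'
    rw [this]

theorem Next.left_unique (h : w.Next p q) (h' : w.Next p' q) : p = p' := by
  rw [next_iff] at h h'
  rcases h with ⟨k, i, j, h, rfl, rfl⟩ | ⟨k, i, j, h, rfl, rfl⟩ <;>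
    rcases h' with ⟨k', i', j', h', rfl, e⟩ | ⟨k', i', j', h', rfl, e⟩
  · have := Sum.inr.inj e
    rw [Sigma.mk.injEq] at this
    obtain rfl := this.1
    obtain rfl := eq_of_heq this.2
    have : i = i' := (w.β k).inj h h'
    rw [this]
  · cases e
  · cases e
  · have := Sum.inl.inj e
    rw [Sigma.mk.injEq] at this
    obtain rfl := Fin.castSucc_injective _ this.1
    obtain rfl := eq_of_heq this.2
    have : j = j' := Option.mem_unique h h'
    rw [this]

theorem adj_iff : w.graph.Adj p q ↔ w.Next p q ∨ w.Next q p := by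
  have arrow : ∀ p q, w.Arrow p q → w.Next p q ∨ w.Next q p := by
    rintro _ _ (⟨k, i, j, h⟩ | ⟨k, i, j, h⟩)
    · exact Or.inl (.beta k i j h)
    · exact Or.inr (.alpha k i j h)
  have next : ∀ p q, w.Next p q → w.Arrow p q ∨ w.Arrow q p := by
    rintro _ _ (⟨k, i, j, h⟩ | ⟨k, i, j, h⟩)
    · exact Or.inl (.beta k i j h)
    · exact Or.inr (.alpha k i j h)
  rw [Laces.graph, SimpleGraph.fromRel_adj]
  constructor
  · rintro ⟨-, h | h⟩
    · exact arrow _ _ h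
    · exact (arrow _ _ h).symm
  · rintro (h | h)
    · refine ⟨?_, next _ _ h⟩
      rintro rfl
      have := h.rank_eq
      omega
    · refine ⟨?_, (next _ _ h).symm⟩
      rintro rfl
      have := h.rank_eq
      omega

/-- The dot `q` lies on the lace of `p`, weakly to the right. -/
def Path (w : Laces dy dx) : Dot dy dx → Dot dy dx → Prop := Relation.ReflTransGen w.Next

theorem Path.rank_le (h : w.Path p q) : p.rank ≤ q.rank := by
  induction h with
  | refl => exact le_rfl
  | tail _ h ih => have := h.rank_eq; omega

theorem Path.eq_of_rank_le (h : w.Path p q) (h' : q.rank ≤ p.rank) : p = q := by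
  rcases Relation.ReflTransGen.cases_tail h with h | ⟨r, h1, h2⟩
  · exact h.symm
  · have := Path.rank_le h1
    have := h2.rank_eq
    omega

/-- Partial permutations give each dot at most one arrow on either side. So a lace is a path, its
dots are ordered by their columns, and each component meets a column at most once. -/
theorem Path.total_left (h : w.Path p q) (h' : w.Path p' q) : w.Path p p' ∨ w.Path p' p := by
  induction h with
  | refl => exact Or.inr h'
  | tail h1 h2 ih =>
    rcases Relation.ReflTransGen.cases_tail h' with h3 | ⟨r, h3, h4⟩
    · rw [← h3]; exact Or.inl (h1.tail h2)
    · rw [h4.left_unique h2] at h3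
      exact ih h3

theorem Path.total_right (h : w.Path p q) (h' : w.Path p q') : w.Path q q' ∨ w.Path q' q := by
  induction h with
  | refl => exact Or.inl h'
  | tail h1 h2 ih =>
    rcases ih with h3 | h3
    · rcases Relation.ReflTransGen.cases_head h3 with h4 | ⟨r, h4, h5⟩
      · rw [← h4]; exact Or.inr (Relation.ReflTransGen.single h2)
      · rw [h4.right_unique h2] at h5
        exact Or.inl h5
    · exact Or.inr (h3.tail h2)

theorem reachable_iff : w.graph.Reachable p q ↔ w.Path p q ∨ w.Path q p := by
  constructor
  · rintro ⟨W⟩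
    induction W with
    | nil => exact Or.inl Relation.ReflTransGen.refl
    | cons h W ih =>
      rw [adj_iff] at h
      rcases h with h | h
      · rcases ih with ih | ih
        · exact Or.inl (Relation.ReflTransGen.head h ih)
        · exact ((Path.total_left ih (Relation.ReflTransGen.single h))).symm
      · rcases ih with ih | ih
        · exact (Path.total_right (Relation.ReflTransGen.single h) ih)
        · exact Or.inr (ih.tail h)
  · have key : ∀ p q, w.Path p q → w.graph.Reachable p q := by
      intro p q h
      induction h with
      | refl => exact SimpleGraph.Reachable.refl _
      | tail _ h ih => exact ih.trans (adj_iff.2 (Or.inl h)).reachable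
    rintro (h | h)
    · exact key _ _ h
    · exact (key _ _ h).symm

theorem exists_leftEnd (w : Laces dy dx) (q : Dot dy dx) :
    ∃ p, w.Path p q ∧ ∀ r, ¬w.Next r p := by
  induction h : q.rank using Nat.strong_induction_on generalizing q with
  | _ m ih =>
    by_cases hq : ∃ r, w.Next r q
    · obtain ⟨r, hr⟩ := hq
      obtain ⟨p, h1, h2⟩ := ih r.rank (by have := hr.rank_eq; omega) r rfl
      exact ⟨p, h1.tail hr, h2⟩
    · push Not at hq
      exact ⟨q, Relation.ReflTransGen.refl, hq⟩

/-- The leftmost column of the lace of a dot. -/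
noncomputable def lab (w : Laces dy dx) (q : Dot dy dx) : Vertex n :=
  Dot.column (w.exists_leftEnd q).choose

theorem lab_of_leftEnd (h : w.Path p q) (h' : ∀ r, ¬w.Next r p) : w.lab q = Dot.column p := by
  obtain ⟨h1, h2⟩ := (w.exists_leftEnd q).choose_spec
  have key : ∀ p p', (∀ r, ¬w.Next r p') → w.Path p p' → p = p' := by
    intro p p' h h'
    rcases Relation.ReflTransGen.cases_tail h' with h3 | ⟨r, -, h3⟩
    · exact h3.symm
    · exact absurd h3 (h r)
  unfold lab
  rcases Path.total_left h h1 with h3 | h3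
  · rw [← key _ _ h2 h3]
  · rw [key _ _ h' h3]

theorem lab_of_path (h : w.Path p q) : w.lab q = w.lab p := by
  obtain ⟨r, h1, h2⟩ := w.exists_leftEnd p
  rw [lab_of_leftEnd h1 h2, lab_of_leftEnd (h1.trans h) h2]

theorem lab_of_next (h : w.Next p q) : w.lab q = w.lab p :=
  lab_of_path (Relation.ReflTransGen.single h)

theorem lab_self (h : ∀ r, ¬w.Next r p) : w.lab p = Dot.column p :=
  lab_of_leftEnd Relation.ReflTransGen.refl h

theorem lab_pos_le (w : Laces dy dx) (q : Dot dy dx) : (w.lab q).pos ≤ q.rank := by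
  obtain ⟨p, h1, h2⟩ := w.exists_leftEnd q
  rw [lab_of_leftEnd h1 h2]
  exact h1.rank_le

/-- A lace is recorded by its right endpoint, the only one of its dots without a successor; its left
column is then the label of that dot. -/
theorem laceCount_eq (w : Laces dy dx) (z z' : Vertex n) : w.laceCount z z' =
    Nat.card {q : Dot dy dx // Dot.column q = z' ∧ (∀ r, ¬w.Next q r) ∧ w.lab q = z} := by
  symm
  unfold laceCount
  have mem : ∀ p q : Dot dy dx, p ∈ (w.graph.connectedComponentMk q).supp ↔
      w.Path p q ∨ w.Path q p := by
    intro p q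
    rw [SimpleGraph.ConnectedComponent.mem_supp_iff, SimpleGraph.ConnectedComponent.eq,
      reachable_iff]
  have last : ∀ p q, (∀ r, ¬w.Next p r) → w.Path p q → q = p := by
    intro p q h h'
    rcases Relation.ReflTransGen.cases_head h' with h3 | ⟨r, h3, -⟩
    · exact h3.symm
    · exact absurd h3 (h r)
  refine Nat.card_congr (Equiv.ofBijective
    (fun q => ⟨w.graph.connectedComponentMk q.1, ?_⟩) ⟨?_, ?_⟩)
  · obtain ⟨q, rfl, h2, rfl⟩ := q
    dsimp only
    obtain ⟨r, h3, h4⟩ := w.exists_leftEnd q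
    refine ⟨⟨⟨r, (mem _ _).2 (Or.inl h3), (lab_of_leftEnd h3 h4).symm⟩, fun p hp => ?_⟩,
      ⟨q, (mem _ _).2 (Or.inl Relation.ReflTransGen.refl), rfl⟩, fun p hp => ?_⟩
    · rcases (mem _ _).1 hp with h | h
      · rw [lab_of_path h]; exact lab_pos_le w p
      · rw [last _ _ h2 h]; exact lab_pos_le w q
    · rcases (mem _ _).1 hp with h | h
      · exact h.rank_le
      · rw [last _ _ h2 h]
  · rintro ⟨q, h1, h2, h3⟩ ⟨q', h1', h2', h3'⟩ h
    rw [Subtype.mk.injEq, SimpleGraph.ConnectedComponent.eq, reachable_iff] at h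
    apply Subtype.ext
    rcases h with h | h
    · exact (last _ _ h2 h).symm
    · exact last _ _ h2' h
  · rintro ⟨C, ⟨⟨p, hp, hpz⟩, hmin⟩, ⟨q, hq, hqz⟩, hmax⟩
    have hC : C = w.graph.connectedComponentMk q :=
      ((SimpleGraph.ConnectedComponent.mem_supp_iff C q).1 hq).symm
    subst hC
    refine ⟨⟨q, hqz, fun r hr => ?_, ?_⟩, rfl⟩
    · have h1 := hmax r ((mem _ _).2 (Or.inr (Relation.ReflTransGen.single hr)))
      have h2 := hr.rank_eq
      have h3 : q.rank = z'.pos := by rw [Dot.rank, hqz]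
      have h4 : r.rank ≤ z'.pos := h1
      omega
    · apply Vertex.pos_injective
      obtain ⟨r, h3, h4⟩ := w.exists_leftEnd q
      have h5 := hmin r ((mem _ _).2 (Or.inl h3))
      rw [lab_of_leftEnd h3 h4]
      refine le_antisymm ?_ h5
      have h6 := (mem _ _).1 hp
      have h7 : w.lab p = w.lab q := by
        rcases h6 with h | h
        · exact (lab_of_path h).symm
        · exact lab_of_path h
      rw [← lab_of_leftEnd h3 h4, ← h7, ← hpz]
      exact lab_pos_le w p

theorem laceCount_eq_zero (w : Laces dy dx) {z z' : Vertex n} (h : z'.pos < z.pos) :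
    w.laceCount z z' = 0 := by
  rw [laceCount_eq, Nat.card_eq_zero]
  left
  constructor
  rintro ⟨q, rfl, -, rfl⟩
  have := lab_pos_le w q
  rw [Dot.rank] at this
  omega

/-- An arrow between neighbouring columns is determined by its left dot. -/
theorem arrowCount_eq (w : Laces dy dx) {z z' : Vertex n} (h : z.pos = z'.pos + 1) :
    w.arrowCount z z' = Nat.card {q : Dot dy dx // Dot.column q = z' ∧ ∃ r, w.Next q r} := by
  unfold arrowCount
  refine Nat.card_congr (Equiv.ofBijective (fun p => ⟨p.1.2, p.2.2.1, ?_⟩) ⟨?_, ?_⟩)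
  · obtain ⟨⟨p, q⟩, rfl, rfl, h3⟩ := p
    rcases adj_iff.1 h3 with h4 | h4
    · have := h4.rank_eq
      simp only [Dot.rank] at this
      dsimp only at h
      omega
    · exact ⟨p, h4⟩
  · rintro ⟨⟨p, q⟩, h1, h2, h3⟩ ⟨⟨p', q'⟩, h1', h2', h3'⟩ e
    rw [Subtype.mk.injEq] at e
    dsimp only at e h1 h2 h3 h1' h2' h3'
    subst e
    have key : ∀ p, Dot.column p = z → w.graph.Adj p q → w.Next q p := by
      intro p hp hadj
      rcases adj_iff.1 hadj with h4 | h4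
      · have := h4.rank_eq
        simp only [Dot.rank, hp, h2] at this
        omega
      · exact h4
    have := (key p h1 h3).right_unique (key p' h1' h3')
    subst this
    rfl
  · rintro ⟨q, rfl, r, hr⟩
    refine ⟨⟨(r, q), ?_, rfl, adj_iff.2 (Or.inr hr)⟩, rfl⟩
    apply Vertex.pos_injective
    rw [h]
    exact hr.rank_eq

end Laces

/-! ### Block rows and block columns -/

theorem inRow_inl {i : Fin (n + 1)} {r : ℕ} : InRow dy dx (Sum.inl i) r ↔
    (frame dy dx).Y i ≤ r ∧ r < (frame dy dx).Y i + dy i := by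
  rw [InRow, rowOffset_inl]; rfl

theorem inRow_inr {k : Fin n} {r : ℕ} : InRow dy dx (Sum.inr k) r ↔
    (frame dy dx).D + (frame dy dx).X (k + 1) ≤ r ∧
      r < (frame dy dx).D + (frame dy dx).X (k + 1) + dx k := by
  rw [InRow, rowOffset_inr]; rfl

theorem inCol_inl {i : Fin (n + 1)} {r : ℕ} : InCol dy dx (Sum.inl i) r ↔
    (frame dy dx).X 0 + (frame dy dx).Y i ≤ r ∧
      r < (frame dy dx).X 0 + (frame dy dx).Y i + dy i := by
  rw [InCol, colOffset_inl]; rfl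

theorem inCol_inr {k : Fin n} {r : ℕ} : InCol dy dx (Sum.inr k) r ↔
    (frame dy dx).X (k + 1) ≤ r ∧ r < (frame dy dx).X (k + 1) + dx k := by
  rw [InCol, colOffset_inr]; rfl

theorem Y_add_dy (i : Fin (n + 1)) : (frame dy dx).Y i + dy i = (frame dy dx).Y (i + 1) := by
  rw [Frame.Y_succ, frame_ey]

theorem X_add_dx (k : Fin n) : (frame dy dx).X (k + 1) + dx k = (frame dy dx).X k := by
  rw [(frame dy dx).X_succ k.isLt, frame_ex]

theorem window_unique {f : ℕ → ℕ} (hf : ∀ i j, i ≤ j → f i ≤ f j) {i j r : ℕ} (h1 : f i ≤ r)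
    (h2 : r < f (i + 1)) (h3 : f j ≤ r) (h4 : r < f (j + 1)) : i = j := by
  rcases lt_trichotomy i j with h | h | h
  · have := hf _ _ (show i + 1 ≤ j by omega); omega
  · exact h
  · have := hf _ _ (show j + 1 ≤ i by omega); omega

theorem window_unique' {f : ℕ → ℕ} (hf : ∀ i j, i ≤ j → f j ≤ f i) {i j r : ℕ} (h1 : f (i + 1) ≤ r)
    (h2 : r < f i) (h3 : f (j + 1) ≤ r) (h4 : r < f j) : i = j := by
  rcases lt_trichotomy i j with h | h | h
  · have := hf _ _ (show i + 1 ≤ j by omega); omega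
  · exact h
  · have := hf _ _ (show j + 1 ≤ i by omega); omega

theorem InRow.unique {z z' : Vertex n} {r : ℕ} (h : InRow dy dx z r) (h' : InRow dy dx z' r) :
    z = z' := by
  have hY := fun i => (frame dy dx).Y_le_D (i := i)
  rw [frame_n] at hY
  rcases z with i | k <;> rcases z' with i' | k'
  · rw [inRow_inl, Y_add_dy] at h h'
    congr 1
    exact Fin.ext (window_unique (fun _ _ => (frame dy dx).Y_mono) h.1 h.2 h'.1 h'.2)
  · rw [inRow_inl, Y_add_dy] at h
    rw [inRow_inr] at h'
    have := hY (i + 1) (by omega)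
    omega
  · rw [inRow_inl, Y_add_dy] at h'
    rw [inRow_inr] at h
    have := hY (i' + 1) (by omega)
    omega
  · rw [inRow_inr, add_assoc, X_add_dx] at h h'
    congr 1
    refine Fin.ext (window_unique' (f := fun k => (frame dy dx).X k)
      (r := r - (frame dy dx).D) (fun _ _ => (frame dy dx).X_anti) ?_ ?_ ?_ ?_) <;> omega

theorem exists_window {f : ℕ → ℕ} (h0 : f 0 = 0) {m r : ℕ} (h : r < f m) :
    ∃ i < m, f i ≤ r ∧ r < f (i + 1) := by
  induction m with
  | zero => omega
  | succ m ih =>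
    by_cases hm : r < f m
    · obtain ⟨i, h1, h2⟩ := ih hm
      exact ⟨i, by omega, h2⟩
    · exact ⟨m, by omega, by omega, h⟩

theorem exists_window' {f : ℕ → ℕ} {m r : ℕ} (hm : f m = 0) (h : r < f 0) :
    ∃ i < m, f (i + 1) ≤ r ∧ r < f i := by
  induction m with
  | zero => omega
  | succ m ih =>
    by_cases hr : r < f m
    · exact ⟨m, by omega, by omega, hr⟩
    · by_contra hc
      push Not at hc
      have key : ∀ i ≤ m, r < f i := by
        intro i hi
        induction i with
        | zero => exact h
        | succ i ih' =>
          by_contra hlt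
          exact absurd (ih' (by omega)) (not_lt.2 (hc i (by omega) (by omega)))
      exact hr (key m le_rfl)

theorem exists_inRow {r : ℕ} (h : r < (frame dy dx).D + (frame dy dx).X 0) :
    ∃ z, InRow dy dx z r := by
  by_cases hr : r < (frame dy dx).D
  · obtain ⟨i, h1, h2⟩ := exists_window (f := (frame dy dx).Y) rfl hr
    exact ⟨Sum.inl ⟨i, h1⟩, by rw [inRow_inl, Y_add_dy]; exact h2⟩
  · obtain ⟨k, h1, h2⟩ := exists_window' (f := (frame dy dx).X) (r := r - (frame dy dx).D)
      (frame dy dx).X_last (by omega)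
    refine ⟨Sum.inr ⟨k, h1⟩, ?_⟩
    rw [inRow_inr, add_assoc, X_add_dx]
    dsimp only
    omega

theorem exists_inCol {r : ℕ} (h : r < (frame dy dx).X 0 + (frame dy dx).D) :
    ∃ z, InCol dy dx z r := by
  by_cases hr : r < (frame dy dx).X 0
  · obtain ⟨k, h1, h2⟩ := exists_window' (f := (frame dy dx).X) (frame dy dx).X_last hr
    exact ⟨Sum.inr ⟨k, h1⟩, by rw [inCol_inr, X_add_dx]; exact h2⟩
  · obtain ⟨i, h1, h2⟩ := exists_window (f := (frame dy dx).Y) (r := r - (frame dy dx).X 0) rfl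
      (m := n + 1) (by change _ < (frame dy dx).D; omega)
    refine ⟨Sum.inl ⟨i, h1⟩, ?_⟩
    rw [inCol_inl, add_assoc, Y_add_dy]
    dsimp only
    omega

theorem inCol_lt {z : Vertex n} {r : ℕ} (h : InCol dy dx z r) :
    r < (∑ i, dy i) + ∑ k, dx k := by
  rw [sum_dy dy dx, sum_dx dy dx]
  rcases z with i | k
  · rw [inCol_inl, add_assoc, Y_add_dy] at h
    have := (frame dy dx).Y_le_D (i := i + 1) (by rw [frame_n]; omega)
    omega
  · rw [inCol_inr, X_add_dx] at h
    have := (frame dy dx).X_anti (Nat.zero_le k)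
    omega

theorem InCol.unique {z z' : Vertex n} {r : ℕ} (h : InCol dy dx z r) (h' : InCol dy dx z' r) :
    z = z' := by
  have hX := fun k => (frame dy dx).X_anti (Nat.zero_le k)
  rcases z with i | k <;> rcases z' with i' | k'
  · rw [inCol_inl, add_assoc, Y_add_dy] at h h'
    congr 1
    exact Fin.ext (window_unique (f := (frame dy dx).Y) (r := r - (frame dy dx).X 0)
      (fun _ _ => (frame dy dx).Y_mono) (by omega) (by omega) (by omega) (by omega))
  · rw [inCol_inl] at h
    rw [inCol_inr, X_add_dx] at h'
    have := hX k'
    omega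
  · rw [inCol_inl] at h'
    rw [inCol_inr, X_add_dx] at h
    have := hX k
    omega
  · rw [inCol_inr, X_add_dx] at h h'
    congr 1
    exact Fin.ext (window_unique' (f := (frame dy dx).X)
      (fun _ _ => (frame dy dx).X_anti) h.1 h.2 h'.1 h'.2)

/-- The `1`s are indexed by columns and traced back to rows, matching the inverse of the product of
blocks, along which wires are followed. -/
theorem onesInBlock_eq_card (v : TotalPerm dy dx) (z z' : Vertex n) : onesInBlock v z z' =
    Nat.card {c : Fin (dim dy dx z') //
      InRow dy dx z ((emb 0 v)⁻¹ (colOffset dy dx z' + c))} := by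
  unfold onesInBlock
  have hv : ∀ r, (emb 0 v)⁻¹ (v r).val = r.val := by
    intro r
    have := emb_add 0 v r
    rw [zero_add, zero_add] at this
    rw [← this, perm_inv_apply]
  refine Nat.card_congr (Equiv.ofBijective (fun r => ⟨⟨(v r.1).val - colOffset dy dx z', ?_⟩, ?_⟩)
    ⟨?_, ?_⟩)
  · have := r.2.2
    rw [InCol] at this
    omega
  · dsimp only
    rw [Nat.add_sub_cancel' r.2.2.1, hv]
    exact r.2.1
  · rintro ⟨r, h1, h2⟩ ⟨r', h1', h2'⟩ h
    have h0 : (v r).val - colOffset dy dx z' = (v r').val - colOffset dy dx z' :=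
      congrArg (fun x => x.1.val) h
    have h3 : colOffset dy dx z' ≤ (v r).val := h2.1
    have h4 : colOffset dy dx z' ≤ (v r').val := h2'.1
    have h5 : r = r' := v.injective (Fin.ext (by omega))
    exact Subtype.ext h5
  · rintro ⟨c, hc⟩
    have hcol : InCol dy dx z' (colOffset dy dx z' + c) := ⟨by omega, by omega⟩
    have hlt := inCol_lt hcol
    have e : v (v⁻¹ ⟨_, hlt⟩) = ⟨colOffset dy dx z' + c, hlt⟩ := perm_apply_inv _ _
    have e' := congrArg Fin.val e
    have e2 := hv (v⁻¹ ⟨_, hlt⟩)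
    rw [e'] at e2
    refine ⟨⟨v⁻¹ ⟨_, hlt⟩, ?_, ?_⟩, ?_⟩
    · rw [← e2]; exact hc
    · rw [e]; exact hcol
    · apply Subtype.ext
      apply Fin.ext
      dsimp only
      rw [e']
      dsimp only
      omega

/-! ### Wires -/

namespace Frame

variable {F : Frame} {A B : ℕ → Perm ℕ}

theorem prePerm_mul_sufPerm {k : ℕ} (hk : k ≤ F.n) :
    F.prePerm A B k * F.sufPerm A B k = F.sufPerm A B 0 := by
  induction k with
  | zero => simp [prePerm]
  | succ k ih =>
    rw [prePerm_succ, mul_assoc, ← sufPerm_eq (by omega), ih (by omega)]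

/-- The row of the wire at position `p` after block `β_k`. -/
def midRow (F : Frame) (A B : ℕ → Perm ℕ) (k p : ℕ) : ℕ :=
  (F.sufPerm A B (k + 1))⁻¹ ((rect (F.X (k + 1) + F.Y (k + 2)) (F.D - F.Y (k + 2)) (F.ex k))⁻¹
    ((B k)⁻¹ p))

theorem sufPerm_inv_apply {k : ℕ} (hk : k < F.n) (p : ℕ) : (F.sufPerm A B k)⁻¹ p =
    F.midRow A B k ((A k)⁻¹ ((rect (F.X (k + 1)) (F.Y k) (F.ex k))⁻¹ p)) := by
  rw [sufPerm_eq hk, colPerm]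
  simp only [mul_inv_rev, Perm.mul_apply, midRow]

theorem midRow_real {k p : ℕ} (hk : k < F.n) (h : (B k)⁻¹ p < F.oB k + F.ey (k + 1)) :
    F.midRow A B k p = (F.sufPerm A B (k + 1))⁻¹ ((B k)⁻¹ p) := by
  obtain ⟨h1, h2, h3, h4, h5, h6⟩ := offsets hk
  rw [midRow, rect_inv_apply, if_neg (by omega), if_neg (by omega)]

theorem midRow_ins (hs : F.Supported A B) {k p j : ℕ} (hk : k < F.n)
    (h : (B k)⁻¹ p = F.oB k + F.ey (k + 1) + j) (hj : j < F.ex k) :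
    F.midRow A B k p = F.D + F.X (k + 1) + j := by
  obtain ⟨h1, h2, h3, h4, h5, h6⟩ := offsets hk
  rw [midRow, h, rect_inv_apply, if_pos (by omega), Perm.inv_eq_iff_eq,
    sufPerm_fix hs (by omega) (by omega)]
  omega

theorem midRow_pending (hs : F.Supported A B) {k i : ℕ} (hk : k < F.n) (hi : i < F.ey k) :
    F.midRow A B k (F.oA k + i) = F.Y k + i := by
  obtain ⟨h1, h2, h3, h4, h5, h6⟩ := offsets hk
  rw [midRow, (supp_inv (hs.right k hk)).1 _ (by omega), rect_inv_apply, if_neg (by omega),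
    if_neg (by omega), Perm.inv_eq_iff_eq, sufPerm_shift hs (by omega) (by omega)]
  omega

theorem sufPerm_inv_real {k i : ℕ} (hk : k < F.n) :
    (F.sufPerm A B k)⁻¹ (F.X k + F.Y k + i) =
      F.midRow A B k ((A k)⁻¹ (F.oA k + (F.ex k + i))) := by
  obtain ⟨h1, h2, h3, h4, h5, h6⟩ := offsets hk
  rw [sufPerm_inv_apply hk, rect_inv_apply, if_neg (by omega), if_neg (by omega)]
  congr 2; omega

/-- A wire ending in block column `x_k` leaves the snake through the first outputs of α_k; the block
columns to its right do not move it. -/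
theorem total_inv_x (hs : F.Supported A B) {k j : ℕ} (hk : k < F.n) (hj : j < F.ex k) :
    (F.sufPerm A B 0)⁻¹ (F.X (k + 1) + j) = F.midRow A B k ((A k)⁻¹ (F.oA k + j)) := by
  obtain ⟨h1, h2, h3, h4, h5, h6⟩ := offsets hk
  rw [← prePerm_mul_sufPerm hk.le, mul_inv_rev, Perm.mul_apply]
  have : (F.prePerm A B k)⁻¹ (F.X (k + 1) + j) = F.X (k + 1) + j := by
    rw [Perm.inv_eq_iff_eq, (prePerm_facts hs hk.le).1 _ (by omega)]
  rw [this, sufPerm_inv_apply hk, rect_inv_apply, if_pos (by omega)]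
  congr 2; omega

/-- A wire ending in block column `y_{k+1}` leaves the snake at the virtual outputs of β_k and is
then only shifted by southeast rectangles. -/
theorem total_inv_y (hs : F.Supported A B) {k i : ℕ} (hk : k < F.n) (hi : i < F.ey (k + 1)) :
    (F.sufPerm A B 0)⁻¹ (F.X 0 + F.Y (k + 1) + i) =
      F.midRow A B k (F.oB k + (F.ex k + i)) := by
  obtain ⟨h1, h2, h3, h4, h5, h6⟩ := offsets hk
  rw [← prePerm_mul_sufPerm hk.le, mul_inv_rev, Perm.mul_apply]
  have : (F.prePerm A B k)⁻¹ (F.X 0 + F.Y (k + 1) + i) = F.X k + (F.Y (k + 1) + i) := by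
    rw [Perm.inv_eq_iff_eq, (prePerm_facts hs hk.le).2.2 _ (by omega) (by omega), add_assoc]
  rw [this, sufPerm_inv_apply hk, rect_inv_apply, if_neg (by omega), if_neg (by omega),
    (supp_inv (hs.left k hk)).1 _ (by omega)]
  congr 1; omega

end Frame

namespace Laces

variable (w : Laces dy dx)

/-- The row of the wire at a dot. -/
noncomputable def row : Dot dy dx → ℕ
  | Sum.inl p => ((frame dy dx).sufPerm w.extended.permA w.extended.permB p.1)⁻¹
      ((frame dy dx).X p.1 + (frame dy dx).Y p.1 + p.2)
  | Sum.inr p => (frame dy dx).midRow w.extended.permA w.extended.permB p.1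
      ((frame dy dx).oB p.1 + p.2)

theorem permB_inv (k : Fin n) (p : Fin (dy k.succ + dx k)) :
    (w.extended.permB k)⁻¹ ((frame dy dx).oB k + p) =
      (frame dy dx).oB k + ((completion (w.β k))⁻¹ p).val := by
  rw [PermTuple.permB_eq, ← emb_inv, emb_add]; rfl

theorem permA_inv (k : Fin n) (p : Fin (dy k.castSucc + dx k)) :
    (w.extended.permA k)⁻¹ ((frame dy dx).oA k + p) =
      (frame dy dx).oA k + (rotCompletion (w.α k) p).val := by
  rw [PermTuple.permA_eq, ← emb_inv, inv_inv, emb_add]; rfl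

theorem oB_eq (k : Fin n) : (frame dy dx).oB k = (frame dy dx).oA k + dy k.castSucc := by
  have := Y_add_dy (dy := dy) (dx := dx) k.castSucc
  rw [Fin.val_castSucc] at this
  rw [Frame.oB, Frame.oA]
  omega

theorem midRow_β {k : Fin n} {p : Fin (dy k.succ + dx k)} {i : Fin (dy k.succ)}
    (h : (completion (w.β k))⁻¹ p = topTail _ i) :
    (frame dy dx).midRow w.extended.permA w.extended.permB k ((frame dy dx).oB k + p) =
      w.row (Sum.inl ⟨k.succ, i⟩) := by
  have e := w.permB_inv k p
  rw [h] at e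
  rw [Frame.midRow_real k.isLt (by rw [e, frame_ey_succ]; simp [topTail]), e]
  rfl

theorem midRow_β_virtual {k : Fin n} {p : Fin (dy k.succ + dx k)}
    (h : dy k.succ ≤ ((completion (w.β k))⁻¹ p).val) :
    InRow dy dx (Sum.inr k) ((frame dy dx).midRow w.extended.permA w.extended.permB k
      ((frame dy dx).oB k + p)) := by
  have e := w.permB_inv k p
  rw [Frame.midRow_ins (PermTuple.supported _) k.isLt
    (j := ((completion (w.β k))⁻¹ p).val - dy k.succ)
    (by rw [e, frame_ey_succ]; omega) (by rw [frame_ex]; omega), inRow_inr]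
  omega

theorem midRow_α {k : Fin n} {p : Fin (dy k.castSucc + dx k)} {j : Fin (dx k)}
    (h : rotCompletion (w.α k) p = botHead _ j) :
    (frame dy dx).midRow w.extended.permA w.extended.permB k
      ((w.extended.permA k)⁻¹ ((frame dy dx).oA k + p)) = w.row (Sum.inr ⟨k, j⟩) := by
  rw [permA_inv, h, row, oB_eq]
  congr 1
  simp only [botHead]
  omega

theorem midRow_α_virtual {k : Fin n} {p : Fin (dy k.castSucc + dx k)}
    (h : (rotCompletion (w.α k) p).val < dy k.castSucc) :
    InRow dy dx (Sum.inl k.castSucc) ((frame dy dx).midRow w.extended.permA w.extended.permB k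
      ((w.extended.permA k)⁻¹ ((frame dy dx).oA k + p))) := by
  rw [permA_inv, Frame.midRow_pending (PermTuple.supported _) k.isLt
    (by rw [frame_ey_castSucc]; exact h), inRow_inl, Fin.val_castSucc]
  omega

theorem row_inl_castSucc (k : Fin n) (i : Fin (dy k.castSucc)) :
    w.row (Sum.inl ⟨k.castSucc, i⟩) = (frame dy dx).midRow w.extended.permA w.extended.permB k
      ((w.extended.permA k)⁻¹ ((frame dy dx).oA k + (botTail (dx k) i).val)) := by
  have := Frame.sufPerm_inv_real (F := frame dy dx) (A := w.extended.permA)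
    (B := w.extended.permB) (i := i.val) k.isLt
  rw [frame_ex] at this
  exact this

/-- One and the same wire runs along an arrow, so its starting row is constant on each lace. -/
theorem row_of_next {p q : Dot dy dx} (h : w.Next p q) : w.row q = w.row p := by
  rcases h with ⟨k, i, j, h⟩ | ⟨k, i, j, h⟩
  · rw [mem_iff_completion] at h
    exact w.midRow_β (p := topHead _ j) (by rw [← h, perm_inv_apply])
  · rw [mem_iff_rotCompletion] at h
    rw [row_inl_castSucc]
    exact w.midRow_α h

/-- At the left end of a lace the wire comes from a virtual dot of the block on the left, which is
fed directly by the block row of that column; the first column is fed directly. -/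
theorem inRow_row_of_leftEnd {p : Dot dy dx} (h : ∀ r, ¬w.Next r p) :
    InRow dy dx (Dot.column p) (w.row p) := by
  rcases p with ⟨i, x⟩ | ⟨k, x⟩
  · induction i using Fin.lastCases with
    | last =>
      have e : w.row (Sum.inl ⟨Fin.last n, x⟩) = (frame dy dx).Y n + x := by
        change ((frame dy dx).sufPerm _ _ n)⁻¹ ((frame dy dx).X n + (frame dy dx).Y n + x) = _
        have h1 := Frame.sufPerm_last (F := frame dy dx) (A := w.extended.permA)
          (B := w.extended.permB)
        have h2 := (frame dy dx).X_last
        rw [frame_n] at h1 h2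
        rw [h1, h2, inv_one, Perm.one_apply, zero_add]
      have hx : x.val < dy (Fin.last n) := x.isLt
      rw [e]
      change InRow dy dx (Sum.inl (Fin.last n)) _
      rw [inRow_inl, Fin.val_last]
      omega
    | cast k =>
      rw [row_inl_castSucc]
      refine w.midRow_α_virtual ?_
      by_contra hc
      refine h (Sum.inr ⟨k, ⟨(rotCompletion (w.α k) (botTail (dx k) x)).val - dy k.castSucc, ?_⟩⟩)
        (.alpha k x _ ?_)
      · omega
      · rw [mem_iff_rotCompletion]
        apply Fin.ext
        simp only [botHead]
        omega
  · refine w.midRow_β_virtual (p := topHead _ x) ?_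
    by_contra hc
    refine h (Sum.inl ⟨k.succ, ⟨((completion (w.β k))⁻¹ (topHead _ x)).val, by omega⟩⟩)
      (.beta k _ x ?_)
    rw [mem_iff_completion]
    exact perm_apply_inv _ _

theorem inRow_row (q : Dot dy dx) : InRow dy dx (w.lab q) (w.row q) := by
  obtain ⟨p, h1, h2⟩ := w.exists_leftEnd q
  rw [lab_of_leftEnd h1 h2]
  have : w.row q = w.row p := by
    clear h2
    induction h1 with
    | refl => rfl
    | tail _ h ih => rw [w.row_of_next h, ih]
  rw [this]
  exact w.inRow_row_of_leftEnd h2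

theorem inRow_row_iff {q : Dot dy dx} {z : Vertex n} : InRow dy dx z (w.row q) ↔ w.lab q = z :=
  ⟨fun h => (w.inRow_row q).unique h, fun h => h ▸ w.inRow_row q⟩

end Laces

/-! ### Counting wires -/

/-- Here `e` lists the non-virtual inputs of a block and `o` its virtual outputs, equally many. The
outputs not served by non-virtual inputs are as many as the non-virtual inputs that go elsewhere,
which are the dots continued by an arrow. -/
theorem card_outputs {d N : ℕ} (c : Perm (Fin N)) {o e : Fin d → Fin N} (ho : Function.Injective o)
    (he : Function.Injective e) {P T : Fin d → Prop} {Q : Prop} [Decidable Q]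
    (h1 : ∀ j x, c (o j) = e x → (T j ↔ P x)) (h2 : ∀ j, (∀ x, c (o j) ≠ e x) → (T j ↔ Q)) :
    Nat.card {j // T j} = Nat.card {x // (∃ j, c (o j) = e x) ∧ P x} +
      if Q then Nat.card {x // ¬∃ j, c (o j) = e x} else 0 := by
  classical
  have key : ∀ T P : Fin d → Prop, (∀ j x, c (o j) = e x → (T j ↔ P x)) →
      (Finset.univ.filter fun j => (∃ x, c (o j) = e x) ∧ T j).card =
      (Finset.univ.filter fun x => (∃ j, c (o j) = e x) ∧ P x).card := by
    intro T P h
    refine Finset.card_bij (fun j hj => ((Finset.mem_filter.1 hj).2.1).choose) ?_ ?_ ?_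
    · intro j hj
      have hs := ((Finset.mem_filter.1 hj).2.1).choose_spec
      exact Finset.mem_filter.2 ⟨Finset.mem_univ _, ⟨j, hs⟩,
        (h j _ hs).1 (Finset.mem_filter.1 hj).2.2⟩
    · intro j hj j' hj' hx
      have hs := ((Finset.mem_filter.1 hj).2.1).choose_spec
      have hs' := ((Finset.mem_filter.1 hj').2.1).choose_spec
      rw [hx, ← hs'] at hs
      exact ho (c.injective hs)
    · intro x hx
      obtain ⟨-, ⟨j, hj⟩, hP⟩ := Finset.mem_filter.1 hx
      have hm : j ∈ Finset.univ.filter fun j => (∃ x, c (o j) = e x) ∧ T j :=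
        Finset.mem_filter.2 ⟨Finset.mem_univ _, ⟨x, hj⟩, (h j x hj).2 hP⟩
      refine ⟨j, hm, ?_⟩
      have hs := ((Finset.mem_filter.1 hm).2.1).choose_spec
      exact he (hs.symm.trans hj)
  simp only [Nat.card_eq_fintype_card, Fintype.card_subtype]
  have s1 := Finset.card_filter_add_card_filter_not (s := Finset.univ.filter T)
    (fun j => ∃ x, c (o j) = e x)
  rw [Finset.filter_filter, Finset.filter_filter] at s1
  have k1 := key T P h1
  simp only [and_comm (b := T _)] at k1
  rw [← s1, k1]
  congr 1
  split_ifs with hQ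
  · have e1 : (Finset.univ.filter fun j => T j ∧ ¬∃ x, c (o j) = e x) =
        Finset.univ.filter fun j => ¬∃ x, c (o j) = e x := by
      ext j
      simp only [Finset.mem_filter, Finset.mem_univ, true_and, and_iff_right_iff_imp]
      intro hj
      exact (h2 j fun x hx => hj ⟨x, hx⟩).2 hQ
    rw [e1]
    have k2 := key (fun _ => True) (fun _ => True) fun _ _ _ => Iff.rfl
    simp only [and_true] at k2
    have t1 := Finset.card_filter_add_card_filter_not (s := (Finset.univ : Finset (Fin d)))
      (fun j => ∃ x, c (o j) = e x)
    have t2 := Finset.card_filter_add_card_filter_not (s := (Finset.univ : Finset (Fin d)))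
      (fun x => ∃ j, c (o j) = e x)
    omega
  · rw [Finset.card_eq_zero, Finset.filter_eq_empty_iff]
    rintro j - ⟨hj, hx⟩
    exact hQ ((h2 j fun x hx' => hx ⟨x, hx'⟩).1 hj)

theorem card_column_inl (i : Fin (n + 1)) (P : Dot dy dx → Prop) :
    Nat.card {q : Dot dy dx // Dot.column q = Sum.inl i ∧ P q} =
      Nat.card {x : Fin (dy i) // P (Sum.inl ⟨i, x⟩)} := by
  symm
  refine Nat.card_congr (Equiv.ofBijective (fun x => ⟨Sum.inl ⟨i, x.1⟩, rfl, x.2⟩) ⟨?_, ?_⟩)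
  · rintro ⟨x, hx⟩ ⟨x', hx'⟩ h
    have := Sum.inl.inj (Subtype.mk.inj h)
    rw [Sigma.mk.injEq] at this
    exact Subtype.ext (eq_of_heq this.2)
  · rintro ⟨⟨i', x⟩ | ⟨k, x⟩, h, hP⟩
    · obtain rfl : i' = i := Sum.inl.inj h
      exact ⟨⟨x, hP⟩, rfl⟩
    · cases h

theorem card_column_inr (k : Fin n) (P : Dot dy dx → Prop) :
    Nat.card {q : Dot dy dx // Dot.column q = Sum.inr k ∧ P q} =
      Nat.card {x : Fin (dx k) // P (Sum.inr ⟨k, x⟩)} := by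
  symm
  refine Nat.card_congr (Equiv.ofBijective (fun x => ⟨Sum.inr ⟨k, x.1⟩, rfl, x.2⟩) ⟨?_, ?_⟩)
  · rintro ⟨x, hx⟩ ⟨x', hx'⟩ h
    have := Sum.inr.inj (Subtype.mk.inj h)
    rw [Sigma.mk.injEq] at this
    exact Subtype.ext (eq_of_heq this.2)
  · rintro ⟨⟨i, x⟩ | ⟨k', x⟩, h, hP⟩
    · cases h
    · obtain rfl : k' = k := Sum.inr.inj h
      exact ⟨⟨x, hP⟩, rfl⟩

namespace Laces

variable (w : Laces dy dx)

theorem no_next_inr {k : Fin n} {x : Fin (dx k)} :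
    (∃ j : Fin (dx k), rotCompletion (w.α k) ⟨j.val, by omega⟩ = botHead _ x) ↔
      ∀ r, ¬w.Next (Sum.inr ⟨k, x⟩) r := by
  constructor
  · rintro ⟨j, hj⟩ r hr
    rw [next_iff] at hr
    rcases hr with ⟨k', i', j', h, h1, h2⟩ | ⟨k', i', j', h, h1, h2⟩
    · cases h1
    · cases h1
      rw [mem_iff_rotCompletion, ← hj] at h
      have := congrArg Fin.val ((rotCompletion (w.α k)).injective h)
      simp only [botTail] at this
      omega
  · intro h
    have hlt : ((rotCompletion (w.α k))⁻¹ (botHead _ x)).val < dx k := by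
      by_contra hc
      refine h (Sum.inl ⟨k.castSucc,
        ⟨((rotCompletion (w.α k))⁻¹ (botHead _ x)).val - dx k, by omega⟩⟩) (.alpha k _ x ?_)
      rw [mem_iff_rotCompletion]
      convert perm_apply_inv _ _ using 2
      apply Fin.ext
      simp only [botTail]
      omega
    exact ⟨⟨_, hlt⟩, perm_apply_inv _ _⟩

theorem no_next_inl {k : Fin n} {x : Fin (dy k.succ)} :
    (∃ j : Fin (dy k.succ), (completion (w.β k))⁻¹ ⟨dx k + j.val, by omega⟩ = topTail _ x) ↔
      ∀ r, ¬w.Next (Sum.inl ⟨k.succ, x⟩) r := by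
  constructor
  · rintro ⟨j, hj⟩ r hr
    rw [next_iff] at hr
    rcases hr with ⟨k', i', j', h, h1, h2⟩ | ⟨k', i', j', h, h1, h2⟩
    · have := Sum.inl.inj h1
      rw [Sigma.mk.injEq] at this
      obtain rfl := Fin.succ_injective _ this.1
      obtain rfl := eq_of_heq this.2
      rw [mem_iff_completion, ← hj, perm_apply_inv] at h
      have := congrArg Fin.val h
      simp only [topHead] at this
      omega
    · cases h1
  · intro h
    have hlt : ¬(completion (w.β k) (topTail _ x)).val < dx k := by
      intro hc
      refine h (Sum.inr ⟨k, ⟨_, hc⟩⟩) (.beta k x _ ?_)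
      rw [mem_iff_completion]
      rfl
    refine ⟨⟨(completion (w.β k) (topTail _ x)).val - dx k, by omega⟩, ?_⟩
    rw [Perm.inv_eq_iff_eq]
    apply Fin.ext
    dsimp only
    omega

/-- In block column `z'`, a wire coming from a non-virtual dot belongs to a lace ending at `z'` and
starts in the row of the left end of that lace. A wire coming from a virtual dot starts in the block
row one vertex to the right of `z'`, and there is one such wire for each arrow leaving `z'` to the
right. -/
theorem onesInBlock_eq {v : TotalPerm dy dx} (hv : emb 0 v = w.extended.product)
    (z z' : Vertex n) : onesInBlock v z z' =
      w.laceCount z z' + if z.pos = z'.pos + 1 then w.arrowCount z z' else 0 := by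
  rw [onesInBlock_eq_card, hv, PermTuple.product, laceCount_eq]
  have hs := w.extended.supported
  rcases z' with i | k
  · rw [card_column_inl]
    change Nat.card {c : Fin (dy i) // _} = _
    simp only [colOffset_inl]
    rcases Fin.eq_zero_or_eq_succ i with rfl | ⟨k, rfl⟩
    · have e : ∀ c : Fin (dy 0), ((frame dy dx).sufPerm w.extended.permA w.extended.permB 0)⁻¹
          ((frame dy dx).X 0 + (frame dy dx).Y (0 : Fin (n + 1)) + c) =
          w.row (Sum.inl ⟨0, c⟩) := fun _ => rfl
      -- The column `y_0` is the rightmost one: every wire there ends a lace and there are no arrows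
      -- to its right.
      have hz : z.pos ≠ Vertex.pos (Sum.inl (0 : Fin (n + 1))) + 1 := by
        rcases z with i | k <;> simp only [Vertex.pos, Fin.val_rev, Fin.val_zero] <;> omega
      rw [if_neg hz, add_zero]
      simp only [e, inRow_row_iff]
      refine Nat.card_congr (Equiv.subtypeEquivRight fun x => ?_)
      refine ⟨fun h => ⟨fun r hr => ?_, h⟩, fun h => h.2⟩
      have := hr.rank_eq
      have h2 : r.rank ≤ 2 * n := by
        rcases r with ⟨i, r⟩ | ⟨k, r⟩ <;>
          simp only [Dot.rank, Dot.column, Vertex.pos, Fin.val_rev] <;> omega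
      simp only [Dot.rank, Dot.column, Vertex.pos, Fin.val_rev, Fin.val_zero] at this h2
      omega
    · have e : ∀ c : Fin (dy k.succ),
          ((frame dy dx).sufPerm w.extended.permA w.extended.permB 0)⁻¹
          ((frame dy dx).X 0 + (frame dy dx).Y k.succ.val + c) =
          (frame dy dx).midRow w.extended.permA w.extended.permB k
            ((frame dy dx).oB k + (dx k + c)) := by
        intro c
        rw [Fin.val_succ, Frame.total_inv_y hs k.isLt (by rw [frame_ey_succ]; exact c.isLt),
          frame_ex]
      simp only [e]
      refine (card_outputs (completion (w.β k))⁻¹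
        (T := fun c => InRow dy dx z ((frame dy dx).midRow w.extended.permA w.extended.permB k
          ((frame dy dx).oB k + (dx k + c))))
        (o := fun c : Fin (dy k.succ) => ⟨dx k + c.val, by omega⟩) (e := topTail (dx k))
        (P := fun x => w.lab (Sum.inl ⟨k.succ, x⟩) = z)
        (Q := z.pos = Vertex.pos (Sum.inl k.succ) + 1) ?_ ?_ ?_ ?_).trans ?_
      rotate_left 4
      · congr 1
        · refine Nat.card_congr (Equiv.subtypeEquivRight fun x => ?_)
          rw [w.no_next_inl]
        · split_ifs with hz
          · rw [w.arrowCount_eq hz, card_column_inl]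
            refine Nat.card_congr (Equiv.subtypeEquivRight fun x => ?_)
            rw [w.no_next_inl, not_forall_not]
          · rfl
      · intro c c' h
        have := congrArg Fin.val h
        exact Fin.ext (by simpa using this)
      · intro c c' h
        have := congrArg Fin.val h
        exact Fin.ext (by simpa [topTail] using this)
      · intro j x h
        rw [w.midRow_β h, inRow_row_iff]
      · intro j hj
        have h1 := w.midRow_β_virtual (k := k) (p := ⟨dx k + j.val, by omega⟩) (by
          by_contra hc
          exact hj ⟨_, not_le.1 hc⟩ rfl)
        have h2 : Vertex.pos (Sum.inr k) = Vertex.pos (Sum.inl k.succ : Vertex n) + 1 := by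
          simp only [Vertex.pos, Fin.val_rev, Fin.val_succ]; omega
        rw [← h2]
        constructor
        · intro h; rw [h.unique h1]
        · intro h; rw [Vertex.pos_injective h]; exact h1
  · rw [card_column_inr]
    change Nat.card {c : Fin (dx k) // _} = _
    simp only [colOffset_inr]
    have e : ∀ c : Fin (dx k),
        ((frame dy dx).sufPerm w.extended.permA w.extended.permB 0)⁻¹
        ((frame dy dx).X (k + 1) + c) =
        (frame dy dx).midRow w.extended.permA w.extended.permB k ((w.extended.permA k)⁻¹
          ((frame dy dx).oA k + c)) := by
      intro c
      rw [Frame.total_inv_x hs k.isLt (by rw [frame_ex]; exact c.isLt)]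
    simp only [e]
    refine (card_outputs (rotCompletion (w.α k))
      (T := fun c => InRow dy dx z ((frame dy dx).midRow w.extended.permA w.extended.permB k
        ((w.extended.permA k)⁻¹ ((frame dy dx).oA k + c))))
      (o := fun c : Fin (dx k) => ⟨c.val, by omega⟩) (e := botHead (dy k.castSucc))
      (P := fun x => w.lab (Sum.inr ⟨k, x⟩) = z)
      (Q := z.pos = Vertex.pos (Sum.inr k) + 1) ?_ ?_ ?_ ?_).trans ?_
    rotate_left 4
    · congr 1
      · refine Nat.card_congr (Equiv.subtypeEquivRight fun x => ?_)
        rw [w.no_next_inr]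
      · split_ifs with hz
        · rw [w.arrowCount_eq hz, card_column_inr]
          refine Nat.card_congr (Equiv.subtypeEquivRight fun x => ?_)
          rw [w.no_next_inr, not_forall_not]
        · rfl
    · intro c c' h
      have := congrArg Fin.val h
      exact Fin.ext this
    · intro c c' h
      have := congrArg Fin.val h
      exact Fin.ext (by simpa [botHead] using this)
    · intro j x h
      rw [w.midRow_α h, inRow_row_iff]
    · intro j hj
      have h1 := w.midRow_α_virtual (k := k) (p := ⟨j.val, by omega⟩) (by
        by_contra hc
        refine hj ⟨(rotCompletion (w.α k) ⟨j.val, by omega⟩).val - dy k.castSucc, by omega⟩ ?_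
        apply Fin.ext
        simp only [botHead]
        omega)
      have h2 : Vertex.pos (Sum.inl k.castSucc) = Vertex.pos (Sum.inr k : Vertex n) + 1 := by
        simp only [Vertex.pos, Fin.val_rev, Fin.val_castSucc]; omega
      rw [← h2]
      constructor
      · intro h; rw [h.unique h1]
      · intro h; rw [Vertex.pos_injective h]; exact h1

end Laces

end

/-! ### Bases adapted to chains of subspaces -/

section

variable {K M N : Type*} [Field K] [AddCommGroup M] [Module K M] [AddCommGroup N] [Module K N]

/-- The independent set `s` contains a basis of each member of `𝓕`. -/
structure AdaptedTo (𝓕 : Set (Submodule K M)) (s : Set M) : Prop where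
  indep : LinearIndepOn K id s
  le_span : ∀ U ∈ 𝓕, U ≤ Submodule.span K (s ∩ U)

theorem AdaptedTo.mono {𝓕 𝓕' : Set (Submodule K M)} {s : Set M} (h : AdaptedTo 𝓕 s)
    (h' : 𝓕' ⊆ 𝓕) : AdaptedTo 𝓕' s :=
  ⟨h.indep, fun U hU => h.le_span U (h' hU)⟩

/-- The map `f` sends each element of `s` to zero or to an element of `s'`, injectively. -/
structure Matches (f : M →ₗ[K] N) (s : Set M) (s' : Set N) : Prop where
  mem : ∀ v ∈ s, f v ≠ 0 → f v ∈ s'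
  inj : ∀ v ∈ s, ∀ v' ∈ s, f v ≠ 0 → f v = f v' → v = v'

/-- Take a largest admissible set. If it fails to span some member of the chain, take the smallest
such member `U` and a vector of `B ∩ U` outside the span. Adding it keeps the set admissible:
members containing `U` contain the vector, and smaller members are spanned already, so the vector
has coefficient zero in their elements. -/
theorem exists_adaptedTo [FiniteDimensional K M] {𝓕 : Set (Submodule K M)}
    (hc : IsChain (· ≤ ·) 𝓕) {s₀ B : Set M} (hs : LinearIndepOn K id s₀)
    (ha : ∀ U ∈ 𝓕, Submodule.span K s₀ ⊓ U ≤ Submodule.span K (s₀ ∩ U)) (hB : s₀ ⊆ B)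
    (hF : ∀ U ∈ 𝓕, U ≤ Submodule.span K (B ∩ U)) :
    ∃ s, s₀ ⊆ s ∧ s ⊆ B ∧ AdaptedTo 𝓕 s := by
  let P : Set M → Prop := fun s => s₀ ⊆ s ∧ s ⊆ B ∧ LinearIndepOn K id s ∧
    ∀ U ∈ 𝓕, Submodule.span K s ⊓ U ≤ Submodule.span K (s ∩ U)
  have hcard : ∀ s, P s → s.ncard ≤ Module.finrank K M := by
    intro s h
    have h1 := h.2.2.1
    have hfin : s.Finite := LinearIndependent.setFinite h1
    have := hfin.fintype
    rw [Set.ncard_eq_toFinset_card']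
    have h2 : LinearIndependent K ((↑) : s → M) := h1
    have h3 := h2.fintype_card_le_finrank
    rwa [Set.toFinset_card]
  obtain ⟨s, hPs, hmax⟩ : ∃ s, P s ∧ ∀ s', P s' → s'.ncard ≤ s.ncard := by
    have hne : ∃ m, ∃ s, P s ∧ s.ncard = m := ⟨_, s₀, ⟨subset_rfl, hB, hs, ha⟩, rfl⟩
    have hbd : ∀ m, (∃ s, P s ∧ s.ncard = m) → m ≤ Module.finrank K M := by
      rintro m ⟨s, h, rfl⟩; exact hcard s h
    classical
    obtain ⟨s, h1, h2⟩ := Nat.findGreatest_spec (P := fun m => ∃ s, P s ∧ s.ncard = m)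
      (hbd _ hne.choose_spec) hne.choose_spec
    refine ⟨s, h1, fun s' h' => ?_⟩
    rw [h2]
    exact Nat.le_findGreatest (hcard s' h') ⟨s', h', rfl⟩
  obtain ⟨h0, hsB, hind, had⟩ := hPs
  refine ⟨s, h0, hsB, hind, ?_⟩
  suffices h : ∀ U ∈ 𝓕, U ≤ Submodule.span K s from
    fun U hU => le_trans (le_inf (h U hU) le_rfl) (had U hU)
  by_contra hcon
  push Not at hcon
  obtain ⟨U, ⟨hU, hUs⟩, hmin⟩ := (wellFounded_lt (α := Submodule K M)).has_min
    {U | U ∈ 𝓕 ∧ ¬U ≤ Submodule.span K s} hcon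
  obtain ⟨v, ⟨hvB, hvU⟩, hvs⟩ : ∃ v ∈ B ∩ U, v ∉ Submodule.span K s := by
    by_contra hc2
    push Not at hc2
    exact hUs ((hF U hU).trans (Submodule.span_le.2 hc2))
  have hvs' : v ∉ s := fun h => hvs (Submodule.subset_span h)
  have hP : P (insert v s) := by
    refine ⟨h0.trans (Set.subset_insert _ _), Set.insert_subset hvB hsB,
      hind.id_insert hvs, fun U' hU' => ?_⟩
    rintro x ⟨hx, hxU⟩
    obtain ⟨a, y, hy, rfl⟩ := Submodule.mem_span_insert.1 hx
    by_cases hle : U ≤ U'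
    · have hy' : y ∈ U' := by
        have := U'.sub_mem hxU (U'.smul_mem a (hle hvU))
        rwa [add_sub_cancel_left] at this
      refine Submodule.add_mem _ (Submodule.smul_mem _ _
        (Submodule.subset_span ⟨Set.mem_insert _ _, hle hvU⟩)) ?_
      exact Submodule.span_mono (Set.inter_subset_inter_left _ (Set.subset_insert _ _))
        (had U' hU' ⟨hy, hy'⟩)
    · have hlt : U' < U := lt_of_le_of_ne ((hc.total hU hU').resolve_left hle)
        fun e => hle e.symm.le
      have hU's : U' ≤ Submodule.span K s := by
        by_contra hc3
        exact hmin U' ⟨hU', hc3⟩ hlt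
      have ha0 : a = 0 := by
        by_contra ha0
        have := (Submodule.span K s).sub_mem (hU's hxU) hy
        rw [add_sub_cancel_right] at this
        exact hvs (((Submodule.span K s).smul_mem_iff ha0).1 this)
      rw [ha0, zero_smul, zero_add] at hxU ⊢
      exact Submodule.span_mono (Set.inter_subset_inter_left _ (Set.subset_insert _ _))
        (had U' hU' ⟨hy, hxU⟩)
  have hfin : s.Finite := LinearIndependent.setFinite hind
  have := hmax _ hP
  rw [Set.ncard_insert_of_notMem hvs' hfin] at this
  omega

/-- A vector of `U` which is a combination of an independent set adapted to `U` only involves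
elements of `U`. -/
theorem mem_of_mem_span {s : Set M} (hs : LinearIndepOn K id s) {U : Submodule K M}
    (hU : U ≤ Submodule.span K (s ∩ U)) {l : M →₀ K}
    (hl : l ∈ Finsupp.supported K K s) (h : Finsupp.linearCombination K id l ∈ U) :
    l ∈ Finsupp.supported K K (s ∩ U) := by
  have h1 := hU h
  rw [← Set.image_id (s ∩ (U : Set M)), Finsupp.mem_span_image_iff_linearCombination] at h1
  obtain ⟨l', hl', e⟩ := h1
  have h2 : l' = l := linearIndepOn_iffₛ.1 hs l'
    (Finsupp.supported_mono Set.inter_subset_left hl') l hl e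
  rwa [← h2]

/-- Elements of `s'` in the image of `f` are lifted as deep into the chain as possible, and the
lifts are completed by vectors of the kernel. Nonzero images then lie in `s'` and determine their
lifts. -/
theorem exists_adaptedTo_lift [FiniteDimensional K M] (f : M →ₗ[K] N) {𝓕 : Set (Submodule K M)}
    (hc : IsChain (· ≤ ·) 𝓕) (ht : ⊤ ∈ 𝓕) {s' : Set N}
    (hs : AdaptedTo (Submodule.map f '' 𝓕) s') : ∃ s, AdaptedTo 𝓕 s ∧ Matches f s s' := by
  -- The lift lies in the smallest member of the chain whose image contains `c`, hence in all such
  -- members. Outside the range the value `0` is arbitrary.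
  have hlift : ∀ c : N, ∃ b : M, c ∈ LinearMap.range f →
      f b = c ∧ ∀ U ∈ 𝓕, c ∈ Submodule.map f U → b ∈ U := by
    intro c
    by_cases hcr : c ∈ LinearMap.range f
    · obtain ⟨U, ⟨hU, hcU⟩, hmin⟩ := (wellFounded_lt (α := Submodule K M)).has_min
        {U | U ∈ 𝓕 ∧ c ∈ Submodule.map f U} ⟨⊤, ht, by rwa [Submodule.map_top]⟩
      obtain ⟨b, hb, rfl⟩ := hcU
      refine ⟨b, fun _ => ⟨rfl, fun U' hU' hc' => ?_⟩⟩
      rcases hc.total hU hU' with h | h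
      · exact h hb
      · rcases h.lt_or_eq with h | h
        · exact absurd h (hmin U' ⟨hU', hc'⟩)
        · rw [h]; exact hb
    · exact ⟨0, fun h => absurd h hcr⟩
  choose b hb using hlift
  let R : Set N := {c | c ∈ s' ∧ c ∈ LinearMap.range f}
  have hRs : R ⊆ s' := fun _ h => h.1
  have hmapR : ∀ U c, c ∈ Submodule.map f U → c ∈ LinearMap.range f := by
    rintro U _ ⟨x, -, rfl⟩; exact ⟨x, rfl⟩
  have hcomb : ∀ l ∈ Finsupp.supported K K R,
      f (Finsupp.linearCombination K b l) = Finsupp.linearCombination K id l := by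
    intro l hl
    rw [Finsupp.apply_linearCombination, Finsupp.linearCombination_apply,
      Finsupp.linearCombination_apply]
    refine Finsupp.sum_congr fun c hcl => ?_
    rw [Function.comp_apply, (hb c (hl hcl).2).1, id]
  have hind : LinearIndepOn K b R := by
    rw [linearIndepOn_iff]
    intro l hl h0
    refine linearIndepOn_iff.1 hs.indep l (Finsupp.supported_mono hRs hl) ?_
    rw [← hcomb l hl, h0, map_zero]
  have hA : ∀ U ∈ 𝓕, Submodule.span K (b '' R) ⊓ U ≤ Submodule.span K (b '' R ∩ U) := by
    rintro U hU x ⟨hx, hxU⟩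
    obtain ⟨l, hl, rfl⟩ := (Finsupp.mem_span_image_iff_linearCombination K).1 hx
    have h1 := mem_of_mem_span hs.indep (hs.le_span _ ⟨U, hU, rfl⟩)
      (Finsupp.supported_mono hRs hl) (by rw [← hcomb l hl]; exact ⟨_, hxU, rfl⟩)
    refine Submodule.span_mono ?_ ((Finsupp.mem_span_image_iff_linearCombination K).2
      ⟨l, (Finsupp.mem_supported K l).2 (Set.subset_inter hl h1), rfl⟩)
    rintro _ ⟨c, ⟨hcR, -, hcU⟩, rfl⟩
    exact ⟨⟨c, hcR, rfl⟩, (hb c hcR.2).2 U hU hcU⟩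
  have hB : ∀ U ∈ 𝓕, U ≤ Submodule.span K ((b '' R ∪ LinearMap.ker f) ∩ U) := by
    intro U hU u hu
    have h1 : Submodule.map f U ≤ Submodule.map f (Submodule.span K (b '' R ∩ U)) := by
      refine (hs.le_span _ ⟨U, hU, rfl⟩).trans (Submodule.span_le.2 ?_)
      rintro c ⟨hcs, hcU⟩
      have hcr := hmapR U c hcU
      exact ⟨b c, Submodule.subset_span ⟨⟨c, ⟨hcs, hcr⟩, rfl⟩, (hb c hcr).2 U hU hcU⟩,
        (hb c hcr).1⟩
    obtain ⟨y, hy, hfy⟩ := h1 ⟨u, hu, rfl⟩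
    have hyU : y ∈ U := (Submodule.span_le.2 Set.inter_subset_right : _ ≤ U) hy
    rw [← add_sub_cancel y u]
    refine Submodule.add_mem _ (Submodule.span_mono
      (Set.inter_subset_inter_left _ Set.subset_union_left) hy)
      (Submodule.subset_span ⟨Or.inr ?_, U.sub_mem hu hyU⟩)
    change f (u - y) = 0
    rw [map_sub, hfy, sub_self]
  obtain ⟨s, h1, h2, h3⟩ := exists_adaptedTo hc (s₀ := b '' R)
    (B := b '' R ∪ LinearMap.ker f) hind.id_image hA Set.subset_union_left hB
  have key : ∀ v ∈ s, f v ≠ 0 → ∃ c ∈ R, b c = v := by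
    intro v hv h0
    rcases h2 hv with h | h
    · exact h
    · exact absurd h h0
  refine ⟨s, h3, ⟨fun v hv h0 => ?_, fun v hv v' hv' h0 h => ?_⟩⟩
  · obtain ⟨c, hcR, rfl⟩ := key v hv h0
    rw [(hb c hcR.2).1]; exact hcR.1
  · obtain ⟨c, hcR, rfl⟩ := key v hv h0
    obtain ⟨c', hcR', rfl⟩ := key v' hv' (h ▸ h0)
    rw [(hb c hcR.2).1, (hb c' hcR'.2).1] at h
    rw [h]

/-- The preimage of `⊥` is the kernel, so adaptedness to it makes the nonzero images of `s`
independent. They are adapted within their span because `s` is adapted to the preimages, and can be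
completed. -/
theorem exists_adaptedTo_push [FiniteDimensional K N] (f : M →ₗ[K] N) {𝓕 : Set (Submodule K N)}
    (hc : IsChain (· ≤ ·) 𝓕) (hbot : ⊥ ∈ 𝓕) {s : Set M}
    (hs : AdaptedTo (Submodule.comap f '' 𝓕) s) : ∃ s', AdaptedTo 𝓕 s' ∧ Matches f s s' := by
  let R : Set M := {v | v ∈ s ∧ f v ≠ 0}
  have hRs : R ⊆ s := fun _ h => h.1
  have hcomb : ∀ l, Finsupp.linearCombination K f l = f (Finsupp.linearCombination K id l) := by
    intro l
    rw [Finsupp.apply_linearCombination]; rfl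
  have key : ∀ U ∈ 𝓕, ∀ l ∈ Finsupp.supported K K R, Finsupp.linearCombination K f l ∈ U →
      l ∈ Finsupp.supported K K (s ∩ Submodule.comap f U) := by
    intro U hU l hl h
    refine mem_of_mem_span hs.indep (hs.le_span _ ⟨U, hU, rfl⟩)
      (Finsupp.supported_mono hRs hl) ?_
    rw [hcomb] at h
    exact h
  have hind : LinearIndepOn K f R := by
    rw [linearIndepOn_iff]
    intro l hl h0
    have h1 := key ⊥ hbot l hl h0
    rw [← Finsupp.support_eq_empty, Finset.eq_empty_iff_forall_notMem]
    intro v hv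
    exact (hl hv).2 (h1 hv).2
  have hA : ∀ U ∈ 𝓕, Submodule.span K (f '' R) ⊓ U ≤ Submodule.span K (f '' R ∩ U) := by
    rintro U hU x ⟨hx, hxU⟩
    obtain ⟨l, hl, rfl⟩ := (Finsupp.mem_span_image_iff_linearCombination K).1 hx
    have h1 := key U hU l hl hxU
    refine Submodule.span_mono ?_ ((Finsupp.mem_span_image_iff_linearCombination K).2
      ⟨l, (Finsupp.mem_supported K l).2 (Set.subset_inter hl h1), rfl⟩)
    rintro _ ⟨c, ⟨hcR, -, hcU⟩, rfl⟩
    exact ⟨⟨c, hcR, rfl⟩, hcU⟩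
  obtain ⟨s', h1, -, h3⟩ := exists_adaptedTo hc (s₀ := f '' R) (B := Set.univ)
    hind.id_image hA (Set.subset_univ _)
    fun U _ => by rw [Set.univ_inter]; exact Submodule.subset_span
  refine ⟨s', h3, ⟨fun v hv h0 => h1 ⟨v, ⟨hv, h0⟩, rfl⟩, fun v hv v' hv' h0 h => ?_⟩⟩
  exact hind.injOn ⟨hv, h0⟩ ⟨hv', h ▸ h0⟩ h

end

/-! ### Every orbit contains a lacing diagram -/

section

variable {K : Type*} [Field K] {n : ℕ} {dy : Fin (n + 1) → ℕ} {dx : Fin n → ℕ}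

/-- The induction removes the rightmost arrows. The chain at the new end records all subspaces
produced from the rest by images along β and preimages along α. Bases are then chosen in the
opposite direction, starting at the end: push along α, lift along β, continue with the smaller
quiver. -/
theorem exists_adapted_bases (V : Rep K dy dx) : ∃ 𝓕 : Set (Submodule K (Fin (dy 0) → K)),
    IsChain (· ≤ ·) 𝓕 ∧ ⊤ ∈ 𝓕 ∧ ∀ s, AdaptedTo 𝓕 s →
      ∃ (sy : ∀ i, Set (Fin (dy i) → K)) (sx : ∀ k, Set (Fin (dx k) → K)), sy 0 = s ∧
        (∀ i, AdaptedTo (K := K) {⊤} (sy i)) ∧ (∀ k, AdaptedTo (K := K) {⊤} (sx k)) ∧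
        ∀ k, Matches (V.β k).vecMulLinear (sy k.succ) (sx k) ∧
          Matches (V.α k).vecMulLinear (sy k.castSucc) (sx k) := by
  induction n with
  | zero =>
    refine ⟨{⊤}, IsChain.singleton, rfl, fun s hs => ⟨Fin.cons s fun i => i.elim0,
      fun i => i.elim0, rfl, fun i => ?_, fun i => i.elim0, fun i => i.elim0⟩⟩
    induction i using Fin.cases with
    | zero => exact hs
    | succ i => exact i.elim0
  | succ n ih =>
    obtain ⟨𝓕, hc, ht, h⟩ := ih (dy := fun i => dy i.succ) (dx := fun k => dx k.succ)
      ⟨fun k => V.β k.succ, fun k => V.α k.succ⟩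
    -- Including `⊥` is needed for pushing along α, and `⊤` makes adapted sets into bases.
    let 𝓖 : Set (Submodule K (Fin (dx 0) → K)) :=
      insert ⊤ (insert ⊥ (Submodule.map (V.β 0).vecMulLinear '' 𝓕))
    have hc' : IsChain (· ≤ ·) 𝓖 := by
      refine IsChain.insert (IsChain.insert ?_ fun _ _ _ => Or.inl bot_le)
        fun _ _ _ => Or.inr le_top
      exact hc.image_of_map_rel _ _ _ fun _ _ h => Submodule.map_mono h
    refine ⟨Submodule.comap (V.α 0).vecMulLinear '' 𝓖,
      hc'.image_of_map_rel _ _ _ fun _ _ h => Submodule.comap_mono h,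
      ⟨⊤, Set.mem_insert _ _, Submodule.comap_top _⟩, fun s hs => ?_⟩
    obtain ⟨s1, h1, m1⟩ := exists_adaptedTo_push (V.α 0).vecMulLinear hc'
      (Set.mem_insert_of_mem _ (Set.mem_insert _ _)) hs
    obtain ⟨s2, h2, m2⟩ := exists_adaptedTo_lift (V.β 0).vecMulLinear hc ht
      (h1.mono ((Set.subset_insert _ _).trans (Set.subset_insert _ _)))
    obtain ⟨sy, sx, rfl, hy, hx, hm⟩ := h s2 h2
    refine ⟨Fin.cons s sy, Fin.cons s1 sx, rfl, fun i => ?_, fun k => ?_, fun k => ?_⟩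
    · induction i using Fin.cases with
      | zero =>
        refine hs.mono (Set.singleton_subset_iff.2 ⟨⊤, Set.mem_insert _ _, ?_⟩)
        exact Submodule.comap_top _
      | succ i => exact hy i
    · induction k using Fin.cases with
      | zero => exact h1.mono (Set.singleton_subset_iff.2 (Set.mem_insert _ _))
      | succ k => exact hx k
    · induction k using Fin.cases with
      | zero => exact ⟨m2, m1⟩
      | succ k => exact hm k

/-! ### From adapted bases to a lacing diagram in the orbit -/

theorem exists_units_rows {d : ℕ} {s : Set (Fin d → K)} (hs : AdaptedTo (K := K) {⊤} s) :
    ∃ g : GL (Fin d) K, ∀ v, v ∈ s ↔ ∃ i, g.val.row i = v := by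
  have hi : LinearIndependent K ((↑) : s → Fin d → K) := hs.indep
  have hspan : ⊤ ≤ Submodule.span K (Set.range ((↑) : s → Fin d → K)) := by
    have := hs.le_span ⊤ rfl
    rw [Submodule.top_coe, Set.inter_univ] at this
    rwa [Subtype.range_coe]
  let b := Module.Basis.mk hi hspan
  have : Finite s := hi.finite
  have := Fintype.ofFinite s
  have hcard : Fintype.card s = d := by
    rw [← Module.finrank_eq_card_basis b, Module.finrank_fin_fun]
  let e := Fintype.equivFinOfCardEq hcard
  have hrow : LinearIndependent K (Matrix.of fun i => (e.symm i).1).row := by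
    exact hi.comp _ e.symm.injective
  rw [Matrix.linearIndependent_rows_iff_isUnit] at hrow
  obtain ⟨g, hg⟩ := hrow
  refine ⟨g, fun v => ⟨fun hv => ⟨e ⟨v, hv⟩, ?_⟩, ?_⟩⟩
  · rw [hg]
    change (e.symm (e ⟨v, hv⟩)).1 = v
    rw [Equiv.symm_apply_apply]
  · rintro ⟨i, rfl⟩
    rw [hg]
    exact (e.symm i).2

theorem exists_pequiv {a b : ℕ} {R : Fin a → Fin b → Prop} (h1 : ∀ i j j', R i j → R i j' → j = j')
    (h2 : ∀ i i' j, R i j → R i' j → i = i') : ∃ w : Fin a ≃. Fin b, ∀ i j, j ∈ w i ↔ R i j := by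
  classical
  let f : Fin a → Option (Fin b) := fun i => if h : ∃ j, R i j then some h.choose else none
  let g : Fin b → Option (Fin a) := fun j => if h : ∃ i, R i j then some h.choose else none
  have hf : ∀ i j, j ∈ f i ↔ R i j := by
    intro i j
    simp only [f, Option.mem_def]
    split_ifs with h
    · rw [Option.some.injEq]
      constructor
      · rintro rfl; exact h.choose_spec
      · exact h1 _ _ _ h.choose_spec
    · constructor
      · intro e; cases e
      · exact fun e => absurd ⟨j, e⟩ h
  have hg : ∀ j i, i ∈ g j ↔ R i j := by
    intro j i
    simp only [g, Option.mem_def]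
    split_ifs with h
    · rw [Option.some.injEq]
      constructor
      · rintro rfl; exact h.choose_spec
      · exact h2 _ _ _ h.choose_spec
    · constructor
      · intro e; cases e
      · exact fun e => absurd ⟨i, e⟩ h
  exact ⟨⟨f, g, fun i j => (hg j i).trans (hf i j).symm⟩, hf⟩

/-- In bases whose vectors are sent to zero or injectively to basis vectors, the map has a partial
permutation matrix. Vectors are rows, so the matrices act from the right. -/
theorem exists_pequiv_conj {a b : ℕ} (A : Matrix (Fin a) (Fin b) K) (g : GL (Fin a) K)
    (h : GL (Fin b) K) {s : Set (Fin a → K)} {s' : Set (Fin b → K)}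
    (hs : ∀ v, v ∈ s ↔ ∃ i, g.val.row i = v) (hs' : ∀ v, v ∈ s' ↔ ∃ i, h.val.row i = v)
    (hm : Matches A.vecMulLinear s s') :
    ∃ w : Fin a ≃. Fin b, (w.toMatrix : Matrix (Fin a) (Fin b) K) =
      g.val * A * (h⁻¹).val := by
  have hli : ∀ {m : ℕ} (u : GL (Fin m) K), LinearIndependent K u.val.row := fun u =>
    Matrix.linearIndependent_rows_iff_isUnit.2 u.isUnit
  obtain ⟨w, hw⟩ := exists_pequiv (R := fun i j => (g.val * A).row i = h.val.row j)
    (fun i j j' e e' => (hli h).injective (e.symm.trans e'))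
    (fun i i' j e e' => by
      refine (hli g).injective (hm.inj _ ((hs _).2 ⟨i, rfl⟩) _ ((hs _).2 ⟨i', rfl⟩) ?_
        (e.trans e'.symm))
      change (g.val * A).row i ≠ 0
      rw [e]
      exact (hli h).ne_zero j)
  refine ⟨w, ?_⟩
  suffices he : (w.toMatrix : Matrix (Fin a) (Fin b) K) * h.val = g.val * A by
    rw [← he, Matrix.mul_assoc, ← Units.val_mul, mul_inv_cancel, Units.val_one, Matrix.mul_one]
  ext i c
  rw [PEquiv.toMatrix_mul_apply]
  rcases e : w i with _ | j
  · have h0 : (g.val * A).row i = 0 := by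
      by_contra h0
      have h1 : (g.val * A).row i ∈ s' := hm.mem _ ((hs _).2 ⟨i, rfl⟩) h0
      obtain ⟨j, hj⟩ := (hs' _).1 h1
      have := (hw i j).2 hj.symm
      rw [e] at this
      cases this
    exact (congrFun h0 c).symm
  · exact (congrFun ((hw i j).1 e) c).symm

theorem exists_laces_mem_orbit (V : Rep K dy dx) : ∃ w : Laces dy dx, w.toRep K ∈ V.orbit := by
  obtain ⟨𝓕, hc, ht, h⟩ := exists_adapted_bases V
  obtain ⟨s, -, -, hs⟩ := exists_adaptedTo hc (s₀ := ∅) (B := Set.univ)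
    (linearIndepOn_empty K id) (fun U _ => by simp) (Set.empty_subset _)
    fun U _ => by rw [Set.univ_inter]; exact Submodule.subset_span
  obtain ⟨sy, sx, -, hy, hx, hm⟩ := h s hs
  choose gy hgy using fun i => exists_units_rows (hy i)
  choose gx hgx using fun k => exists_units_rows (hx k)
  choose wβ hβ using fun k => exists_pequiv_conj (V.β k) _ _ (hgy k.succ) (hgx k) (hm k).1
  choose wα hα using fun k => exists_pequiv_conj (V.α k) _ _ (hgy k.castSucc) (hgx k) (hm k).2
  refine ⟨⟨wβ, wα⟩, fun i => (gy i)⁻¹, fun k => (gx k)⁻¹, ?_⟩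
  ext1 <;> funext k
  · simp only [Laces.toRep, Rep.act, inv_inv]; exact hβ k
  · simp only [Laces.toRep, Rep.act, inv_inv]; exact hα k

/-! ### Compatible families of vectors -/

/-- Families of vectors in the spaces at the vertices which are compatible with the arrows between
the columns `a` and `b`, and vanish in column `a` if `ε` holds. -/
def Rep.families (V : Rep K dy dx) (a b : ℕ) (ε : Prop) : Submodule K (Dot dy dx → K) where
  carrier := {f | (∀ k : Fin n, a ≤ Vertex.pos (Sum.inl k.succ) → Vertex.pos (Sum.inr k) ≤ b →
      (fun j => f (Sum.inr ⟨k, j⟩)) = Matrix.vecMul (fun i => f (Sum.inl ⟨k.succ, i⟩)) (V.β k)) ∧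
    (∀ k : Fin n, a ≤ Vertex.pos (Sum.inr k) → Vertex.pos (Sum.inl k.castSucc) ≤ b →
      (fun j => f (Sum.inr ⟨k, j⟩)) =
        Matrix.vecMul (fun i => f (Sum.inl ⟨k.castSucc, i⟩)) (V.α k)) ∧
    (ε → ∀ p : Dot dy dx, p.rank = a → f p = 0)}
  add_mem' := by
    rintro f g ⟨h1, h2, h3⟩ ⟨h1', h2', h3'⟩
    refine ⟨fun k ha hb => ?_, fun k ha hb => ?_, fun e p hp => ?_⟩
    · exact (congrArg₂ (· + ·) (h1 k ha hb) (h1' k ha hb)).trans (Matrix.add_vecMul _ _ _).symm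
    · exact (congrArg₂ (· + ·) (h2 k ha hb) (h2' k ha hb)).trans (Matrix.add_vecMul _ _ _).symm
    · rw [Pi.add_apply, h3 e p hp, h3' e p hp, add_zero]
  zero_mem' := by
    refine ⟨fun k _ _ => ?_, fun k _ _ => ?_, fun _ _ _ => rfl⟩
    · exact (Matrix.zero_vecMul _).symm
    · exact (Matrix.zero_vecMul _).symm
  smul_mem' := by
    rintro c f ⟨h1, h2, h3⟩
    refine ⟨fun k ha hb => ?_, fun k ha hb => ?_, fun e p hp => ?_⟩
    · exact (congrArg (c • ·) (h1 k ha hb)).trans (Matrix.smul_vecMul _ _ _).symm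
    · exact (congrArg (c • ·) (h2 k ha hb)).trans (Matrix.smul_vecMul _ _ _).symm
    · rw [Pi.smul_apply, h3 e p hp, smul_zero]

open Classical in
/-- The projection to the space at the vertex `z`. -/
noncomputable def columnProj (K : Type*) [Field K] (dy : Fin (n + 1) → ℕ) (dx : Fin n → ℕ)
    (z : Vertex n) : (Dot dy dx → K) →ₗ[K] (Dot dy dx → K) where
  toFun f p := if Dot.column p = z then f p else 0
  map_add' f g := by
    funext p; dsimp only [Pi.add_apply]; split_ifs <;> simp
  map_smul' c f := by
    funext p; dsimp only [Pi.smul_apply, RingHom.id_apply]; split_ifs <;> simp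

/-- The action of `GL(d)` on families of vectors. -/
def actFamily (gy : ∀ i, GL (Fin (dy i)) K) (gx : ∀ k, GL (Fin (dx k)) K) :
    (Dot dy dx → K) →ₗ[K] (Dot dy dx → K) where
  toFun f
    | Sum.inl p => Matrix.vecMul (fun i => f (Sum.inl ⟨p.1, i⟩)) (gy p.1).val p.2
    | Sum.inr p => Matrix.vecMul (fun i => f (Sum.inr ⟨p.1, i⟩)) (gx p.1).val p.2
  map_add' f g := by
    funext p
    rcases p with p | p
    · exact congrFun (Matrix.add_vecMul _ _ _) p.2
    · exact congrFun (Matrix.add_vecMul _ _ _) p.2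
  map_smul' c f := by
    funext p
    rcases p with p | p
    · exact congrFun (Matrix.smul_vecMul _ _ _) p.2
    · exact congrFun (Matrix.smul_vecMul _ _ _) p.2

theorem actFamily_injective (gy : ∀ i, GL (Fin (dy i)) K) (gx : ∀ k, GL (Fin (dx k)) K) :
    Function.Injective (actFamily gy gx) := by
  have hg : ∀ {m : ℕ} (g : GL (Fin m) K) (v v' : Fin m → K),
      (∀ i, Matrix.vecMul v g.val i = Matrix.vecMul v' g.val i) → v = v' := by
    intro m g v v' h
    have := congrArg (fun u => Matrix.vecMul u (g⁻¹).val) (funext h)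
    simpa only [Matrix.vecMul_vecMul, ← Units.val_mul, mul_inv_cancel, Units.val_one,
      Matrix.vecMul_one] using this
  intro f f' h
  funext p
  rcases p with ⟨i, x⟩ | ⟨k, x⟩
  · exact congrFun (hg (gy i) (fun x => f (Sum.inl ⟨i, x⟩)) (fun x => f' (Sum.inl ⟨i, x⟩))
      fun x => congrFun h (Sum.inl ⟨i, x⟩)) x
  · exact congrFun (hg (gx k) (fun x => f (Sum.inr ⟨k, x⟩)) (fun x => f' (Sum.inr ⟨k, x⟩))
      fun x => congrFun h (Sum.inr ⟨k, x⟩)) x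

theorem actFamily_mem (V : Rep K dy dx) (gy : ∀ i, GL (Fin (dy i)) K)
    (gx : ∀ k, GL (Fin (dx k)) K) {a b : ℕ} {ε : Prop} {f : Dot dy dx → K}
    (hf : f ∈ V.families a b ε) : actFamily gy gx f ∈ (V.act gy gx).families a b ε := by
  obtain ⟨h1, h2, h3⟩ := hf
  have key : ∀ {m m' : ℕ} (g : GL (Fin m) K) (g' : GL (Fin m') K) (A : Matrix (Fin m) (Fin m') K)
      (v : Fin m → K) (v' : Fin m' → K), v' = Matrix.vecMul v A →
      Matrix.vecMul v' g'.val = Matrix.vecMul (Matrix.vecMul v g.val) ((g⁻¹).val * A * g'.val) := by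
    rintro m m' g g' A v v' rfl
    rw [Matrix.vecMul_vecMul, Matrix.vecMul_vecMul, ← Matrix.mul_assoc, ← Matrix.mul_assoc,
      ← Units.val_mul, mul_inv_cancel, Units.val_one, Matrix.one_mul]
  refine ⟨fun k ha hb => key (gy k.succ) (gx k) _ _ _ (h1 k ha hb),
    fun k ha hb => key (gy k.castSucc) (gx k) _ _ _ (h2 k ha hb), fun e p hp => ?_⟩
  have h0 : ∀ {m : ℕ} (g : GL (Fin m) K) (v : Fin m → K) (x : Fin m), (∀ i, v i = 0) →
      Matrix.vecMul v g.val x = 0 := by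
    intro m g v x h
    rw [show v = 0 from funext h, Matrix.zero_vecMul]; rfl
  rcases p with ⟨i, x⟩ | ⟨k, x⟩
  · exact h0 _ _ _ fun j => h3 e (Sum.inl ⟨i, j⟩) hp
  · exact h0 _ _ _ fun j => h3 e (Sum.inr ⟨k, j⟩) hp

theorem columnProj_actFamily (gy : ∀ i, GL (Fin (dy i)) K) (gx : ∀ k, GL (Fin (dx k)) K)
    (z : Vertex n) (f : Dot dy dx → K) : columnProj K dy dx z (actFamily gy gx f) =
      actFamily gy gx (columnProj K dy dx z f) := by
  have h0 : ∀ {m : ℕ} (P : Prop) [Decidable P] (A : Matrix (Fin m) (Fin m) K) (v : Fin m → K)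
      (x : Fin m), (if P then Matrix.vecMul v A x else 0) =
        Matrix.vecMul (fun i => if P then v i else 0) A x := by
    intro m P _ A v x
    split_ifs
    · rfl
    · exact (congrFun (Matrix.zero_vecMul A) x).symm
  funext p
  rcases p with ⟨i, x⟩ | ⟨k, x⟩
  · exact h0 _ _ _ _
  · exact h0 _ _ _ _

/-- The group maps compatible families injectively to compatible families of the moved
representation and commutes with projection. The inequality suffices, since it can be used for the
inverse element too. -/
theorem finrank_families_le (V : Rep K dy dx) (gy : ∀ i, GL (Fin (dy i)) K)
    (gx : ∀ k, GL (Fin (dx k)) K) (a b : ℕ) (ε : Prop) (z : Vertex n) :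
    Module.finrank K ((V.families a b ε).map (columnProj K dy dx z)) ≤
      Module.finrank K (((V.act gy gx).families a b ε).map (columnProj K dy dx z)) := by
  rw [(Submodule.equivMapOfInjective (actFamily gy gx) (actFamily_injective gy gx)
    ((V.families a b ε).map (columnProj K dy dx z))).finrank_eq]
  refine Submodule.finrank_mono ?_
  rintro _ ⟨_, ⟨f, hf, rfl⟩, rfl⟩
  rw [← columnProj_actFamily]
  exact ⟨_, actFamily_mem V gy gx hf, rfl⟩

/-! ### Compatible families of a lacing diagram -/

theorem vecMul_toMatrix_of_mem {a b : ℕ} {w : Fin a ≃. Fin b} (v : Fin a → K) {i : Fin a}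
    {j : Fin b} (h : j ∈ w i) : Matrix.vecMul v (w.toMatrix : Matrix (Fin a) (Fin b) K) j = v i := by
  rw [Matrix.vecMul, dotProduct, Finset.sum_eq_single i]
  · rw [PEquiv.toMatrix_apply, if_pos h, mul_one]
  · intro i' _ hi
    rw [PEquiv.toMatrix_apply, if_neg fun h' => hi (w.inj h' h), mul_zero]
  · intro h; exact absurd (Finset.mem_univ _) h

theorem vecMul_toMatrix_of_forall {a b : ℕ} {w : Fin a ≃. Fin b} (v : Fin a → K) {j : Fin b}
    (h : ∀ i, j ∉ w i) : Matrix.vecMul v (w.toMatrix : Matrix (Fin a) (Fin b) K) j = 0 := by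
  rw [Matrix.vecMul, dotProduct, Finset.sum_eq_zero]
  intro i _
  rw [PEquiv.toMatrix_apply, if_neg (h i), mul_zero]

namespace Laces

variable {w : Laces dy dx} {p q : Dot dy dx}

theorem pos_inr_eq (k : Fin n) : Vertex.pos (Sum.inr k) = Vertex.pos (Sum.inl k.succ) + 1 := by
  simp only [Vertex.pos, Fin.val_rev, Fin.val_succ]; omega

theorem pos_castSucc_eq (k : Fin n) :
    Vertex.pos (Sum.inl k.castSucc) = Vertex.pos (Sum.inr k) + 1 := by
  simp only [Vertex.pos, Fin.val_rev, Fin.val_castSucc]; omega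

/-- For a lacing diagram compatibility means constancy along arrows, and vanishing at a dot of a
sink column that lacks an arrow on a side lying between `a` and `b`. -/
theorem mem_families_iff {a b : ℕ} {ε : Prop} {f : Dot dy dx → K} :
    f ∈ (w.toRep K).families a b ε ↔
    (∀ p q, w.Next p q → a ≤ p.rank → q.rank ≤ b → f p = f q) ∧
    (∀ k j, (∀ r, ¬w.Next r (Sum.inr ⟨k, j⟩)) → a < Vertex.pos (Sum.inr k) →
      Vertex.pos (Sum.inr k) ≤ b → f (Sum.inr ⟨k, j⟩) = 0) ∧
    (∀ k j, (∀ r, ¬w.Next (Sum.inr ⟨k, j⟩) r) → a ≤ Vertex.pos (Sum.inr k) →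
      Vertex.pos (Sum.inr k) < b → f (Sum.inr ⟨k, j⟩) = 0) ∧
    (ε → ∀ p : Dot dy dx, p.rank = a → f p = 0) := by
  constructor
  · rintro ⟨h1, h2, h3⟩
    refine ⟨?_, fun k j hr ha hb => ?_, fun k j hr ha hb => ?_, h3⟩
    · rintro _ _ (⟨k, i, j, h⟩ | ⟨k, i, j, h⟩) ha hb
      · exact ((congrFun (h1 k ha hb) j).trans (vecMul_toMatrix_of_mem _ h)).symm
      · exact (congrFun (h2 k ha hb) j).trans (vecMul_toMatrix_of_mem _ h)
    · rw [pos_inr_eq] at ha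
      exact (congrFun (h1 k (by omega) hb) j).trans
        (vecMul_toMatrix_of_forall _ fun i hi => hr _ (.beta k i j hi))
    · exact (congrFun (h2 k ha (by rw [pos_castSucc_eq]; omega)) j).trans
        (vecMul_toMatrix_of_forall _ fun i hi => hr _ (.alpha k i j hi))
  · rintro ⟨h1, h2, h3, h4⟩
    refine ⟨fun k ha hb => ?_, fun k ha hb => ?_, h4⟩
    · funext j
      by_cases hj : ∃ i, j ∈ w.β k i
      · obtain ⟨i, hi⟩ := hj
        exact (h1 _ _ (.beta k i j hi) ha hb).symm.trans
          (vecMul_toMatrix_of_mem (fun i => f (Sum.inl ⟨k.succ, i⟩)) hi).symm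
      · push Not at hj
        refine (h2 k j (fun r hr => ?_) (by rw [pos_inr_eq]; omega) hb).trans
          (vecMul_toMatrix_of_forall _ hj).symm
        rw [next_iff] at hr
        rcases hr with ⟨k', i', j', h, -, e⟩ | ⟨k', i', j', h, -, e⟩
        · cases e; exact hj _ h
        · cases e
    · funext j
      by_cases hj : ∃ i, j ∈ w.α k i
      · obtain ⟨i, hi⟩ := hj
        exact (h1 _ _ (.alpha k i j hi) ha hb).trans
          (vecMul_toMatrix_of_mem (fun i => f (Sum.inl ⟨k.castSucc, i⟩)) hi).symm
      · push Not at hj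
        refine (h3 k j (fun r hr => ?_) ha (by rw [pos_castSucc_eq] at hb; omega)).trans
          (vecMul_toMatrix_of_forall _ hj).symm
        rw [next_iff] at hr
        rcases hr with ⟨k', i', j', h, e, -⟩ | ⟨k', i', j', h, e, -⟩
        · cases e
        · cases e; exact hj _ h

theorem Path.exists_rank (h : w.Path p q) {a : ℕ} (ha : p.rank ≤ a) (hb : a ≤ q.rank) :
    ∃ r, w.Path p r ∧ w.Path r q ∧ r.rank = a := by
  induction h with
  | refl => exact ⟨p, .refl, .refl, by omega⟩
  | @tail q q' h1 h2 ih =>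
    by_cases hq : a ≤ q.rank
    · obtain ⟨r, h3, h4, h5⟩ := ih hq
      exact ⟨r, h3, h4.tail h2, h5⟩
    · exact ⟨q', h1.tail h2, .refl, by have := h2.rank_eq; omega⟩

/-- The number of dots in column `z` whose lace begins in a column with property `P`. -/
noncomputable def dots (w : Laces dy dx) (z : Vertex n) (P : Vertex n → Prop) : ℕ :=
  Nat.card {q : Dot dy dx // Dot.column q = z ∧ P (w.lab q)}

theorem dots_congr {z : Vertex n} {P Q : Vertex n → Prop}
    (h : ∀ v : Vertex n, v.pos ≤ z.pos → (P v ↔ Q v)) : w.dots z P = w.dots z Q := by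
  refine Nat.card_congr (Equiv.subtypeEquivRight fun q => and_congr_right fun hq => h _ ?_)
  rw [← hq]
  exact w.lab_pos_le q

theorem dots_add {z : Vertex n} {P Q : Vertex n → Prop} (h : ∀ v, P v → ¬Q v) :
    w.dots z (fun v => P v ∨ Q v) = w.dots z P + w.dots z Q := by
  classical
  simp only [dots, Nat.card_eq_fintype_card, Fintype.card_subtype]
  rw [← Finset.card_union_of_disjoint]
  · congr 1
    ext q
    simp only [Finset.mem_filter, Finset.mem_union, Finset.mem_univ, true_and, and_or_left]
  · rw [Finset.disjoint_filter]
    rintro q - ⟨-, h1⟩ ⟨-, h2⟩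
    exact h _ h1 h2

theorem finrank_vanishing {ι : Type*} [Fintype ι] (T : ι → Prop) (S : Submodule K (ι → K))
    (hS : ∀ h, h ∈ S ↔ ∀ i, ¬T i → h i = 0) : Module.finrank K S = Nat.card {i // T i} := by
  classical
  let e : S ≃ₗ[K] ({i // T i} → K) := LinearEquiv.ofBijective
    ((LinearMap.funLeft K K (Subtype.val : {i // T i} → ι)).domRestrict S) ⟨?_, ?_⟩
  · rw [e.finrank_eq, Module.finrank_fintype_fun_eq_card, Nat.card_eq_fintype_card]
  · rintro ⟨f, hf⟩ ⟨g, hg⟩ h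
    apply Subtype.ext
    funext i
    by_cases hi : T i
    · exact congrFun h ⟨i, hi⟩
    · exact ((hS f).1 hf i hi).trans ((hS g).1 hg i hi).symm
  · intro g
    refine ⟨⟨fun i => if h : T i then g ⟨i, h⟩ else 0, (hS _).2 fun i hi => dif_neg hi⟩, ?_⟩
    funext i
    exact dif_pos i.2

/-- A compatible family has an arbitrary value on a lace reaching `z` unless it must vanish: at a
left end in a sink column after `a`, or in column `a` when `ε` holds. So the projection to `z` is a
coordinate subspace. -/
theorem finrank_families (w : Laces dy dx) {a : ℕ} (ε : Prop) {z : Vertex n} (ha : a ≤ z.pos) :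
    Module.finrank K (((w.toRep K).families a z.pos ε).map (columnProj K dy dx z)) =
      w.dots z fun v => (v.pos ≤ a ∧ ¬ε) ∨ (a < v.pos ∧ ∃ i, v = Sum.inl i) := by
  refine finrank_vanishing _ _ fun h => ⟨?_, fun hh => ?_⟩
  · rintro ⟨f, hf, rfl⟩ q hq
    change (if Dot.column q = z then f q else 0) = 0
    by_cases hz : Dot.column q = z
    swap
    · exact if_neg hz
    rw [if_pos hz]
    obtain ⟨h1, h2, -, h4⟩ := mem_families_iff.1 hf
    have hrank : q.rank = z.pos := by rw [Dot.rank, hz]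
    have hpath : ∀ p q, w.Path p q → a ≤ p.rank → q.rank ≤ z.pos → f p = f q := by
      intro p q h
      induction h with
      | refl => intros; rfl
      | tail h5 h6 ih =>
        intro h7 h8
        have h9 := h6.rank_eq
        have h10 := Path.rank_le h5
        rw [ih h7 (by omega)]
        exact h1 _ _ h6 (by omega) h8
    obtain ⟨p, h5, h6⟩ := w.exists_leftEnd q
    have hl := lab_of_leftEnd h5 h6
    by_cases hp : a < p.rank
    · rw [← hpath p q h5 hp.le hrank.le]
      have h7 := h5.rank_le
      rcases p with ⟨i, x⟩ | ⟨k, x⟩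
      · exact absurd ⟨hz, Or.inr (by rw [hl]; exact ⟨hp, i, rfl⟩)⟩ hq
      · exact h2 k x h6 hp (h7.trans hrank.le)
    · by_cases he : ε
      · obtain ⟨r, h7, h8, h9⟩ := h5.exists_rank (not_lt.1 hp) (by omega)
        rw [← hpath r q h8 h9.ge hrank.le]
        exact h4 he r h9
      · exact absurd ⟨hz, Or.inl (by rw [hl]; exact ⟨not_lt.1 hp, he⟩)⟩ hq
  · classical
    -- Extend the prescribed values to the left along the laces meeting `z`, and by zero to all
    -- other dots.
    let f : Dot dy dx → K := fun p =>
      if hp : ∃ q, w.Path p q ∧ Dot.column q = z then h hp.choose else 0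
    have huniq : ∀ p q q' : Dot dy dx, w.Path p q → w.Path p q' → Dot.column q = z →
        Dot.column q' = z → q = q' := by
      intro p q q' h1 h2 h3 h4
      have e : q.rank = q'.rank := by rw [Dot.rank, Dot.rank, h3, h4]
      rcases Path.total_right h1 h2 with h5 | h5
      · exact h5.eq_of_rank_le e.ge
      · exact (h5.eq_of_rank_le e.le).symm
    have hf1 : ∀ p q, w.Path p q → Dot.column q = z → f p = h q := by
      intro p q h1 h2
      have hp : ∃ q, w.Path p q ∧ Dot.column q = z := ⟨q, h1, h2⟩
      have e : f p = h hp.choose := dif_pos hp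
      rw [e, huniq p _ _ hp.choose_spec.1 h1 hp.choose_spec.2 h2]
    have hf0 : ∀ p, (∀ q, w.Path p q → Dot.column q ≠ z) → f p = 0 := by
      intro p h1
      exact dif_neg fun ⟨q, h2, h3⟩ => h1 q h2 h3
    have hrank : ∀ q : Dot dy dx, Dot.column q = z → q.rank = z.pos := by
      intro q hq; rw [Dot.rank, hq]
    refine ⟨f, mem_families_iff.2 ⟨fun p q h1 h2 h3 => ?_, fun k j h1 h2 h3 => ?_,
      fun k j h1 h2 h3 => ?_, fun he p hp => ?_⟩, ?_⟩
    · by_cases hq : ∃ r, w.Path q r ∧ Dot.column r = z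
      · obtain ⟨r, h4, h5⟩ := hq
        rw [hf1 q r h4 h5, hf1 p r (Relation.ReflTransGen.head h1 h4) h5]
      · push Not at hq
        rw [hf0 q hq, hf0]
        intro r h4 h5
        rcases Relation.ReflTransGen.cases_head h4 with h6 | ⟨q', h6, h7⟩
        · have := h1.rank_eq
          have := hrank r h5
          rw [h6] at *
          omega
        · rw [h6.right_unique h1] at h7
          exact hq r h7 h5
    · by_cases hq : ∃ r, w.Path (Sum.inr ⟨k, j⟩) r ∧ Dot.column r = z
      · obtain ⟨r, h4, h5⟩ := hq
        rw [hf1 _ r h4 h5]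
        refine hh r ?_
        rw [lab_of_leftEnd h4 h1]
        rintro ⟨-, ⟨h6, -⟩ | ⟨-, i, h6⟩⟩
        · change Vertex.pos (Sum.inr k) ≤ a at h6
          omega
        · cases h6
      · push Not at hq
        exact hf0 _ hq
    · refine hf0 _ fun q h4 h5 => ?_
      rcases Relation.ReflTransGen.cases_head h4 with h6 | ⟨q', h6, -⟩
      · have := hrank q h5
        rw [← h6] at this
        change Vertex.pos (Sum.inr k) = _ at this
        omega
      · exact h1 _ h6
    · by_cases hq : ∃ r, w.Path p r ∧ Dot.column r = z
      · obtain ⟨r, h4, h5⟩ := hq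
        rw [hf1 _ r h4 h5]
        refine hh r ?_
        have h6 := w.lab_pos_le p
        rw [lab_of_path h4]
        rintro ⟨-, ⟨-, h7⟩ | ⟨h7, -⟩⟩
        · exact h7 he
        · omega
      · push Not at hq
        exact hf0 _ hq
    · funext q
      change (if Dot.column q = z then f q else 0) = h q
      split_ifs with hq
      · exact hf1 q q .refl hq
      · exact (hh q fun h' => hq h'.1).symm

/-! ### Counts of laces in an orbit -/

variable {w' : Laces dy dx} {V : Rep K dy dx}

/-- Subtracting the dimension with vanishing in column `a` from the one without leaves exactly the
laces that start at or before `a` and reach `z`. Both dimensions are orbit invariants. -/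
theorem dots_le_eq (h : w.toRep K ∈ V.orbit) (h' : w'.toRep K ∈ V.orbit) {a : ℕ} {z : Vertex n}
    (ha : a ≤ z.pos) : w.dots z (fun v => v.pos ≤ a) = w'.dots z (fun v => v.pos ≤ a) := by
  have hle : ∀ {w w' : Laces dy dx}, w.toRep K ∈ V.orbit → w'.toRep K ∈ V.orbit → ∀ ε,
      Module.finrank K (((w.toRep K).families a z.pos ε).map (columnProj K dy dx z)) ≤
      Module.finrank K (((w'.toRep K).families a z.pos ε).map (columnProj K dy dx z)) := by
    rintro w w' ⟨gy, gx, e⟩ ⟨gy', gx', e'⟩ ε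
    have : w'.toRep K = (w.toRep K).act (fun i => (gy i)⁻¹ * gy' i) fun k => (gx k)⁻¹ * gx' k := by
      rw [e, e', Rep.act_act]
      simp only [mul_inv_cancel_left]
    rw [this]
    exact finrank_families_le _ _ _ _ _ _ _
  have heq := fun ε => le_antisymm (hle h h' ε) (hle h' h ε)
  simp only [finrank_families _ _ ha] at heq
  have hadd : ∀ w : Laces dy dx, w.dots z (fun v => (v.pos ≤ a ∧ ¬False) ∨
      (a < v.pos ∧ ∃ i, v = Sum.inl i)) = w.dots z (fun v => v.pos ≤ a) +
      w.dots z (fun v => (v.pos ≤ a ∧ ¬True) ∨ (a < v.pos ∧ ∃ i, v = Sum.inl i)) := by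
    intro w
    rw [← dots_add]
    · simp
    · rintro v h1 (⟨-, h2⟩ | ⟨h2, -⟩)
      · exact h2 trivial
      · omega
  have h1 := heq False
  have h2 := heq True
  rw [hadd, hadd] at h1
  omega

theorem dots_self_eq (h : w.toRep K ∈ V.orbit) (h' : w'.toRep K ∈ V.orbit) (z z' : Vertex n) :
    w.dots z' (· = z) = w'.dots z' (· = z) := by
  by_cases hz : z.pos ≤ z'.pos
  · have h1 := dots_le_eq h h' hz
    rcases Nat.eq_zero_or_pos z.pos with h0 | h0
    · have h2 : ∀ v : Vertex n, v.pos ≤ z.pos ↔ v = z := fun v =>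
        ⟨fun hv => Vertex.pos_injective (by omega), fun hv => by rw [hv]⟩
      simpa only [h2] using h1
    · have h2 := dots_le_eq h h' (a := z.pos - 1) (z := z') (by omega)
      have hadd : ∀ w : Laces dy dx, w.dots z' (fun v => v.pos ≤ z.pos) =
          w.dots z' (· = z) + w.dots z' (fun v => v.pos ≤ z.pos - 1) := by
        intro w
        rw [← dots_add]
        · refine dots_congr fun v _ => ⟨fun hv => ?_, ?_⟩
          · by_cases hv' : v.pos = z.pos
            · exact Or.inl (Vertex.pos_injective hv')
            · exact Or.inr (by omega)
          · rintro (rfl | hv)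
            · exact le_rfl
            · omega
        · rintro v rfl hv
          omega
      rw [hadd, hadd] at h1
      omega
  · have h0 : ∀ w : Laces dy dx, w.dots z' (· = z) = 0 := by
      intro w
      rw [dots, Nat.card_eq_zero]
      left
      constructor
      rintro ⟨q, rfl, rfl⟩
      exact hz (w.lab_pos_le q)
    rw [h0, h0]

theorem card_next (w : Laces dy dx) {z z' : Vertex n} (h : z.pos = z'.pos + 1)
    (P : Vertex n → Prop) :
    Nat.card {q : Dot dy dx // Dot.column q = z' ∧ (∃ r, w.Next q r) ∧ P (w.lab q)} =
      w.dots z (fun v => v.pos ≤ z'.pos ∧ P v) := by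
  refine Nat.card_congr (Equiv.ofBijective (fun q => ⟨q.2.2.1.choose, ?_, ?_, ?_⟩) ⟨?_, ?_⟩)
  · apply Vertex.pos_injective
    have h1 := q.2.2.1.choose_spec.rank_eq
    rw [Dot.rank, Dot.rank, congrArg Vertex.pos q.2.1] at h1
    rw [h1, h]
  · rw [lab_of_next q.2.2.1.choose_spec]
    exact (w.lab_pos_le _).trans_eq (congrArg Vertex.pos q.2.1)
  · rw [lab_of_next q.2.2.1.choose_spec]
    exact q.2.2.2
  · rintro ⟨q, h1, h2, h3⟩ ⟨q', h1', h2', h3'⟩ e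
    rw [Subtype.mk.injEq] at e
    have h4 := h2.choose_spec
    have h5 := h2'.choose_spec
    have e' : h2.choose = h2'.choose := e
    rw [e'] at h4
    exact Subtype.ext (h4.left_unique h5)
  · rintro ⟨r, h1, h2, h3⟩
    have hr : ∃ q, w.Next q r := by
      by_contra hc
      push Not at hc
      rw [lab_self hc, h1] at h2
      omega
    obtain ⟨q, hq⟩ := hr
    have hq1 : Dot.column q = z' := by
      apply Vertex.pos_injective
      have := hq.rank_eq
      rw [Dot.rank, Dot.rank, h1] at this
      omega
    rw [lab_of_next hq] at h3
    refine ⟨⟨q, hq1, ⟨r, hq⟩, h3⟩, Subtype.ext ?_⟩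
    exact Next.right_unique (Exists.choose_spec (⟨r, hq⟩ : ∃ r, w.Next q r)) hq

theorem arrowCount_eq_dots (w : Laces dy dx) {z z' : Vertex n} (h : z.pos = z'.pos + 1) :
    w.arrowCount z z' = w.dots z (fun v => v.pos ≤ z'.pos) := by
  have := w.card_next h fun _ => True
  simp only [and_true] at this
  rw [arrowCount_eq w h, this]

/-- A lace from `z` that reaches `z'` either ends there or goes on to the next column. So lace
counts are differences of the invariant dot counts. -/
theorem laceCount_add_dots (w : Laces dy dx) {z z' z'' : Vertex n} (h : z''.pos = z'.pos + 1)
    (hz : z.pos ≤ z'.pos) : w.laceCount z z' + w.dots z'' (· = z) = w.dots z' (· = z) := by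
  classical
  have h1 := w.card_next h (· = z)
  have h2 : w.dots z'' (fun v => v.pos ≤ z'.pos ∧ v = z) = w.dots z'' (· = z) :=
    dots_congr fun v _ => ⟨fun hv => hv.2, fun hv => ⟨hv ▸ hz, hv⟩⟩
  rw [← h2, ← h1, laceCount_eq, dots]
  simp only [Nat.card_eq_fintype_card, Fintype.card_subtype]
  rw [← Finset.card_union_of_disjoint]
  · congr 1
    ext q
    simp only [Finset.mem_filter, Finset.mem_union, Finset.mem_univ, true_and]
    rw [← not_exists]
    tauto
  · rw [Finset.disjoint_filter]
    rintro q - ⟨-, h3, -⟩ ⟨-, ⟨r, h4⟩, -⟩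
    exact h3 r h4

theorem laceCount_eq_dots (w : Laces dy dx) {z z' : Vertex n} (h : z'.pos = 2 * n) :
    w.laceCount z z' = w.dots z' (· = z) := by
  rw [laceCount_eq, dots]
  refine Nat.card_congr (Equiv.subtypeEquivRight fun q => and_congr_right fun hq =>
    and_iff_right fun r hr => ?_)
  have h1 := hr.rank_eq
  rw [Dot.rank, Dot.rank, hq, h] at h1
  rcases e : Dot.column r with i | k <;> rw [e] at h1 <;>
    simp only [Vertex.pos, Fin.val_rev] at h1 <;> omega

theorem exists_pos_eq {m : ℕ} (h : m ≤ 2 * n) : ∃ z : Vertex n, z.pos = m := by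
  obtain ⟨r, hr⟩ := Nat.even_or_odd' m
  rcases hr with rfl | rfl
  · refine ⟨Sum.inl ⟨n - r, by omega⟩, ?_⟩
    simp only [Vertex.pos, Fin.val_rev]; omega
  · refine ⟨Sum.inr ⟨n - 1 - r, by omega⟩, ?_⟩
    simp only [Vertex.pos, Fin.val_rev]; omega

theorem pos_le (z : Vertex n) : z.pos ≤ 2 * n := by
  rcases z with i | k <;> simp only [Vertex.pos, Fin.val_rev] <;> omega

theorem laceCount_eq_of_mem_orbit (h : w.toRep K ∈ V.orbit) (h' : w'.toRep K ∈ V.orbit)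
    (z z' : Vertex n) : w.laceCount z z' = w'.laceCount z z' := by
  rcases lt_or_ge z'.pos z.pos with hz | hz
  · rw [laceCount_eq_zero _ hz, laceCount_eq_zero _ hz]
  · rcases (pos_le z').lt_or_eq with hn | hn
    · obtain ⟨z'', hz''⟩ := exists_pos_eq (n := n) (m := z'.pos + 1) hn
      have h1 := w.laceCount_add_dots hz'' hz
      have h2 := w'.laceCount_add_dots hz'' hz
      rw [dots_self_eq h h', dots_self_eq h h'] at h1
      omega
    · rw [laceCount_eq_dots _ hn, laceCount_eq_dots _ hn, dots_self_eq h h']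

theorem arrowCount_eq_of_mem_orbit (h : w.toRep K ∈ V.orbit) (h' : w'.toRep K ∈ V.orbit)
    {z z' : Vertex n} (hz : z.pos = z'.pos + 1) : w.arrowCount z z' = w'.arrowCount z z' := by
  rw [arrowCount_eq_dots _ hz, arrowCount_eq_dots _ hz, dots_le_eq h h' (by omega)]

end Laces

end

section

variable {n : ℕ} {dy : Fin (n + 1) → ℕ} {dx : Fin n → ℕ}

/-! ### Lacing diagrams with the same laces -/

namespace Laces

variable {w w' : Laces dy dx} {p q : Dot dy dx}

/-- The lace `C` has its left endpoint in column `e.1` and its right endpoint in column `e.2`. -/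
def HasEnds (w : Laces dy dx) (C : w.graph.ConnectedComponent) (e : Vertex n × Vertex n) : Prop :=
  ((∃ p ∈ C.supp, Dot.column p = e.1) ∧ ∀ p ∈ C.supp, e.1.pos ≤ (Dot.column p).pos) ∧
    ((∃ p ∈ C.supp, Dot.column p = e.2) ∧ ∀ p ∈ C.supp, (Dot.column p).pos ≤ e.2.pos)

theorem HasEnds.unique {C : w.graph.ConnectedComponent} {e e' : Vertex n × Vertex n}
    (h : w.HasEnds C e) (h' : w.HasEnds C e') : e = e' := by
  obtain ⟨⟨⟨p, hp, h1⟩, h2⟩, ⟨q, hq, h3⟩, h4⟩ := h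
  obtain ⟨⟨⟨p', hp', h1'⟩, h2'⟩, ⟨q', hq', h3'⟩, h4'⟩ := h'
  refine Prod.ext (Vertex.pos_injective (le_antisymm ?_ ?_))
    (Vertex.pos_injective (le_antisymm ?_ ?_))
  · rw [← h1']; exact h2 _ hp'
  · rw [← h1]; exact h2' _ hp
  · rw [← h3]; exact h4' _ hq
  · rw [← h3']; exact h4 _ hq'

theorem exists_hasEnds (C : w.graph.ConnectedComponent) : ∃ e, w.HasEnds C e := by
  obtain ⟨p, hp, h1⟩ := Set.exists_min_image C.supp (fun p => (Dot.column p).pos) (Set.toFinite _)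
    C.nonempty_supp
  obtain ⟨q, hq, h2⟩ := Set.exists_max_image C.supp (fun p => (Dot.column p).pos) (Set.toFinite _)
    C.nonempty_supp
  exact ⟨(Dot.column p, Dot.column q), ⟨⟨p, hp, rfl⟩, h1⟩, ⟨q, hq, rfl⟩, h2⟩

/-- The columns of the endpoints of a lace. -/
noncomputable def ends (w : Laces dy dx) (C : w.graph.ConnectedComponent) : Vertex n × Vertex n :=
  (exists_hasEnds C).choose

theorem hasEnds_ends (C : w.graph.ConnectedComponent) : w.HasEnds C (w.ends C) :=
  (exists_hasEnds C).choose_spec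

theorem laceCount_eq_card_ends (w : Laces dy dx) (e : Vertex n × Vertex n) :
    w.laceCount e.1 e.2 = Nat.card {C // w.ends C = e} :=
  Nat.card_congr (Equiv.subtypeEquivRight fun C =>
    ⟨fun h => (hasEnds_ends C).unique h, fun h => h ▸ hasEnds_ends C⟩)

theorem mk_eq_iff : w.graph.connectedComponentMk p = w.graph.connectedComponentMk q ↔
    w.Path p q ∨ w.Path q p := by
  rw [SimpleGraph.ConnectedComponent.eq, reachable_iff]

theorem eq_of_mk_eq (h : w.graph.connectedComponentMk p = w.graph.connectedComponentMk q)
    (h' : Dot.column p = Dot.column q) : p = q := by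
  have e : p.rank = q.rank := by rw [Dot.rank, Dot.rank, h']
  rcases mk_eq_iff.1 h with h1 | h1
  · exact h1.eq_of_rank_le e.ge
  · exact (h1.eq_of_rank_le e.le).symm

theorem next_iff_mk : w.Next p q ↔
    w.graph.connectedComponentMk p = w.graph.connectedComponentMk q ∧ q.rank = p.rank + 1 := by
  constructor
  · intro h
    exact ⟨mk_eq_iff.2 (Or.inl (Relation.ReflTransGen.single h)), h.rank_eq⟩
  · rintro ⟨h, hr⟩
    rcases mk_eq_iff.1 h with h1 | h1
    · rcases Relation.ReflTransGen.cases_tail h1 with h2 | ⟨r, h2, h3⟩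
      · rw [h2] at hr; omega
      · have := h3.rank_eq
        rwa [Path.eq_of_rank_le h2 (by omega)]
    · have := h1.rank_le
      omega

theorem exists_dot {C : w.graph.ConnectedComponent} {z : Vertex n} (h1 : (w.ends C).1.pos ≤ z.pos)
    (h2 : z.pos ≤ (w.ends C).2.pos) :
    ∃ p, w.graph.connectedComponentMk p = C ∧ Dot.column p = z := by
  obtain ⟨⟨⟨p, hp, e1⟩, -⟩, ⟨q, hq, e2⟩, -⟩ := hasEnds_ends C
  rw [SimpleGraph.ConnectedComponent.mem_supp_iff] at hp hq
  rw [← e1] at h1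
  rw [← e2] at h2
  have key : ∀ p q, w.Path p q → w.graph.connectedComponentMk p = C → p.rank ≤ z.pos →
      z.pos ≤ q.rank → ∃ p, w.graph.connectedComponentMk p = C ∧ Dot.column p = z := by
    intro p q h hp h1 h2
    obtain ⟨r, h3, -, h4⟩ := h.exists_rank h1 h2
    exact ⟨r, (mk_eq_iff.2 (Or.inr h3)).trans hp, Vertex.pos_injective h4⟩
  rcases mk_eq_iff.1 (hp.trans hq.symm) with h | h
  · exact key p q h hp h1 h2
  · have := h.rank_le
    rw [Dot.rank, Dot.rank] at this
    exact key p p .refl hp h1 (by rw [Dot.rank]; omega)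

theorem exists_perm {d : ℕ} {f : Fin d → Fin d} (hf : Function.Injective f) :
    ∃ ρ : Perm (Fin d), ∀ x, ρ x = f x :=
  ⟨Equiv.ofBijective f (Finite.injective_iff_bijective.1 hf), fun _ => rfl⟩

/-- Match the laces of the two diagrams with the same pair of end columns. A lace has exactly one
dot in each column between its ends, so the matching induces permutations of the dots in each
column, and these respect the arrows. -/
theorem exists_eq_conj (h : ∀ z z', w.laceCount z z' = w'.laceCount z z') :
    ∃ ρ τ, w' = w.conj ρ τ := by
  have hfib : ∀ e, Nonempty ({C // w'.ends C = e} ≃ {C // w.ends C = e}) := by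
    intro e
    rw [← Finite.card_eq, ← laceCount_eq_card_ends, ← laceCount_eq_card_ends, h]
  let E := Equiv.ofFiberEquiv fun e => (hfib e).some
  have hE : ∀ C, w.ends (E C) = w'.ends C := fun C => Equiv.ofFiberEquiv_map _ C
  have hφ : ∀ p : Dot dy dx, ∃ q, w.graph.connectedComponentMk q =
      E (w'.graph.connectedComponentMk p) ∧ Dot.column q = Dot.column p := by
    intro p
    have h1 := hasEnds_ends (w'.graph.connectedComponentMk p)
    refine exists_dot ?_ ?_
    · rw [hE]; exact h1.1.2 p rfl
    · rw [hE]; exact h1.2.2 p rfl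
  choose φ hφ1 hφ2 using hφ
  have hinj : Function.Injective φ := by
    intro p q e
    refine eq_of_mk_eq (w := w') (E.injective ?_) ?_
    · rw [← hφ1, ← hφ1, e]
    · exact (hφ2 p).symm.trans ((congrArg Dot.column e).trans (hφ2 q))
  have hnext : ∀ p q, w'.Next p q ↔ w.Next (φ p) (φ q) := by
    intro p q
    rw [next_iff_mk, next_iff_mk, hφ1, hφ1, E.injective.eq_iff, Dot.rank, Dot.rank, Dot.rank,
      Dot.rank, hφ2, hφ2]
  have hy : ∀ i, ∃ ρ : Perm (Fin (dy i)), ∀ x, φ (Sum.inl ⟨i, x⟩) = Sum.inl ⟨i, ρ x⟩ := by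
    intro i
    have : ∀ x : Fin (dy i), ∃ x', φ (Sum.inl ⟨i, x⟩) = Sum.inl ⟨i, x'⟩ := by
      intro x
      have h1 := hφ2 (Sum.inl ⟨i, x⟩)
      rcases e : φ (Sum.inl ⟨i, x⟩) with ⟨i', x'⟩ | ⟨k, x'⟩ <;> rw [e] at h1
      · obtain rfl : i' = i := Sum.inl.inj h1
        exact ⟨x', rfl⟩
      · cases h1
    choose f hf using this
    obtain ⟨ρ, hρ⟩ := exists_perm (f := f) fun x x' e => by
      have h1 := hinj (show φ (Sum.inl ⟨i, x⟩) = φ (Sum.inl ⟨i, x'⟩) by rw [hf, hf, e])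
      have h2 := Sum.inl.inj h1
      rw [Sigma.mk.injEq] at h2
      exact eq_of_heq h2.2
    exact ⟨ρ, fun x => by rw [hρ, hf]⟩
  have hx : ∀ k, ∃ ρ : Perm (Fin (dx k)), ∀ x, φ (Sum.inr ⟨k, x⟩) = Sum.inr ⟨k, ρ x⟩ := by
    intro k
    have : ∀ x : Fin (dx k), ∃ x', φ (Sum.inr ⟨k, x⟩) = Sum.inr ⟨k, x'⟩ := by
      intro x
      have h1 := hφ2 (Sum.inr ⟨k, x⟩)
      rcases e : φ (Sum.inr ⟨k, x⟩) with ⟨i', x'⟩ | ⟨k', x'⟩ <;> rw [e] at h1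
      · cases h1
      · obtain rfl : k' = k := Sum.inr.inj h1
        exact ⟨x', rfl⟩
    choose f hf using this
    obtain ⟨ρ, hρ⟩ := exists_perm (f := f) fun x x' e => by
      have h1 := hinj (show φ (Sum.inr ⟨k, x⟩) = φ (Sum.inr ⟨k, x'⟩) by rw [hf, hf, e])
      have h2 := Sum.inr.inj h1
      rw [Sigma.mk.injEq] at h2
      exact eq_of_heq h2.2
    exact ⟨ρ, fun x => by rw [hρ, hf]⟩
  choose ρ hρ using hy
  choose τ hτ using hx
  have hmem : ∀ {a b : ℕ} (u : Fin a ≃. Fin b) (r : Perm (Fin a)) (t : Perm (Fin b)) (i j),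
      j ∈ (r.toPEquiv.trans (u.trans t⁻¹.toPEquiv)) i ↔ t j ∈ u (r i) := by
    intro a b u r t i j
    rw [PEquiv.mem_trans]
    simp only [Equiv.toPEquiv_apply, Option.mem_some_iff, exists_eq_left', PEquiv.mem_trans]
    constructor
    · rintro ⟨x, hx, rfl⟩
      rwa [perm_apply_inv]
    · intro hx
      exact ⟨t j, hx, perm_inv_apply t j⟩
  refine ⟨ρ, fun k => (τ k)⁻¹, ?_⟩
  ext1 <;> funext k <;> refine pequiv_ext fun i j => ?_
  · refine Iff.trans ?_ (hmem _ _ _ i j).symm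
    rw [← next_inl_inr, hnext, hρ, hτ, next_inl_inr]
  · refine Iff.trans ?_ (hmem _ _ _ i j).symm
    rw [← next_inr_inl, hnext, hρ, hτ, next_inr_inl]

end Laces

/-! ### Permutations determined by their block counts -/

theorem exists_rowLabel (r : Fin ((∑ i, dy i) + ∑ k, dx k)) : ∃ z, InRow dy dx z r.val := by
  refine exists_inRow ?_
  rw [← sum_dy dy dx, ← sum_dx dy dx]
  exact r.isLt

theorem exists_colLabel (r : Fin ((∑ i, dy i) + ∑ k, dx k)) : ∃ z, InCol dy dx z r.val := by
  refine exists_inCol ?_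
  rw [← sum_dy dy dx, ← sum_dx dy dx]
  exact r.isLt.trans_eq (add_comm _ _)

/-- The block row of a row. -/
noncomputable def rowLabel (r : Fin ((∑ i, dy i) + ∑ k, dx k)) : Vertex n :=
  (exists_rowLabel r).choose

/-- The block column of a column. -/
noncomputable def colLabel (r : Fin ((∑ i, dy i) + ∑ k, dx k)) : Vertex n :=
  (exists_colLabel r).choose

theorem rowLabel_eq_iff {r : Fin ((∑ i, dy i) + ∑ k, dx k)} {z : Vertex n} :
    rowLabel r = z ↔ InRow dy dx z r.val :=
  ⟨fun h => h ▸ (exists_rowLabel r).choose_spec, fun h => (exists_rowLabel r).choose_spec.unique h⟩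

theorem colLabel_eq_iff {r : Fin ((∑ i, dy i) + ∑ k, dx k)} {z : Vertex n} :
    colLabel r = z ↔ InCol dy dx z r.val :=
  ⟨fun h => h ▸ (exists_colLabel r).choose_spec, fun h => (exists_colLabel r).choose_spec.unique h⟩

open Classical in
theorem onesInBlock_eq_card_filter (v : TotalPerm dy dx) (z z' : Vertex n) :
    onesInBlock v z z' =
      (Finset.univ.filter fun r => rowLabel r = z ∧ colLabel (v r) = z').card := by
  rw [onesInBlock, Nat.card_eq_fintype_card, Fintype.card_subtype]
  simp only [rowLabel_eq_iff, colLabel_eq_iff]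

open Classical in
theorem sum_onesInBlock (v : TotalPerm dy dx) (z : Vertex n) : ∑ z', onesInBlock v z z' =
    (Finset.univ.filter fun r : Fin ((∑ i, dy i) + ∑ k, dx k) => rowLabel r = z).card := by
  rw [Finset.card_eq_sum_card_fiberwise (f := fun r => colLabel (v r)) (t := Finset.univ)
    fun _ _ => Finset.mem_coe.2 (Finset.mem_univ _)]
  refine Finset.sum_congr rfl fun z' _ => ?_
  rw [onesInBlock_eq_card_filter, Finset.filter_filter]

theorem not_inCol_of_onesInBlock_eq_zero {v : TotalPerm dy dx} {z z' : Vertex n}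
    (h : onesInBlock v z z' = 0) {r : Fin ((∑ i, dy i) + ∑ k, dx k)} (hr : InRow dy dx z r.val) :
    ¬InCol dy dx z' (v r).val := by
  intro hc
  rw [onesInBlock, Nat.card_eq_zero] at h
  rcases h with h | h
  · exact h.elim ⟨r, hr, hc⟩
  · exact h.not_finite inferInstance

theorem InCol.eq_of_colOffset_eq {z z' : Vertex n} {r r' : ℕ} (h : InCol dy dx z r)
    (h' : InCol dy dx z' r') (e : colOffset dy dx z = colOffset dy dx z') : z = z' := by
  refine InCol.unique (dy := dy) (dx := dx) (r := colOffset dy dx z) ?_ ?_ <;>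
    rw [InCol] at * <;> omega

theorem colOffset_le_of_le {z z' : Vertex n} {r r' : ℕ} (h : InCol dy dx z r)
    (h' : InCol dy dx z' r') (hr : r ≤ r') : colOffset dy dx z ≤ colOffset dy dx z' := by
  by_contra hc
  have : z = z' := by
    refine InCol.unique (dy := dy) (dx := dx) (r := colOffset dy dx z) ?_ ?_ <;>
      rw [InCol] at * <;> omega
  rw [this] at hc
  exact hc le_rfl

/-- The offset of a block column is used as its label, since `blockMono_unique` needs labels that
increase with the column. Only nonempty blocks receive a label, and these have distinct offsets. -/
theorem eq_of_onesInBlock_eq {v v' : TotalPerm dy dx}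
    (hc : ∀ z z', onesInBlock v z z' = onesInBlock v' z z')
    (h1 : ∀ (z : Vertex n) (r r'), InRow dy dx z (Fin.val r) → InRow dy dx z (Fin.val r') →
      r < r' → v r < v r')
    (h1' : ∀ (z : Vertex n) (r r'), InRow dy dx z (Fin.val r) → InRow dy dx z (Fin.val r') →
      r < r' → v' r < v' r')
    (h2 : ∀ (z : Vertex n) (r r'), InCol dy dx z (v r).val → InCol dy dx z (v r').val →
      r < r' → v r < v r')
    (h2' : ∀ (z : Vertex n) (r r'), InCol dy dx z (v' r).val → InCol dy dx z (v' r').val →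
      r < r' → v' r < v' r') : v = v' := by
  classical
  have lab : ∀ r : Fin ((∑ i, dy i) + ∑ k, dx k), InCol dy dx (colLabel r) r.val :=
    fun r => colLabel_eq_iff.1 rfl
  refine blockMono_unique (ρ := rowLabel) (σ := fun r => colOffset dy dx (colLabel r))
    (fun r r' h => colOffset_le_of_le (lab r) (lab r') h) (fun z c => ?_) ?_ ?_ ?_ ?_
  · by_cases hex : ∃ r : Fin ((∑ i, dy i) + ∑ k, dx k), colOffset dy dx (colLabel r) = c
    · obtain ⟨r, rfl⟩ := hex
      have key : ∀ r' : Fin ((∑ i, dy i) + ∑ k, dx k),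
          colOffset dy dx (colLabel r') = colOffset dy dx (colLabel r) ↔
            colLabel r' = colLabel r :=
        fun r' => ⟨fun e => (lab r').eq_of_colOffset_eq (lab r) e, fun e => by rw [e]⟩
      simp only [key]
      have := hc z (colLabel r)
      rwa [onesInBlock_eq_card_filter, onesInBlock_eq_card_filter] at this
    · push Not at hex
      simp only [hex, and_false]
  · exact fun r r' e => h1 _ r r' (rowLabel_eq_iff.1 rfl) (rowLabel_eq_iff.1 e.symm)
  · exact fun r r' e => h1' _ r r' (rowLabel_eq_iff.1 rfl) (rowLabel_eq_iff.1 e.symm)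
  · exact fun r r' e => h2 _ r r' (lab _) (colLabel_eq_iff.1
      ((lab _).eq_of_colOffset_eq (lab _) e.symm))
  · exact fun r r' e => h2' _ r r' (lab _) (colLabel_eq_iff.1
      ((lab _).eq_of_colOffset_eq (lab _) e.symm))

theorem rowMono_of_rowAsc {v : TotalPerm dy dx} (h : (frame dy dx).RowAsc (emb 0 v))
    (z : Vertex n) (r r' : Fin ((∑ i, dy i) + ∑ k, dx k)) (hr : InRow dy dx z r.val)
    (hr' : InRow dy dx z r'.val) (hlt : r < r') : v r < v r' := by
  have e := emb_lt_iff 0 v r r'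
  rw [zero_add, zero_add] at e
  rw [← e]
  rcases z with i | k
  · rw [inRow_inl] at hr hr'
    have h1 := h.y i (by rw [frame_n]; omega)
    rw [frame_ey] at h1
    exact lt_of_succ_lt h1 _ _ hr.1 hlt hr'.2
  · rw [inRow_inr] at hr hr'
    have h1 := h.x k (by rw [frame_n]; omega)
    rw [frame_ex] at h1
    exact lt_of_succ_lt h1 _ _ hr.1 hlt hr'.2

theorem colMono_of_colAsc {v : TotalPerm dy dx} (h : (frame dy dx).ColAsc (emb 0 v))
    (z : Vertex n) (r r' : Fin ((∑ i, dy i) + ∑ k, dx k)) (hr : InCol dy dx z (v r).val)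
    (hr' : InCol dy dx z (v r').val) (hlt : r < r') : v r < v r' := by
  by_contra hc
  have hc : v r' < v r := lt_of_le_of_ne (not_lt.1 hc) fun e => hlt.ne (v.injective e).symm
  have hv : ∀ r, (emb 0 v)⁻¹ (v r).val = r.val := by
    intro r
    have := emb_add 0 v r
    rw [zero_add, zero_add] at this
    rw [← this, perm_inv_apply]
  suffices h : (emb 0 v)⁻¹ (v r').val < (emb 0 v)⁻¹ (v r).val by
    rw [hv, hv] at h
    exact absurd hlt (not_lt.2 h.le)
  rcases z with i | k
  · rw [inCol_inl] at hr hr'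
    have h1 := h.y i (by rw [frame_n]; omega)
    rw [frame_ey] at h1
    exact lt_of_succ_lt h1 _ _ hr'.1 hc hr.2
  · rw [inCol_inr] at hr hr'
    have h1 := h.x k (by rw [frame_n]; omega)
    rw [frame_ex] at h1
    exact lt_of_succ_lt h1 _ _ hr'.1 hc hr.2

/-- The cells outside the snake make up exactly the blocks whose row vertex lies at least two places
to the right of the column vertex. -/
theorem cornerZero_of_onesInBlock {v : TotalPerm dy dx}
    (h : ∀ z z' : Vertex n, z'.pos + 1 < z.pos → onesInBlock v z z' = 0) :
    (frame dy dx).CornerZero (emb 0 v) := by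
  have hv : ∀ r : Fin ((∑ i, dy i) + ∑ k, dx k), emb 0 v r.val = (v r).val := by
    intro r
    have := emb_add 0 v r
    rwa [zero_add, zero_add] at this
  have hm : (∑ i, dy i) + ∑ k, dx k = (frame dy dx).D + (frame dy dx).X 0 := by
    rw [← sum_dy dy dx, ← sum_dx dy dx]
  constructor
  · intro k hk i hi
    rw [frame_n] at hk
    have h1 := (frame dy dx).Y_le_D (i := k) (by rw [frame_n]; omega)
    obtain ⟨r, rfl⟩ : ∃ r : Fin ((∑ i, dy i) + ∑ k, dx k), r.val = i := ⟨⟨i, by omega⟩, rfl⟩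
    rw [hv]
    by_contra hc
    obtain ⟨z, hz⟩ := exists_rowLabel r
    obtain ⟨z', hz'⟩ := exists_colLabel (v r)
    refine not_inCol_of_onesInBlock_eq_zero (h z z' ?_) hz hz'
    have h2 := (frame dy dx).X_anti (Nat.zero_le k)
    rcases z with j | j
    · rw [inRow_inl] at hz
      rcases z' with l | l
      · rw [inCol_inl] at hz'; omega
      · rw [inCol_inr] at hz'
        have h3 : j.val < k := by
          by_contra hj
          have := (frame dy dx).Y_mono (not_lt.1 hj)
          omega
        have h4 : k ≤ l.val := by
          by_contra hl
          have := (frame dy dx).X_anti (show l.val + 1 ≤ k by omega)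
          omega
        simp only [Vertex.pos, Fin.val_rev]
        omega
    · rw [inRow_inr] at hz; omega
  · intro k hk i hi hi'
    rw [frame_n] at hk
    obtain ⟨r, rfl⟩ : ∃ r : Fin ((∑ i, dy i) + ∑ k, dx k), r.val = i := ⟨⟨i, by omega⟩, rfl⟩
    rw [hv]
    by_contra hc
    obtain ⟨z, hz⟩ := exists_rowLabel r
    obtain ⟨z', hz'⟩ := exists_colLabel (v r)
    refine not_inCol_of_onesInBlock_eq_zero (h z z' ?_) hz hz'
    rcases z with j | j
    · rw [inRow_inl, Y_add_dy] at hz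
      have h1 := (frame dy dx).Y_le_D (i := j + 1) (by rw [frame_n]; omega)
      omega
    · rw [inRow_inr, add_assoc, X_add_dx] at hz
      rcases z' with l | l
      · rw [inCol_inl, add_assoc, Y_add_dy] at hz'
        have h3 : j.val ≤ k := by
          by_contra hj
          have := (frame dy dx).X_anti (show k + 1 ≤ j.val by omega)
          omega
        have h4 : k + 2 ≤ l.val := by
          by_contra hl
          have := (frame dy dx).Y_mono (show l.val + 1 ≤ k + 2 by omega)
          omega
        simp only [Vertex.pos, Fin.val_rev]
        omega
      · rw [inCol_inr, X_add_dx] at hz'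
        have := (frame dy dx).X_anti (Nat.zero_le l.val)
        omega

theorem exists_emb_eq {m : ℕ} {u : Perm ℕ} (hu : ∀ p, m ≤ p → u p = p) :
    ∃ v : Perm (Fin m), emb 0 v = u := by
  have hlt : ∀ i < m, u i < m := by
    intro i hi
    by_contra hc
    have := u.injective (hu _ (not_lt.1 hc))
    omega
  obtain ⟨v, hv⟩ := Laces.exists_perm (f := fun i : Fin m => ⟨u i, hlt i i.isLt⟩)
    fun i j h => Fin.ext (u.injective (congrArg Fin.val h))
  refine ⟨v, Equiv.ext fun i => ?_⟩
  by_cases hi : i < m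
  · have h1 := emb_add 0 v ⟨i, hi⟩
    rw [zero_add, zero_add, hv] at h1
    exact h1
  · rw [emb_out _ (Or.inr (by omega)), hu i (by omega)]

end

/-! ### The bipartite Zelevinsky permutation -/

section

variable {K : Type*} [Field K] {n : ℕ} {dy : Fin (n + 1) → ℕ} {dx : Fin n → ℕ} {V : Rep K dy dx}

/-- The definition leaves the blocks far below the diagonal unspecified. The prescribed counts agree
by orbit invariance and `v` has nothing elsewhere, so equality of row sums forces `v'` to have
nothing there either. -/
theorem IsZelevinsky.eq_of_onesInBlock {v v' : TotalPerm dy dx} (h : IsZelevinsky V.orbit v)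
    (h' : IsZelevinsky V.orbit v')
    (h0 : ∀ z z' : Vertex n, z'.pos + 1 < z.pos → onesInBlock v z z' = 0) : v' = v := by
  obtain ⟨⟨w, hw, c1, c2⟩, r, c⟩ := h
  obtain ⟨⟨w', hw', c1', c2'⟩, r', c'⟩ := h'
  have heq : ∀ z z' : Vertex n, z.pos ≤ z'.pos + 1 → onesInBlock v' z z' = onesInBlock v z z' := by
    intro z z' hz
    rcases hz.lt_or_eq with hz | hz
    · rw [c1 z z' (by omega), c1' z z' (by omega), Laces.laceCount_eq_of_mem_orbit hw hw']
    · rw [c2 z z' hz, c2' z z' hz, Laces.arrowCount_eq_of_mem_orbit hw hw' hz]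
  have hle : ∀ z z' : Vertex n, onesInBlock v z z' ≤ onesInBlock v' z z' := by
    intro z z'
    rcases le_or_gt z.pos (z'.pos + 1) with hz | hz
    · exact (heq z z' hz).ge
    · rw [h0 z z' hz]; exact Nat.zero_le _
  refine eq_of_onesInBlock_eq (fun z z' => ?_) r' r c' c
  have hs := (Finset.sum_eq_sum_iff_of_le (s := Finset.univ) fun z' _ => hle z z').1
    ((sum_onesInBlock v z).trans (sum_onesInBlock v' z).symm)
  exact (hs z' (Finset.mem_univ _)).symm

theorem onesInBlock_of_product {w : Laces dy dx} {v : TotalPerm dy dx}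
    (hv : emb 0 v = w.extended.product) :
    (∀ z z' : Vertex n, z.pos ≤ z'.pos → onesInBlock v z z' = w.laceCount z z') ∧
    (∀ z z' : Vertex n, z.pos = z'.pos + 1 → onesInBlock v z z' = w.arrowCount z z') ∧
    (∀ z z' : Vertex n, z'.pos + 1 < z.pos → onesInBlock v z z' = 0) := by
  refine ⟨fun z z' h => ?_, fun z z' h => ?_, fun z z' h => ?_⟩ <;> rw [w.onesInBlock_eq hv]
  · rw [if_neg (by omega), add_zero]
  · rw [if_pos h, w.laceCount_eq_zero (by omega), zero_add]
  · rw [if_neg (by omega), w.laceCount_eq_zero (by omega)]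

/-- The Demazure product of a minimal diagram is an ordinary product for its left-pushed form, which
lies in the same orbit. The wires of that product give the block counts, and minimality gives the
ascents in block rows and block columns. -/
theorem exists_isZelevinsky {w : Laces dy dx}
    (hw : w ∈ minLength {w | w.toRep K ∈ V.orbit}) : ∃ v : TotalPerm dy dx,
      emb 0 v = w.total ∧ IsZelevinsky V.orbit v ∧
      ∀ z z' : Vertex n, z'.pos + 1 < z.pos → onesInBlock v z z' = 0 := by
  have hS : ConjStable {w : Laces dy dx | w.toRep K ∈ V.orbit} :=
    fun w h ρ τ => Laces.conj_mem_orbit h ρ τ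
  have hr := rowAsc_of_minLength hS hw
  have hc := colAsc_of_minLength hS hw
  obtain ⟨⟨w', hw', e⟩, -⟩ := exists_product_of_minLength hS hw
  obtain ⟨v, hv⟩ := exists_emb_eq (m := (∑ i, dy i) + ∑ k, dx k) (u := w'.extended.product) (by
    intro p hp
    rw [sum_dy dy dx, sum_dx dy dx] at hp
    exact Frame.sufPerm_fix w'.extended.supported (Nat.zero_le _) (by omega))
  obtain ⟨h1, h2, h3⟩ := onesInBlock_of_product hv
  rw [e, ← hv] at hr hc
  exact ⟨v, hv.trans e.symm, ⟨⟨w', hw', h1, h2⟩, rowMono_of_rowAsc hr, colMono_of_colAsc hc⟩, h3⟩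

theorem minLength_nonempty (V : Rep K dy dx) :
    (minLength {w : Laces dy dx | w.toRep K ∈ V.orbit}).Nonempty := by
  obtain ⟨w, h1, h2⟩ := (measure (Laces.length (dy := dy) (dx := dx))).wf.has_min
    {w | w.toRep K ∈ V.orbit} (exists_laces_mem_orbit V)
  exact ⟨w, h1, fun w' h' => not_lt.1 (h2 w' h')⟩

/-- Moves preserve the product, and all minimal diagrams have the product `v` by uniqueness.
Conversely, a diagram with product `v` comes by moves from a left-pushed one; its lace counts are
read off from `v`, which puts it in the orbit, and its length is read off from the inversions of
`v`, which makes it minimal. -/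
theorem KW_eq {w₀ : Laces dy dx} (h₀ : w₀ ∈ minLength {w | w.toRep K ∈ V.orbit})
    {v : TotalPerm dy dx} (hv : emb 0 v = w₀.total) (hz : IsZelevinsky V.orbit v)
    (h0 : ∀ z z' : Vertex n, z'.pos + 1 < z.pos → onesInBlock v z z' = 0) :
    KW V.orbit = {w : Laces dy dx | w.total = emb 0 v} := by
  have hS : ConjStable {w : Laces dy dx | w.toRep K ∈ V.orbit} :=
    fun w h ρ τ => Laces.conj_mem_orbit h ρ τ
  ext w
  constructor
  · rintro ⟨w', hw', h⟩
    obtain ⟨v', e, hz', -⟩ := exists_isZelevinsky hw'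
    rw [Set.mem_ofPred_eq, total_eq_of_reflTransGen h, ← e, hz.eq_of_onesInBlock hz' h0]
  · intro h
    rw [Set.mem_ofPred_eq] at h
    obtain ⟨w', h1, h2, h3⟩ := exists_leftNormal_of_rowAsc (w := w)
      (by rw [h, hv]; exact rowAsc_of_minLength hS h₀)
    obtain ⟨⟨wL, h4, h5⟩, h6⟩ := exists_product_of_minLength hS h₀
    -- Both diagrams have `v` as ordinary product, so their wires, and hence their laces, have the
    -- same numbers of endpoints.
    obtain ⟨ρ, τ, rfl⟩ : ∃ ρ τ, w' = wL.conj ρ τ := by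
      refine Laces.exists_eq_conj fun z z' => ?_
      rcases le_or_gt z.pos z'.pos with hp | hp
      · rw [← (onesInBlock_of_product (hv.trans h5)).1 z z' hp,
          ← (onesInBlock_of_product (h.symm.trans h2)).1 z z' hp]
      · rw [Laces.laceCount_eq_zero _ hp, Laces.laceCount_eq_zero _ hp]
    refine ⟨_, ⟨hS _ h4 ρ τ, fun w'' hw'' => ?_⟩, h1⟩
    rw [h, hv, h6, Nat.cast_inj] at h3
    have := h₀.2 w'' hw''
    omega

end

end BipartiteLaces

theorem mainTheorem6 {K : Type*} [Field K] {n : ℕ} (dy : Fin (n + 1) → ℕ) (dx : Fin n → ℕ)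
    (V : BipartiteLaces.Rep K dy dx) :
    (∃! v, BipartiteLaces.IsZelevinsky V.orbit v) ∧
      Set.BijOn BipartiteLaces.LD (BipartiteLaces.XSet V.orbit) (BipartiteLaces.KW V.orbit) := by
  open BipartiteLaces in
  obtain ⟨w, hw⟩ := minLength_nonempty V
  obtain ⟨v, hv, hz, h0⟩ := exists_isZelevinsky hw
  have huniq : ∀ v', IsZelevinsky V.orbit v' → v' = v := fun v' h =>
    hz.eq_of_onesInBlock h h0
  have hS : ConjStable {w : Laces dy dx | w.toRep K ∈ V.orbit} :=
    fun w h ρ τ => Laces.conj_mem_orbit h ρ τ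
  refine ⟨⟨v, hz, huniq⟩, ?_⟩
  have e : zelevinsky V.orbit = v := huniq _ (Classical.epsilon_spec ⟨v, hz⟩)
  rw [XSet, e, KW_eq hw hv hz h0]
  exact bijOn_LD_pipes (hv ▸ rowAsc_of_minLength hS hw) (hv ▸ colAsc_of_minLength hS hw)
    (cornerZero_of_onesInBlock h0)
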